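/- **Setting.** Let $\mathcal G$ be a Lie groupoid with smooth manifold of objects $M$, source $s$ and target $t$ (smooth surjective submersions) and smooth product, inverse and unit. For smooth maps $x,y:S\to M$ from a manifold $S$, let $\mathcal G_{x,y}(S)$ be the set of smooth $g:S\to\mathcal G$ with $t\circ g=x$, $s\circ g=y$ (the local sections of $\mathcal G$); products $\mathcal G_{x,y}(S)\times\mathcal G_{y,z}(S)\to\mathcal G_{x,z}(S)$ are pointwise. Let $\mathcal O=\mathcal O_S$ be a sheaf of graded commutative differential graded algebras $(\mathcal O_S,d)$ given on all manifolds $S$, with pull-backs. Let $\mathcal A$ be a sheaf of graded $\mathcal O$-algebras (the image of $\mathcal O$ being graded central) on $M$, given together with its inverse images $x^*\mathcal A$ along all smooth $x:S\to M$; its sections over $S$ are denoted $A_x$ (for fixed $S$). Similarly for sheaves of graded $\mathcal A$-modules. All data below are compatible with inverse images and with the gradings. *Action up to inner automorphisms:* $\mathcal O$-linear graded algebra isomorphisms $T_g:A_y\to A_x$ for $g\in\mathcal G_{x,y}(S)$, and invertible elements $c(g_1,g_2)\in A_x$ of degree $0$ for $g_1\in\mathcal G_{x,y}(S)$, $g_2\in\mathcal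 G_{y,z}(S)$, with $$T_{g_1}T_{g_2}=\mathrm{Ad}(c(g_1,g_2))T_{g_1g_2},\qquad c(g_1,g_2)c(g_1g_2,g_3)=T_{g_1}(c(g_2,g_3))\,c(g_1,g_2g_3).$$ *Compatible flat connection up to inner derivations:* a derivation $\nabla$ of $\mathcal A$ of degree $1$ with $\nabla(\omega a)=d\omega\, a+(-1)^{|\omega|}\omega\nabla a$ for $\omega\in\mathcal O$, a section $R\in\mathcal A^2$, and $\alpha(g)\in A_x^1$ for $g\in\mathcal G_{x,y}(S)$ with $$\nabla^2=\mathrm{ad}(R),\quad \nabla R=0,\quad T_g\nabla T_g^{-1}=\nabla+\mathrm{ad}(\alpha(g)),\quad \nabla\alpha(g)+\alpha(g)^2=T_gR-R,$$ $$\alpha(g_1)+T_{g_1}\alpha(g_2)-\mathrm{Ad}(c(g_1,g_2))\alpha(g_1g_2)+\nabla c(g_1,g_2)\cdot c(g_1,g_2)^{-1}=0.$$ *Compatible modules:* sheaves $\mathcal V,\mathcal W$ of graded $\mathcal A$-modules with additive isomorphisms $T_g:V_y\to V_x$, $T_g(av)=T_g(a)T_g(v)$, $T_{g_1}T_{g_2}=c(g_1,g_2)T_{g_1g_2}$,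 and a degree-one operator $\nabla$ with $\nabla^2=R$, $\nabla(av)=\nabla(a)v+(-1)^{|a|}a\nabla v$, $T_g\nabla T_g^{-1}=\nabla+\alpha(g)$. *Standard complex.* $\mathcal C=\mathcal C(\mathcal V,\mathcal A,\mathcal W)$ has degree $m$ part $\prod_{n}\underline{\mathrm{Hom}}_{\mathcal O}^{m-n}(\mathcal A^{\otimes_{\mathcal O}n},\underline{\mathrm{Hom}}_{\mathcal O}(\mathcal V,\mathcal W))$; here $\mathcal O$-linearity is understood with the Koszul signs in which an argument $a_i$ has degree $|a_i|+1$, and $x^*\mathcal C$ is the standard complex of $x^*\mathcal V,x^*\mathcal A,x^*\mathcal W$. With $\varepsilon_j=\sum_{i\le j}(|a_i|+1)$ and $|\varphi|=m$ the total degree, $$(\delta\varphi)(a_1,\dots,a_{n})=(-1)^{m|a_1|}a_1\varphi(a_2,\dots,a_{n})+\sum_{j=1}^{n-1}(-1)^{\varepsilon_j}\varphi(\dots,a_ja_{j+1},\dots)-(-1)^{\varepsilon_{n-1}}\varphi(a_1,\dots,a_{n-1})a_{n},$$ with $\delta\varphi=0$ on the empty string, $$(D\varphi)(a_1,\dots,a_n)=(-1)^{m+1}\bigl(\nabla\circ\varphi(a_1,\dots,a_n)-(-1)^{m+\varepsilon_n}\varphi(a_1,\dots,a_n)\circ\nabla\bigr)-\sum_{j}(-1)^{\varepsilon_{j-1}}\varphi(\dots,\nabla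 a_j,\dots),$$ $$(\iota_R\varphi)(a_1,\dots,a_n)=-\sum_{j=0}^n(-1)^{\varepsilon_j}\varphi(a_1,\dots,a_j,R,a_{j+1},\dots,a_n),$$ and for $a$ of degree $1$, $(\iota_a\varphi)(a_1,\dots,a_n)=\sum_{j=0}^n\varphi(a_1,\dots,a_j,a,a_{j+1},\dots,a_n)$. Then $\exp(\iota_a)\varphi$ is the sum over $n$ of the sums over all insertions of $n$ copies of $a$. We say that $\exp(\iota_a)$ *converges* for a section $a$ of degree one over $x:S\to M$ if, for every cochain $\varphi$ on any $S'\to S$ and all arguments on $S'$, only finitely many of these $n$ contribute. Put $(T_g\varphi)(a_1,\dots,a_n)=T_g\,\varphi(T_g^{-1}a_1,\dots,T_g^{-1}a_n)\,T_g^{-1}$ and $\mathcal T_g=\exp(\iota_{\alpha(g)})T_g$. *Operators $\phi$.* Call an invertible $c$ of degree $0$ admissible if $\exp(-\iota_{\nabla c\cdot c^{-1}})$ converges, and set $\widetilde{\mathrm{Ad}}(c)=\exp(-\iota_{\nabla c\cdot c^{-1}})\mathrm{Ad}(c)$, both on cochains and on strings ($\mathrm{Ad}(c)$ acting entrywise and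 $\iota_a$ inserting $a$ in all places, also in the empty string; thus $\widetilde{\mathrm{Ad}}(c)^{-1}\mathbf a$ is the sum over all insertions of copies of $-c^{-1}\nabla c$ into $c^{-1}\mathbf a c$). For admissible $c_1,\dots,c_m$ put $$(\phi(c_1,\dots,c_m)\varphi)(a_1,\dots,a_n)=(-1)^{\frac{m(m+1)}2}\sum\pm\varphi\bigl(\mathbf a_0,c_1,\widetilde{\mathrm{Ad}}(c_1)^{-1}\mathbf a_1,\dots,c_m,\widetilde{\mathrm{Ad}}(c_1\cdots c_m)^{-1}\mathbf a_m\bigr)(c_1\cdots c_m)^{-1},$$ the sum being over all decompositions of $(a_1,\dots,a_n)$ into $m+1$ consecutive, possibly empty, strings $\mathbf a_0,\dots,\mathbf a_m$, and the sign being $(-1)^N$, where $N$ is the sum over $j=1,\dots,m$ of $\sum(|a_i|+1)$ over the $a_i$ standing to the left of $c_j$. *Recursion.* On formal linear combinations of expressions $c_0\Phi(c_1,\dots,c_m)$ ($c_i$ invertible, $\Phi()=1$) define an associative product by $\Phi(c_1,\dots,c_m)d=d\,\Phi(d^{-1}c_1d,\dots,d^{-1}c_md)$ and by letting $\Phi(c_1,\dots,c_m)\Phi(d_1,\dots,d_n)$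 be the sum over all shuffles of the two lists, in which each $c_j$ is replaced by $x^{-1}c_jx$, $x$ being the product of the $d_k$ to its left, with sign $(-1)^{\text{number of pairs }(d_k\text{ left of }c_j)}$. Put $s(c_0\Phi(c_1,\dots,c_m))=\Phi(c_0,c_1,\dots,c_m)$, let $T_g$ act on all entries, and put $\Psi(g)=1$ and $$\Psi(g_1,\dots,g_n)=s\sum_{j=1}^{n-1}(-1)^j\,\Psi(g_1,\dots,g_j)\;T_{g_1\cdots g_j}\Psi(g_{j+1},\dots,g_n)\;c(g_1\cdots g_j,g_{j+1}\cdots g_n)\qquad(n\ge2).$$ Let $\psi(g_1,\dots,g_n)$ be the operator obtained from $\Psi(g_1,\dots,g_n)$ by $c_0\Phi(c_1,\dots,c_m)\mapsto\widetilde{\mathrm{Ad}}(c_0)\phi(c_1,\dots,c_m)$. **Theorem.** (1) In this setting assume that $\exp(\iota_{\alpha(g)})$ converges for all $S$ and all local sections $g$ of $\mathcal G$ over $S$ (for example, $\alpha(g)\in\mathcal O^1\cdot\mathcal A^0$ with $\mathcal O$ the de Rham algebra, or $\alpha=0$). Then: (a) $(\mathcal C,\delta+D-\iota_R)$ is a differential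 graded $\mathcal O$-module; in particular $(\delta+D-\iota_R)^2=0$. Here $\omega$ of degree $i$ acts on $\varphi$ of degree $m$ by multiplication of the values with $(-1)^{im+i(i+1)/2}\omega$. (b) For admissible $c_1,\dots,c_m$ (and $c_0$), the sums defining $\phi(c_1,\dots,c_m)$ (and $\widetilde{\mathrm{Ad}}(c_0)\phi(c_1,\dots,c_m)$) are finite on all arguments and these are operators of degree $-m$ on $\mathcal C$, with $\phi()=\mathrm{id}$, and, with $d=\delta+D-\iota_R$, for $m\ge1$, $$[d,\phi(c_1,\dots,c_m)]+\widetilde{\mathrm{Ad}}(c_1)\phi(c_2,\dots,c_m)+\sum_{j=1}^{m-1}(-1)^j\phi(\dots,c_jc_{j+1},\dots)+(-1)^m\phi(c_1,\dots,c_{m-1})=0 .$$ All $c(g_1,g_2)$ are admissible. (c) There is an $A_\infty$ action of $\mathcal G$ on $\mathcal C$: for all $x_1,\dots,x_{n+1}:S\to M$ and $g_j\in\mathcal G_{x_j,x_{j+1}}(S)$, $n\ge1$, $\mathcal O$-linear operators $T(g_1,\dots,g_n):x_{n+1}^*\mathcal C\to x_1^*\mathcal C$ of degree $1-n$, compatible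 with inverse images, with $$[d,T(g_1,\dots,g_n)]+\sum_{j=1}^{n-1}(-1)^jT(g_1,\dots,g_j)T(g_{j+1},\dots,g_n)-\sum_{j=1}^{n-1}(-1)^jT(g_1,\dots,g_jg_{j+1},\dots,g_n)=0,$$ such that $T(g)=\mathcal T_g=\exp(\iota_{\alpha(g)})T_g$ and, for all $n$, $T(g_1,\dots,g_n)=\psi(g_1,\dots,g_n)\,\mathcal T_{g_1\cdots g_n}$. (2) The same holds for a discrete groupoid (in particular, a group) with set of objects $X$ acting on a family $\{A_x\}_{x\in X}$ of graded algebras over a graded commutative differential graded ground ring (in particular, on ungraded algebras with $\nabla=0$, $R=0$, $\alpha=0$, where $T(g)=T_g$), with families of modules $V_x,W_x$, where $\mathcal C_x=\mathcal C(V_x,A_x,W_x)$. In this case it also holds if in $\mathcal C$ the product over $n$ is replaced by the direct sum (the convergence hypothesis being then automatic). -/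

import Mathlib

open CategoryTheory Opposite

universe u v w w₁ w₂

namespace InnerAct

/-! ## Composable strings of arrows -/

/-- A nonempty string `(g₁, …, gₙ)` of composable arrows `x₁ ⟶ x₂ ⟶ ⋯ ⟶ xₙ₊₁`. -/
inductive Chain {X : Type u} [Category.{v} X] : X → X → Type (max u v)
  | single {x y : X} (g : x ⟶ y) : Chain x y
  | cons {x y z : X} (g : x ⟶ y) (gs : Chain y z) : Chain x z

namespace Chain

variable {X : Type u} [Category.{v} X]

/-- The number `n` of arrows. -/
def length : ∀ {x y : X}, Chain x y → ℕ
  | _, _, single _ => 1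
  | _, _, cons _ gs => gs.length + 1

/-- The product `g₁ ⋯ gₙ`. -/
def comp : ∀ {x y : X}, Chain x y → (x ⟶ y)
  | _, _, single g => g
  | _, _, cons g gs => g ≫ gs.comp

/-- The image of a string under a functor. -/
def map {Y : Type w} [Category.{w₁} Y] (F : X ⥤ Y) :
    ∀ {x y : X}, Chain x y → Chain (F.obj x) (F.obj y)
  | _, _, single g => single (F.map g)
  | _, _, cons g gs => cons (F.map g) (gs.map F)

/-- `∑_{j=1}^{n-1} (-1)^j f (g₁, …, gⱼ) (gⱼ₊₁, …, gₙ)`. -/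
def splitSum {M : Type w} [AddCommGroup M] : ∀ {x y : X}, Chain x y →
    (∀ z : X, Chain x z → Chain z y → M) → M
  | _, _, single _, _ => 0
  | _, _, cons g gs, f =>
      -f _ (single g) gs - gs.splitSum (fun z a b => f z (cons g a) b)

/-- `∑_{j=1}^{n-1} (-1)^j f (g₁, …, gⱼ gⱼ₊₁, …, gₙ)`. -/
def mergeSum {M : Type w} [AddCommGroup M] : ∀ {x y : X}, Chain x y → (Chain x y → M) → M
  | _, _, single _, _ => 0
  | _, _, cons g (single h), f => -f (single (g ≫ h))
  | _, _, cons g (cons h gs), f =>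
      -f (cons (g ≫ h) gs) - (cons h gs).mergeSum (fun c => f (cons g c))

end Chain

/-! ## Operations on multilinear functions of several arguments

A family `(φₙ)ₙ` of functions of `n` arguments in `A` is a function `φ` on lists. -/

section Algebra

variable {A : Type u} [Ring A] (𝒜 : ℤ → AddSubgroup A) [GradedRing 𝒜]

/-- The additive map that multiplies the elements of degree `i` by `(-1) ^ e i`. -/
noncomputable def signBy (e : ℤ → ℤ) : A →+ A :=
  (DirectSum.toAddMonoid fun i => ((e i).negOnePow : ℤ) • (𝒜 i).subtype).comp
    (DirectSum.decomposeAddEquiv 𝒜).toAddMonoidHom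

/-- `a ↦ (-1) ^ (n |a|) a`. -/
noncomputable def koszul (n : ℤ) : A →+ A := signBy 𝒜 fun i => n * i

/-- `a ↦ (-1) ^ (n (|a| + 1)) a`. -/
noncomputable def bar (n : ℤ) : A →+ A := signBy 𝒜 fun i => n * (i + 1)

/-- All ways of inserting `n` copies of `a` into the list `l`, the positions of the copies being
chosen independently: `n` copies of `a` are distributed over the `l.length + 1` gaps of `l`. -/
def insertions {B : Type u} (a : B) : ℕ → List B → List (List B)
  | 0, l => [l]
  | n + 1, [] => [List.replicate (n + 1) a]
  | n + 1, b :: l =>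
      ((insertions a n (b :: l)).map (List.cons a)) ++ ((insertions a (n + 1) l).map (List.cons b))

/-- The insertion operator `ι_a` without signs, as it occurs for `a` of degree one. -/
def insertOnce {B : Type u} {M : Type v} [AddCommMonoid M] (a : B) (φ : List B → M)
    (l : List B) : M :=
  ∑ j ∈ Finset.range (l.length + 1), φ (l.take j ++ a :: l.drop j)

lemma insertOnce_cons {B : Type u} {M : Type v} [AddCommMonoid M] (a : B) (φ : List B → M)
    (b : B) (l : List B) :
    insertOnce a φ (b :: l) = φ (a :: b :: l) + insertOnce a (fun x => φ (b :: x)) l := by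
  unfold insertOnce
  rw [List.length_cons, Finset.sum_range_succ', add_comm]
  simp

lemma insertions_cons_succ {B : Type u} (a b : B) (n : ℕ) (l : List B) :
    insertions a (n + 1) (b :: l)
      = (insertions a n (b :: l)).map (List.cons a)
        ++ (insertions a (n + 1) l).map (List.cons b) := by
  rw [insertions]

/-- With `ι = insertOnce a`, the operator `φ ↦ ∑_{x ∈ insertions a n l} φ x` is the divided power
`ιⁿ / n!`, so that the sum of these operators over all `n` is `exp ι`. -/
lemma insertions_divided_power {B : Type u} {M : Type v} [AddCommMonoid M] (a : B) (n : ℕ)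
    (l : List B) (φ : List B → M) :
    ((insertions a n l).map (insertOnce a φ)).sum
      = (n + 1) • ((insertions a (n + 1) l).map φ).sum := by
  induction l generalizing n φ with
  | nil =>
    cases n with
    | zero => simp [insertions, insertOnce]
    | succ n =>
      simp only [insertions, List.map_cons, List.map_nil, List.sum_cons, List.sum_nil, add_zero,
        insertOnce, List.length_replicate]
      rw [Finset.sum_congr rfl (g := fun _ => φ (List.replicate (n + 1 + 1) a))]
      · simp
      · intro j hj
        have hj' : j ≤ n + 1 := by simpa [Nat.lt_succ_iff] using hj
        congr 1
        rw [List.take_replicate, List.drop_replicate, ← List.replicate_succ,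
          List.replicate_append_replicate]
        congr 1
        omega
  | cons b l ih =>
    induction n generalizing φ with
    | zero =>
      have h := ih 0 (fun x => φ (b :: x))
      simp only [insertions, List.map_cons, List.map_nil, List.sum_cons, List.sum_nil, add_zero,
        zero_add, one_smul, List.map_append, List.map_map, List.sum_append] at h ⊢
      rw [insertOnce_cons, h]
      rfl
    | succ n ihn =>
      have h1 := ihn (fun x => φ (a :: x))
      have h2 := ih (n + 1) (fun x => φ (b :: x))
      have e1 : (insertOnce a φ ∘ List.cons a)
          = fun x => φ (a :: a :: x) + insertOnce a (fun y => φ (a :: y)) x := by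
        funext x; exact insertOnce_cons a φ a x
      have e2 : (insertOnce a φ ∘ List.cons b)
          = fun x => φ (a :: b :: x) + insertOnce a (fun y => φ (b :: y)) x := by
        funext x; exact insertOnce_cons a φ b x
      have e3 : ((insertions a (n + 1) (b :: l)).map fun x => φ (a :: x)).sum
          = ((insertions a n (b :: l)).map fun x => φ (a :: a :: x)).sum
            + ((insertions a (n + 1) l).map fun x => φ (a :: b :: x)).sum := by
        simp [insertions, Function.comp_def]
      have e4 : ((insertions a (n + 1 + 1) (b :: l)).map φ).sum
          = ((insertions a (n + 1) (b :: l)).map fun x => φ (a :: x)).sum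
            + ((insertions a (n + 1 + 1) l).map fun x => φ (b :: x)).sum := by
        rw [insertions_cons_succ, List.map_append, List.sum_append, List.map_map, List.map_map]
        rfl
      have e5 : ((insertions a (n + 1) (b :: l)).map (insertOnce a φ)).sum
          = (((insertions a n (b :: l)).map fun x => φ (a :: a :: x)).sum
            + (n + 1) • ((insertions a (n + 1) (b :: l)).map fun x => φ (a :: x)).sum)
            + (((insertions a (n + 1) l).map fun x => φ (a :: b :: x)).sum
            + (n + 1 + 1) • ((insertions a (n + 1 + 1) l).map fun x => φ (b :: x)).sum) := by
        rw [← h1, ← h2, ← List.sum_map_add, ← List.sum_map_add, ← e1, ← e2,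
          insertions_cons_succ a b n l, List.map_append, List.sum_append, List.map_map,
          List.map_map]
      rw [e5, e4, smul_add, succ_nsmul (n := n + 1)
        (a := ((insertions a (n + 1) (b :: l)).map fun x => φ (a :: x)).sum),
        add_add_add_comm, ← e3, add_comm ((n + 1) • _)
          ((insertions a (n + 1) (b :: l)).map fun x => φ (a :: x)).sum]
      rw [← add_assoc]

/-- `∑_{1 ≤ j < n} φ (s a₁, …, s aⱼ₋₁, (s aⱼ) aⱼ₊₁, aⱼ₊₂, …, aₙ)` with `s a = (-1) ^ (|a| + 1) a`. -/
noncomputable def mulAdjacent {M : Type v} [AddCommGroup M] : (List A → M) → List A → M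
  | _, [] => 0
  | _, [_] => 0
  | φ, a :: b :: l =>
      φ (bar 𝒜 1 a * b :: l) + mulAdjacent (fun x => φ (bar 𝒜 1 a :: x)) (b :: l)

/-- `∑ⱼ φ (s a₁, …, s aⱼ₋₁, D aⱼ, aⱼ₊₁, …, aₙ)` with `s a = (-1) ^ (|a| + 1) a`. -/
noncomputable def deriveEntries {M : Type v} [AddCommGroup M] (D : A → A) :
    (List A → M) → List A → M
  | _, [] => 0
  | φ, a :: l => φ (D a :: l) + deriveEntries D (fun x => φ (bar 𝒜 1 a :: x)) l

/-- `∑_{0 ≤ j ≤ n} φ (s a₁, …, s aⱼ, r, aⱼ₊₁, …, aₙ)` with `s a = (-1) ^ (|a| + 1) a`. -/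
noncomputable def insertSigned {M : Type v} [AddCommGroup M] (r : A) :
    (List A → M) → List A → M
  | φ, [] => φ [r]
  | φ, a :: l => φ (r :: a :: l) + insertSigned r (fun x => φ (bar 𝒜 1 a :: x)) l

/-- For a block `𝐚 = (a₁, …, aₙ)`, the lists whose sum is the part of the expression
`exp (ι_{-u⁻¹ D u}) (u⁻¹ a₁ u, …, u⁻¹ aₙ u)` (that is, `Ãd(u)⁻¹ 𝐚`) with `k` inserted elements. -/
def blocks (D : A → A) (u : Aˣ) (k : ℕ) (l : List A) : List (List A) :=
  insertions (-(↑u⁻¹ * D ↑u)) k (l.map fun a => ↑u⁻¹ * a * ↑u)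

/-- For `cs = (c₁, …, cₘ)` this is the sum over all decompositions of the list into consecutive
blocks `(𝐚₀, …, 𝐚ₘ)` of the terms `± f (Ãd(u)⁻¹ 𝐚₀, c₁, Ãd(u c₁)⁻¹ 𝐚₁, …, cₘ, Ãd(u c₁ ⋯ cₘ)⁻¹ 𝐚ₘ)`
with exactly `K` elements inserted by the exponentials. Every `cⱼ` contributes the sign
`(-1) ^ (|a| + 1)` for each argument `a` to the left of it. -/
noncomputable def phiSum {M : Type v} [AddCommGroup M] (D : A → A) :
    Aˣ → List Aˣ → ℕ → List A → (List A → M) → M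
  | u, [], K, l, f => ((blocks D u K l).map f).sum
  | u, c :: cs, K, l, f =>
      ∑ j ∈ Finset.range (l.length + 1), ∑ i ∈ Finset.range (K + 1),
        ((blocks D u i ((l.take j).map (bar 𝒜 (cs.length + 1)))).map fun y =>
          phiSum D (u * c) cs (K - i) (l.drop j) fun z => f (y ++ ↑c :: z)).sum

/-- `∑_{j=1}^{n-1} (-1)^j f (c₁, …, cⱼ cⱼ₊₁, …, cₙ)`. -/
def mergeListSum {G : Type u} [Mul G] {M : Type v} [AddCommGroup M] : List G → (List G → M) → M
  | [], _ => 0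
  | [_], _ => 0
  | a :: b :: l, f => -f (a * b :: l) - mergeListSum (b :: l) (fun x => f (a :: x))

end Algebra

/-! ## Formal expressions `c₀ Φ(c₁, …, cₘ)` -/

section Words

variable {G : Type u} [Group G]

/-- The product `Φ(c₁, …, cₘ) Φ(d₁, …, dₙ)`: the sum of all shuffles of the two lists, in which a
`c` that has been moved past `d₁, …, dₖ` is replaced by its conjugate
`(d₁ ⋯ dₖ)⁻¹ c (d₁ ⋯ dₖ)`, with the sign of the shuffle. -/
def shuffle : List G → List G → FreeAbelianGroup (List G)
  | [], ds => FreeAbelianGroup.of ds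
  | c :: cs, [] => FreeAbelianGroup.of (c :: cs)
  | c :: cs, d :: ds =>
      FreeAbelianGroup.map (List.cons c) (shuffle cs (d :: ds))
        + ((((cs.length : ℤ) + 1).negOnePow : ℤˣ) : ℤ) •
          FreeAbelianGroup.map (List.cons d)
            (shuffle ((c :: cs).map fun x => d⁻¹ * x * d) ds)
  termination_by cs ds => cs.length + ds.length

/-- Linear combinations of the expressions `c₀ Φ(c₁, …, cₘ)`; the generator is `(c₀, [c₁, …, cₘ])`. -/
abbrev Words (G : Type u) := FreeAbelianGroup (G × List G)

/-- The product, with `Φ(c₁, …, cₘ) d = d Φ(d⁻¹ c₁ d, …, d⁻¹ cₘ d)`. -/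
noncomputable def wordMul (x y : Words G) : Words G :=
  FreeAbelianGroup.lift (fun w => FreeAbelianGroup.lift (fun w' =>
    FreeAbelianGroup.map (fun l => (w.1 * w'.1, l))
      (shuffle (w.2.map fun c => w'.1⁻¹ * c * w'.1) w'.2)) y) x

/-- The homotopy `s (c₀ Φ(c₁, …, cₘ)) = Φ(c₀, c₁, …, cₘ)`. -/
noncomputable def wordShift : Words G →+ Words G :=
  FreeAbelianGroup.map fun w => (1, w.1 :: w.2)

/-- The map induced by a group homomorphism. -/
noncomputable def wordMap {H : Type u} [Group H] (f : G →* H) : Words G →+ Words H :=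
  FreeAbelianGroup.map fun w => (f w.1, w.2.map f)

end Words

/-! ## Groupoids over a category of test objects -/

/-- A presheaf of groupoids on `𝕋`. An arrow `g : x ⟶ y` is an element of `G_{x,y}`, so that
`g₁ ≫ g₂` is the product `g₁ g₂`. -/
structure GroupoidPresheaf (𝕋 : Type u) [Category.{v} 𝕋] where
  Ob : 𝕋 → Type w
  grpd : ∀ S, Groupoid.{w} (Ob S)
  res : ∀ {S' S : 𝕋}, (S' ⟶ S) → (Ob S ⥤ Ob S')
  res_id : ∀ S : 𝕋, res (𝟙 S) = 𝟭 (Ob S)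
  res_comp : ∀ {S'' S' S : 𝕋} (k : S'' ⟶ S') (h : S' ⟶ S), res (k ≫ h) = res h ⋙ res k

attribute [instance] GroupoidPresheaf.grpd

section General

variable {𝕋 : Type u} [Category.{v} 𝕋]

/-- The test objects over the object of objects: pairs of a test object `S` and an `S`-point of
the objects of the groupoid. -/
structure El (F : GroupoidPresheaf.{u, v, w} 𝕋) where
  base : 𝕋
  pt : F.Ob base

/-- A morphism over the object of objects. -/
@[ext]
structure El.Hom {F : GroupoidPresheaf.{u, v, w} 𝕋} (q p : El F) where
  map : q.base ⟶ p.base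
  eq : (F.res map).obj p.pt = q.pt

instance (F : GroupoidPresheaf.{u, v, w} 𝕋) : Category (El F) where
  Hom q p := El.Hom q p
  id p := ⟨𝟙 p.base, by rw [F.res_id]; rfl⟩
  comp k' k := ⟨k'.map ≫ k.map, by
    rw [F.res_comp, Functor.comp_obj, k.eq, k'.eq]⟩
  id_comp k := El.Hom.ext (Category.id_comp k.map)
  comp_id k := El.Hom.ext (Category.comp_id k.map)
  assoc k l m := El.Hom.ext (Category.assoc k.map l.map m.map)

/-- The functor that forgets the point. -/
def El.toBase (F : GroupoidPresheaf.{u, v, w} 𝕋) : El F ⥤ 𝕋 where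
  obj p := p.base
  map k := El.Hom.map k

/-- The morphism `h : (S', h^* x) ⟶ (S, x)`. -/
def El.lift (F : GroupoidPresheaf.{u, v, w} 𝕋) {S' S : 𝕋} (h : S' ⟶ S) (x : F.Ob S) :
    (⟨S', (F.res h).obj x⟩ : El F) ⟶ ⟨S, x⟩ :=
  El.Hom.mk h rfl

/-- The inverse image of an arrow `g : x ⟶ y` along a morphism to `(S, x)`. -/
def El.pull {F : GroupoidPresheaf.{u, v, w} 𝕋} {S : 𝕋} {x y : F.Ob S} (g : x ⟶ y) {q : El F}
    (k : q ⟶ ⟨S, x⟩) : q.pt ⟶ (F.res (El.Hom.map k)).obj y :=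
  eqToHom (El.Hom.eq k).symm ≫ (F.res (El.Hom.map k)).map g

end General

/-! ## Sheaves of graded algebras and modules -/

/-- A presheaf of `ℤ`-graded rings on `E`. -/
structure GrAlg (E : Type u) [Category.{v} E] where
  obj : E → Type w
  ring : ∀ p, Ring (obj p)
  gr : ∀ p, ℤ → AddSubgroup (obj p)
  graded : ∀ p, GradedRing (gr p)
  res : ∀ {q p : E}, (q ⟶ p) → (obj p →+* obj q)
  res_mem : ∀ {q p : E} (k : q ⟶ p) {i : ℤ} {a : obj p}, a ∈ gr p i → res k a ∈ gr q i
  res_id : ∀ (p : E) (a : obj p), res (𝟙 p) a = a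
  res_comp : ∀ {r q p : E} (k' : r ⟶ q) (k : q ⟶ p) (a : obj p),
    res (k' ≫ k) a = res k' (res k a)

attribute [instance] GrAlg.ring GrAlg.graded

/-- The presheaf of homogeneous elements of degree `i`. -/
def GrAlg.component {E : Type u} [Category.{v} E] (A : GrAlg.{u, v, w} E) (i : ℤ) :
    Eᵒᵖ ⥤ Type w where
  obj p := A.gr p.unop i
  map k := TypeCat.ofHom fun a => ⟨A.res k.unop a.1, A.res_mem k.unop a.2⟩
  map_id p := by
    ext a
    exact A.res_id p.unop a.1
  map_comp k l := by
    ext a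
    exact A.res_comp l.unop k.unop a.1

/-- The presheaf is a sheaf of graded rings. -/
def GrAlg.IsSheaf {E : Type u} [Category.{v} E] (A : GrAlg.{u, v, w} E) (J : Precoverage E) :
    Prop :=
  ∀ (i : ℤ) (p : E), ∀ R ∈ J p, Presieve.IsSheafFor (A.component i) R

/-- A presheaf of `ℤ`-graded left modules. -/
structure GrMod {E : Type u} [Category.{v} E] (A : GrAlg.{u, v, w} E) where
  obj : E → Type w
  grp : ∀ p, AddCommGroup (obj p)
  mod : ∀ p, Module (A.obj p) (obj p)
  gr : ∀ p, ℤ → AddSubgroup (obj p)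
  dec : ∀ p, DirectSum.Decomposition (gr p)
  smul_mem : ∀ {p : E} {i j : ℤ} {a : A.obj p} {v : obj p}, a ∈ A.gr p i → v ∈ gr p j →
    a • v ∈ gr p (i + j)
  res : ∀ {q p : E}, (q ⟶ p) → (obj p →+ obj q)
  res_mem : ∀ {q p : E} (k : q ⟶ p) {i : ℤ} {v : obj p}, v ∈ gr p i → res k v ∈ gr q i
  res_smul : ∀ {q p : E} (k : q ⟶ p) (a : A.obj p) (v : obj p),
    res k (a • v) = A.res k a • res k v
  res_id : ∀ (p : E) (v : obj p), res (𝟙 p) v = v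
  res_comp : ∀ {r q p : E} (k' : r ⟶ q) (k : q ⟶ p) (v : obj p),
    res (k' ≫ k) v = res k' (res k v)

attribute [instance] GrMod.grp GrMod.mod

/-- The presheaf of homogeneous elements of degree `i`. -/
def GrMod.component {E : Type u} [Category.{v} E] {A : GrAlg.{u, v, w} E} (V : GrMod A) (i : ℤ) :
    Eᵒᵖ ⥤ Type w where
  obj p := V.gr p.unop i
  map k := TypeCat.ofHom fun a => ⟨V.res k.unop a.1, V.res_mem k.unop a.2⟩
  map_id p := by
    ext a
    exact V.res_id p.unop a.1
  map_comp k l := by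
    ext a
    exact V.res_comp l.unop k.unop a.1

/-- The presheaf is a sheaf of graded modules. -/
def GrMod.IsSheaf {E : Type u} [Category.{v} E] {A : GrAlg.{u, v, w} E} (V : GrMod A)
    (J : Precoverage E) : Prop :=
  ∀ (i : ℤ) (p : E), ∀ R ∈ J p, Presieve.IsSheafFor (V.component i) R

/-- A graded commutative differential graded algebra `𝒪_S`, defined for every test object `S`, with
its inverse images. -/
structure DGScalars (𝕋 : Type u) [Category.{v} 𝕋] extends GrAlg.{u, v, w} 𝕋 where
  comm : ∀ {S : 𝕋} {i j : ℤ} {a b : obj S}, a ∈ gr S i → b ∈ gr S j →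
    a * b = (i * j).negOnePow • (b * a)
  d : ∀ S, obj S →+ obj S
  d_mem : ∀ {S : 𝕋} {i : ℤ} {a : obj S}, a ∈ gr S i → d S a ∈ gr S (i + 1)
  d_d : ∀ (S : 𝕋) (a : obj S), d S (d S a) = 0
  d_mul : ∀ (S : 𝕋) (a b : obj S), d S (a * b) = d S a * b + koszul (gr S) 1 a * d S b
  d_res : ∀ {S' S : 𝕋} (h : S' ⟶ S) (a : obj S), d S' (res h a) = res h (d S a)

section Geometry

variable {𝕋 : Type u} [Category.{v} 𝕋]

/-- A presheaf `𝒜` of graded `𝒪`-algebras: for a test object `S` and an `S`-point `x` of the objects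
of the groupoid, `A.obj ⟨S, x⟩` is the algebra of sections over `S` of the inverse image `x^* 𝒜`. -/
structure OAlg (O : DGScalars.{u, v, w₂} 𝕋) (F : GroupoidPresheaf.{u, v, w} 𝕋) extends
    GrAlg.{max u w, v, w₂} (El F) where
  η : ∀ p : El F, O.obj p.base →+* obj p
  η_mem : ∀ {p : El F} {i : ℤ} {ω : O.obj p.base}, ω ∈ O.gr p.base i → η p ω ∈ gr p i
  η_comm : ∀ {p : El F} {i j : ℤ} {ω : O.obj p.base} {a : obj p},
    ω ∈ O.gr p.base i → a ∈ gr p j → η p ω * a = (i * j).negOnePow • (a * η p ω)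
  η_res : ∀ {q p : El F} (k : q ⟶ p) (ω : O.obj p.base),
    res k (η p ω) = η q (O.res (El.Hom.map k) ω)

variable {O : DGScalars.{u, v, w₂} 𝕋} {F : GroupoidPresheaf.{u, v, w} 𝕋}

/-- An action of the groupoid on `𝒜` up to inner automorphisms. -/
structure InnerAction (A : OAlg O F) where
  T : ∀ {S : 𝕋} {x y : F.Ob S}, (x ⟶ y) → (A.obj ⟨S, y⟩ ≃+* A.obj ⟨S, x⟩)
  T_mem : ∀ {S : 𝕋} {x y : F.Ob S} (g : x ⟶ y) {i : ℤ} {a : A.obj ⟨S, y⟩},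
    a ∈ A.gr ⟨S, y⟩ i → T g a ∈ A.gr ⟨S, x⟩ i
  T_η : ∀ {S : 𝕋} {x y : F.Ob S} (g : x ⟶ y) (ω : O.obj S),
    T g (A.η ⟨S, y⟩ ω) = A.η ⟨S, x⟩ ω
  T_res : ∀ {S' S : 𝕋} (h : S' ⟶ S) {x y : F.Ob S} (g : x ⟶ y) (a : A.obj ⟨S, y⟩),
    A.res (El.lift F h x) (T g a) = T ((F.res h).map g) (A.res (El.lift F h y) a)
  c : ∀ {S : 𝕋} {x y z : F.Ob S}, (x ⟶ y) → (y ⟶ z) → (A.obj ⟨S, x⟩)ˣ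
  c_mem : ∀ {S : 𝕋} {x y z : F.Ob S} (g₁ : x ⟶ y) (g₂ : y ⟶ z),
    (c g₁ g₂ : A.obj ⟨S, x⟩) ∈ A.gr ⟨S, x⟩ 0
  c_res : ∀ {S' S : 𝕋} (h : S' ⟶ S) {x y z : F.Ob S} (g₁ : x ⟶ y) (g₂ : y ⟶ z),
    A.res (El.lift F h x) (c g₁ g₂ : A.obj ⟨S, x⟩)
      = (c ((F.res h).map g₁) ((F.res h).map g₂) : A.obj ⟨S', (F.res h).obj x⟩)
  T_T : ∀ {S : 𝕋} {x y z : F.Ob S} (g₁ : x ⟶ y) (g₂ : y ⟶ z) (a : A.obj ⟨S, z⟩),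
    T g₁ (T g₂ a) = c g₁ g₂ * T (g₁ ≫ g₂) a * ↑(c g₁ g₂)⁻¹
  cocycle : ∀ {S : 𝕋} {x y z t : F.Ob S} (g₁ : x ⟶ y) (g₂ : y ⟶ z) (g₃ : z ⟶ t),
    (c g₁ g₂ * c (g₁ ≫ g₂) g₃ : A.obj ⟨S, x⟩)
      = T g₁ (c g₂ g₃ : A.obj ⟨S, y⟩) * c g₁ (g₂ ≫ g₃)

/-- A flat connection on `𝒜` up to inner derivations, compatible with an action of the groupoid up
to inner automorphisms. -/
structure FlatConnection {A : OAlg O F} (act : InnerAction A) where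
  D : ∀ p : El F, A.obj p →+ A.obj p
  D_mem : ∀ {p : El F} {i : ℤ} {a : A.obj p}, a ∈ A.gr p i → D p a ∈ A.gr p (i + 1)
  D_mul : ∀ (p : El F) (a b : A.obj p),
    D p (a * b) = D p a * b + koszul (A.gr p) 1 a * D p b
  D_η : ∀ (p : El F) (ω : O.obj p.base), D p (A.η p ω) = A.η p (O.d p.base ω)
  D_res : ∀ {q p : El F} (k : q ⟶ p) (a : A.obj p), D q (A.res k a) = A.res k (D p a)
  R : ∀ p : El F, A.obj p
  R_mem : ∀ p : El F, R p ∈ A.gr p 2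
  R_res : ∀ {q p : El F} (k : q ⟶ p), A.res k (R p) = R q
  α : ∀ {S : 𝕋} {x y : F.Ob S}, (x ⟶ y) → A.obj ⟨S, x⟩
  α_mem : ∀ {S : 𝕋} {x y : F.Ob S} (g : x ⟶ y), α g ∈ A.gr ⟨S, x⟩ 1
  α_res : ∀ {S' S : 𝕋} (h : S' ⟶ S) {x y : F.Ob S} (g : x ⟶ y),
    A.res (El.lift F h x) (α g) = α ((F.res h).map g)
  D_D : ∀ (p : El F) (a : A.obj p), D p (D p a) = R p * a - a * R p
  D_R : ∀ p : El F, D p (R p) = 0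
  T_D : ∀ {S : 𝕋} {x y : F.Ob S} (g : x ⟶ y) (a : A.obj ⟨S, x⟩),
    act.T g (D ⟨S, y⟩ ((act.T g).symm a))
      = D ⟨S, x⟩ a + (α g * a - koszul (A.gr ⟨S, x⟩) 1 a * α g)
  D_α : ∀ {S : 𝕋} {x y : F.Ob S} (g : x ⟶ y),
    D ⟨S, x⟩ (α g) + α g * α g = act.T g (R ⟨S, y⟩) - R ⟨S, x⟩
  α_α : ∀ {S : 𝕋} {x y z : F.Ob S} (g₁ : x ⟶ y) (g₂ : y ⟶ z),
    α g₁ + act.T g₁ (α g₂) - act.c g₁ g₂ * α (g₁ ≫ g₂) * ↑(act.c g₁ g₂)⁻¹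
      + D ⟨S, x⟩ (act.c g₁ g₂) * ↑(act.c g₁ g₂)⁻¹ = 0

/-- A graded `𝒜`-module with a compatible action of the groupoid and a compatible connection. -/
structure CompatModule {A : OAlg O F} {act : InnerAction A} (conn : FlatConnection act) extends
    GrMod A.toGrAlg where
  T : ∀ {S : 𝕋} {x y : F.Ob S}, (x ⟶ y) → (obj ⟨S, y⟩ ≃+ obj ⟨S, x⟩)
  T_mem : ∀ {S : 𝕋} {x y : F.Ob S} (g : x ⟶ y) {i : ℤ} {v : obj ⟨S, y⟩},
    v ∈ gr ⟨S, y⟩ i → T g v ∈ gr ⟨S, x⟩ i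
  T_res : ∀ {S' S : 𝕋} (h : S' ⟶ S) {x y : F.Ob S} (g : x ⟶ y) (v : obj ⟨S, y⟩),
    res (El.lift F h x) (T g v) = T ((F.res h).map g) (res (El.lift F h y) v)
  T_smul : ∀ {S : 𝕋} {x y : F.Ob S} (g : x ⟶ y) (a : A.obj ⟨S, y⟩) (v : obj ⟨S, y⟩),
    T g (a • v) = act.T g a • T g v
  T_T : ∀ {S : 𝕋} {x y z : F.Ob S} (g₁ : x ⟶ y) (g₂ : y ⟶ z) (v : obj ⟨S, z⟩),
    T g₁ (T g₂ v) = (act.c g₁ g₂ : A.obj ⟨S, x⟩) • T (g₁ ≫ g₂) v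
  D : ∀ p : El F, obj p →+ obj p
  D_mem : ∀ {p : El F} {i : ℤ} {v : obj p}, v ∈ gr p i → D p v ∈ gr p (i + 1)
  D_res : ∀ {q p : El F} (k : q ⟶ p) (v : obj p), D q (res k v) = res k (D p v)
  D_D : ∀ (p : El F) (v : obj p), D p (D p v) = conn.R p • v
  D_smul : ∀ (p : El F) (a : A.obj p) (v : obj p),
    D p (a • v) = conn.D p a • v + koszul (A.gr p) 1 a • D p v
  T_D : ∀ {S : 𝕋} {x y : F.Ob S} (g : x ⟶ y) (v : obj ⟨S, x⟩),
    T g (D ⟨S, y⟩ ((T g).symm v)) = D ⟨S, x⟩ v + conn.α g • v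

/-! ## Complexes of `𝒪`-modules and `A_∞` actions -/

/-- The data of a presheaf of differential graded `𝒪`-modules. The component of degree `m` is the
subgroup `deg p m` of an ambient group; `smul m ω φ` and `d m φ` are the product and the differential
of an element `φ` of degree `m`. -/
structure CxData (O : DGScalars.{u, v, w₂} 𝕋) (F : GroupoidPresheaf.{u, v, w} 𝕋) where
  obj : El F → Type w₁
  grp : ∀ p, AddCommGroup (obj p)
  deg : ∀ p, ℤ → AddSubgroup (obj p)
  smul : ∀ {p : El F}, ℤ → O.obj p.base → obj p → obj p
  d : ∀ {p : El F}, ℤ → obj p → obj p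
  res : ∀ {q p : El F}, (q ⟶ p) → obj p → obj q

attribute [instance] CxData.grp

/-- The axioms of a presheaf of differential graded `𝒪`-modules. -/
structure CxData.IsDGModule (C : CxData.{u, v, w, w₁, w₂} O F) : Prop where
  smul_mem : ∀ {p : El F} {i m : ℤ} {ω : O.obj p.base} {φ : C.obj p},
    ω ∈ O.gr p.base i → φ ∈ C.deg p m → C.smul m ω φ ∈ C.deg p (i + m)
  add_smul : ∀ {p : El F} (m : ℤ) (ω ω' : O.obj p.base) {φ : C.obj p}, φ ∈ C.deg p m →
    C.smul m (ω + ω') φ = C.smul m ω φ + C.smul m ω' φ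
  smul_add : ∀ {p : El F} (m : ℤ) (ω : O.obj p.base) {φ ψ : C.obj p}, φ ∈ C.deg p m →
    ψ ∈ C.deg p m → C.smul m ω (φ + ψ) = C.smul m ω φ + C.smul m ω ψ
  one_smul : ∀ {p : El F} (m : ℤ) {φ : C.obj p}, φ ∈ C.deg p m → C.smul m 1 φ = φ
  mul_smul : ∀ {p : El F} {i m : ℤ} (ω : O.obj p.base) {ω' : O.obj p.base} {φ : C.obj p},
    ω' ∈ O.gr p.base i → φ ∈ C.deg p m →
    C.smul m (ω * ω') φ = C.smul (i + m) ω (C.smul m ω' φ)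
  d_mem : ∀ {p : El F} {m : ℤ} {φ : C.obj p}, φ ∈ C.deg p m → C.d m φ ∈ C.deg p (m + 1)
  d_add : ∀ {p : El F} {m : ℤ} {φ ψ : C.obj p}, φ ∈ C.deg p m → ψ ∈ C.deg p m →
    C.d m (φ + ψ) = C.d m φ + C.d m ψ
  d_d : ∀ {p : El F} {m : ℤ} {φ : C.obj p}, φ ∈ C.deg p m → C.d (m + 1) (C.d m φ) = 0
  d_smul : ∀ {p : El F} {i m : ℤ} {ω : O.obj p.base} {φ : C.obj p},
    ω ∈ O.gr p.base i → φ ∈ C.deg p m →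
    C.d (i + m) (C.smul m ω φ)
      = C.smul m (O.d p.base ω) φ + i.negOnePow • C.smul (m + 1) ω (C.d m φ)
  res_mem : ∀ {q p : El F} (k : q ⟶ p) {m : ℤ} {φ : C.obj p}, φ ∈ C.deg p m →
    C.res k φ ∈ C.deg q m
  res_add : ∀ {q p : El F} (k : q ⟶ p) {m : ℤ} {φ ψ : C.obj p}, φ ∈ C.deg p m →
    ψ ∈ C.deg p m → C.res k (φ + ψ) = C.res k φ + C.res k ψ
  res_id : ∀ {p : El F} {m : ℤ} {φ : C.obj p}, φ ∈ C.deg p m → C.res (𝟙 p) φ = φ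
  res_comp : ∀ {r q p : El F} (k' : r ⟶ q) (k : q ⟶ p) {m : ℤ} {φ : C.obj p},
    φ ∈ C.deg p m → C.res (k' ≫ k) φ = C.res k' (C.res k φ)
  res_smul : ∀ {q p : El F} (k : q ⟶ p) {m : ℤ} (ω : O.obj p.base) {φ : C.obj p},
    φ ∈ C.deg p m → C.res k (C.smul m ω φ) = C.smul m (O.res (El.Hom.map k) ω) (C.res k φ)
  res_d : ∀ {q p : El F} (k : q ⟶ p) {m : ℤ} {φ : C.obj p}, φ ∈ C.deg p m →
    C.res k (C.d m φ) = C.d m (C.res k φ)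

/-- An `A_∞` action of the groupoid on a differential graded `𝒪`-module `𝒞`: for every string
`g = (g₁, …, gₙ)` an `𝒪`-linear operator `T(g₁, …, gₙ)` of degree `1 - n`, compatible with inverse
images, subject to the `A_∞` relations. -/
structure AInfAction (C : CxData.{u, v, w, w₁, w₂} O F) where
  T : ∀ {S : 𝕋} {x y : F.Ob S}, Chain x y → ℤ → C.obj ⟨S, y⟩ → C.obj ⟨S, x⟩
  mem : ∀ {S : 𝕋} {x y : F.Ob S} (g : Chain x y) {m : ℤ} {φ : C.obj ⟨S, y⟩},
    φ ∈ C.deg ⟨S, y⟩ m → T g m φ ∈ C.deg ⟨S, x⟩ (m + 1 - g.length)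
  map_add : ∀ {S : 𝕋} {x y : F.Ob S} (g : Chain x y) {m : ℤ} {φ ψ : C.obj ⟨S, y⟩},
    φ ∈ C.deg ⟨S, y⟩ m → ψ ∈ C.deg ⟨S, y⟩ m → T g m (φ + ψ) = T g m φ + T g m ψ
  map_smul : ∀ {S : 𝕋} {x y : F.Ob S} (g : Chain x y) {i m : ℤ} {ω : O.obj S}
    {φ : C.obj ⟨S, y⟩}, ω ∈ O.gr S i → φ ∈ C.deg ⟨S, y⟩ m →
    T g (i + m) (C.smul (p := ⟨S, y⟩) m ω φ)
      = (i * (1 - g.length)).negOnePow •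
        C.smul (p := ⟨S, x⟩) (m + 1 - g.length) ω (T g m φ)
  res : ∀ {S' S : 𝕋} (h : S' ⟶ S) {x y : F.Ob S} (g : Chain x y) {m : ℤ} {φ : C.obj ⟨S, y⟩},
    φ ∈ C.deg ⟨S, y⟩ m →
    C.res (El.lift F h x) (T g m φ) = T (g.map (F.res h)) m (C.res (El.lift F h y) φ)
  relation : ∀ {S : 𝕋} {x y : F.Ob S} (g : Chain x y) {m : ℤ} {φ : C.obj ⟨S, y⟩},
    φ ∈ C.deg ⟨S, y⟩ m →
    (C.d (m + 1 - g.length) (T g m φ)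
        - (1 - (g.length : ℤ)).negOnePow • T g (m + 1) (C.d m φ))
      + g.splitSum (fun _ a b => T a (m + 1 - b.length) (T b m φ))
      - g.mergeSum (fun g' => T g' m φ) = 0

/-! ## The standard complex -/

/-- Cochains with components of all arities (the direct product), or with components of finitely
many arities only (the direct sum). -/
inductive CochainKind
  | prod
  | sum

variable {A : OAlg O F} {act : InnerAction A} {conn : FlatConnection act}

/-- Functions `φ(a₁, …, aₙ) v` of local sections. -/
abbrev Raw (V W : CompatModule conn) (p : El F) :=
  ∀ q : El F, (q ⟶ p) → List (A.obj q) → V.obj q → W.obj q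

variable {V W : CompatModule conn}

/-- `φ` is a local section over `p` of degree `m` of
`∏ₙ Hom_𝒪(𝒜^{⊗ₙ}, Hom_𝒪(𝒱, 𝒲))` (or of the direct sum): it is additive in every argument, compatible
with inverse images, of degree `m - n` on `n` arguments, and `𝒪`-linear. The signs in the
`𝒪`-linearity are those of the convention in which an argument `a` has the degree `|a| + 1`. -/
structure IsCochain (κ : CochainKind) (p : El F) (m : ℤ) (φ : Raw V W p) : Prop where
  res : ∀ {r q : El F} (k' : r ⟶ q) (k : q ⟶ p) (l : List (A.obj q)) (v : V.obj q),
    W.res k' (φ q k l v) = φ r (k' ≫ k) (l.map (A.res k')) (V.res k' v)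
  add_entry : ∀ {q : El F} (k : q ⟶ p) (l l' : List (A.obj q)) (a b : A.obj q) (v : V.obj q),
    φ q k (l ++ (a + b) :: l') v = φ q k (l ++ a :: l') v + φ q k (l ++ b :: l') v
  add_right : ∀ {q : El F} (k : q ⟶ p) (l : List (A.obj q)) (v v' : V.obj q),
    φ q k l (v + v') = φ q k l v + φ q k l v'
  degree : ∀ {q : El F} (k : q ⟶ p) {l : List (A.obj q)} {e : List ℤ} {j : ℤ} {v : V.obj q},
    List.Forall₂ (fun a i => a ∈ A.gr q i) l e → v ∈ V.gr q j →
    φ q k l v ∈ W.gr q (e.sum + j + m - l.length)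
  linear_nil : ∀ {q : El F} (k : q ⟶ p) {i : ℤ} {ω : O.obj q.base} (v : V.obj q),
    ω ∈ O.gr q.base i →
    φ q k [] (A.η q ω • v) = (i * m).negOnePow • (A.η q ω • φ q k [] v)
  linear_first : ∀ {q : El F} (k : q ⟶ p) {i : ℤ} {ω : O.obj q.base} (a : A.obj q)
    (l : List (A.obj q)) (v : V.obj q), ω ∈ O.gr q.base i →
    φ q k (A.η q ω * a :: l) v = (i * (m + 1)).negOnePow • (A.η q ω • φ q k (a :: l) v)
  linear_middle : ∀ {q : El F} (k : q ⟶ p) {i : ℤ} {ω : O.obj q.base} (l l' : List (A.obj q))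
    (a b : A.obj q) (v : V.obj q), ω ∈ O.gr q.base i →
    φ q k (l ++ a * A.η q ω :: b :: l') v
      = i.negOnePow • φ q k (l ++ a :: A.η q ω * b :: l') v
  linear_last : ∀ {q : El F} (k : q ⟶ p) (ω : O.obj q.base) (l : List (A.obj q)) (a : A.obj q)
    (v : V.obj q),
    φ q k (l ++ [a * A.η q ω]) v = φ q k (l ++ [a]) (A.η q ω • v)
  bounded : κ = CochainKind.sum → ∃ N : ℕ, ∀ (q : El F) (k : q ⟶ p) (l : List (A.obj q))
    (v : V.obj q), N ≤ l.length → φ q k l v = 0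

variable (V W) in
/-- The group of cochains of degree `m` over `p`. -/
def cochains (κ : CochainKind) (p : El F) (m : ℤ) : AddSubgroup (Raw V W p) where
  carrier := {φ | IsCochain κ p m φ}
  zero_mem' := by
    constructor <;> intros <;> simp
  add_mem' := by
    rintro φ ψ hφ hψ
    constructor
    · intro r q k' k l v
      simp [hφ.res, hψ.res]
    · intro q k l l' a b v
      simp only [Pi.add_apply, hφ.add_entry, hψ.add_entry]
      abel
    · intro q k l v v'
      simp only [Pi.add_apply, hφ.add_right, hψ.add_right]
      abel
    · intro q k l e j v hl hv
      exact add_mem (hφ.degree k hl hv) (hψ.degree k hl hv)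
    · intro q k i ω v hω
      simp only [Pi.add_apply, hφ.linear_nil k v hω, hψ.linear_nil k v hω, smul_add]
    · intro q k i ω a l v hω
      simp only [Pi.add_apply, hφ.linear_first k a l v hω, hψ.linear_first k a l v hω, smul_add]
    · intro q k i ω l l' a b v hω
      simp only [Pi.add_apply, hφ.linear_middle k l l' a b v hω,
        hψ.linear_middle k l l' a b v hω, smul_add]
    · intro q k ω l a v
      simp only [Pi.add_apply, hφ.linear_last, hψ.linear_last]
    · intro hκ
      obtain ⟨N, hN⟩ := hφ.bounded hκ
      obtain ⟨N', hN'⟩ := hψ.bounded hκ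
      refine ⟨max N N', fun q k l v h => ?_⟩
      simp [hN q k l v (le_trans (le_max_left _ _) h), hN' q k l v (le_trans (le_max_right _ _) h)]
  neg_mem' := by
    rintro φ hφ
    constructor
    · intro r q k' k l v
      simp [hφ.res]
    · intro q k l l' a b v
      simp only [Pi.neg_apply, hφ.add_entry]
      abel
    · intro q k l v v'
      simp only [Pi.neg_apply, hφ.add_right]
      abel
    · intro q k l e j v hl hv
      exact neg_mem (hφ.degree k hl hv)
    · intro q k i ω v hω
      simp only [Pi.neg_apply, hφ.linear_nil k v hω, smul_neg]
    · intro q k i ω a l v hω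
      simp only [Pi.neg_apply, hφ.linear_first k a l v hω, smul_neg]
    · intro q k i ω l l' a b v hω
      simp only [Pi.neg_apply, hφ.linear_middle k l l' a b v hω, smul_neg]
    · intro q k ω l a v
      simp only [Pi.neg_apply, hφ.linear_last]
    · intro hκ
      obtain ⟨N, hN⟩ := hφ.bounded hκ
      exact ⟨N, fun q k l v h => by simp [hN q k l v h]⟩

/-- The Hochschild differential `δ` of a cochain of degree `m`:
`δφ(a₁, …, aₙ) v = (-1)^{m |a₁|} a₁ φ(a₂, …, aₙ) v
  + ∑_{j<n} φ(s a₁, …, s aⱼ₋₁, (s aⱼ) aⱼ₊₁, …, aₙ) v - φ(s a₁, …, s aₙ₋₁) (aₙ v)`. -/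
noncomputable def delta {p : El F} (m : ℤ) (φ : Raw V W p) : Raw V W p := fun q k l v =>
  (match l with
    | [] => 0
    | a :: l' => koszul (A.gr q) m a • φ q k l' v)
  + mulAdjacent (A.gr q) (fun x => φ q k x v) l
  - (if h : l = [] then 0
      else φ q k (l.dropLast.map (bar (A.gr q) 1)) (l.getLast h • v))

/-- The operator induced on cochains of degree `m` by the connections:
`(-1)^{m+1} [∇, φ(a₁, …, aₙ)] - ∑ⱼ φ(s a₁, …, s aⱼ₋₁, ∇ aⱼ, …, aₙ)`, where `φ(a₁, …, aₙ)` has the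
degree `m + ∑ (|aⱼ| + 1)` modulo two. -/
noncomputable def nablaHom {p : El F} (m : ℤ) (φ : Raw V W p) : Raw V W p := fun q k l v =>
  (m + 1).negOnePow •
      (W.D q (φ q k l v) - m.negOnePow • φ q k (l.map (bar (A.gr q) 1)) (V.D q v))
    - deriveEntries (A.gr q) (conn.D q) (fun x => φ q k x v) l

/-- The operator `-ι_R`, that is,
`φ ↦ ∑ⱼ (-1)^{∑_{i≤j} (|aᵢ| + 1)} φ(a₁, …, aⱼ, R, aⱼ₊₁, …, aₙ)`. -/
noncomputable def curvatureTerm {p : El F} (φ : Raw V W p) : Raw V W p := fun q k l v =>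
  insertSigned (A.gr q) (conn.R q) (fun x => φ q k x v) l

/-- Inverse image of a cochain. -/
def Raw.restrict {q p : El F} (k : q ⟶ p) (φ : Raw V W p) : Raw V W q :=
  fun r k' l v => φ r (k' ≫ k) l v

/-- Left multiplication of the values by `(-1)^{i m + i (i + 1) / 2} ω`, for `ω` of degree `i`. -/
noncomputable def Raw.scale {p : El F} (m : ℤ) (ω : O.obj p.base) (φ : Raw V W p) : Raw V W p :=
  fun q k l v =>
    A.η q (O.res (El.Hom.map k) (signBy (O.gr p.base) (fun i => i * m + i * (i + 1) / 2) ω)) •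
      φ q k l v

/-- The total differential `δ + ∇ - ι_R` of a cochain of degree `m`. -/
noncomputable def totalD {p : El F} (m : ℤ) (φ : Raw V W p) : Raw V W p :=
  delta m φ + nablaHom m φ + curvatureTerm φ

variable (V W) in
/-- The standard complex `𝒞(𝒱, 𝒜, 𝒲)` with the total differential `δ + ∇ - ι_R`. -/
noncomputable def stdCx (κ : CochainKind) : CxData O F where
  obj p := Raw V W p
  grp _ := inferInstance
  deg p m := cochains V W κ p m
  smul m ω φ := Raw.scale m ω φ
  d m φ := totalD m φ
  res k φ := Raw.restrict k φ

/-! ## The operators of the action -/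

variable (V W) in
/-- The series `exp(ι_a)`, for `a` of degree one over `p`, converges on cochains in the sense that
it is a finite sum on each list of arguments. -/
def ExpDefined (κ : CochainKind) (p : El F) (a : A.obj p) : Prop :=
  ∀ (q : El F) (k : q ⟶ p) (m : ℤ) (φ : Raw V W q), φ ∈ cochains V W κ q m →
    ∀ (l : List (A.obj q)) (v : V.obj q), ∃ N : ℕ, ∀ n ≥ N,
      ((insertions (A.res k a) n l).map fun y => φ q (𝟙 q) y v).sum = 0

/-- `(T_g φ)(a₁, …, aₙ) v = T_g (φ(T_g⁻¹ a₁, …, T_g⁻¹ aₙ) (T_g⁻¹ v))`. -/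
def conjHom {S : 𝕋} {x y : F.Ob S} (g : x ⟶ y) (φ : Raw V W ⟨S, y⟩) : Raw V W ⟨S, x⟩ :=
  fun _ k l v =>
    W.T (El.pull g k) (φ _ (El.lift F (El.Hom.map k) y)
      (l.map (act.T (El.pull g k)).symm) ((V.T (El.pull g k)).symm v))

/-- The operator `exp(ι_a)` for `a` of degree one; all sums have finitely many nonzero terms if the
series converges. -/
noncomputable def expInsert {p : El F} (a : A.obj p) (φ : Raw V W p) : Raw V W p :=
  fun q k l v => ∑ᶠ n : ℕ, ((insertions (A.res k a) n l).map fun y => φ q k y v).sum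

/-- The operator `𝒯_g = exp(ι_{α(g)}) T_g`. -/
noncomputable def curvedT {S : 𝕋} {x y : F.Ob S} (g : x ⟶ y) (φ : Raw V W ⟨S, y⟩) :
    Raw V W ⟨S, x⟩ :=
  expInsert (conn.α g) (conjHom g φ)

/-- The part with `K` inserted elements of the operator `c₀ φ(c₁, …, cₘ)`, that is, of the composition
of `Ãd(c₀) = exp(-ι_{∇ c₀ · c₀⁻¹}) Ad(c₀)` with `φ(c₁, …, cₘ)`. -/
noncomputable def phiTerm {p : El F} (c₀ : (A.obj p)ˣ) (cs : List (A.obj p)ˣ) (φ : Raw V W p)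
    (q : El F) (k : q ⟶ p) (l : List (A.obj q)) (v : V.obj q) (K : ℕ) : W.obj q :=
  phiSum (A.gr q) (conn.D q) (Units.map (A.res k).toMonoidHom c₀)
    (cs.map (Units.map (A.res k).toMonoidHom)) K l
    (fun y => φ q k y (A.res k ↑(c₀ * cs.prod)⁻¹ • v))

/-- The operator `c₀ φ(c₁, …, cₘ)`. -/
noncomputable def phiOp {p : El F} (c₀ : (A.obj p)ˣ) (cs : List (A.obj p)ˣ) (φ : Raw V W p) :
    Raw V W p := fun q k l v =>
  ((cs.length : ℤ) * (cs.length + 1) / 2).negOnePow •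
    (A.res k (c₀ : A.obj p) • ∑ᶠ K : ℕ, phiTerm c₀ cs φ q k l v K)

variable (V W) in
/-- An invertible element of degree zero for which `Ãd(c) = exp(-ι_{∇ c · c⁻¹}) Ad(c)` is defined. -/
def Admissible (κ : CochainKind) (p : El F) (c : (A.obj p)ˣ) : Prop :=
  (c : A.obj p) ∈ A.gr p 0 ∧ ExpDefined V W κ p (-(conn.D p c * ↑c⁻¹))

/-- Auxiliary to `psiWord`; the first argument bounds the depth of the recursion. -/
noncomputable def psiAux (act : InnerAction A) {S : 𝕋} :
    ℕ → ∀ {x y : F.Ob S}, Chain x y → Words (A.obj ⟨S, x⟩)ˣ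
  | 0, _, _, _ => 0
  | _ + 1, _, _, Chain.single _ => FreeAbelianGroup.of (1, [])
  | N + 1, _, _, Chain.cons g gs =>
      wordShift ((Chain.cons g gs).splitSum fun _ a b =>
        wordMul
          (wordMul (psiAux act N a)
            (wordMap (Units.map (act.T a.comp).toRingHom.toMonoidHom) (psiAux act N b)))
          (FreeAbelianGroup.of (act.c a.comp b.comp, [])))

/-- The expressions `Ψ(g₁, …, gₙ)` with `Ψ(g) = 1` and
`Ψ(g₁, …, gₙ) = s ∑_{j=1}^{n-1} (-1)^j Ψ(g₁, …, gⱼ) · T_{g₁⋯gⱼ} Ψ(gⱼ₊₁, …, gₙ) · c(g₁⋯gⱼ, gⱼ₊₁⋯gₙ)`. -/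
noncomputable def psiWord (act : InnerAction A) {S : 𝕋} {x y : F.Ob S} (g : Chain x y) :
    Words (A.obj ⟨S, x⟩)ˣ :=
  psiAux act g.length g

/-- The operator `T(g₁, …, gₙ) = ψ(g₁, …, gₙ) 𝒯_{g₁⋯gₙ}`, where `ψ` is obtained from `Ψ` by
substituting the operators `c₀ φ(c₁, …, cₘ)` for the formal expressions. -/
noncomputable def higherT {S : 𝕋} {x y : F.Ob S} (g : Chain x y) (φ : Raw V W ⟨S, y⟩) :
    Raw V W ⟨S, x⟩ :=
  FreeAbelianGroup.lift (fun w => phiOp w.1 w.2 (curvedT g.comp φ)) (psiWord act g)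

variable (V W) in
/-- The operators `φ(c₁, …, cₘ)` are defined, have degree `-m`, and make the action of the
invertible elements of degree zero by `Ãd(c)` homotopically trivial:
`[d, φ(c₁, …, cₘ)] + Ãd(c₁) φ(c₂, …, cₘ) + ∑_{j=1}^{m-1} (-1)^j φ(c₁, …, cⱼ cⱼ₊₁, …, cₘ)
  + (-1)^m φ(c₁, …, cₘ₋₁) = 0`. -/
structure InnerHomotopies (κ : CochainKind) : Prop where
  finite : ∀ {p : El F} {m : ℤ} (c₀ : (A.obj p)ˣ) (cs : List (A.obj p)ˣ) {φ : Raw V W p},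
    Admissible V W κ p c₀ → (∀ c ∈ cs, Admissible V W κ p c) → φ ∈ cochains V W κ p m →
    ∀ (q : El F) (k : q ⟶ p) (l : List (A.obj q)) (v : V.obj q),
      (Function.support (phiTerm c₀ cs φ q k l v)).Finite
  mem : ∀ {p : El F} {m : ℤ} (c₀ : (A.obj p)ˣ) (cs : List (A.obj p)ˣ) {φ : Raw V W p},
    Admissible V W κ p c₀ → (∀ c ∈ cs, Admissible V W κ p c) → φ ∈ cochains V W κ p m →
    phiOp c₀ cs φ ∈ cochains V W κ p (m - cs.length)
  one : ∀ {p : El F} {m : ℤ} {φ : Raw V W p}, φ ∈ cochains V W κ p m → phiOp 1 [] φ = φ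
  homotopy : ∀ {p : El F} {m : ℤ} (c : (A.obj p)ˣ) (cs : List (A.obj p)ˣ) {φ : Raw V W p},
    (∀ b ∈ c :: cs, Admissible V W κ p b) → φ ∈ cochains V W κ p m →
    (totalD (m - (cs.length + 1)) (phiOp 1 (c :: cs) φ)
        - ((cs.length : ℤ) + 1).negOnePow • phiOp 1 (c :: cs) (totalD m φ))
      + phiOp c cs φ + mergeListSum (c :: cs) (fun cs' => phiOp 1 cs' φ)
      + ((cs.length : ℤ) + 1).negOnePow • phiOp 1 (c :: cs).dropLast φ = 0

variable (V W) in
/-- The standard complex is a differential graded `𝒪`-module, inner automorphisms act on it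
homotopically trivially through the operators `φ(c₁, …, cₘ)`, the elements `c(g₁, g₂)` being
admissible, and it carries an `A_∞` action with `T(g) = 𝒯_g` whose higher components are given by
the recursion. -/
def HasCurvedAInfAction (κ : CochainKind) : Prop :=
  (stdCx V W κ).IsDGModule ∧
  InnerHomotopies V W κ ∧
  (∀ {S : 𝕋} {x y z : F.Ob S} (g₁ : x ⟶ y) (g₂ : y ⟶ z),
    Admissible V W κ ⟨S, x⟩ (act.c g₁ g₂)) ∧
  ∃ τ : AInfAction (stdCx V W κ),
    (∀ {S : 𝕋} {x y : F.Ob S} (g : x ⟶ y) (m : ℤ), ∀ φ ∈ cochains V W κ ⟨S, y⟩ m,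
      τ.T (Chain.single g) m φ = curvedT g φ) ∧
    (∀ {S : 𝕋} {x y : F.Ob S} (g : Chain x y) (m : ℤ), ∀ φ ∈ cochains V W κ ⟨S, y⟩ m,
      τ.T g m φ = higherT g φ)

end Geometry

/-! ## Discrete groupoids -/

section Discrete

/-- A groupoid, regarded as a presheaf of groupoids on the category with one morphism. -/
def constGroupoid (X : Type w) [G : Groupoid.{w} X] :
    GroupoidPresheaf.{0, 0, w} (Discrete PUnit.{1}) where
  Ob _ := X
  grpd _ := G
  res _ := 𝟭 X
  res_id _ := rfl
  res_comp _ _ := rfl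

end Discrete

/-! ## Lie groupoids -/

section Lie

open scoped Manifold ContDiff
open Manifold

/-- A smooth manifold (Hausdorff, second countable). -/
structure Mfd : Type (u + 1) where
  dim : ℕ
  carrier : Type u
  top : TopologicalSpace carrier
  charted : ChartedSpace (EuclideanSpace ℝ (Fin dim)) carrier
  smooth : IsManifold (𝓡 dim) ∞ carrier
  t2 : T2Space carrier
  secondCountable : SecondCountableTopology carrier

attribute [instance] Mfd.top Mfd.charted Mfd.smooth Mfd.t2 Mfd.secondCountable

/-- A smooth map. -/
@[ext]
structure Mfd.Hom (S S' : Mfd.{u}) where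
  toFun : S.carrier → S'.carrier
  smooth : ContMDiff (𝓡 S.dim) (𝓡 S'.dim) ∞ toFun

instance : Category Mfd.{u} where
  Hom S S' := Mfd.Hom S S'
  id _ := ⟨id, contMDiff_id⟩
  comp f g := ⟨g.toFun ∘ f.toFun, g.smooth.comp f.smooth⟩

/-- The underlying map of a morphism of manifolds. -/
def Mfd.fn {S S' : Mfd.{u}} (f : S ⟶ S') : S.carrier → S'.carrier := Mfd.Hom.toFun f

/-- The coverings are the families of diffeomorphisms onto open subsets whose images cover. -/
def openCoverings : Precoverage Mfd.{u} where
  coverings S := {P |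
    (∀ ⦃S' : Mfd.{u}⦄ (f : S' ⟶ S), P f →
      Topology.IsOpenEmbedding (Mfd.fn f) ∧ IsLocalDiffeomorph (𝓡 S'.dim) (𝓡 S.dim) ∞ (Mfd.fn f)) ∧
    ∀ x : S.carrier, ∃ (S' : Mfd.{u}) (f : S' ⟶ S), P f ∧ x ∈ Set.range (Mfd.fn f)}

/-- A Lie groupoid. The product `mul a b` is defined if `s a = t b`; it is smooth on the fiber product
`G ×_M G`, which is expressed by means of smooth families `S → G ×_M G`. -/
structure LieGroupoid where
  M : Mfd.{u}
  G : Mfd.{u}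
  s : G ⟶ M
  t : G ⟶ M
  s_submersion : IsSubmersion (𝓡 G.dim) (𝓡 M.dim) ∞ (Mfd.fn s)
  t_submersion : IsSubmersion (𝓡 G.dim) (𝓡 M.dim) ∞ (Mfd.fn t)
  s_surjective : Function.Surjective (Mfd.fn s)
  t_surjective : Function.Surjective (Mfd.fn t)
  unit : M ⟶ G
  inv : G ⟶ G
  mul : ∀ a b : G.carrier, Mfd.fn s a = Mfd.fn t b → G.carrier
  mul_smooth : ∀ (S : Mfd.{u}) (a b : S ⟶ G)
    (h : ∀ x, Mfd.fn s (Mfd.fn a x) = Mfd.fn t (Mfd.fn b x)),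
    ContMDiff (𝓡 S.dim) (𝓡 G.dim) ∞ fun x => mul (Mfd.fn a x) (Mfd.fn b x) (h x)
  s_unit : ∀ x, Mfd.fn s (Mfd.fn unit x) = x
  t_unit : ∀ x, Mfd.fn t (Mfd.fn unit x) = x
  s_inv : ∀ a, Mfd.fn s (Mfd.fn inv a) = Mfd.fn t a
  t_inv : ∀ a, Mfd.fn t (Mfd.fn inv a) = Mfd.fn s a
  s_mul : ∀ a b h, Mfd.fn s (mul a b h) = Mfd.fn s b
  t_mul : ∀ a b h, Mfd.fn t (mul a b h) = Mfd.fn t a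
  mul_assoc : ∀ a b c (h : Mfd.fn s a = Mfd.fn t b) (h' : Mfd.fn s b = Mfd.fn t c),
    mul (mul a b h) c ((s_mul a b h).trans h') = mul a (mul b c h') (h.trans (t_mul b c h').symm)
  unit_mul : ∀ a, mul (Mfd.fn unit (Mfd.fn t a)) a (s_unit _) = a
  mul_unit : ∀ a, mul a (Mfd.fn unit (Mfd.fn s a)) (t_unit _).symm = a
  inv_mul : ∀ a, mul (Mfd.fn inv a) a (s_inv a) = Mfd.fn unit (Mfd.fn s a)
  mul_inv : ∀ a, mul a (Mfd.fn inv a) (t_inv a).symm = Mfd.fn unit (Mfd.fn t a)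

namespace LieGroupoid

variable (L : LieGroupoid.{u})

/-- Smooth families, parametrized by `S`, of arrows in `G_{x,y} = {g | t g = x, s g = y}`. -/
@[ext]
structure Arrow {S : Mfd.{u}} (x y : S ⟶ L.M) where
  g : S ⟶ L.G
  t_g : g ≫ L.t = x
  s_g : g ≫ L.s = y

variable {L}

lemma Arrow.composable {S : Mfd.{u}} {x y z : S ⟶ L.M} (a : L.Arrow x y) (b : L.Arrow y z)
    (p : S.carrier) : Mfd.fn L.s (Mfd.fn a.g p) = Mfd.fn L.t (Mfd.fn b.g p) :=
  congrFun (congrArg Mfd.fn (a.s_g.trans b.t_g.symm)) p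

/-- Pointwise product of families. -/
def Arrow.mul {S : Mfd.{u}} {x y z : S ⟶ L.M} (a : L.Arrow x y) (b : L.Arrow y z) :
    L.Arrow x z where
  g := Mfd.Hom.mk _ (L.mul_smooth S a.g b.g (a.composable b))
  t_g := Eq.trans (b := a.g ≫ L.t)
    (Mfd.Hom.ext (funext fun p => L.t_mul _ _ (a.composable b p))) a.t_g
  s_g := Eq.trans (b := b.g ≫ L.s)
    (Mfd.Hom.ext (funext fun p => L.s_mul _ _ (a.composable b p))) b.s_g

/-- The family of units. -/
def Arrow.one {S : Mfd.{u}} (x : S ⟶ L.M) : L.Arrow x x where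
  g := x ≫ L.unit
  t_g := Mfd.Hom.ext (funext fun _ => L.t_unit _)
  s_g := Mfd.Hom.ext (funext fun _ => L.s_unit _)

/-- Pointwise inverse of families. -/
def Arrow.inv {S : Mfd.{u}} {x y : S ⟶ L.M} (a : L.Arrow x y) : L.Arrow y x where
  g := a.g ≫ L.inv
  t_g := Eq.trans (b := a.g ≫ L.s) (Mfd.Hom.ext (funext fun _ => L.t_inv _)) a.s_g
  s_g := Eq.trans (b := a.g ≫ L.t) (Mfd.Hom.ext (funext fun _ => L.s_inv _)) a.t_g

variable (L)

/-- The smooth maps from `S` to the manifold of objects. -/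
def Pt (S : Mfd.{u}) := S ⟶ L.M

lemma mul_congr {a a' b b' : L.G.carrier} (ha : a = a') (hb : b = b')
    (h : Mfd.fn L.s a = Mfd.fn L.t b) (h' : Mfd.fn L.s a' = Mfd.fn L.t b') :
    L.mul a b h = L.mul a' b' h' := by
  subst ha hb; rfl

instance (S : Mfd.{u}) : Groupoid (L.Pt S) where
  Hom x y := Arrow (L := L) (S := S) x y
  id x := Arrow.one (L := L) (S := S) x
  comp a b := Arrow.mul a b
  id_comp {x y} a := by
    refine Arrow.ext (Mfd.Hom.ext (funext fun p => ?_))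
    have h : Mfd.fn x p = Mfd.fn L.t (Mfd.fn a.g p) :=
      congrFun (congrArg Mfd.fn a.t_g.symm) p
    exact (L.mul_congr (congrArg (Mfd.fn L.unit) h) rfl _ (L.s_unit _)).trans (L.unit_mul _)
  comp_id {x y} a := by
    refine Arrow.ext (Mfd.Hom.ext (funext fun p => ?_))
    have h : Mfd.fn y p = Mfd.fn L.s (Mfd.fn a.g p) :=
      congrFun (congrArg Mfd.fn a.s_g.symm) p
    exact (L.mul_congr rfl (congrArg (Mfd.fn L.unit) h) _ (L.t_unit _).symm).trans (L.mul_unit _)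
  assoc a b c := by
    refine Arrow.ext (Mfd.Hom.ext (funext fun p => ?_))
    exact L.mul_assoc _ _ _ (a.composable b p) (b.composable c p)
  inv a := Arrow.inv a
  inv_comp {x y} a := by
    refine Arrow.ext (Mfd.Hom.ext (funext fun p => ?_))
    have h : Mfd.fn L.s (Mfd.fn a.g p) = Mfd.fn y p := congrFun (congrArg Mfd.fn a.s_g) p
    exact (L.inv_mul _).trans (congrArg (Mfd.fn L.unit) h)
  comp_inv {x y} a := by
    refine Arrow.ext (Mfd.Hom.ext (funext fun p => ?_))
    have h : Mfd.fn L.t (Mfd.fn a.g p) = Mfd.fn x p := congrFun (congrArg Mfd.fn a.t_g) p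
    exact (L.mul_inv _).trans (congrArg (Mfd.fn L.unit) h)

/-- Composition of families with a smooth map `S' ⟶ S`. -/
def Arrow.comap {S' S : Mfd.{u}} (h : S' ⟶ S) {x y : S ⟶ L.M} (a : L.Arrow x y) :
    L.Arrow (h ≫ x) (h ≫ y) where
  g := h ≫ a.g
  t_g := (Category.assoc h a.g L.t).trans (congrArg (fun f => h ≫ f) a.t_g)
  s_g := (Category.assoc h a.g L.s).trans (congrArg (fun f => h ≫ f) a.s_g)

/-- The presheaf of groupoids of a Lie groupoid: the objects over `S` are the smooth maps `S → M`,
the arrows over `S` are the smooth maps `S → G`. -/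
def points : GroupoidPresheaf.{u + 1, u, u} Mfd.{u} where
  Ob S := L.Pt S
  grpd _ := inferInstance
  res {S' S} h :=
    { obj := fun x => show S' ⟶ L.M from h ≫ (show S ⟶ L.M from x)
      map := fun a => Arrow.comap L h a
      map_id := fun _ => rfl
      map_comp := fun _ _ => rfl }
  res_id _ := rfl
  res_comp _ _ := rfl

end LieGroupoid

end Lie

end InnerAct

set_option linter.unusedSectionVars false

namespace InnerAct

noncomputable section

open DistribSMul (toAddMonoidHom)
open List (map_cons map_nil length_cons length_map map_map cons_append nil_append mem_map mem_cons
  replicate mem_singleton forall_mem_cons map_congr_left mem_cons_of_mem append_assoc not_mem_nil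
    replicate_succ map_replicate map_append singleton_append mem_append length_nil length_append
    append_nil)
open Int (negOnePow_add negOnePow_two_mul negOnePow_succ negOnePow_zero negOnePow_one negOnePow_sub)
open Finset (sum_congr sum_add_distrib sum_eq_zero sum_range_succ)
open Finset.HasAntidiagonal (antidiagonal)

section Signs

lemma negOnePow_eq_of {a b c : ℤ} (h : a = b + 2 * c) : a.negOnePow = b.negOnePow := by
  rw [h, negOnePow_add, negOnePow_two_mul, mul_one]

variable {A : Type u} [Ring A] (gr : ℤ → AddSubgroup A) [GradedRing gr]

lemma signBy_of_mem (e : ℤ → ℤ) {i : ℤ} {a : A} (ha : a ∈ gr i) :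
    signBy gr e a = (e i).negOnePow • a := by
  have h : signBy gr e a = DirectSum.toAddMonoid (fun i => ((e i).negOnePow : ℤ) • (gr i).subtype)
      (DirectSum.decompose gr a) := rfl
  rw [h, DirectSum.decompose_of_mem gr ha, DirectSum.toAddMonoid_of]
  rfl

lemma bar_of_mem (n : ℤ) {i : ℤ} {a : A} (ha : a ∈ gr i) :
    bar gr n a = (n * (i + 1)).negOnePow • a := signBy_of_mem gr _ ha

lemma koszul_of_mem (n : ℤ) {i : ℤ} {a : A} (ha : a ∈ gr i) :
    koszul gr n a = (n * i).negOnePow • a := signBy_of_mem gr _ ha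

lemma units_smul_mem {M : Type*} [AddCommGroup M] (H : AddSubgroup M) (e : ℤˣ) {a : M}
    (ha : a ∈ H) : e • a ∈ H := by
  rcases Int.units_eq_one_or e with rfl | rfl
  all_goals simp_all

lemma bar_mem (n : ℤ) {i : ℤ} {a : A} (ha : a ∈ gr i) : bar gr n a ∈ gr i := by
  rw [bar_of_mem gr n ha]; exact units_smul_mem _ _ ha

lemma koszul_mem (n : ℤ) {i : ℤ} {a : A} (ha : a ∈ gr i) : koszul gr n a ∈ gr i := by
  rw [koszul_of_mem gr n ha]; exact units_smul_mem _ _ ha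

/-- Two additive maps that agree on homogeneous elements agree. -/
lemma addHom_ext_homogeneous {M N : Type*} [AddCommGroup M] [AddCommGroup N]
    (ℳ : ℤ → AddSubgroup M) [DirectSum.Decomposition ℳ] {f g : M →+ N}
    (h : ∀ i, ∀ a ∈ ℳ i, f a = g a) (a : M) : f a = g a := by
  induction a using DirectSum.Decomposition.inductionOn ℳ with
  | zero => simp
  | homogeneous a => exact h _ _ a.2
  | add a b ha hb => rw [map_add, map_add, ha, hb]

lemma map_units_smul {M N F : Type*} [AddCommGroup M] [AddCommGroup N] [FunLike F M N]
    [AddMonoidHomClass F M N] (f : F) (e : ℤˣ) (a : M) : f (e • a) = e • f a := by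
  simp

lemma units_smul_mul (e : ℤˣ) (a b : A) : (e • a) * b = e • (a * b) := by
  rcases Int.units_eq_one_or e with rfl | rfl <;> simp

lemma mul_units_smul (e : ℤˣ) (a b : A) : a * (e • b) = e • (a * b) := by
  rcases Int.units_eq_one_or e with rfl | rfl <;> simp

lemma units_smul_smul {M : Type*} [AddCommGroup M] [Module A M] (e : ℤˣ) (a : A) (b : M) :
    (e • a) • b = e • (a • b) := by
  simp

lemma smul_units_smul {M : Type*} [AddCommGroup M] [Module A M] (e : ℤˣ) (a : A) (b : M) :
    a • (e • b) = e • (a • b) := by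
  rcases Int.units_eq_one_or e with rfl | rfl <;> simp

@[simp] lemma bar_zero (a : A) : bar gr 0 a = a := by
  refine addHom_ext_homogeneous gr (f := bar gr 0) (g := AddMonoidHom.id A) (fun i a ha => ?_) a
  simp [bar_of_mem gr 0 ha]

lemma bar_bar (m n : ℤ) (a : A) : bar gr m (bar gr n a) = bar gr (m + n) a := by
  refine addHom_ext_homogeneous gr (f := (bar gr m).comp (bar gr n)) (g := bar gr (m + n))
    (fun i a ha => ?_) a
  rw [AddMonoidHom.comp_apply, bar_of_mem gr n ha, map_units_smul, bar_of_mem gr m ha,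
    bar_of_mem gr _ ha, smul_smul, ← negOnePow_add]
  grind

lemma bar_two_mul (n : ℤ) (a : A) : bar gr (2 * n) a = a := by
  refine addHom_ext_homogeneous gr (f := bar gr (2 * n)) (g := AddMonoidHom.id A)
    (fun i a ha => ?_) a
  rw [bar_of_mem gr _ ha, mul_assoc, negOnePow_two_mul]; simp

lemma bar_one_one (a : A) : bar gr 1 (bar gr 1 a) = a := by rw [bar_bar]; exact bar_two_mul gr 1 a

lemma bar_bar_one (n : ℤ) (a : A) : bar gr n (bar gr 1 a) = bar gr (n - 1) a := by
  have h : n = (n - 1) + 1 := by ring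
  conv_lhs => rw [h, ← bar_bar, bar_one_one]

lemma koszul_eq_bar (n : ℤ) (a : A) : koszul gr n a = n.negOnePow • bar gr n a := by
  have := addHom_ext_homogeneous gr (f := koszul gr n)
    (g := (toAddMonoidHom A n.negOnePow).comp (bar gr n)) (fun i a ha => ?_) a
  · simp_all
  · rw [AddMonoidHom.comp_apply, koszul_of_mem gr n ha, bar_of_mem gr n ha]
    change _ = n.negOnePow • (_ • a)
    rw [smul_smul, ← negOnePow_add]
    congr 1
    rw [negOnePow_eq_of (show n + n * (i + 1) = n * i + 2 * n by ring)]

lemma koszul_one (a : A) : koszul gr 1 a = -bar gr 1 a := by rw [koszul_eq_bar]; simp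

lemma koszul_koszul (m n : ℤ) (a : A) : koszul gr m (koszul gr n a) = koszul gr (m + n) a := by
  rw [koszul_eq_bar, koszul_eq_bar, koszul_eq_bar, map_units_smul, bar_bar, smul_smul,
    negOnePow_add]

lemma addHom_ext_homogeneous₂ {N : Type*} [AddCommGroup N] {f g : A →+ A →+ N}
    (h : ∀ i j, ∀ a ∈ gr i, ∀ b ∈ gr j, f a b = g a b) (a b : A) : f a b = g a b := by
  have := addHom_ext_homogeneous gr (f := f) (g := g) (fun i a ha => AddMonoidHom.ext fun b =>
      addHom_ext_homogeneous gr (fun j b hb => h i j a ha b hb) b) a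
  grind

lemma koszul_mul (n : ℤ) (a b : A) : koszul gr n (a * b) = koszul gr n a * koszul gr n b := by
  refine addHom_ext_homogeneous₂ gr (f := AddMonoidHom.mul.compr₂ (koszul gr n))
    (g := (AddMonoidHom.mul.comp (koszul gr n)).compl₂ (koszul gr n)) (fun i j a ha b hb => ?_) a b
  change koszul gr n (a * b) = koszul gr n a * koszul gr n b
  rw [koszul_of_mem gr n ha, koszul_of_mem gr n hb, koszul_of_mem gr n (SetLike.mul_mem_graded ha hb),
    units_smul_mul, mul_units_smul, smul_smul, ← negOnePow_add, mul_add]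

lemma negOnePow_smul_smul {M : Type*} [AddCommGroup M] (i : ℤ) (y : M) :
    i.negOnePow • i.negOnePow • y = y := by
  rw [smul_smul, ← negOnePow_add, ← two_mul, negOnePow_two_mul, one_smul]

lemma bar_eq_koszul (n : ℤ) (a : A) : bar gr n a = n.negOnePow • koszul gr n a := by
  rw [koszul_eq_bar, negOnePow_smul_smul]

lemma bar_mul (n : ℤ) (a b : A) : bar gr n (a * b) = n.negOnePow • (bar gr n a * bar gr n b) := by
  rw [bar_eq_koszul, bar_eq_koszul, bar_eq_koszul, koszul_mul, units_smul_mul, mul_units_smul,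
    smul_smul, smul_smul, ← negOnePow_add, ← two_mul, negOnePow_two_mul, one_mul]

lemma bar_one_mul (a b : A) : bar gr 1 (a * b) = -(bar gr 1 a * bar gr 1 b) := by rw [bar_mul]; simp

lemma bar_map {A' : Type*} [Ring A'] (gr' : ℤ → AddSubgroup A') [GradedRing gr'] (f : A →+ A')
    {d : ℤ} (hf : ∀ {i a}, a ∈ gr i → f a ∈ gr' (i + d)) (n : ℤ) (a : A) :
    bar gr' n (f a) = (n * d).negOnePow • f (bar gr n a) := by
  have := addHom_ext_homogeneous gr (f := (bar gr' n).comp f)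
    (g := (toAddMonoidHom A' (n * d).negOnePow).comp (f.comp (bar gr n))) (fun i a ha => ?_) a
  · simp_all
  · change bar gr' n (f a) = (n * d).negOnePow • f (bar gr n a)
    rw [bar_of_mem gr' n (hf ha), bar_of_mem gr n ha, map_units_smul, smul_smul, ← negOnePow_add]
    grind

lemma bar_map_zero {A' : Type*} [Ring A'] (gr' : ℤ → AddSubgroup A') [GradedRing gr']
    (f : A →+ A') (hf : ∀ {i a}, a ∈ gr i → f a ∈ gr' i) (n : ℤ) (a : A) :
    bar gr' n (f a) = f (bar gr n a) := by
  rw [bar_map gr gr' f (d := 0) (fun h => by simpa using hf h)]; simp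

lemma koszul_map_zero {A' : Type*} [Ring A'] (gr' : ℤ → AddSubgroup A') [GradedRing gr']
    (f : A →+ A') (hf : ∀ {i a}, a ∈ gr i → f a ∈ gr' i) (n : ℤ) (a : A) :
    koszul gr' n (f a) = f (koszul gr n a) := by
  rw [koszul_eq_bar, koszul_eq_bar, map_units_smul, bar_map_zero gr gr' f hf]

lemma bar_of_mem_one (n : ℤ) {a : A} (ha : a ∈ gr 1) : bar gr n a = a := by
  rw [bar_of_mem gr n ha, show n * (1 + 1) = 2 * n by ring, negOnePow_two_mul, one_smul]

lemma bar_of_mem_zero (n : ℤ) {a : A} (ha : a ∈ gr 0) : bar gr n a = n.negOnePow • a := by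
  rw [bar_of_mem gr n ha]; simp

lemma koszul_of_mem_zero (n : ℤ) {a : A} (ha : a ∈ gr 0) : koszul gr n a = a := by
  rw [koszul_of_mem gr n ha]; simp

lemma units_inv_mem_zero (u : Aˣ) (hu : (u : A) ∈ gr 0) : (↑u⁻¹ : A) ∈ gr 0 := by
  classical
  have h1 : GradedRing.proj gr 0 (↑u * ↑u⁻¹) = ↑u * GradedRing.proj gr 0 (↑u⁻¹ : A) := by
    have := DirectSum.coe_decompose_mul_add_of_left_mem gr (i := 0) (j := 0) hu (b := (↑u⁻¹ : A))
    simp_all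
  rw [Units.mul_inv] at h1
  have h2 : GradedRing.proj gr 0 (1 : A) = 1 := by
    rw [GradedRing.proj_apply, DirectSum.decompose_of_mem_same gr (SetLike.one_mem_graded gr)]
  rw [h2] at h1
  have h3 : (↑u⁻¹ : A) = GradedRing.proj gr 0 (↑u⁻¹ : A) := by
    calc (↑u⁻¹ : A) = ↑u⁻¹ * (↑u * GradedRing.proj gr 0 (↑u⁻¹ : A)) := by rw [← h1, mul_one]
      _ = _ := by rw [Units.inv_mul_cancel_left]
  rw [h3, GradedRing.proj_apply]
  exact SetLike.coe_mem _

end Signs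

/-! ## Sequences with finitely many nonzero terms -/

section Sequences

variable {Y : Type*} [AddCommGroup Y]

/-- All but finitely many terms vanish. -/
def EvZero (X : ℕ → Y) : Prop := ∃ N, ∀ n ≥ N, X n = 0

/-- The sum of the terms of a sequence with finitely many nonzero terms. -/
def tot (X : ℕ → Y) : Y := ∑ᶠ n, X n

/-- The sequence moved by one place. -/
def shift : (ℕ → Y) →+ (ℕ → Y) where
  toFun X n := match n with
    | 0 => 0
    | n + 1 => X n
  map_zero' := by funext n; cases n <;> rfl
  map_add' X Z := by funext n; cases n <;> simp

@[simp] lemma shift_zero_apply (X : ℕ → Y) : shift X 0 = 0 := rfl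
@[simp] lemma shift_succ_apply (X : ℕ → Y) (n : ℕ) : shift X (n + 1) = X n := rfl

lemma EvZero.finite {X : ℕ → Y} (h : EvZero X) : (Function.support X).Finite := by
  obtain ⟨N, hN⟩ := h
  refine (Set.finite_lt_nat N).subset fun n hn => ?_
  by_contra hlt
  simp_all

lemma tot_eq_sum {X : ℕ → Y} {N : ℕ} (h : ∀ n ≥ N, X n = 0) :
    tot X = ∑ n ∈ Finset.range N, X n := by
  refine finsum_eq_sum_of_support_subset X fun n hn => ?_
  simp only [Finset.coe_range, Set.mem_Iio]
  by_contra hlt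
  simp_all

lemma evZero_zero : EvZero (0 : ℕ → Y) := ⟨0, fun _ _ => rfl⟩

lemma EvZero.add {X Z : ℕ → Y} (hX : EvZero X) (hZ : EvZero Z) : EvZero (X + Z) := by
  obtain ⟨N, hN⟩ := hX
  obtain ⟨N', hN'⟩ := hZ
  refine ⟨max N N', fun n hn => ?_⟩
  simp_all

lemma EvZero.map {Y' : Type*} [AddCommGroup Y'] (f : Y →+ Y') {X : ℕ → Y} (hX : EvZero X) :
    EvZero fun n => f (X n) := by
  obtain ⟨N, hN⟩ := hX
  exact ⟨N, fun n hn => by simp [hN n hn]⟩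

lemma EvZero.neg {X : ℕ → Y} (hX : EvZero X) : EvZero (-X) := hX.map (-AddMonoidHom.id Y)

lemma EvZero.sub {X Z : ℕ → Y} (hX : EvZero X) (hZ : EvZero Z) : EvZero (X - Z) := by
  rw [sub_eq_add_neg]; exact hX.add hZ.neg

lemma EvZero.shift {X : ℕ → Y} (hX : EvZero X) : EvZero (shift X) := by
  obtain ⟨N, hN⟩ := hX
  refine ⟨N + 1, fun n hn => ?_⟩
  obtain ⟨k, rfl⟩ : ∃ k, n = k + 1 := ⟨n - 1, by omega⟩
  exact hN k (by omega)

@[simp] lemma tot_zero : tot (0 : ℕ → Y) = 0 := by simp [tot]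

lemma tot_add {X Z : ℕ → Y} (hX : EvZero X) (hZ : EvZero Z) : tot (X + Z) = tot X + tot Z :=
  finsum_add_distrib hX.finite hZ.finite

lemma tot_map {Y' : Type*} [AddCommGroup Y'] (f : Y →+ Y') {X : ℕ → Y} (hX : EvZero X) :
    tot (fun n => f (X n)) = f (tot X) := (f.map_finsum hX.finite).symm

lemma tot_neg {X : ℕ → Y} (hX : EvZero X) : tot (-X) = -tot X := tot_map (-AddMonoidHom.id Y) hX

lemma tot_sub {X Z : ℕ → Y} (hX : EvZero X) (hZ : EvZero Z) : tot (X - Z) = tot X - tot Z := by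
  rw [sub_eq_add_neg, tot_add hX hZ.neg, tot_neg hZ, sub_eq_add_neg]

lemma tot_shift {X : ℕ → Y} (hX : EvZero X) : tot (shift X) = tot X := by
  obtain ⟨N, hN⟩ := hX
  rw [tot_eq_sum hN, tot_eq_sum (N := N + 1), Finset.sum_range_succ']
  · simp
  · intro n hn
    obtain ⟨k, rfl⟩ : ∃ k, n = k + 1 := ⟨n - 1, by omega⟩
    exact hN k (by omega)

/-- If the rows are finite and, for every set `P`, the sums of the entries of the rows in the
antidiagonals with index in `P` vanish for almost all rows, then only finitely many entries are
nonzero. -/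
lemma finite_of_rows {X : ℕ → ℕ → Y} (h₁ : ∀ k, EvZero (X k))
    (h₂ : ∀ P : Set ℕ, EvZero fun k => tot fun j => open Classical in if k + j ∈ P then X k j else 0) :
    ∃ N, ∀ k j, N ≤ k + j → X k j = 0 := by
  classical
  by_contra hne
  push Not at hne
  choose B hB using h₁
  -- nonzero entries exist in arbitrarily late rows
  have hrow : ∀ k₀, ∃ k j, k₀ ≤ k ∧ X k j ≠ 0 := by
    intro k₀
    obtain ⟨k, j, hkj, hX⟩ := hne (k₀ + ∑ k ∈ Finset.range k₀, B k)
    refine ⟨k, j, ?_, hX⟩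
    by_contra hlt
    push Not at hlt
    have h1 : B k ≤ ∑ k ∈ Finset.range k₀, B k :=
      Finset.single_le_sum (f := B) (fun _ _ => Nat.zero_le _) (Finset.mem_range.mpr hlt)
    grind
  choose r c hr hX using hrow
  -- the sequence of chosen entries: start from row bounds `b`
  let b : ℕ → ℕ := fun i => Nat.rec 0 (fun _ m => max (r m + c m) (r m + B (r m)) + 1) i
  have hb : ∀ i, b (i + 1) = max (r (b i) + c (b i)) (r (b i) + B (r (b i))) + 1 := fun i => rfl
  have hmono : StrictMono b := by
    refine strictMono_nat_of_lt_succ fun i => ?_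
    grind
  let P : Set ℕ := Set.range fun i => r (b i) + c (b i)
  obtain ⟨N, hN⟩ := h₂ P
  have hi : N ≤ r (b N) := le_trans (hmono.id_le N) (hr _)
  have h0 := hN _ hi
  change finsum _ = 0 at h0
  rw [finsum_eq_single _ (c (b N))] at h0
  · rw [if_pos ⟨N, rfl⟩] at h0
    exact hX _ h0
  · intro j hj
    by_cases hP : r (b N) + j ∈ P
    · rw [if_pos hP]
      obtain ⟨i, hi⟩ := hP
      simp only at hi
      rcases lt_trichotomy i N with hlt | rfl | hlt
      · exfalso
        have h1 : b (i + 1) ≤ b N := hmono.monotone hlt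
        have := hr (b N)
        have := le_max_left (r (b i) + c (b i)) (r (b i) + B (r (b i)))
        rw [hb] at h1
        omega
      · exact absurd (by omega) hj
      · apply hB
        have h1 : b (N + 1) ≤ b i := hmono.monotone hlt
        have := hr (b i)
        have := le_max_right (r (b N) + c (b N)) (r (b N) + B (r (b N)))
        rw [hb] at h1
        omega
    · rw [if_neg hP]

lemma tot_tot_eq {X : ℕ → ℕ → Y} (h : ∃ N, ∀ k j, N ≤ k + j → X k j = 0) :
    (EvZero fun k => tot (X k)) ∧ (EvZero fun n => ∑ p ∈ antidiagonal n, X p.1 p.2) ∧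
    tot (fun k => tot (X k)) = tot fun n => ∑ p ∈ antidiagonal n, X p.1 p.2 := by
  obtain ⟨N, hN⟩ := h
  have h1 : ∀ k ≥ N, tot (X k) = 0 := fun k hk => by
    rw [show X k = 0 from funext fun j => hN k j (by omega), tot_zero]
  have h2 : ∀ n ≥ N, ∑ p ∈ antidiagonal n, X p.1 p.2 = 0 := fun n hn =>
    sum_eq_zero fun p hp => hN _ _ (by rw [Finset.HasAntidiagonal.mem_antidiagonal] at hp; omega)
  refine ⟨⟨N, h1⟩, ⟨N, h2⟩, ?_⟩
  rw [tot_eq_sum h1, tot_eq_sum h2, sum_congr rfl (g := fun k => ∑ j ∈ Finset.range (N - k), X k j)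
    fun k _ => tot_eq_sum fun j hj => hN _ _ (by omega)]
  rw [Finset.sum_sigma', Finset.sum_sigma']
  refine Finset.sum_bij' (fun x _ => ⟨x.1 + x.2, (x.1, x.2)⟩) (fun x _ => ⟨x.2.1, x.2.2⟩)
    ?_ ?_ ?_ ?_ ?_
  · rintro ⟨a, b⟩ h; simp at h ⊢; omega
  · rintro ⟨n, a, b⟩ h; simp at h ⊢; omega
  · rintro ⟨a, b⟩ h; rfl
  · rintro ⟨n, a, b⟩ h; simp at h ⊢; omega
  · rintro ⟨a, b⟩ h; rfl

end Sequences

/-! ## Insertion operators along lattice paths -/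

section Paths

variable {A A' A'' V V' V'' Y : Type*} [Ring A] [Ring A'] [Ring A''] [AddCommGroup V]
  [AddCommGroup V'] [AddCommGroup V''] [AddCommGroup Y]

/-- The function `f (a, ·)`. -/
def consF {B M : Type*} (a : B) (f : List B → M) : List B → M := fun x => f (a :: x)

@[simp] lemma consF_apply {B M : Type*} (a : B) (f : List B → M) (x : List B) :
    consF a f x = f (a :: x) := rfl

lemma consF_add {B M : Type*} [Add M] (a : B) (f g : List B → M) :
    consF a (f + g) = consF a f + consF a g := rfl

/-- A function of strings that is additive in every argument. -/
structure MultiAdd (f : List A → V → Y) : Prop where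
  entry : ∀ (l l' : List A) (a b : A) (v : V),
    f (l ++ (a + b) :: l') v = f (l ++ a :: l') v + f (l ++ b :: l') v
  right : ∀ (l : List A) (v v' : V), f l (v + v') = f l v + f l v'

namespace MultiAdd

variable {f : List A → V → Y}

lemma cons (hf : MultiAdd f) (a : A) : MultiAdd (consF a f) :=
  ⟨fun l l' b c v => hf.entry (a :: l) l' b c v, fun l v v' => hf.right (a :: l) v v'⟩

lemma consF_add (hf : MultiAdd f) (a b : A) : consF (a + b) f = consF a f + consF b f := by
  funext x v; exact hf.entry [] x a b v

/-- A multiadditive function of the first entry. -/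
def hom (hf : MultiAdd f) (l : List A) (v : V) : A →+ Y :=
  AddMonoidHom.mk' (fun a => f (a :: l) v) fun a b => hf.entry [] l a b v

/-- The function as an additive function of the last argument. -/
def rightHom (hf : MultiAdd f) (l : List A) : V →+ Y :=
  AddMonoidHom.mk' (fun v => f l v) fun a b => hf.right l a b

lemma consF_neg (hf : MultiAdd f) (a : A) : consF (-a) f = -consF a f := by
  funext x v; exact map_neg (hf.hom x v) a

lemma consF_zero (hf : MultiAdd f) : consF (0 : A) f = 0 := by
  funext x v; exact map_zero (hf.hom x v)

lemma consF_sub (hf : MultiAdd f) (a b : A) : consF (a - b) f = consF a f - consF b f := by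
  funext x v; exact map_sub (hf.hom x v) a b

lemma consF_units_smul (hf : MultiAdd f) (e : ℤˣ) (a : A) : consF (e • a) f = e • consF a f := by
  funext x v; exact map_units_smul (hf.hom x v) e a

lemma map_right_neg (hf : MultiAdd f) (l : List A) (v : V) : f l (-v) = -f l v :=
  map_neg (hf.rightHom l) v

lemma add {g : List A → V → Y} (hf : MultiAdd f) (hg : MultiAdd g) : MultiAdd (f + g) := by
  constructor
  · intro l l' a b v
    simp only [Pi.add_apply, hf.entry, hg.entry]; abel
  · intro l v v'
    simp only [Pi.add_apply, hf.right, hg.right]; abel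

lemma comp {Y' : Type*} [AddCommGroup Y'] (hf : MultiAdd f) (g : Y →+ Y') :
    MultiAdd fun l v => g (f l v) :=
  ⟨fun l l' a b v => by rw [hf.entry, map_add], fun l v v' => by rw [hf.right, map_add]⟩

end MultiAdd

/-- For `γ` and `(e₁, γ₁), …, (eₙ, γₙ)` the sum of the values of a function on the strings
`(γ, …, γ, e₁, γ₁, …, γ₁, e₂, …, eₙ, γₙ, …, γₙ)` with `K` of the inserted elements. -/
def prog {B M : Type*} [AddCommMonoid M] : B → List (B × B) → ℕ → (List B → M) → M
  | _, [], 0, f => f []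
  | γ, [], K + 1, f => prog γ [] K (consF γ f)
  | _, (e, γ') :: ps, 0, f => prog γ' ps 0 (consF e f)
  | γ, (e, γ') :: ps, K + 1, f =>
      prog γ ((e, γ') :: ps) K (consF γ f) + prog γ' ps (K + 1) (consF e f)
  termination_by _ ps K _ => ps.length + K

lemma prog_nil {B M : Type*} [AddCommMonoid M] (γ : B) (K : ℕ) (f : List B → M) :
    prog γ [] K f = f (replicate K γ) := by
  induction K generalizing f with
  | zero => rw [prog]; rfl
  | succ K ih => rw [prog, ih]; rfl

lemma prog_map {B M M' : Type*} [AddCommMonoid M] [AddCommMonoid M'] (g : M →+ M') (γ : B)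
    (ps : List (B × B)) (K : ℕ) (f : List B → M) :
    prog γ ps K (fun x => g (f x)) = g (prog γ ps K f) := by
  induction' hn : ps.length + K using Nat.strong_induction_on with n ih generalizing γ ps K f
  match ps, K with
  | [], K => rw [prog_nil, prog_nil]
  | (e, γ') :: ps, 0 =>
    rw [prog, prog]
    exact ih _ (by simp [← hn]) γ' ps 0 _ rfl
  | (e, γ') :: ps, K + 1 =>
    rw [prog, prog, map_add]
    congr 1
    · exact ih _ (by simp [← hn]) γ _ K _ rfl
    · exact ih _ (by simp [← hn]) γ' ps (K + 1) _ rfl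

lemma prog_add {B M : Type*} [AddCommMonoid M] (γ : B) (ps : List (B × B)) (K : ℕ)
    (f g : List B → M) : prog γ ps K (f + g) = prog γ ps K f + prog γ ps K g := by
  have h := prog_map (AddMonoidHom.fst M M + AddMonoidHom.snd M M) γ ps K (fun x => (f x, g x))
  have h1 := prog_map (AddMonoidHom.fst M M) γ ps K (fun x => (f x, g x))
  have h2 := prog_map (AddMonoidHom.snd M M) γ ps K (fun x => (f x, g x))
  change prog γ ps K (fun x => f x + g x) = _
  simp_all

/-- A vertex of a lattice path: a map on arguments, the element that is inserted, and a map on the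
last argument. -/
@[ext]
structure Vtx (A A' V V' : Type*) [Ring A] [Ring A'] [AddCommGroup V] [AddCommGroup V'] where
  θ : A →+ A'
  β : A'
  ν : V →+ V'

/-- The steps of a lattice path. -/
abbrev Steps (A A' V V' : Type*) [Ring A] [Ring A'] [AddCommGroup V] [AddCommGroup V'] :=
  List (A' × Vtx A A' V V')

/-- Composition of vertices. -/
def Vtx.comp (h : Vtx A A' V V') (k : Vtx A' A'' V' V'') : Vtx A A'' V V'' where
  θ := k.θ.comp h.θ
  β := k.β + k.θ h.β
  ν := k.ν.comp h.ν

/-- Sum over the lattice paths that pass through the steps and the arguments; an argument `a`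
contributes with the sign `(-1) ^ (N (|a| + 1))`, `N` being the number of remaining steps. -/
def pathSum (gr : ℤ → AddSubgroup A) [GradedRing gr] :
    ℤ → Vtx A A' V V' → Steps A A' V V' → List A → (List (A' × A') → V' → Y) → V → Y
  | _, h, [], [], Φ, v => Φ [] (h.ν v)
  | N, h, [], a :: l, Φ, v => pathSum gr N h [] l (consF (h.θ (bar gr N a), h.β) Φ) v
  | N, _, s :: hs, [], Φ, v => pathSum gr (N - 1) s.2 hs [] (consF (s.1, s.2.β) Φ) v
  | N, h, s :: hs, a :: l, Φ, v => pathSum gr (N - 1) s.2 hs (a :: l) (consF (s.1, s.2.β) Φ) v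
        + pathSum gr N h (s :: hs) l (consF (h.θ (bar gr N a), h.β) Φ) v
  termination_by _ _ hs l _ _ => hs.length + l.length

/-- The first step of a lattice path. -/
def stepMove {B M : Type*} [Zero M] (l : List B) (F : B → List B → M) : M :=
  match l with
  | [] => 0
  | a :: l => F a l

@[simp] lemma stepMove_nil {B M : Type*} [Zero M] (F : B → List B → M) : stepMove [] F = 0 := rfl
@[simp] lemma stepMove_cons {B M : Type*} [Zero M] (a : B) (l : List B) (F : B → List B → M) :
    stepMove (a :: l) F = F a l := rfl

variable (gr : ℤ → AddSubgroup A) [GradedRing gr]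

variable (N : ℤ) (h : Vtx A A' V V') (hs : Steps A A' V V')

lemma pathSum_rec (l : List A) (Φ : List (A' × A') → V' → Y) (v : V) : pathSum gr N h hs l Φ v
      = stepMove hs (fun s hs' => pathSum gr (N - 1) s.2 hs' l (consF (s.1, s.2.β) Φ) v)
        + stepMove l (fun a l' => pathSum gr N h hs l' (consF (h.θ (bar gr N a), h.β) Φ) v)
        + (if hs = [] ∧ l = [] then Φ [] (h.ν v) else 0) := by
  match hs, l with
  | [], [] => rw [pathSum]; simp
  | [], a :: l => rw [pathSum]; simp
  | s :: hs, [] => rw [pathSum]; simp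
  | s :: hs, a :: l => rw [pathSum]; simp

lemma pathSum_add (l : List A) (Φ Ψ : List (A' × A') → V' → Y) (v : V) :
    pathSum gr N h hs l (Φ + Ψ) v = pathSum gr N h hs l Φ v + pathSum gr N h hs l Ψ v := by
  induction' hn : hs.length + l.length using Nat.strong_induction_on with
    n ih generalizing N h hs l Φ Ψ
  match hs, l with
  | [], [] => rw [pathSum, pathSum, pathSum]; rfl
  | [], a :: l =>
    rw [pathSum, pathSum, pathSum, consF_add]
    grind
  | s :: hs, [] =>
    rw [pathSum, pathSum, pathSum, consF_add]
    grind
  | s :: hs, a :: l =>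
    rw [pathSum, pathSum, pathSum, consF_add, consF_add,
      ih _ (by simp [← hn]) _ _ hs (a :: l) _ _ rfl, ih _ (by simp [← hn]) _ _ (s :: hs) l _ _ rfl]
    abel

lemma pathSum_map {Y' : Type*} [AddCommGroup Y'] (g : Y →+ Y') (N : ℤ) (h : Vtx A A' V V')
    (hs : Steps A A' V V') (l : List A) (Φ : List (A' × A') → V' → Y) (v : V) :
    pathSum gr N h hs l (fun x v' => g (Φ x v')) v = g (pathSum gr N h hs l Φ v) := by
  induction' hn : hs.length + l.length using Nat.strong_induction_on with
    n ih generalizing N h hs l Φ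
  match hs, l with
  | [], [] => rw [pathSum, pathSum]
  | [], a :: l =>
    rw [pathSum, pathSum]
    exact ih _ (by simp [← hn]) _ _ _ _ _ rfl
  | s :: hs, [] =>
    rw [pathSum, pathSum]
    exact ih _ (by simp [← hn]) _ _ _ _ _ rfl
  | s :: hs, a :: l =>
    rw [pathSum, pathSum, map_add]
    congr 1
    · exact ih _ (by simp [← hn]) _ _ hs (a :: l) _ rfl
    · exact ih _ (by simp [← hn]) _ _ (s :: hs) l _ rfl

/-- The sum of the values of `f` on all strings obtained from the lattice paths by the insertion
of `K` elements. -/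
def op (K : ℕ) (l : List A) (f : List A' → V' → Y) (v : V) : Y :=
  pathSum gr N h hs l (fun ps v' => prog h.β ps K f v') v

lemma op_rec (K : ℕ) (l : List A) (f : List A' → V' → Y) (v : V) : op gr N h hs K l f v
      = shift (fun K' => op gr N h hs K' l (consF h.β f) v) K
        + stepMove hs (fun s hs' => op gr (N - 1) s.2 hs' K l (consF s.1 f) v)
        + stepMove l (fun a l' => op gr N h hs K l' (consF (h.θ (bar gr N a)) f) v)
        + (if hs = [] ∧ l = [] ∧ K = 0 then f [] (h.ν v) else 0) := by
  cases K with
  | zero =>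
    rw [op, pathSum_rec, shift_zero_apply, zero_add]
    congr 1
    · congr 1
      · congr 1; funext s hs'
        rw [op]; congr 1; funext ps; rw [consF_apply, prog]
      · congr 1; funext a l'
        rw [op]; congr 1; funext ps; rw [consF_apply, prog]
    · simp [prog_nil]
  | succ K =>
    have h1 : (fun ps v' => prog h.β ps (K + 1) f v')
        = (fun ps v' => prog h.β ps K (consF h.β f) v')
          + fun ps => stepMove ps fun s ps' => prog s.2 ps' (K + 1) (consF s.1 f) := by
      funext ps v'
      match ps with
      | [] => rw [prog]; simp
      | (e, γ') :: ps => rw [prog]; rfl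
    rw [op, h1, pathSum_add, pathSum_rec gr N h hs l (fun ps => stepMove ps _)]
    simp only [shift_succ_apply]
    rw [← add_assoc, ← add_assoc]
    exact congrArg₂ _ (congrArg₂ _ (congrArg₂ _ rfl rfl) rfl) (by simp)

lemma op_add (K : ℕ) (l : List A) (f g : List A' → V' → Y) (v : V) :
    op gr N h hs K l (f + g) v = op gr N h hs K l f v + op gr N h hs K l g v := by
  rw [op, op, op, ← pathSum_add]
  congr 1; funext ps v'
  rw [prog_add]; rfl

lemma op_map {Y' : Type*} [AddCommGroup Y'] (g : Y →+ Y') (N : ℤ) (h : Vtx A A' V V')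
    (hs : Steps A A' V V') (K : ℕ) (l : List A) (f : List A' → V' → Y) (v : V) :
    op gr N h hs K l (fun x v' => g (f x v')) v = g (op gr N h hs K l f v) := by
  rw [op, op, ← pathSum_map]
  congr 1; funext ps v'
  let g' : (V' → Y) →+ (V' → Y') :=
    AddMonoidHom.mk' (fun F v => g (F v)) fun F F' => by funext v; exact map_add g _ _
  exact congrFun (prog_map g' h.β ps K f) v'

lemma op_zero (K : ℕ) (l : List A) (v : V) : op gr N h hs K l (0 : List A' → V' → Y) v = 0 :=
  op_map gr (0 : Y →+ Y) N h hs K l 0 v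

/-- Induction principle for the insertion operators. -/
lemma op_induction {S B : Type*} {P : List S → ℕ → List B → Prop}
    (H : ∀ hs K l, (∀ K', K = K' + 1 → P hs K' l) → (∀ s hs', hs = s :: hs' → P hs' K l) →
    (∀ a l', l = a :: l' → P hs K l') → P hs K l)
    (hs : List S) (K : ℕ) (l : List B) : P hs K l := by
  induction' hn : hs.length + K + l.length using Nat.strong_induction_on with
    n ih generalizing hs K l
  all_goals grind

/-- Sum over the shuffles of two lists of steps, with signs. -/
def shSum : ℤ → Vtx A A' V V' → Steps A A' V V' → Vtx A' A'' V' V'' →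
    Steps A' A'' V' V'' → (Steps A A'' V V'' → Y) → Y
  | _, _, [], _, [], F => F []
  | N, _, s :: hs, k, [], F => N.negOnePow • shSum N s.2 hs k [] (consF (k.θ s.1, s.2.comp k) F)
  | N, h, [], _, s' :: ks, F => shSum (N - 1) h [] s'.2 ks (consF (s'.1, h.comp s'.2) F)
  | N, h, s :: hs, k, s' :: ks, F =>
      N.negOnePow • shSum N s.2 hs k (s' :: ks) (consF (k.θ s.1, s.2.comp k) F)
        + shSum (N - 1) h (s :: hs) s'.2 ks (consF (s'.1, h.comp s'.2) F)
  termination_by _ _ hs _ ks _ => hs.length + ks.length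

lemma shSum_rec (k : Vtx A' A'' V' V'') (ks : Steps A' A'' V' V'') (F : Steps A A'' V V'' → Y) :
    shSum N h hs k ks F = stepMove hs (fun s hs' =>
          N.negOnePow • shSum N s.2 hs' k ks (consF (k.θ s.1, s.2.comp k) F))
        + stepMove ks (fun s' ks' => shSum (N - 1) h hs s'.2 ks' (consF (s'.1, h.comp s'.2) F))
        + (if hs = [] ∧ ks = [] then F [] else 0) := by
  match hs, ks with
  | [], [] => rw [shSum]; simp
  | [], a :: l => rw [shSum]; simp
  | s :: hs, [] => rw [shSum]; simp
  | s :: hs, a :: l => rw [shSum]; simp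

lemma shSum_add (k : Vtx A' A'' V' V'') (ks : Steps A' A'' V' V'') (F G : Steps A A'' V V'' → Y) :
    shSum N h hs k ks (F + G) = shSum N h hs k ks F + shSum N h hs k ks G := by
  induction' hn : hs.length + ks.length using Nat.strong_induction_on with
    n ih generalizing N h hs k ks F G
  match hs, ks with
  | [], [] => rw [shSum, shSum, shSum]; rfl
  | [], a :: l =>
    rw [shSum, shSum, shSum, consF_add]
    grind
  | s :: hs, [] =>
    rw [shSum, shSum, shSum, consF_add, ih _ (by simp [← hn]) _ _ hs _ [] _ _ rfl, smul_add]
  | s :: hs, a :: l =>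
    rw [shSum, shSum, shSum, consF_add, consF_add, ih _ (by simp [← hn]) _ _ hs _ (a :: l) _ _ rfl,
      ih _ (by simp [← hn]) _ _ (s :: hs) _ l _ _ rfl, smul_add]
    abel

lemma shSum_map {Y' : Type*} [AddCommGroup Y'] (g : Y →+ Y') (N : ℤ) (h : Vtx A A' V V')
    (hs : Steps A A' V V') (k : Vtx A' A'' V' V'') (ks : Steps A' A'' V' V'')
    (F : Steps A A'' V V'' → Y) :
    shSum N h hs k ks (fun z => g (F z)) = g (shSum N h hs k ks F) := by
  induction' hn : hs.length + ks.length using Nat.strong_induction_on with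
    n ih generalizing N h hs k ks F
  match hs, ks with
  | [], [] => rw [shSum, shSum]
  | [], a :: l =>
    rw [shSum, shSum]
    exact ih _ (by simp [← hn]) _ _ _ _ _ _ rfl
  | s :: hs, [] =>
    rw [shSum, shSum, map_units_smul]
    congr 1
    exact ih _ (by simp [← hn]) _ _ hs _ [] _ rfl
  | s :: hs, a :: l =>
    rw [shSum, shSum, map_add, map_units_smul]
    congr 1
    · congr 1
      exact ih _ (by simp [← hn]) _ _ hs _ (a :: l) _ rfl
    · exact ih _ (by simp [← hn]) _ _ (s :: hs) _ l _ rfl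

lemma shSum_zero (k : Vtx A' A'' V' V'') (ks : Steps A' A'' V' V'') :
    shSum N h hs k ks (fun _ => (0 : Y)) = 0 :=
  shSum_map (0 : Y →+ Y) N h hs k ks (fun _ => 0)

lemma stepMove_add {B M : Type*} [AddZeroClass M] (l : List B) (F G : B → List B → M) :
    stepMove l (fun a l' => F a l' + G a l') = stepMove l F + stepMove l G := by
  cases l <;> simp

lemma stepMove_map {B M M' : Type*} [AddCommGroup M] [AddCommGroup M'] (g : M →+ M') (l : List B)
    (F : B → List B → M) : stepMove l (fun a l' => g (F a l')) = g (stepMove l F) := by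
  cases l <;> simp

lemma stepMove_congr {B M : Type*} [Zero M] {l : List B} {F G : B → List B → M}
    (h : ∀ a l', l = a :: l' → F a l' = G a l') : stepMove l F = stepMove l G := by
  cases l
  all_goals simp_all

lemma sum_antidiagonal_shift_right (X : ℕ → ℕ → Y) (n : ℕ) :
    ∑ p ∈ antidiagonal n, shift (fun j => X p.1 j) p.2
      = shift (fun n => ∑ p ∈ antidiagonal n, X p.1 p.2) n := by
  cases n with
  | zero => simp
  | succ n => rw [Finset.Nat.sum_antidiagonal_succ']; simp

lemma sum_antidiagonal_shift_left (X : ℕ → ℕ → Y) (n : ℕ) :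
    ∑ p ∈ antidiagonal n, shift (fun j => X j p.2) p.1
      = shift (fun n => ∑ p ∈ antidiagonal n, X p.1 p.2) n := by
  cases n with
  | zero => simp
  | succ n => rw [Finset.Nat.sum_antidiagonal_succ]; simp

end Paths

section Composition

variable {A A' A'' V V' V'' Y : Type*} [Ring A] [Ring A'] [Ring A''] [AddCommGroup V]
  [AddCommGroup V'] [AddCommGroup V''] [AddCommGroup Y]
  (gr : ℤ → AddSubgroup A) [GradedRing gr] (gr' : ℤ → AddSubgroup A') [GradedRing gr']
  (gr'' : ℤ → AddSubgroup A'') [GradedRing gr'']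

/-- The map on arguments preserves degrees and the inserted element has degree one. -/
structure Vtx.Graded (h : Vtx A A' V V') : Prop where
  θ_mem : ∀ {i a}, a ∈ gr i → h.θ a ∈ gr' i
  β_mem : h.β ∈ gr' 1

/-- All vertices of a path are graded and the elements of the steps have degree zero. -/
structure PathGraded (h : Vtx A A' V V') (hs : Steps A A' V V') : Prop where
  vtx : h.Graded gr gr'
  step : ∀ s ∈ hs, s.1 ∈ gr' 0 ∧ s.2.Graded gr gr'

variable {gr gr' gr''}

lemma PathGraded.tail {h : Vtx A A' V V'} {s : A' × Vtx A A' V V'} {hs : Steps A A' V V'}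
    (H : PathGraded gr gr' h (s :: hs)) : PathGraded gr gr' s.2 hs :=
  ⟨(H.step s (by simp)).2, fun t ht => H.step t (by simp [ht])⟩

lemma PathGraded.step_mem {h : Vtx A A' V V'} {s : A' × Vtx A A' V V'} {hs : Steps A A' V V'}
    (H : PathGraded gr gr' h (s :: hs)) : s.1 ∈ gr' 0 :=
  (H.step s (by simp)).1

variable (gr gr')

/-- The terms with `n` inserted elements of the composition of two insertion operators. -/
def opop (N N' : ℤ) (h : Vtx A A' V V') (hs : Steps A A' V V')
    (k : Vtx A' A'' V' V'') (ks : Steps A' A'' V' V'') (n : ℕ) (l : List A)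
    (f : List A'' → V'' → Y) (v : V) : Y :=
  ∑ p ∈ antidiagonal n, op gr N h hs p.1 l (fun x v' => op gr' N' k ks p.2 x f v') v

lemma opop_add (N N' : ℤ) (h : Vtx A A' V V') (hs : Steps A A' V V') (k : Vtx A' A'' V' V'')
    (ks : Steps A' A'' V' V'') (n : ℕ) (l : List A) (f g : List A'' → V'' → Y) (v : V) :
    opop gr gr' N N' h hs k ks n l (f + g) v
      = opop gr gr' N N' h hs k ks n l f v + opop gr gr' N N' h hs k ks n l g v := by
  rw [opop, opop, opop, ← sum_add_distrib]
  refine sum_congr rfl fun p _ => ?_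
  rw [← op_add]
  congr 1; funext x v'
  exact op_add _ _ _ _ _ _ _ _ _

lemma shift_add_fun (X Z : ℕ → Y) (n : ℕ) :
    shift (fun n => X n + Z n) n = shift X n + shift Z n := by
  change shift (X + Z) n = _
  simp

lemma opop_rec (N N' : ℤ) {h : Vtx A A' V V'} {hs : Steps A A' V V'} (H : PathGraded gr gr' h hs)
    (k : Vtx A' A'' V' V'') (ks : Steps A' A'' V' V'') (n : ℕ) (l : List A)
    {f : List A'' → V'' → Y} (hf : MultiAdd f) (v : V) : opop gr gr' N N' h hs k ks n l f v
      = shift (fun n => opop gr gr' N N' h hs k ks n l (consF (k.β + k.θ h.β) f) v) n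
        + stepMove hs (fun s hs' => N'.negOnePow •
            opop gr gr' (N - 1) N' s.2 hs' k ks n l (consF (k.θ s.1) f) v)
        + stepMove ks (fun s ks' => opop gr gr' N (N' - 1) h hs s.2 ks' n l (consF s.1 f) v)
        + stepMove l (fun a l' => opop gr gr' N N' h hs k ks n l'
            (consF (k.θ (bar gr' N' (h.θ (bar gr N a)))) f) v)
        + (if hs = [] ∧ ks = [] ∧ l = [] ∧ n = 0 then f [] (k.ν (h.ν v)) else 0) := by
  let A₁ : ℕ → List A' → V' → Y := fun j x v' =>
    shift (fun j' => op gr' N' k ks j' x (consF k.β f) v') j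
  let A₂ : ℕ → List A' → V' → Y := fun j x v' =>
    stepMove ks (fun s ks' => op gr' (N' - 1) s.2 ks' j x (consF s.1 f) v')
  let A₃ : ℕ → List A' → V' → Y := fun j x v' =>
    stepMove x (fun y x' => op gr' N' k ks j x' (consF (k.θ (bar gr' N' y)) f) v')
  let A₄ : ℕ → List A' → V' → Y := fun j x v' =>
    if ks = [] ∧ x = [] ∧ j = 0 then f [] (k.ν v') else 0
  have h0 : ∀ j, (fun x v' => op gr' N' k ks j x f v') = A₁ j + A₂ j + A₃ j + A₄ j := by
    intro j; funext x v'; exact op_rec gr' N' k ks j x f v'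
  have h1 : ∀ n l, ∑ p ∈ antidiagonal n, op gr N h hs p.1 l (A₁ p.2) v
      = shift (fun n => opop gr gr' N N' h hs k ks n l (consF k.β f) v) n := by
    intro n l
    refine Eq.trans ?_ (sum_antidiagonal_shift_right
      (fun i j => op gr N h hs i l (fun x v' => op gr' N' k ks j x (consF k.β f) v') v) n)
    refine sum_congr rfl fun p _ => ?_
    cases hp : p.2 with
    | zero => exact op_zero _ _ _ _ _ _ _
    | succ j => rfl
  have h2 : ∑ p ∈ antidiagonal n, op gr N h hs p.1 l (A₂ p.2) v
      = stepMove ks (fun s ks' => opop gr gr' N (N' - 1) h hs s.2 ks' n l (consF s.1 f) v) := by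
    cases hks : ks with
    | nil =>
      refine sum_eq_zero fun p _ => ?_
      simp only [A₂, hks]
      exact op_zero _ _ _ _ _ _ _
    | cons s ks' =>
      refine sum_congr rfl fun p _ => ?_
      simp only [A₂, hks]
      rfl
  have hc : ∀ j y, consF y (A₃ j)
      = fun x' v' => op gr' N' k ks j x' (consF (k.θ (bar gr' N' y)) f) v' := fun j y => rfl
  have h3 : ∑ p ∈ antidiagonal n, op gr N h hs p.1 l (A₃ p.2) v
      = shift (fun n => opop gr gr' N N' h hs k ks n l (consF (k.θ h.β) f) v) n
        + stepMove hs (fun s hs' => N'.negOnePow •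
            opop gr gr' (N - 1) N' s.2 hs' k ks n l (consF (k.θ s.1) f) v)
        + stepMove l (fun a l' => opop gr gr' N N' h hs k ks n l'
            (consF (k.θ (bar gr' N' (h.θ (bar gr N a)))) f) v) := by
    rw [sum_congr rfl fun p _ => op_rec gr N h hs p.1 l (A₃ p.2) v]
    rw [sum_add_distrib, sum_add_distrib, sum_add_distrib,
      sum_eq_zero (f := fun p : ℕ × ℕ => if hs = [] ∧ l = [] ∧ p.1 = 0
        then A₃ p.2 [] (h.ν v) else 0) (fun p _ => by simp [A₃]), add_zero]
    simp only [hc]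
    congr 1
    · congr 1
      · refine Eq.trans ?_ (sum_antidiagonal_shift_left (fun i j => op gr N h hs i l
          (fun x v' => op gr' N' k ks j x (consF (k.θ h.β) f) v') v) n)
        refine sum_congr rfl fun p _ => ?_
        rw [bar_of_mem_one gr' N' H.vtx.β_mem]
      · cases hs with
        | nil => simp
        | cons s hs' =>
          simp only [stepMove_cons]
          rw [opop, Finset.smul_sum]
          refine sum_congr rfl fun p _ => ?_
          rw [bar_of_mem_zero gr' N' H.step_mem, map_units_smul, hf.consF_units_smul]
          have := op_map gr (toAddMonoidHom Y N'.negOnePow) (N - 1) s.2 hs' p.1 l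
            (fun x v' => op gr' N' k ks p.2 x (consF (k.θ s.1) f) v') v
          refine Eq.trans ?_ this
          congr 1; funext x v'
          have := op_map gr' (toAddMonoidHom Y N'.negOnePow) N' k ks p.2 x (consF (k.θ s.1) f) v'
          exact this
    · cases l with
      | nil => simp
      | cons a l' => rfl
  have h4 : ∑ p ∈ antidiagonal n, op gr N h hs p.1 l (A₄ p.2) v
      = if hs = [] ∧ ks = [] ∧ l = [] ∧ n = 0 then f [] (k.ν (h.ν v)) else 0 := by
    have hz : ∀ j y, consF y (A₄ j) = 0 := by intro j y; funext x v'; simp [A₄]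
    rw [sum_congr rfl fun p _ => op_rec gr N h hs p.1 l (A₄ p.2) v]
    simp only [hz, op_zero]
    have e1 : ∀ i, shift (fun _ => (0 : Y)) i = 0 := fun i => by cases i <;> rfl
    have e2 : stepMove hs (fun _ _ => (0 : Y)) = 0 := by cases hs <;> rfl
    have e3 : stepMove l (fun _ _ => (0 : Y)) = 0 := by cases l <;> rfl
    simp only [e1, e2, e3, zero_add, A₄]
    by_cases hn : n = 0
    · subst hn
      simp only [antidiagonal]
      by_cases g1 : hs = [] <;> by_cases g2 : l = [] <;> by_cases g3 : ks = [] <;>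
        simp [g1, g2, g3]
    · rw [if_neg (by simp [hn])]
      refine sum_eq_zero fun p hp => ?_
      rw [Finset.HasAntidiagonal.mem_antidiagonal] at hp
      by_cases g : p.1 = 0
      · have g' : p.2 ≠ 0 := by omega
        simp [g']
      · simp [g]
  have hβ : ∀ n, opop gr gr' N N' h hs k ks n l (consF (k.β + k.θ h.β) f) v
      = opop gr gr' N N' h hs k ks n l (consF k.β f) v
        + opop gr gr' N N' h hs k ks n l (consF (k.θ h.β) f) v := by
    intro n; rw [hf.consF_add, opop_add]
  simp only [hβ, shift_add_fun]
  conv_lhs => rw [opop]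
  rw [sum_congr rfl fun p _ => by rw [h0, op_add, op_add, op_add],
    sum_add_distrib, sum_add_distrib, sum_add_distrib, h1, h2, h3, h4]
  abel

/-- The composition of two insertion operators is a sum over shuffles. -/
theorem opop_eq_shSum (N N' : ℤ) {h : Vtx A A' V V'} {hs : Steps A A' V V'}
    (H : PathGraded gr gr' h hs) {k : Vtx A' A'' V' V''} {ks : Steps A' A'' V' V''}
    (hk : PathGraded gr' gr'' k ks) (n : ℕ) (l : List A) {f : List A'' → V'' → Y}
    (hf : MultiAdd f) (v : V) : opop gr gr' N N' h hs k ks n l f v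
      = shSum N' h hs k ks (fun z => op gr (N + N') (h.comp k) z n l f v) := by
  induction' hm : hs.length + ks.length + n + l.length using Nat.strong_induction_on with
    m ih generalizing N N' h hs k ks n l f
  rw [opop_rec gr gr' N N' H k ks n l hf v]
  have e : (fun z => op gr (N + N') (h.comp k) z n l f v)
      = (fun z => shift (fun n => op gr (N + N') (h.comp k) z n l (consF (h.comp k).β f) v) n)
        + (fun z => stepMove z fun s z' => op gr (N + N' - 1) s.2 z' n l (consF s.1 f) v)
        + (fun z => stepMove l fun a l' => op gr (N + N') (h.comp k) z n l'
            (consF ((h.comp k).θ (bar gr (N + N') a)) f) v)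
        + fun z => if z = [] ∧ l = [] ∧ n = 0 then f [] ((h.comp k).ν v) else 0 := by
    funext z; exact op_rec _ _ _ _ _ _ _ _
  rw [e, shSum_add, shSum_add, shSum_add, shSum_rec N' h hs k ks (fun z => stepMove z _),
    shSum_rec N' h hs k ks (fun z => if z = [] ∧ l = [] ∧ n = 0 then f [] ((h.comp k).ν v) else 0)]
  have g1 : shift (fun n => opop gr gr' N N' h hs k ks n l (consF (k.β + k.θ h.β) f) v) n
      = shSum N' h hs k ks (fun z =>
        shift (fun n => op gr (N + N') (h.comp k) z n l (consF (h.comp k).β f) v) n) := by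
    cases n with
    | zero => exact (shSum_zero _ _ _ _ _).symm
    | succ n => exact ih _ (by omega) N N' H hk n l (hf.cons _) rfl
  have g2 : stepMove hs (fun s hs' => N'.negOnePow •
          opop gr gr' (N - 1) N' s.2 hs' k ks n l (consF (k.θ s.1) f) v)
      = stepMove hs (fun s hs' => N'.negOnePow • shSum N' s.2 hs' k ks (consF (k.θ s.1, s.2.comp k)
            (fun z => stepMove z fun s z' => op gr (N + N' - 1) s.2 z' n l (consF s.1 f) v))) := by
    refine stepMove_congr fun s hs' hh => ?_
    subst hh
    rw [ih _ (by simp [← hm]) (N - 1) N' H.tail hk n l (hf.cons _) rfl]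
    congr 2; funext z
    rw [show N - 1 + N' = N + N' - 1 by ring]; rfl
  have g3 : stepMove ks (fun s ks' => opop gr gr' N (N' - 1) h hs s.2 ks' n l (consF s.1 f) v)
      = stepMove ks (fun s' ks' => shSum (N' - 1) h hs s'.2 ks' (consF (s'.1, h.comp s'.2)
            (fun z => stepMove z fun s z' => op gr (N + N' - 1) s.2 z' n l (consF s.1 f) v))) := by
    refine stepMove_congr fun s ks' hh => ?_
    subst hh
    rw [ih _ (by simp [← hm]) N (N' - 1) H hk.tail n l (hf.cons _) rfl]
    congr 1; funext z
    rw [show N + (N' - 1) = N + N' - 1 by ring]; rfl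
  have g4 : stepMove l (fun a l' => opop gr gr' N N' h hs k ks n l'
          (consF (k.θ (bar gr' N' (h.θ (bar gr N a)))) f) v)
      = shSum N' h hs k ks (fun z => stepMove l fun a l' => op gr (N + N') (h.comp k) z n l'
            (consF ((h.comp k).θ (bar gr (N + N') a)) f) v) := by
    cases l with
    | nil => exact (shSum_zero _ _ _ _ _).symm
    | cons a l' =>
      simp only [stepMove_cons]
      rw [ih _ (by simp [← hm]) N N' H hk n l' (hf.cons _) rfl]
      rw [bar_map_zero gr gr' h.θ H.vtx.θ_mem, bar_bar, add_comm N' N]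
      rfl
  have g5 : ∀ s : A'' × Vtx A A'' V V'', consF s
      (fun z => if z = [] ∧ l = [] ∧ n = 0 then f [] ((h.comp k).ν v) else 0)
      = fun _ => 0 := fun s => by funext z; simp
  simp only [g5, shSum_zero]
  have g6 : stepMove hs (fun _ _ => N'.negOnePow • (0 : Y)) = 0 := by cases hs <;> simp
  have g7 : stepMove ks (fun _ _ => (0 : Y)) = 0 := by cases ks <;> rfl
  rw [g1, g2, g3, g4, g6, g7]
  simp only [stepMove_nil, true_and, ite_self, zero_add, add_zero]
  have g8 : (if hs = [] ∧ ks = [] ∧ l = [] ∧ n = 0 then f [] (k.ν (h.ν v)) else 0)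
    = if hs = [] ∧ ks = [] then if l = [] ∧ n = 0 then f [] ((h.comp k).ν v) else 0 else 0 := by
    rw [← ite_and]
    simp only [and_assoc]; rfl
  rw [g8]
  abel

end Composition

/-! ## The differential on functions of strings -/

section Curved

/-- A graded ring with a flat connection up to inner derivations. -/
structure Curved {A : Type*} [Ring A] (gr : ℤ → AddSubgroup A) [GradedRing gr] where
  D : A →+ A
  R : A
  D_mem : ∀ {i : ℤ} {a : A}, a ∈ gr i → D a ∈ gr (i + 1)
  R_mem : R ∈ gr 2
  D_mul : ∀ a b : A, D (a * b) = D a * b + koszul gr 1 a * D b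
  D_D : ∀ a : A, D (D a) = R * a - a * R
  D_R : D R = 0

/-- A module with a compatible connection. -/
structure CurvedMod {A : Type*} [Ring A] {gr : ℤ → AddSubgroup A} [GradedRing gr] (C : Curved gr)
    (V : Type*) [AddCommGroup V] [Module A V] where
  D : V →+ V
  D_D : ∀ v : V, D (D v) = C.R • v
  D_smul : ∀ (a : A) (v : V), D (a • v) = C.D a • v + koszul gr 1 a • D v

variable {A V W Y : Type*} [Ring A] {gr : ℤ → AddSubgroup A} [GradedRing gr] (C : Curved gr)
  [AddCommGroup V] [Module A V] [AddCommGroup W] [Module A W] [AddCommGroup Y]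

lemma Curved.bar_D (n : ℤ) (a : A) : bar gr n (C.D a) = n.negOnePow • C.D (bar gr n a) := by
  rw [bar_map gr gr C.D C.D_mem, mul_one]

lemma Curved.bar_one_D (a : A) : bar gr 1 (C.D a) = -C.D (bar gr 1 a) := by rw [C.bar_D]; simp

lemma Curved.bar_R (n : ℤ) : bar gr n C.R = n.negOnePow • C.R := by
  rw [bar_of_mem gr n C.R_mem, negOnePow_eq_of (show n * (2 + 1) = n + 2 * n by ring)]

lemma Curved.bar_one_R : bar gr 1 C.R = -C.R := by rw [C.bar_R]; simp

lemma Curved.koszul_R (n : ℤ) : koszul gr n C.R = C.R := by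
  rw [koszul_of_mem gr n C.R_mem, mul_comm, negOnePow_two_mul, one_smul]

lemma Curved.D_bar_mul (a b : A) : C.D (bar gr 1 a * b) = -(bar gr 1 (C.D a) * b) - a * C.D b := by
  rw [C.D_mul, koszul_one, bar_one_one, C.bar_one_D]
  noncomm_ring

variable (gr) in
/-- Multiplication of `a` with the first entry of a string, or with the last argument if the
string is empty. -/
def mulFirst (a : A) (f : List A → V → Y) : List A → V → Y
  | [], v => -f [] (a • v)
  | b :: l, v => f (bar gr 1 a * b :: l) v

variable {C} (CV : CurvedMod C V)

/-- The part of the differential of a function of strings that does not involve the module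
structure of the values. -/
def strB : (List A → V → Y) → List A → V → Y
  | f, [], v => f [C.R] v + f [] (CV.D v)
  | f, a :: l, v => f (C.R :: a :: l) v - f (C.D a :: l) v + mulFirst gr a f l v
      + strB (consF (bar gr 1 a) f) l v

lemma strB_cons (a : A) (f : List A → V → Y) : consF a (strB CV f)
    = consF a (consF C.R f) - consF (C.D a) f + mulFirst gr a f
      + strB CV (consF (bar gr 1 a) f) := rfl

lemma strB_cons_apply (a : A) (f : List A → V → Y) (l : List A) (v : V) : strB CV f (a :: l) v
    = f (C.R :: a :: l) v - f (C.D a :: l) v + mulFirst gr a f l v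
      + strB CV (consF (bar gr 1 a) f) l v := rfl

lemma mulFirst_cons (a b : A) (f : List A → V → Y) (l : List A) (v : V) :
    mulFirst gr a f (b :: l) v = f (bar gr 1 a * b :: l) v := rfl

lemma mulFirst_map {Y' : Type*} [AddCommGroup Y'] (g : Y →+ Y') (a : A) (f : List A → V → Y)
    (l : List A) (v : V) : mulFirst gr a (fun x v => g (f x v)) l v = g (mulFirst gr a f l v) := by
  cases l <;> simp [mulFirst]

lemma strB_map {Y' : Type*} [AddCommGroup Y'] (g : Y →+ Y') (f : List A → V → Y) (l : List A)
    (v : V) : strB CV (fun x v => g (f x v)) l v = g (strB CV f l v) := by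
  induction l generalizing f with
  | nil => simp [strB]
  | cons a l ih =>
    simp only [strB, map_add, map_sub, mulFirst_map]
    congr 1
    exact ih _

lemma mulFirst_add (a : A) (f g : List A → V → Y) (l : List A) (v : V) :
    mulFirst gr a (f + g) l v = mulFirst gr a f l v + mulFirst gr a g l v := by
  cases l <;> simp [mulFirst, add_comm]

lemma strB_add (f g : List A → V → Y) (l : List A) (v : V) :
    strB CV (f + g) l v = strB CV f l v + strB CV g l v := by
  induction l generalizing f g with
  | nil => simp only [strB, Pi.add_apply]; abel
  | cons a l ih =>
    simp only [strB, mulFirst_add, consF_add, ih, Pi.add_apply]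
    abel

lemma strB_neg (f : List A → V → Y) (l : List A) (v : V) :
    strB CV (-f) l v = -strB CV f l v := strB_map CV (-AddMonoidHom.id Y) f l v

lemma strB_sub (f g : List A → V → Y) (l : List A) (v : V) :
    strB CV (f - g) l v = strB CV f l v - strB CV g l v := by
  rw [sub_eq_add_neg, strB_add, strB_neg, sub_eq_add_neg]

lemma strB_zero (l : List A) (v : V) : strB CV (0 : List A → V → Y) l v = 0 :=
  strB_map CV (0 : Y →+ Y) 0 l v

lemma MultiAdd.mulFirst {f : List A → V → Y} (hf : MultiAdd f) (a : A) :
    MultiAdd (mulFirst gr a f) := by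
  constructor
  · intro l l' b c v
    cases l with
    | nil =>
      simp only [nil_append, InnerAct.mulFirst, mul_add]
      exact hf.entry [] _ _ _ _
    | cons x l =>
      simp only [cons_append, InnerAct.mulFirst]
      exact hf.entry (_ :: l) l' b c v
  · intro l v v'
    cases l with
    | nil => simp only [InnerAct.mulFirst, smul_add, hf.right]; abel
    | cons x l => exact hf.right _ _ _

lemma mulFirst_add_left {f : List A → V → Y} (hf : MultiAdd f) (a b : A) (l : List A) (v : V) :
    mulFirst gr (a + b) f l v = mulFirst gr a f l v + mulFirst gr b f l v := by
  cases l with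
  | nil => simp only [mulFirst, add_smul, hf.right]; abel
  | cons x l =>
    simp only [mulFirst, map_add, add_mul]
    exact hf.entry [] _ _ _ _

lemma MultiAdd.strB {f : List A → V → Y} (hf : MultiAdd f) : MultiAdd (strB CV f) := by
  constructor
  · intro l l' b c v
    induction l generalizing f with
    | nil =>
      simp only [nil_append, InnerAct.strB]
      rw [mulFirst_add_left hf, map_add, map_add, hf.consF_add, strB_add]
      have h1 := hf.entry [C.R] l' b c v
      have h2 := hf.entry [] l' (C.D b) (C.D c) v
      grind
    | cons a l ih =>
      simp only [cons_append, InnerAct.strB]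
      have h1 := hf.entry (C.R :: a :: l) l' b c v
      have h2 := hf.entry (C.D a :: l) l' b c v
      simp only [cons_append] at h1 h2
      rw [h1, h2, (hf.mulFirst a).entry, ih (hf.cons _)]; abel
  · intro l v v'
    induction l generalizing f with
    | nil => simp only [InnerAct.strB, map_add, hf.right]; abel
    | cons a l ih =>
      simp only [InnerAct.strB, hf.right, (hf.mulFirst a).right, ih (hf.cons _)]; abel

lemma mulFirst_strB {f : List A → V → Y} (hf : MultiAdd f) (a : A) (l : List A) (v : V) :
    mulFirst gr a (strB CV f) l v + strB CV (mulFirst gr (bar gr 1 a) f) l v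
      = f (a * C.R :: l) v + mulFirst gr a (consF C.R f) l v + mulFirst gr (C.D a) f l v := by
  cases l with
  | nil =>
    simp only [mulFirst, strB, bar_one_one, CV.D_smul, hf.right, consF_apply]
    rw [koszul_one, neg_smul, hf.map_right_neg]
    abel
  | cons b l =>
    have e1 : mulFirst gr (bar gr 1 a * b) f l v + mulFirst gr b (mulFirst gr (bar gr 1 a) f) l v =
      0 := by
      cases l with
      | nil => simp [mulFirst, mul_smul]
      | cons c l =>
        simp only [mulFirst, bar_one_one, bar_one_mul, neg_mul]
        rw [show f (-(a * bar gr 1 b * c) :: l) v = -f ((a * bar gr 1 b * c) :: l) v from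
          congrFun (congrFun (hf.consF_neg _) l) v, mul_assoc]
        simp
    have e2 : consF (bar gr 1 b) (mulFirst gr (bar gr 1 a) f) = consF (a * bar gr 1 b) f := by
      funext x v; simp [mulFirst, bar_one_one]
    have e3 : f (C.D (bar gr 1 a * b) :: l) v
        = -f (bar gr 1 (C.D a) * b :: l) v - f (a * C.D b :: l) v := by
      rw [C.D_bar_mul]
      change consF _ f l v = _
      rw [hf.consF_sub, hf.consF_neg]; rfl
    rw [mulFirst_cons, mulFirst_cons, mulFirst_cons, strB_cons_apply, strB_cons_apply,
      e2, bar_one_mul, bar_one_one, hf.consF_neg, strB_neg, e3, mulFirst_cons, mulFirst_cons,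
      bar_one_one, consF_apply]
    grind

/-- The operator `strB` squares to zero. -/
theorem strB_strB {f : List A → V → Y} (hf : MultiAdd f) (l : List A) (v : V) :
    strB CV (strB CV f) l v = 0 := by
  induction l generalizing f with
  | nil =>
    simp only [strB, mulFirst, consF_apply, CV.D_D, C.D_R, C.bar_one_R]
    have h1 : f [-C.R, C.R] v = -f [C.R, C.R] v := congrFun (congrFun (hf.consF_neg _) _) v
    have h2 : f [-C.R] (CV.D v) = -f [C.R] (CV.D v) := congrFun (congrFun (hf.consF_neg _) _) _
    have h3 : f [0] v = 0 := congrFun (congrFun hf.consF_zero _) _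
    grind
  | cons a l ih =>
    have h1 : consF (bar gr 1 C.R) f = -consF C.R f := by rw [C.bar_one_R, hf.consF_neg]
    have e1 : strB CV f (C.R :: a :: l) v = f (-(C.R * a) :: l) v + f (C.R :: C.D a :: l) v
        - mulFirst gr a (consF C.R f) l v - strB CV (consF (bar gr 1 a) (consF C.R f)) l v := by
      have h3 : f (C.D C.R :: a :: l) v = 0 := by
        rw [C.D_R]; exact congrFun (congrFun hf.consF_zero _) _
      rw [strB_cons_apply, h1, strB_neg, strB_cons_apply, h3, mulFirst_cons, C.bar_one_R, neg_mul]
      simp only [consF_apply]; abel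
    have e2 : strB CV f (C.D a :: l) v = f (C.R :: C.D a :: l) v - f ((C.R * a - a * C.R) :: l) v
        + mulFirst gr (C.D a) f l v - strB CV (consF (C.D (bar gr 1 a)) f) l v := by
      rw [strB_cons_apply, C.D_D, C.bar_one_D, hf.consF_neg, strB_neg, ← sub_eq_add_neg]
    have e3 : strB CV (consF (bar gr 1 a) (strB CV f)) l v
        = strB CV (consF (bar gr 1 a) (consF C.R f)) l v - strB CV (consF (C.D (bar gr 1 a)) f) l v
          + strB CV (mulFirst gr (bar gr 1 a) f) l v := by
      rw [strB_cons, strB_add, strB_add, strB_sub, bar_one_one, ih (hf.cons a), add_zero]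
    have e4 : f (-(C.R * a) :: l) v + f ((C.R * a - a * C.R) :: l) v = -f (a * C.R :: l) v := by
      change consF _ f l v + consF _ f l v = -consF _ f l v
      rw [hf.consF_neg, hf.consF_sub]
      simp only [Pi.neg_apply, Pi.sub_apply]; abel
    have e5 := mulFirst_strB CV hf a l v
    rw [strB_cons_apply, e1, e2, e3]
    grind

variable (CW : CurvedMod C W)

/-- The part of the differential of a function of strings of degree `m` that involves the module
structure of the values. -/
def frontD (m : ℤ) (f : List A → V → W) (l : List A) (v : V) : W :=
  (m + 1).negOnePow • CW.D (f l v) + stepMove l (fun a l' => koszul gr m a • f l' v)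

/-- The differential of a function of strings of degree `m`. -/
def strD (m : ℤ) (f : List A → V → W) : List A → V → W := frontD CW m f + strB CV f

lemma frontD_add (m : ℤ) (f g : List A → V → W) :
    frontD CW m (f + g) = frontD CW m f + frontD CW m g := by
  funext l v
  cases l <;> simp [frontD, smul_add]
  abel

lemma MultiAdd.frontD {f : List A → V → W} (hf : MultiAdd f) (m : ℤ) :
    MultiAdd (frontD CW m f) := by
  constructor
  · intro l l' a b v
    cases l with
    | nil =>
      simp only [InnerAct.frontD, map_add, nil_append, stepMove_cons, add_smul]
      rw [show f ((a + b) :: l') v = f (a :: l') v + f (b :: l') v from hf.entry [] l' a b v,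
        map_add, smul_add]
      abel
    | cons x l =>
      simp only [InnerAct.frontD, hf.entry, smul_add, cons_append, stepMove_cons]
      rw [show f (x :: (l ++ (a + b) :: l')) v = f (x :: (l ++ a :: l')) v
        + f (x :: (l ++ b :: l')) v from hf.entry (x :: l) l' a b v, map_add, smul_add]
      abel
  · intro l v v'
    cases l with
    | nil => simp [InnerAct.frontD, hf.right]
    | cons x l => simp only [InnerAct.frontD, hf.right, map_add, smul_add, stepMove_cons]; abel

lemma MultiAdd.strD {f : List A → V → W} (hf : MultiAdd f) (m : ℤ) : MultiAdd (strD CV CW m f) :=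
  (hf.frontD CW m).add (hf.strB CV)

/-- Left multiplication of the values by the first entry. -/
def actFirst (m : ℤ) (f : List A → V → W) (l : List A) (v : V) : W :=
  stepMove l (fun a l' => koszul gr m a • f l' v)

lemma strB_actFirst {f : List A → V → W} (m : ℤ) (l : List A) (v : V) :
    strB CV (actFirst (gr := gr) m f) l v
      = C.R • f l v - stepMove l (fun a l' => m.negOnePow • C.D (koszul gr m a) • f l' v
          + stepMove l' (fun b l'' => koszul gr (m + 1) a • koszul gr m b • f l'' v)
          + koszul gr (m + 1) a • strB CV f l' v) := by
  cases l with
  | nil => simp [strB, actFirst, C.koszul_R]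
  | cons a l =>
    have h1 : consF (bar gr 1 a) (actFirst (gr := gr) m f)
        = fun x v => (-koszul gr (m + 1) a) • f x v := by
      funext x v
      simp only [consF_apply, actFirst, stepMove_cons]
      rw [bar_eq_koszul, map_units_smul, koszul_koszul]; simp
    have h2 : koszul gr m (C.D a) = m.negOnePow • C.D (koszul gr m a) := by
      rw [koszul_eq_bar, C.bar_D, koszul_eq_bar gr m a, map_units_smul]
    have h3 : mulFirst gr a (actFirst (gr := gr) m f) l v
        = -stepMove l (fun b l'' => koszul gr (m + 1) a • koszul gr m b • f l'' v) := by
      cases l with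
      | nil => simp [mulFirst, actFirst]
      | cons b l =>
        rw [mulFirst_cons]
        simp only [actFirst, stepMove_cons]
        rw [koszul_mul, bar_eq_koszul, map_units_smul, koszul_koszul]
        simp [mul_smul]
    have h4 : strB CV (fun x v => (-koszul gr (m + 1) a) • f x v) l v
        = (-koszul gr (m + 1) a) • strB CV f l v :=
      strB_map CV (toAddMonoidHom W (-koszul gr (m + 1) a)) f l v
    rw [strB_cons_apply, h1, h3, h4]
    simp only [actFirst, stepMove_cons]
    rw [C.koszul_R, h2, units_smul_smul, neg_smul]
    abel

/-- The differential on functions of strings squares to zero. -/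
theorem strD_strD (m : ℤ) {f : List A → V → W} (hf : MultiAdd f) (l : List A) (v : V) :
    strD CV CW (m + 1) (strD CV CW m f) l v = 0 := by
  have h1 : strB CV (frontD CW m f) l v
      = (m + 1).negOnePow • CW.D (strB CV f l v) + strB CV (actFirst (gr := gr) m f) l v := by
    rw [show frontD CW m f = (fun l v => (m + 1).negOnePow • CW.D (f l v))
      + actFirst (gr := gr) m f from rfl, strB_add]
    congr 1
    exact strB_map CV ((toAddMonoidHom W (m + 1).negOnePow).comp CW.D) f l v
  rw [strD, Pi.add_apply, Pi.add_apply, strD, frontD_add, strB_add, strB_strB CV hf, h1,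
    strB_actFirst, add_zero, Pi.add_apply, Pi.add_apply]
  have hs : ∀ x : W, (m + 1 + 1).negOnePow • x = m.negOnePow • x := fun x => by
    rw [negOnePow_eq_of (show m + 1 + 1 = m + 2 * 1 by ring)]
  have hs' : ∀ x : W, (m + 1).negOnePow • x = -(m.negOnePow • x) := fun x => by
    rw [negOnePow_succ, Units.neg_smul]
  have hm : ∀ x : W, m.negOnePow • m.negOnePow • x = x := negOnePow_smul_smul m
  cases l with
  | nil =>
    simp only [frontD, stepMove_nil, add_zero, hs, hs', map_neg, map_units_smul, smul_neg, hm,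
      CW.D_D]
    abel
  | cons a l =>
    have h5 : koszul gr 1 (koszul gr m a) = koszul gr (m + 1) a := by rw [koszul_koszul, add_comm]
    cases l with
    | nil =>
      simp only [frontD, stepMove_nil, stepMove_cons, add_zero, hs, hs', map_neg, map_add,
        map_units_smul, smul_neg, hm, CW.D_D, CW.D_smul, smul_add, h5, smul_units_smul, smul_zero]
      abel
    | cons b l =>
      simp only [frontD, stepMove_cons, hs, hs', map_neg, map_add,
        map_units_smul, smul_neg, hm, CW.D_D, CW.D_smul, smul_add, h5, smul_units_smul]
      abel

end Curved

/-! ## The differential and insertion operators -/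

section Programs

variable {A V W Y : Type*} [Ring A] {gr : ℤ → AddSubgroup A} [GradedRing gr] {C : Curved gr}
  [AddCommGroup V] [Module A V] [AddCommGroup W] [Module A W] [AddCommGroup Y]
  (CV : CurvedMod C V)

lemma prog_rec (γ : A) (ps : List (A × A)) (K : ℕ) (f : List A → V → Y) (v : V) :
    prog γ ps K f v = shift (fun K => prog γ ps K (consF γ f) v) K
      + stepMove ps (fun s ps' => prog s.2 ps' K (consF s.1 f) v)
      + (if ps = [] ∧ K = 0 then f [] v else 0) := by
  match ps, K with
  | [], 0 => rw [prog]; simp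
  | [], K + 1 => rw [prog]; simp
  | (e, γ') :: ps, 0 => rw [prog]; simp
  | (e, γ') :: ps, K + 1 => rw [prog]; simp

/-- The sequence of the terms of a program. -/
def progSeq (γ : A) (f : List A → V → Y) (ps : List (A × A)) (v : V) : ℕ → Y :=
  fun K => prog γ ps K f v

/-- The sequence that is concentrated in degree zero. -/
def delta₀ : Y →+ (ℕ → Y) where
  toFun y n := if n = 0 then y else 0
  map_zero' := by funext n; simp
  map_add' x y := by funext n; by_cases h : n = 0 <;> simp [h]

lemma progSeq_nil (γ : A) (f : List A → V → Y) (v : V) :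
    progSeq γ f [] v = shift (progSeq γ (consF γ f) [] v) + delta₀ (f [] v) := by
  funext K
  rw [progSeq, prog_rec]
  simp [delta₀]
  rfl

lemma progSeq_cons (γ e γ' : A) (f : List A → V → Y) (ps : List (A × A)) (v : V) :
    progSeq γ f ((e, γ') :: ps) v
      = shift (progSeq γ (consF γ f) ((e, γ') :: ps) v) + progSeq γ' (consF e f) ps v := by
  funext K
  rw [progSeq, prog_rec]
  simp
  rfl

lemma progSeq_add (γ : A) (f g : List A → V → Y) (ps : List (A × A)) (v : V) :
    progSeq γ (f + g) ps v = progSeq γ f ps v + progSeq γ g ps v := by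
  funext K; simp [progSeq, prog_add]

lemma progSeq_map {Y' : Type*} [AddCommGroup Y'] (g : Y →+ Y') (γ : A) (f : List A → V → Y)
    (ps : List (A × A)) (v : V) (K : ℕ) :
    progSeq γ (fun l v => g (f l v)) ps v K = g (progSeq γ f ps v K) := by
  let g' : (V → Y) →+ (V → Y') :=
    AddMonoidHom.mk' (fun F v => g (F v)) fun F F' => by funext v; exact map_add g _ _
  exact congrFun (prog_map g' γ ps K f) v

lemma progSeq_neg (γ : A) (f : List A → V → Y) (ps : List (A × A)) (v : V) :
    progSeq γ (-f) ps v = -progSeq γ f ps v := by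
  funext K; exact progSeq_map (-AddMonoidHom.id Y) γ f ps v K

lemma progSeq_sub (γ : A) (f g : List A → V → Y) (ps : List (A × A)) (v : V) :
    progSeq γ (f - g) ps v = progSeq γ f ps v - progSeq γ g ps v := by
  rw [sub_eq_add_neg, progSeq_add, progSeq_neg, sub_eq_add_neg]

variable (gr) in
/-- Multiplication of `e` with the first entry of a program. -/
def mulFirstP (e : A) (Φ : List (A × A) → V → Y) : List (A × A) → V → Y
  | [], v => -Φ [] (e • v)
  | s :: ps, v => Φ ((bar gr 1 e * s.1, s.2) :: ps) v

variable (C) in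
/-- Insertion of the curvature `R - t D γ + t² γ²` at the beginning of a program. -/
def insP (t : Y →+ Y) (γ : A) (Φ : List (A × A) → V → Y) (ps : List (A × A)) (v : V) :
    Y :=
  Φ ((C.R, γ) :: ps) v - t (Φ ((C.D γ, γ) :: ps) v) + t (t (Φ ((γ * γ, γ) :: ps) v))

/-- The differential of a function of programs, in which the inserted elements are counted by
`t`. -/
def progB (t : Y →+ Y) : A → (List (A × A) → V → Y) → List (A × A) → V → Y
  | γ, Φ, [], v => insP C t γ Φ [] v + Φ [] (CV.D v) - t (Φ [] (γ • v))
  | γ, Φ, s :: ps, v => insP C t γ Φ (s :: ps) v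
      - Φ ((C.D s.1, s.2) :: ps) v + t (Φ ((γ * s.1 + bar gr 1 s.1 * s.2, s.2) :: ps) v)
      + mulFirstP gr s.1 Φ ps v + progB t s.2 (consF (bar gr 1 s.1, s.2) Φ) ps v

lemma insP_add (t : Y →+ Y) (γ : A) (Φ Ψ : List (A × A) → V → Y) (ps : List (A × A)) (v : V) :
    insP C t γ (Φ + Ψ) ps v = insP C t γ Φ ps v + insP C t γ Ψ ps v := by
  simp only [insP, Pi.add_apply, map_add]; abel

lemma mulFirstP_add (e : A) (Φ Ψ : List (A × A) → V → Y) (ps : List (A × A)) (v : V) :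
    mulFirstP gr e (Φ + Ψ) ps v = mulFirstP gr e Φ ps v + mulFirstP gr e Ψ ps v := by
  cases ps <;> simp [mulFirstP, add_comm]

lemma progB_add (t : Y →+ Y) (γ : A) (Φ Ψ : List (A × A) → V → Y) (ps : List (A × A)) (v : V) :
    progB CV t γ (Φ + Ψ) ps v = progB CV t γ Φ ps v + progB CV t γ Ψ ps v := by
  induction ps generalizing γ Φ Ψ with
  | nil => simp only [progB, insP_add, Pi.add_apply, map_add]; abel
  | cons s ps ih =>
    simp only [progB, insP_add, Pi.add_apply, map_add, mulFirstP_add, consF_add, ih]; abel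

lemma progB_map (t : Y →+ Y) (γ : A) (Φ : List (A × A) → V → Y) (ps : List (A × A)) (v : V) :
    progB CV t γ (fun ps v => t (Φ ps v)) ps v = t (progB CV t γ Φ ps v) := by
  induction ps generalizing γ Φ with
  | nil => simp only [progB, insP, map_add, map_sub]
  | cons s ps ih =>
    have h1 : mulFirstP gr s.1 (fun ps v => t (Φ ps v)) ps v = t (mulFirstP gr s.1 Φ ps v) := by
      cases ps <;> simp [mulFirstP]
    have h2 := ih s.2 (consF (bar gr 1 s.1, s.2) Φ)
    simp only [progB, insP, map_add, map_sub, h1]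
    rw [← h2]; rfl

lemma eq_of_shift {F : Type*} (L : F → F) (P : F → Prop) (hP : ∀ f, P f → P (L f))
    (X Q : F → ℕ → Y) (h : ∀ f, P f → X f - Q f = shift (X (L f) - Q (L f))) {f : F} (hf : P f) :
    X f = Q f := by
  funext n
  induction n generalizing f with
  | zero => exact sub_eq_zero.mp (congrFun (h f hf) 0)
  | succ n ih =>
    have := congrFun (h f hf) (n + 1)
    simp only [shift_succ_apply, Pi.sub_apply, ih (hP f hf), sub_self] at this
    grind

lemma consF_mulFirst (a b : A) (f : List A → V → Y) :
    consF b (mulFirst gr a f) = consF (bar gr 1 a * b) f := rfl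

/-- The terms of a program for the function `strB f`. -/
theorem progSeq_strB (γ : A) (ps : List (A × A)) (hγ : γ ∈ gr 1) (hps : ∀ s ∈ ps, s.2 ∈ gr 1)
    {f : List A → V → Y} (hf : MultiAdd f) (v : V) :
    progSeq γ (strB CV f) ps v = progB CV shift γ (progSeq γ f) ps v := by
  induction ps generalizing γ f v with
  | nil =>
    refine eq_of_shift (consF γ) MultiAdd (fun f hf => hf.cons γ)
      (fun f => progSeq γ (strB CV f) [] v) (fun f => progB CV shift γ (progSeq γ f) [] v)
      (fun f hf => ?_) hf
    have hb : bar gr 1 γ = γ := bar_of_mem_one gr 1 hγ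
    have e1 : progSeq γ (strB CV f) [] v
        = shift (progSeq γ (consF γ (consF C.R f)) [] v - progSeq γ (consF (C.D γ) f) [] v
            + progSeq γ (mulFirst gr γ f) [] v) + shift (progSeq γ (strB CV (consF γ f)) [] v)
          + delta₀ (f [C.R] v) + delta₀ (f [] (CV.D v)) := by
      rw [progSeq_nil, strB_cons, progSeq_add, progSeq_add, progSeq_sub, hb, strB]
      grind
    have e2 : progSeq γ (mulFirst gr γ f) [] v
        = shift (progSeq γ (consF (γ * γ) f) [] v) - delta₀ (f [] (γ • v)) := by
      rw [progSeq_nil, consF_mulFirst, hb, mulFirst, map_neg, sub_eq_add_neg]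
    have e3 := progSeq_nil γ (consF C.R f) v
    simp only [progB, insP]
    rw [progSeq_cons γ C.R γ f, progSeq_cons γ (C.D γ) γ f, progSeq_cons γ (γ * γ) γ f,
      progSeq_nil γ f (CV.D v), progSeq_nil γ f (γ • v), e1, e2, e3]
    simp only [map_add, map_sub, consF_apply]
    abel
  | cons s ps ih =>
    obtain ⟨e, γ'⟩ := s
    refine eq_of_shift (consF γ) MultiAdd (fun f hf => hf.cons γ)
      (fun f => progSeq γ (strB CV f) ((e, γ') :: ps) v)
      (fun f => progB CV shift γ (progSeq γ f) ((e, γ') :: ps) v) (fun f hf => ?_) hf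
    have hb : bar gr 1 γ = γ := bar_of_mem_one gr 1 hγ
    have hγ' : γ' ∈ gr 1 := hps (e, γ') (by simp)
    have IH : progSeq γ' (strB CV (consF (bar gr 1 e) f)) ps v
      = progB CV shift γ' (progSeq γ' (consF (bar gr 1 e) f)) ps v :=
      ih γ' hγ' (fun s hs => hps s (by simp [hs])) (hf.cons _) v
    have e1 : progSeq γ (strB CV f) ((e, γ') :: ps) v
        = shift (progSeq γ (consF γ (consF C.R f)) ((e, γ') :: ps) v
            - progSeq γ (consF (C.D γ) f) ((e, γ') :: ps) v
            + progSeq γ (mulFirst gr γ f) ((e, γ') :: ps) v)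
          + shift (progSeq γ (strB CV (consF γ f)) ((e, γ') :: ps) v)
          + (progSeq γ' (consF e (consF C.R f)) ps v - progSeq γ' (consF (C.D e) f) ps v
            + progSeq γ' (mulFirst gr e f) ps v
            + progB CV shift γ' (progSeq γ' (consF (bar gr 1 e) f)) ps v) := by
      rw [progSeq_cons, strB_cons, strB_cons, progSeq_add, progSeq_add, progSeq_sub, progSeq_add,
        progSeq_add, progSeq_sub, hb, IH, map_add]
    have e2 : progSeq γ (mulFirst gr γ f) ((e, γ') :: ps) v
        = shift (progSeq γ (consF (γ * γ) f) ((e, γ') :: ps) v)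
          + progSeq γ' (consF (γ * e) f) ps v := by
      rw [progSeq_cons, consF_mulFirst, consF_mulFirst, hb]
    have e3 := progSeq_cons γ e γ' (consF C.R f) ps v
    have e4 : progSeq γ' (consF (γ * e + bar gr 1 e * γ') f) ps v
        = progSeq γ' (consF (γ * e) f) ps v + progSeq γ' (consF (bar gr 1 e * γ') f) ps v := by
      rw [hf.consF_add, progSeq_add]
    have e5 : progSeq γ' (mulFirst gr e f) ps v + shift (mulFirstP gr e (progSeq γ (consF γ f)) ps v)
        = shift (progSeq γ' (consF (bar gr 1 e * γ') f) ps v) + mulFirstP gr e (progSeq γ f) ps v := by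
      cases ps with
      | nil =>
        rw [progSeq_nil, mulFirstP, mulFirstP, mulFirst, consF_mulFirst, progSeq_nil γ f]
        simp only [map_neg]
        abel
      | cons p ps =>
        obtain ⟨b, γ''⟩ := p
        rw [progSeq_cons, mulFirstP, mulFirstP, consF_mulFirst, consF_mulFirst,
          progSeq_cons γ (bar gr 1 e * b) γ'' f]
        abel
    have e6 : progB CV shift γ' (consF (bar gr 1 e, γ') (progSeq γ f)) ps v
        = shift (progB CV shift γ' (consF (bar gr 1 e, γ') (progSeq γ (consF γ f))) ps v)
          + progB CV shift γ' (progSeq γ' (consF (bar gr 1 e) f)) ps v := by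
      rw [← progB_map, ← progB_add]
      congr 1; funext x v'
      exact progSeq_cons γ (bar gr 1 e) γ' f x v'
    simp only [progB, insP]
    rw [progSeq_cons γ C.R γ f, progSeq_cons γ (C.D γ) γ f, progSeq_cons γ (γ * γ) γ f,
      progSeq_cons γ (C.D e) γ' f, progSeq_cons γ (γ * e + bar gr 1 e * γ') γ' f, e1, e2, e3, e4, e6,
      eq_sub_of_add_eq e5]
    simp only [map_add, map_sub]
    abel

/-- Additivity of a function of programs. -/
structure ProgAdd (Φ : List (A × A) → V → Y) : Prop where
  entry : ∀ (l l' : List (A × A)) (a b γ : A) (v : V),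
    Φ (l ++ (a + b, γ) :: l') v = Φ (l ++ (a, γ) :: l') v + Φ (l ++ (b, γ) :: l') v
  right : ∀ (l : List (A × A)) (v v' : V), Φ l (v + v') = Φ l v + Φ l v'

lemma ProgAdd.cons {Φ : List (A × A) → V → Y} (h : ProgAdd Φ) (s : A × A) : ProgAdd (consF s Φ) :=
  ⟨fun l l' a b γ v => h.entry (s :: l) l' a b γ v, fun l => h.right (s :: l)⟩

lemma prog_progAdd {f : List A → V → Y} (hf : MultiAdd f) (γ : A) (K : ℕ) :
    ProgAdd fun ps v => prog γ ps K f v := by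
  constructor
  · intro l l' a b γ' v
    induction' hn : l.length + K using Nat.strong_induction_on with n ih generalizing l γ K f
    rw [prog_rec, prog_rec γ (l ++ (a, γ') :: l'), prog_rec γ (l ++ (b, γ') :: l')]
    have h1 : shift (fun K => prog γ (l ++ (a + b, γ') :: l') K (consF γ f) v) K
        = shift (fun K => prog γ (l ++ (a, γ') :: l') K (consF γ f) v) K
          + shift (fun K => prog γ (l ++ (b, γ') :: l') K (consF γ f) v) K := by
      cases K with
      | zero => simp
      | succ K => exact ih _ (by omega) (hf.cons γ) γ K l rfl
    rw [h1]
    cases l with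
    | nil =>
      simp only [nil_append, stepMove_cons, hf.consF_add, prog_add]
      simp; abel
    | cons s l =>
      simp only [cons_append, stepMove_cons]
      rw [ih _ (by simp [← hn]) (hf.cons _) _ K l rfl]
      grind
  · intro l v v'
    induction' hn : l.length + K using Nat.strong_induction_on with n ih generalizing l γ K f
    rw [prog_rec, prog_rec γ l K f v, prog_rec γ l K f v']
    have h1 : shift (fun K => prog γ l K (consF γ f) (v + v')) K
        = shift (fun K => prog γ l K (consF γ f) v) K
          + shift (fun K => prog γ l K (consF γ f) v') K := by
      cases K with
      | zero => simp
      | succ K => exact ih _ (by omega) (hf.cons γ) γ K l rfl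
    rw [h1]
    cases l with
    | nil =>
      by_cases hK : K = 0
      · simp [hK, hf.right]
      all_goals simp_all
    | cons s l =>
      simp only [stepMove_cons]
      rw [ih _ (by simp [← hn]) (hf.cons _) _ K l rfl]
      grind

/-- The sum over all numbers of inserted elements. -/
def progTot (γ : A) (f : List A → V → Y) (ps : List (A × A)) (v : V) : Y :=
  tot (progSeq γ f ps v)

/-- All programs whose labels satisfy a condition have finitely many nonzero terms. -/
def ProgFinite (Γ : A → Prop) (f : List A → V → Y) : Prop :=
  ∀ γ, Γ γ → ∀ ps : List (A × A), (∀ s ∈ ps, Γ s.2) → ∀ v, EvZero (progSeq γ f ps v)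

lemma tot_progB (Γ : A → Prop) (γ : A) (hγ : Γ γ) (Φ : List (A × A) → V → ℕ → Y)
    (hΦ : ∀ ps : List (A × A), (∀ s ∈ ps, Γ s.2) → ∀ v, EvZero (Φ ps v)) (ps : List (A × A))
    (hps : ∀ s ∈ ps, Γ s.2) (v : V) :
    EvZero (progB CV shift γ Φ ps v) ∧ tot (progB CV shift γ Φ ps v)
      = progB CV (.id Y) γ (fun ps v => tot (Φ ps v)) ps v := by
  have key : ∀ {X : ℕ → Y}, EvZero X → EvZero (shift X) ∧ tot (shift X) = tot X := fun h =>
    ⟨h.shift, tot_shift h⟩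
  have hins : ∀ (γ : A), Γ γ → ∀ (Φ : List (A × A) → V → ℕ → Y),
      (∀ ps : List (A × A), (∀ s ∈ ps, Γ s.2) → ∀ v, EvZero (Φ ps v)) →
      ∀ ps : List (A × A), (∀ s ∈ ps, Γ s.2) → ∀ v,
      EvZero (insP C shift γ Φ ps v) ∧ tot (insP C shift γ Φ ps v)
        = insP C (.id Y) γ (fun ps v => tot (Φ ps v)) ps v := by
    intro γ hγ Φ hΦ ps hps v
    have hx : ∀ x, EvZero (Φ ((x, γ) :: ps) v) := fun x => hΦ _ (by
      intro s hs
      rcases mem_cons.mp hs with rfl | hs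
      · exact hγ
      · exact hps s hs) v
    refine ⟨((hx _).sub (hx _).shift).add (hx _).shift.shift, ?_⟩
    rw [insP, tot_add ((hx _).sub (hx _).shift) (hx _).shift.shift, tot_sub (hx _) (hx _).shift,
      tot_shift (hx _), tot_shift (hx _).shift, tot_shift (hx _)]
    rfl
  induction ps generalizing γ Φ v with
  | nil =>
    have h1 := hins γ hγ Φ hΦ [] hps v
    have h2 := hΦ [] hps (CV.D v)
    have h3 := hΦ [] hps (γ • v)
    refine ⟨(h1.1.add h2).sub h3.shift, ?_⟩
    rw [progB, tot_sub (h1.1.add h2) h3.shift, tot_add h1.1 h2, h1.2, tot_shift h3]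
    rfl
  | cons s ps ih =>
    have hs : Γ s.2 := hps s (by simp)
    have hps' : ∀ s ∈ ps, Γ s.2 := fun t ht => hps t (by simp [ht])
    have h1 := hins γ hγ Φ hΦ _ hps v
    have hx : ∀ x, EvZero (Φ ((x, s.2) :: ps) v) := fun x => hΦ _ (by
      intro t ht
      rcases mem_cons.mp ht with rfl | ht
      · exact hs
      · exact hps' t ht) v
    have h2 : EvZero (mulFirstP gr s.1 Φ ps v) ∧ tot (mulFirstP gr s.1 Φ ps v)
        = mulFirstP gr s.1 (fun ps v => tot (Φ ps v)) ps v := by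
      cases ps with
      | nil => exact ⟨(hΦ [] hps' _).neg, tot_neg (hΦ [] hps' _)⟩
      | cons p ps =>
        refine ⟨hΦ _ ?_ v, rfl⟩
        intro t ht
        rcases mem_cons.mp ht with rfl | ht
        · exact hps' p (by simp)
        · exact hps' t (by simp [ht])
    have h3 := ih s.2 hs (consF (bar gr 1 s.1, s.2) Φ) (fun qs hqs v => hΦ _ (by
      intro t ht
      rcases mem_cons.mp ht with rfl | ht
      · exact hs
      · exact hqs t ht) v) hps' v
    refine ⟨(((h1.1.sub (hx _)).add (hx _).shift).add h2.1).add h3.1, ?_⟩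
    rw [progB, tot_add (((h1.1.sub (hx _)).add (hx _).shift).add h2.1) h3.1,
      tot_add ((h1.1.sub (hx _)).add (hx _).shift) h2.1, tot_add (h1.1.sub (hx _)) (hx _).shift,
      tot_sub h1.1 (hx _), h1.2, h2.2, h3.2, tot_shift (hx _)]
    rfl

end Programs

/-! ## The differential and lattice paths -/

section PathDifferential

variable {A A' V V' Y : Type*} [Ring A] [Ring A'] {gr : ℤ → AddSubgroup A} [GradedRing gr]
  {gr' : ℤ → AddSubgroup A'} [GradedRing gr'] {C : Curved gr} {C' : Curved gr'}
  [AddCommGroup V] [Module A V] [AddCommGroup V'] [Module A' V'] [AddCommGroup Y]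
  (CV : CurvedMod C V) (CV' : CurvedMod C' V')

/-- A vertex that is compatible with the connections. -/
structure Vtx.Compat (h : Vtx A A' V V') : Prop where
  graded : h.Graded gr gr'
  θ_mul : ∀ a b, h.θ (a * b) = h.θ a * h.θ b
  θ_D : ∀ a, h.θ (C.D a) = C'.D (h.θ a) - (h.β * h.θ a + bar gr' 1 (h.θ a) * h.β)
  θ_R : h.θ C.R = C'.R - C'.D h.β + h.β * h.β
  ν_smul : ∀ (a : A) (v : V), h.ν (a • v) = h.θ a • h.ν v
  ν_D : ∀ v, h.ν (CV.D v) = CV'.D (h.ν v) - h.β • h.ν v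

/-- An element that connects two vertices. -/
structure Vtx.Edge (C' : Curved gr') (h : Vtx A A' V V') (c : A') (h' : Vtx A A' V V') : Prop where
  mem : c ∈ gr' 0
  θ : ∀ a, c * h'.θ a = h.θ a * c
  D : C'.D c = h.β * c - c * h'.β
  ν : ∀ v, c • h'.ν v = h.ν v

/-- Compatibility of all vertices and steps of a path. -/
def PathCompat : Vtx A A' V V' → Steps A A' V V' → Prop
  | h, [] => h.Compat CV CV'
  | h, s :: hs => h.Compat CV CV' ∧ h.Edge C' s.1 s.2 ∧ PathCompat s.2 hs

lemma PathCompat.head {h : Vtx A A' V V'} {hs : Steps A A' V V'} (H : PathCompat CV CV' h hs) :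
    h.Compat CV CV' := by
  cases hs with
  | nil => exact H
  | cons s hs => exact H.1

/-- `∑_{0<j<n} (-1)^j F (…, cⱼ cⱼ₊₁, …) + (-1)^n F (c₁, …, cₙ₋₁)`. -/
def dropSum {H : Type*} : List (A' × H) → (List (A' × H) → Y) → Y
  | [], _ => 0
  | [_], F => -F []
  | s :: t :: hs, F => -F ((s.1 * t.1, t.2) :: hs) - dropSum (t :: hs) (consF s F)

lemma dropSum_map {H Y' : Type*} [AddCommGroup Y'] (g : Y →+ Y') (hs : List (A' × H))
    (F : List (A' × H) → Y) : dropSum hs (fun x => g (F x)) = g (dropSum hs F) := by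
  induction hs generalizing F with
  | nil => simp [dropSum]
  | cons s hs ih =>
    cases hs with
    | nil => simp [dropSum]
    | cons t hs =>
      rw [dropSum, dropSum, map_sub, map_neg]
      congr 1
      exact ih _

lemma dropSum_add {H : Type*} (hs : List (A' × H)) (F G : List (A' × H) → Y) :
    dropSum hs (F + G) = dropSum hs F + dropSum hs G := by
  induction hs generalizing F G with
  | nil => simp [dropSum]
  | cons s hs ih =>
    cases hs with
    | nil => simp [dropSum, add_comm]
    | cons t hs =>
      rw [dropSum, dropSum, dropSum, consF_add, ih, Pi.add_apply]
      abel

variable {Φ : List (A' × A') → V' → Y}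

lemma ProgAdd.consF_add (h : ProgAdd Φ) (a b γ : A') :
    consF (a + b, γ) Φ = consF (a, γ) Φ + consF (b, γ) Φ := by
  funext x v; exact h.entry [] x a b γ v

/-- A function of programs as an additive function of the first entry. -/
def ProgAdd.hom (h : ProgAdd Φ) (γ : A') : A' →+ (List (A' × A') → V' → Y) :=
  AddMonoidHom.mk' (fun a => consF (a, γ) Φ) fun a b => h.consF_add a b γ

lemma ProgAdd.consF_neg (h : ProgAdd Φ) (a γ : A') :
    consF (-a, γ) Φ = -consF (a, γ) Φ := map_neg (h.hom γ) a

lemma ProgAdd.consF_sub (h : ProgAdd Φ) (a b γ : A') :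
    consF (a - b, γ) Φ = consF (a, γ) Φ - consF (b, γ) Φ := map_sub (h.hom γ) a b

lemma ProgAdd.consF_zero (h : ProgAdd Φ) (γ : A') : consF (0, γ) Φ = 0 := map_zero (h.hom γ)

lemma ProgAdd.consF_units_smul (h : ProgAdd Φ) (e : ℤˣ) (a γ : A') :
    consF (e • a, γ) Φ = e • consF (a, γ) Φ := map_units_smul (h.hom γ) e a

lemma ProgAdd.right_sub (h : ProgAdd Φ) (l : List (A' × A')) (v v' : V') :
    Φ l (v - v') = Φ l v - Φ l v' :=
  map_sub (AddMonoidHom.mk' (Φ l) (h.right l)) v v'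

variable (N : ℤ) (h : Vtx A A' V V') (hs : Steps A A' V V')

lemma pathSum_neg (l : List A) (Φ : List (A' × A') → V' → Y) (v : V) :
    pathSum gr N h hs l (-Φ) v = -pathSum gr N h hs l Φ v :=
  pathSum_map gr (-AddMonoidHom.id Y) N h hs l Φ v

lemma pathSum_units_smul (l : List A) (e : ℤˣ) (Φ : List (A' × A') → V' → Y) (v : V) :
    pathSum gr N h hs l (e • Φ) v = e • pathSum gr N h hs l Φ v :=
  pathSum_map gr (toAddMonoidHom Y e) N h hs l Φ v

lemma pathSum_mulFirstP (l : List A) (e : A') (Φ : List (A' × A') → V' → Y) (v : V) :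
    pathSum gr N h hs l (mulFirstP gr' e Φ) v = stepMove hs (fun s hs' =>
          pathSum gr (N - 1) s.2 hs' l (consF (bar gr' 1 e * s.1, s.2.β) Φ) v)
        + stepMove l (fun a l' =>
          pathSum gr N h hs l' (consF (bar gr' 1 e * h.θ (bar gr N a), h.β) Φ) v)
        + (if hs = [] ∧ l = [] then -Φ [] (e • h.ν v) else 0) :=
  pathSum_rec gr N h hs l (mulFirstP gr' e Φ) v

lemma dropSum_pathSum (l : List A) (Φ : List (A' × A') → V' → Y) (v : V) :
    dropSum hs (fun hs' => pathSum gr N h hs' l Φ v) = stepMove hs (fun s hs' =>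
          stepMove hs' (fun t hs'' => -pathSum gr (N - 1) t.2 hs'' l (consF (s.1 * t.1, t.2.β) Φ) v)
          - dropSum hs' (fun hs'' => pathSum gr (N - 1) s.2 hs'' l (consF (s.1, s.2.β) Φ) v)
          + (if hs' = [] ∧ l = [] then -Φ [] (h.ν v) else 0))
        + stepMove l (fun a l' => dropSum hs
          (fun hs' => pathSum gr N h hs' l' (consF (h.θ (bar gr N a), h.β) Φ) v)) := by
  match hs with
  | [] => cases l <;> simp [dropSum]
  | [s] =>
    simp only [dropSum, stepMove_cons, stepMove_nil]
    rw [pathSum_rec]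
    cases l <;> simp
  | s :: t :: hs =>
    have h1 : (consF s fun hs' => pathSum gr N h hs' l Φ v)
        = (fun hs'' => pathSum gr (N - 1) s.2 hs'' l (consF (s.1, s.2.β) Φ) v)
          + fun hs'' => stepMove l (fun a l' =>
            pathSum gr N h (s :: hs'') l' (consF (h.θ (bar gr N a), h.β) Φ) v) := by
      funext x
      rw [consF_apply, pathSum_rec]
      simp
    rw [dropSum, h1, dropSum_add, pathSum_rec]
    cases l with
    | nil =>
      have h2 : dropSum (t :: hs) (fun _ : Steps A A' V V' => (0 : Y)) = 0 :=
        dropSum_map (0 : Y →+ Y) (t :: hs) (fun _ => (0 : Y))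
      simp_all
    | cons a l =>
      simp only [stepMove_cons]
      rw [dropSum]
      have h3 : (consF s fun hs' => pathSum gr N h hs' l (consF (h.θ (bar gr N a), h.β) Φ) v)
        = fun hs'' => pathSum gr N h (s :: hs'') l (consF (h.θ (bar gr N a), h.β) Φ) v := rfl
      grind

/-- The sum over lattice paths as a function of strings. -/
def pathFun (gr : ℤ → AddSubgroup A) [GradedRing gr] (N : ℤ) (h : Vtx A A' V V')
    (hs : Steps A A' V V') (Φ : List (A' × A') → V' → Y) : List A → V → Y :=
  fun l v => pathSum gr N h hs l Φ v

lemma pathFun_cons (a : A) (Φ : List (A' × A') → V' → Y) : consF a (pathFun gr N h hs Φ)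
      = consF a (fun l v => stepMove hs fun s hs' =>
          pathFun gr (N - 1) s.2 hs' (consF (s.1, s.2.β) Φ) l v)
        + pathFun gr N h hs (consF (h.θ (bar gr N a), h.β) Φ) := by
  funext l v
  rw [consF_apply, pathFun, pathSum_rec]
  simp [pathFun]

lemma strB_pathFun (Φ : List (A' × A') → V' → Y) (l : List A) (v : V) :
    strB CV (pathFun gr N h hs Φ) l v = stepMove hs (fun s hs' =>
          strB CV (pathFun gr (N - 1) s.2 hs' (consF (s.1, s.2.β) Φ)) l v)
        + pathSum gr N h hs l (consF (h.θ (bar gr N C.R), h.β) Φ) v + stepMove l (fun a l' =>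
            -pathSum gr N h hs l' (consF (h.θ (bar gr N (C.D a)), h.β) Φ) v
            + stepMove l' (fun b l'' =>
              pathSum gr N h hs l'' (consF (h.θ (bar gr N (bar gr 1 a * b)), h.β) Φ) v)
            + strB CV (pathFun gr N h hs (consF (h.θ (bar gr N (bar gr 1 a)), h.β) Φ)) l' v
            + (if hs = [] ∧ l' = [] then -Φ [] (h.ν (a • v)) else 0))
        + (if hs = [] ∧ l = [] then Φ [] (h.ν (CV.D v)) else 0) := by
  have key : ∀ x l v, pathFun gr N h hs Φ (x :: l) v = (stepMove hs fun s hs' =>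
          pathFun gr (N - 1) s.2 hs' (consF (s.1, s.2.β) Φ) (x :: l) v)
        + pathSum gr N h hs l (consF (h.θ (bar gr N x), h.β) Φ) v := fun x l v =>
    congrFun (congrFun (pathFun_cons N h hs x Φ) l) v
  have knil : ∀ v, pathFun gr N h hs Φ [] v = (stepMove hs fun s hs' =>
          pathFun gr (N - 1) s.2 hs' (consF (s.1, s.2.β) Φ) [] v)
        + (if hs = [] then Φ [] (h.ν v) else 0) := fun v => by
    rw [pathFun, pathSum_rec]; simp [pathFun]
  cases l with
  | nil =>
    simp only [strB, stepMove_nil, key, knil]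
    cases hs <;> simp
    abel
  | cons a l =>
    have h1 : mulFirst gr a (pathFun gr N h hs Φ) l v = stepMove hs (fun s hs' => mulFirst gr a
            (pathFun gr (N - 1) s.2 hs' (consF (s.1, s.2.β) Φ)) l v)
          + stepMove l (fun b l'' =>
              pathSum gr N h hs l'' (consF (h.θ (bar gr N (bar gr 1 a * b)), h.β) Φ) v)
          + (if hs = [] ∧ l = [] then -Φ [] (h.ν (a • v)) else 0) := by
      cases l with
      | nil =>
        simp only [mulFirst, knil]
        cases hs <;> simp
      | cons b l =>
        simp only [mulFirst, key]
        simp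
    rw [strB_cons_apply, key, key, h1, pathFun_cons, strB_add]
    cases hs with
    | nil =>
      have h2 : strB CV (consF (bar gr 1 a) fun (_ : List A) (_ : V) => (0 : Y)) l v = 0 :=
        strB_zero CV l v
      simp [h2]; abel
    | cons s hs => simp [strB_cons_apply]; abel

lemma consF_progB (γ e γ' : A') (hΦ : ProgAdd Φ) : consF (e, γ') (progB CV' (.id Y) γ Φ)
      = consF (e, γ') (consF (C'.R - C'.D γ + γ * γ, γ) Φ)
        - consF (C'.D e - (γ * e + bar gr' 1 e * γ'), γ') Φ
        + mulFirstP gr' e Φ + progB CV' (.id Y) γ' (consF (bar gr' 1 e, γ') Φ) := by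
  rw [hΦ.consF_add _ _ γ, hΦ.consF_sub _ _ γ, hΦ.consF_sub _ _ γ']
  funext ps v
  simp only [consF_apply, progB, insP, AddMonoidHom.id_apply, Pi.add_apply, Pi.sub_apply]
  abel

lemma progB_nil (γ : A') (hΦ : ProgAdd Φ) (v : V') : progB CV' (.id Y) γ Φ [] v
      = Φ [(C'.R - C'.D γ + γ * γ, γ)] v + Φ [] (CV'.D v - γ • v) := by
  change _ = consF _ Φ [] v + _
  rw [hΦ.consF_add, hΦ.consF_sub, hΦ.right_sub]
  simp only [consF_apply, progB, insP, AddMonoidHom.id_apply, Pi.add_apply, Pi.sub_apply]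
  abel

lemma stepMove_smul {B : Type*} (e : ℤˣ) (l : List B) (F : B → List B → Y) :
    e • stepMove l F = stepMove l fun a l' => e • F a l' :=
  (stepMove_map (toAddMonoidHom Y e) l F).symm

/-- Sums over lattice paths commute with the differentials up to the removal of vertices. -/
theorem pathSum_progB {h : Vtx A A' V V'} {hs : Steps A A' V V'} (H : PathCompat CV CV' h hs)
    (l : List A) (hΦ : ProgAdd Φ) (v : V) : pathSum gr hs.length h hs l (progB CV' (.id Y) h.β Φ) v
      = (hs.length : ℤ).negOnePow • strB CV (pathFun gr hs.length h hs Φ) l v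
        + dropSum hs (fun hs' => pathSum gr ((hs.length : ℤ) - 1) h hs' l Φ v) := by
  induction' hn : hs.length + l.length using Nat.strong_induction_on with n ih generalizing h hs l Φ
  have hh := H.head
  have hbθ : ∀ n a, bar gr' n (h.θ a) = h.θ (bar gr n a) := fun n a =>
    bar_map_zero gr gr' h.θ hh.graded.θ_mem n a
  generalize hN : (hs.length : ℤ) = N
  have e0 : pathSum gr N h hs l (progB CV' (.id Y) h.β Φ) v
    = pathSum gr N h hs l (consF (h.θ C.R, h.β) Φ) v
      + stepMove hs (fun s hs' => pathSum gr (N - 1) s.2 hs' l (mulFirstP gr' s.1 Φ) v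
        - pathSum gr (N - 1) s.2 hs' l (progB CV' (.id Y) s.2.β (consF (s.1, s.2.β) Φ)) v)
      + stepMove l (fun a l' => - pathSum gr N h hs l' (consF (h.θ (C.D (bar gr N a)), h.β) Φ) v
        + pathSum gr N h hs l' (mulFirstP gr' (h.θ (bar gr N a)) Φ) v
        + pathSum gr N h hs l' (progB CV' (.id Y) h.β
            (consF (h.θ (bar gr N (bar gr 1 a)), h.β) Φ)) v)
      + (if hs = [] ∧ l = [] then Φ [] (h.ν (CV.D v)) else 0) := by
    rw [pathSum_rec, pathSum_rec gr N h hs l (consF (h.θ C.R, h.β) Φ)]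
    have c1 : ∀ a l', pathSum gr N h hs l' (consF (h.θ (bar gr N a), h.β)
        (progB CV' (.id Y) h.β Φ)) v
        = pathSum gr N h hs l' (consF (h.θ (bar gr N a), h.β) (consF (h.θ C.R, h.β) Φ)) v
          + (- pathSum gr N h hs l' (consF (h.θ (C.D (bar gr N a)), h.β) Φ) v
          + pathSum gr N h hs l' (mulFirstP gr' (h.θ (bar gr N a)) Φ) v
          + pathSum gr N h hs l' (progB CV' (.id Y) h.β
            (consF (h.θ (bar gr N (bar gr 1 a)), h.β) Φ)) v) := by
      intro a l'
      rw [consF_progB CV' h.β _ h.β hΦ, ← hh.θ_D, ← hh.θ_R, hbθ, bar_bar, bar_bar,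
        add_comm 1 N, sub_eq_add_neg, pathSum_add, pathSum_add, pathSum_add, pathSum_neg]
      abel
    have c2 : stepMove hs (fun s hs' => pathSum gr (N - 1) s.2 hs' l (consF (s.1, s.2.β)
        (progB CV' (.id Y) h.β Φ)) v)
        = stepMove hs (fun s hs' => pathSum gr (N - 1) s.2 hs' l (consF (s.1, s.2.β)
          (consF (h.θ C.R, h.β) Φ)) v)
        + stepMove hs (fun s hs' => pathSum gr (N - 1) s.2 hs' l (mulFirstP gr' s.1 Φ) v
        - pathSum gr (N - 1) s.2 hs' l (progB CV' (.id Y) s.2.β (consF (s.1, s.2.β) Φ)) v) := by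
      cases hs with
      | nil => simp
      | cons s hs =>
        have he := H.2.1
        have hb : bar gr' 1 s.1 = -s.1 := by rw [bar_of_mem_zero gr' 1 he.mem]; simp
        have hz : C'.D s.1 - (h.β * s.1 + -s.1 * s.2.β) = 0 := by rw [he.D]; noncomm_ring
        have hneg : progB CV' (.id Y) s.2.β (-consF (s.1, s.2.β) Φ)
            = -progB CV' (.id Y) s.2.β (consF (s.1, s.2.β) Φ) := by
          rw [eq_neg_iff_add_eq_zero]
          funext ps v
          rw [Pi.add_apply, Pi.add_apply, ← progB_add, neg_add_cancel]
          have : ∀ ps γ, progB CV' (.id Y) γ 0 ps v = 0 := by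
            intro ps
            induction ps with
            | nil => intro γ; simp [progB, insP]
            | cons p ps ih =>
              intro γ
              have : mulFirstP gr' p.1 (0 : List (A' × A') → V' → Y) ps v = 0 := by
                cases ps <;> simp [mulFirstP]
              simp only [progB, insP, this]
              have h2 := ih p.2
              simp
              exact h2
          exact this ps _
        simp only [stepMove_cons]
        rw [consF_progB CV' h.β _ _ hΦ, ← hh.θ_R, hb, hz, hΦ.consF_zero, hΦ.consF_neg, hneg,
          sub_zero, pathSum_add, pathSum_add, pathSum_neg]
        abel
    have c3 : (if hs = [] ∧ l = [] then progB CV' (.id Y) h.β Φ [] (h.ν v) else 0)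
        = (if hs = [] ∧ l = [] then consF (h.θ C.R, h.β) Φ [] (h.ν v) else 0)
          + (if hs = [] ∧ l = [] then Φ [] (h.ν (CV.D v)) else 0) := by
      split_ifs
      · rw [progB_nil CV' h.β hΦ, ← hh.θ_R, hh.ν_D]; rfl
      · simp
    rw [c2, c3]
    simp only [c1, stepMove_add]
    abel
  have e1 : N.negOnePow • pathSum gr N h hs l (consF (h.θ (bar gr N C.R), h.β) Φ) v
      = pathSum gr N h hs l (consF (h.θ C.R, h.β) Φ) v := by
    rw [C.bar_R, map_units_smul, hΦ.consF_units_smul, pathSum_units_smul, negOnePow_smul_smul]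
  have e2 : ∀ a l', N.negOnePow • pathSum gr N h hs l' (consF (h.θ (bar gr N (C.D a)), h.β) Φ) v
      = pathSum gr N h hs l' (consF (h.θ (C.D (bar gr N a)), h.β) Φ) v := by
    intro a l'
    rw [C.bar_D, map_units_smul, hΦ.consF_units_smul, pathSum_units_smul, negOnePow_smul_smul]
  have e3 : ∀ a b l', N.negOnePow • pathSum gr N h hs l'
        (consF (h.θ (bar gr N (bar gr 1 a * b)), h.β) Φ) v
      = pathSum gr N h hs l'
        (consF (bar gr' 1 (h.θ (bar gr N a)) * h.θ (bar gr N b), h.β) Φ) v := by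
    intro a b l'
    rw [bar_mul, map_units_smul, hΦ.consF_units_smul, pathSum_units_smul, negOnePow_smul_smul,
      hh.θ_mul, hbθ, bar_bar, bar_bar, add_comm]
  have e4 : stepMove hs (fun s hs' =>
        pathSum gr (N - 1) s.2 hs' l (progB CV' (.id Y) s.2.β (consF (s.1, s.2.β) Φ)) v)
      = -(N.negOnePow • stepMove hs (fun s hs' =>
          strB CV (pathFun gr (N - 1) s.2 hs' (consF (s.1, s.2.β) Φ)) l v))
        + stepMove hs (fun s hs' =>
          dropSum hs' (fun hs'' => pathSum gr (N - 1 - 1) s.2 hs'' l (consF (s.1, s.2.β) Φ) v)) := by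
    cases hs with
    | nil => simp
    | cons s hs =>
      have := ih _ (by simp [← hn]) H.2.2 l (hΦ.cons (s.1, s.2.β)) rfl
      rw [show (hs.length : ℤ) = N - 1 by rw [← hN]; simp] at this
      simp only [stepMove_cons]
      rw [this, negOnePow_sub]
      simp
  have e5 : ∀ a l', l = a :: l' → pathSum gr N h hs l' (progB CV' (.id Y) h.β
            (consF (h.θ (bar gr N (bar gr 1 a)), h.β) Φ)) v
      = N.negOnePow • strB CV (pathFun gr N h hs (consF (h.θ (bar gr N (bar gr 1 a)), h.β) Φ)) l' v
        + dropSum hs (fun hs' => pathSum gr (N - 1) h hs' l'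
            (consF (h.θ (bar gr (N - 1) a), h.β) Φ) v) := by
    intro a l' hl
    subst hl
    have := ih _ (by simp [← hn]) H l' (hΦ.cons (h.θ (bar gr N (bar gr 1 a)), h.β)) rfl
    rw [hN] at this
    rw [this, bar_bar_one]
  rw [e0, strB_pathFun, dropSum_pathSum]
  cases hs with
  | nil =>
    obtain rfl : N = 0 := by rw [← hN]; rfl
    cases l with
    | nil => simp [C.bar_R]
    | cons a l =>
      have e3' := e3 a
      simp only [bar_zero, negOnePow_zero, one_smul] at e3' e5
      simp [pathSum_mulFirstP, e5 a l rfl, e3', hh.ν_smul, dropSum]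
      abel
  | cons s hs =>
    have he := H.2.1
    have hb : bar gr' 1 s.1 = -s.1 := by rw [bar_of_mem_zero gr' 1 he.mem]; simp
    simp only [stepMove_cons] at e4
    have hcc : ∀ x, stepMove hs (fun t hs' =>
        pathSum gr (N - 1 - 1) t.2 hs' x (consF (bar gr' 1 s.1 * t.1, t.2.β) Φ) v)
      = stepMove hs (fun t hs' =>
        -pathSum gr (N - 1 - 1) t.2 hs' x (consF (s.1 * t.1, t.2.β) Φ) v) := fun x =>
      stepMove_congr fun t hs' _ => by rw [hb, neg_mul, hΦ.consF_neg, pathSum_neg]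
    cases l with
    | nil =>
      simp [pathSum_mulFirstP, hcc, e4, e1, he.ν, smul_add]
      abel
    | cons a l =>
      have hca : pathSum gr (N - 1) s.2 hs l
            (consF (bar gr' 1 s.1 * s.2.θ (bar gr (N - 1) a), s.2.β) Φ) v
          = -pathSum gr (N - 1) s.2 hs l
            (consF (bar gr' 1 (h.θ (bar gr N a)) * s.1, s.2.β) Φ) v := by
        rw [hb, neg_mul, he.θ, hΦ.consF_neg, pathSum_neg, hbθ, bar_bar,
          show 1 + N = N - 1 + 2 * 1 by ring, ← bar_bar, bar_two_mul]
      simp only [stepMove_cons, pathSum_mulFirstP, hcc, hca, e4, e5 a l rfl, smul_add, e1, e2,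
        smul_neg, stepMove_smul, e3]
      simp
      abel

end PathDifferential

/-! ## The differential and insertion operators -/

section TotalOperators

variable {A A' V V' W W' Y : Type*} [Ring A] [Ring A'] {gr : ℤ → AddSubgroup A} [GradedRing gr]
  {gr' : ℤ → AddSubgroup A'} [GradedRing gr'] {C : Curved gr} {C' : Curved gr'}
  [AddCommGroup V] [Module A V] [AddCommGroup V'] [Module A' V'] [AddCommGroup Y]
  [AddCommGroup W] [Module A W] [AddCommGroup W'] [Module A' W']
  (CV : CurvedMod C V) (CV' : CurvedMod C' V') (CW : CurvedMod C W) (CW' : CurvedMod C' W')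

/-- All labels of a program satisfy a condition. -/
def LabelsIn (Γ : A' → Prop) (ps : List (A' × A')) : Prop := ∀ s ∈ ps, Γ s.2

/-- All labels of the vertices of a path satisfy a condition. -/
def PathIn (Γ : A' → Prop) (h : Vtx A A' V V') (hs : Steps A A' V V') : Prop :=
  Γ h.β ∧ ∀ s ∈ hs, Γ s.2.β

lemma LabelsIn.cons {Γ : A' → Prop} {ps : List (A' × A')} (h : LabelsIn Γ ps) {s : A' × A'}
    (hs : Γ s.2) : LabelsIn Γ (s :: ps) := by
  intro t ht
  rcases mem_cons.mp ht with rfl | ht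
  · grind
  · exact h t ht

variable {Γ : A' → Prop} {h : Vtx A A' V V'} {hs : Steps A A' V V'}

lemma PathIn.tail {s : A' × Vtx A A' V V'} (H : PathIn Γ h (s :: hs)) : PathIn Γ s.2 hs :=
  ⟨H.2 s (by simp), fun t ht => H.2 t (by simp [ht])⟩

lemma pathSum_congr (H : PathIn Γ h hs) (N : ℤ) (l : List A) {Φ Ψ : List (A' × A') → V' → Y}
    (hΦ : ∀ ps, LabelsIn Γ ps → ∀ v, Φ ps v = Ψ ps v) (v : V) :
    pathSum gr N h hs l Φ v = pathSum gr N h hs l Ψ v := by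
  induction' hn : hs.length + l.length using Nat.strong_induction_on with
    n ih generalizing N h hs l Φ Ψ
  rw [pathSum_rec, pathSum_rec gr N h hs l Ψ, hΦ [] (fun _ h => by simp at h)]
  congr 2
  · refine stepMove_congr fun s hs' e => ?_
    subst e
    exact ih _ (by simp [← hn]) H.tail _ _ (fun ps hps v => hΦ _ (hps.cons H.tail.1) v) rfl
  · refine stepMove_congr fun a l' e => ?_
    subst e
    exact ih _ (by simp [← hn]) H _ _ (fun ps hps v => hΦ _ (hps.cons H.1) v) rfl

lemma pathSum_tot (H : PathIn Γ h hs) (N : ℤ) (l : List A) {Φ : List (A' × A') → V' → ℕ → Y}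
    (hΦ : ∀ ps, LabelsIn Γ ps → ∀ v, EvZero (Φ ps v)) (v : V) : EvZero (pathSum gr N h hs l Φ v) ∧
    tot (pathSum gr N h hs l Φ v) = pathSum gr N h hs l (fun ps v => tot (Φ ps v)) v := by
  induction' hn : hs.length + l.length using Nat.strong_induction_on with
    n ih generalizing N h hs l Φ
  rw [pathSum_rec, pathSum_rec gr N h hs l fun ps v => tot (Φ ps v)]
  have h1 : EvZero (stepMove hs (fun s hs' =>
      pathSum gr (N - 1) s.2 hs' l (consF (s.1, s.2.β) Φ) v)) ∧ tot (stepMove hs (fun s hs' =>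
      pathSum gr (N - 1) s.2 hs' l (consF (s.1, s.2.β) Φ) v)) = stepMove hs (fun s hs' =>
      pathSum gr (N - 1) s.2 hs' l (consF (s.1, s.2.β) fun ps v => tot (Φ ps v)) v) := by
    cases hs with
    | nil => exact ⟨evZero_zero, tot_zero⟩
    | cons s hs =>
      exact ih _ (by simp [← hn]) H.tail _ _ (fun ps hps v => hΦ _ (hps.cons H.tail.1) v) rfl
  have h2 : EvZero (stepMove l (fun a l' =>
      pathSum gr N h hs l' (consF (h.θ (bar gr N a), h.β) Φ) v)) ∧ tot (stepMove l (fun a l' =>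
      pathSum gr N h hs l' (consF (h.θ (bar gr N a), h.β) Φ) v)) = stepMove l (fun a l' =>
      pathSum gr N h hs l' (consF (h.θ (bar gr N a), h.β) fun ps v => tot (Φ ps v)) v) := by
    cases l with
    | nil => exact ⟨evZero_zero, tot_zero⟩
    | cons a l => exact ih _ (by simp [← hn]) H _ _ (fun ps hps v => hΦ _ (hps.cons H.1) v) rfl
  have h3 : EvZero (if hs = [] ∧ l = [] then Φ [] (h.ν v) else 0) ∧
      tot (if hs = [] ∧ l = [] then Φ [] (h.ν v) else 0)
        = if hs = [] ∧ l = [] then tot (Φ [] (h.ν v)) else 0 := by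
    split_ifs
    · exact ⟨hΦ [] (fun _ h => by simp at h) _, rfl⟩
    · exact ⟨evZero_zero, tot_zero⟩
  refine ⟨(h1.1.add h2.1).add h3.1, ?_⟩
  rw [tot_add (h1.1.add h2.1) h3.1, tot_add h1.1 h2.1, h1.2, h2.2, h3.2]

variable (gr) in
/-- The sum of the terms of an insertion operator with any number of inserted elements. -/
def opTot (N : ℤ) (h : Vtx A A' V V') (hs : Steps A A' V V') (f : List A' → V' → Y)
    (l : List A) (v : V) : Y :=
  pathSum gr N h hs l (fun ps v' => progTot h.β f ps v') v

lemma op_evZero (H : PathIn Γ h hs) (N : ℤ) {f : List A' → V' → Y} (hf : ProgFinite Γ f)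
    (l : List A) (v : V) : EvZero (fun K => op gr N h hs K l f v) ∧
    tot (fun K => op gr N h hs K l f v) = opTot gr N h hs f l v := by
  have h1 : (fun K => op gr N h hs K l f v) = pathSum gr N h hs l (progSeq h.β f) v := by
    funext K
    exact pathSum_map gr (Pi.evalAddMonoidHom (fun _ : ℕ => Y) K) N h hs l (progSeq h.β f) v
  rw [h1]
  exact pathSum_tot H N l (fun ps hps v => hf _ H.1 ps hps v) v

lemma opTot_map (H : PathIn Γ h hs) (N : ℤ) {f : List A' → V' → Y} (hf : ProgFinite Γ f)
    {Y' : Type*} [AddCommGroup Y'] (g : Y →+ Y') (l : List A) (v : V) :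
    opTot gr N h hs (fun x v => g (f x v)) l v = g (opTot gr N h hs f l v) := by
  rw [opTot, opTot, ← pathSum_map]
  refine pathSum_congr H N l (fun ps hps v => ?_) v
  rw [progTot, progTot, ← tot_map g (hf _ H.1 ps hps v)]
  congr 1; funext K
  exact progSeq_map g _ f ps v K

lemma opTot_add (H : PathIn Γ h hs) (N : ℤ) {f g : List A' → V' → Y} (hf : ProgFinite Γ f)
    (hg : ProgFinite Γ g) (l : List A) (v : V) :
    opTot gr N h hs (f + g) l v = opTot gr N h hs f l v + opTot gr N h hs g l v := by
  rw [opTot, opTot, opTot, ← pathSum_add]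
  refine pathSum_congr H N l (fun ps hps v => ?_) v
  rw [progTot, progSeq_add, tot_add (hf _ H.1 ps hps v) (hg _ H.1 ps hps v)]
  rfl

lemma ProgFinite.add {f g : List A' → V' → Y} (hf : ProgFinite Γ f) (hg : ProgFinite Γ g) :
    ProgFinite Γ (f + g) := fun γ hγ ps hps v => by
  rw [progSeq_add]; exact (hf γ hγ ps hps v).add (hg γ hγ ps hps v)

lemma ProgFinite.map {f : List A' → V' → Y} (hf : ProgFinite Γ f) {Y' : Type*} [AddCommGroup Y']
    (g : Y →+ Y') : ProgFinite Γ (fun x v => g (f x v)) :=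
  fun γ hγ ps hps v => by
    rw [show progSeq γ (fun x v => g (f x v)) ps v = fun K => g (progSeq γ f ps v K) from
      funext fun K => progSeq_map g γ f ps v K]
    exact (hf γ hγ ps hps v).map g

lemma ProgFinite.strB (hΓ : ∀ γ, Γ γ → γ ∈ gr' 1) {f : List A' → V' → Y} (hm : MultiAdd f)
    (hf : ProgFinite Γ f) : ProgFinite Γ (strB CV' f) := fun γ hγ ps hps v => by
  rw [progSeq_strB CV' γ ps (hΓ γ hγ) (fun s hs => hΓ _ (hps s hs)) hm]
  exact (tot_progB CV' Γ γ hγ (progSeq γ f) (fun ps hps v => hf γ hγ ps hps v) ps hps v).1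

lemma progSeq_actFirst (m : ℤ) (γ : A') (f : List A' → V' → W') (ps : List (A' × A')) (v : V') :
    progSeq γ (actFirst (gr := gr') m f) ps v = shift (fun K => koszul gr' m γ • progSeq γ f ps v K)
        + stepMove ps (fun s ps' K => koszul gr' m s.1 • progSeq s.2 f ps' v K) := by
  have key : ∀ (e γ : A') (ps : List (A' × A')) (K : ℕ),
      prog γ ps K (consF e (actFirst (gr := gr') m f)) v = koszul gr' m e • progSeq γ f ps v K :=
    fun e γ ps K => progSeq_map (toAddMonoidHom W' (koszul gr' m e)) γ f ps v K
  funext K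
  rw [progSeq, prog_rec]
  simp only [key, Pi.add_apply]
  cases ps with
  | nil => simp [actFirst]
  | cons s ps => simp

lemma actFirst_evZero (m : ℤ) {γ : A'} (hγ : Γ γ) {f : List A' → V' → W'} (hf : ProgFinite Γ f)
    {ps : List (A' × A')} (hps : LabelsIn Γ ps) (v : V') :
    EvZero (progSeq γ (actFirst (gr := gr') m f) ps v) ∧
    progTot γ (actFirst (gr := gr') m f) ps v = koszul gr' m γ • progTot γ f ps v
      + stepMove ps (fun s ps' => koszul gr' m s.1 • progTot s.2 f ps' v) := by
  have h1 : ∀ e γ ps, Γ γ → LabelsIn Γ ps → EvZero (fun K => koszul gr' m e • progSeq γ f ps v K) ∧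
      tot (fun K => koszul gr' m e • progSeq γ f ps v K) = koszul gr' m e • progTot γ f ps v :=
    fun e γ ps hγ hps => ⟨(hf γ hγ ps hps v).map (toAddMonoidHom W' (koszul gr' m e)),
        tot_map (toAddMonoidHom W' (koszul gr' m e)) (hf γ hγ ps hps v)⟩
  have h2 := h1 γ γ ps hγ hps
  rw [progTot, progSeq_actFirst]
  cases ps with
  | nil => exact ⟨h2.1.shift.add evZero_zero, by
      rw [stepMove_nil, add_zero, tot_shift h2.1, h2.2, stepMove_nil, add_zero]⟩
  | cons s ps =>
    have h3 := h1 s.1 s.2 ps (hps s (by simp)) fun t ht => hps t (by simp [ht])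
    exact ⟨h2.1.shift.add h3.1, by
      rw [stepMove_cons, tot_add h2.1.shift h3.1, tot_shift h2.1, h2.2, h3.2, stepMove_cons]⟩

lemma opTot_actFirst (hΓ : ∀ γ, Γ γ → γ ∈ gr' 1) (H : PathIn Γ h hs) (N m : ℤ)
    {f : List A' → V' → W'} (hf : ProgFinite Γ f) (l : List A) (v : V) :
    opTot gr N h hs (actFirst (gr := gr') m f) l v = m.negOnePow • (h.β • opTot gr N h hs f l v)
        + stepMove hs (fun s hs' => koszul gr' m s.1 • opTot gr (N - 1) s.2 hs' f l v)
        + stepMove l (fun a l' => koszul gr' m (h.θ (bar gr N a)) • opTot gr N h hs f l' v) := by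
  have h0 : ∀ (e : A') (N : ℤ) (h : Vtx A A' V V') hs l,
      pathSum gr N h hs l (fun ps v => e • progTot h.β f ps v) v = e • opTot gr N h hs f l v :=
    fun e N h hs l => pathSum_map gr (toAddMonoidHom W' e) N h hs l _ v
  have h1 : opTot gr N h hs (actFirst (gr := gr') m f) l v
      = pathSum gr N h hs l ((fun ps v => koszul gr' m h.β • progTot h.β f ps v)
        + fun ps v => stepMove ps (fun s ps' => koszul gr' m s.1 • progTot s.2 f ps' v)) v :=
    pathSum_congr H N l (fun ps hps v => (actFirst_evZero m H.1 hf hps v).2) v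
  have h2 : koszul gr' m h.β = m.negOnePow • h.β := by rw [koszul_of_mem gr' m (hΓ _ H.1), mul_one]
  rw [h1, pathSum_add, h0, h2, units_smul_smul, add_assoc]
  congr 1
  rw [pathSum_rec]
  simp only [stepMove_nil, ite_self, add_zero]
  congr 1
  · exact stepMove_congr fun s hs' _ => h0 _ _ _ _ _
  · exact stepMove_congr fun a l' _ => h0 _ _ _ _ _

lemma progB_congr (t : Y →+ Y) {γ : A'} (hγ : Γ γ) {Φ Ψ : List (A' × A') → V' → Y}
    (hΦ : ∀ ps, LabelsIn Γ ps → ∀ v, Φ ps v = Ψ ps v) {ps : List (A' × A')} (hps : LabelsIn Γ ps)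
    (v : V') : progB CV' t γ Φ ps v = progB CV' t γ Ψ ps v := by
  induction ps generalizing γ Φ Ψ with
  | nil =>
    have h1 : ∀ x, Φ [(x, γ)] v = Ψ [(x, γ)] v := fun x => hΦ _ (hps.cons hγ) v
    simp only [progB, insP, h1, hΦ [] hps]
  | cons s ps ih =>
    have hs : Γ s.2 := hps s (by simp)
    have hps' : LabelsIn Γ ps := fun t ht => hps t (by simp [ht])
    have h1 : ∀ x, Φ ((x, γ) :: s :: ps) v = Ψ ((x, γ) :: s :: ps) v :=
      fun x => hΦ _ (hps.cons hγ) v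
    have h2 : ∀ x, Φ ((x, s.2) :: ps) v = Ψ ((x, s.2) :: ps) v := fun x =>
      hΦ ((x, s.2) :: ps) (hps'.cons hs) v
    have h3 : mulFirstP gr' s.1 Φ ps v = mulFirstP gr' s.1 Ψ ps v := by
      cases ps with
      | nil => simp only [mulFirstP, hΦ [] hps']
      | cons p ps =>
        have hp : LabelsIn Γ ps := fun t ht => hps' t (mem_cons_of_mem _ ht)
        exact hΦ ((bar gr' 1 s.1 * p.1, p.2) :: ps) (hp.cons (hps' p (by simp))) v
    simp only [progB, insP, h1, h2, h3]
    rw [ih (Φ := consF (bar gr' 1 s.1, s.2) Φ) (Ψ := consF (bar gr' 1 s.1, s.2) Ψ) hs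
      (fun ps hps v => hΦ ((bar gr' 1 s.1, s.2) :: ps) (hps.cons hs) v) hps']

lemma dropSum_congr {H : Type*} {P : H → Prop} {hs : List (A' × H)} (hhs : ∀ s ∈ hs, P s.2)
    {F G : List (A' × H) → Y} (h : ∀ hs', (∀ s ∈ hs', P s.2) → F hs' = G hs') :
    dropSum hs F = dropSum hs G := by
  induction hs generalizing F G with
  | nil => rfl
  | cons s hs ih =>
    cases hs with
    | nil => rw [dropSum, dropSum, h [] (by simp)]
    | cons t hs =>
      rw [dropSum, dropSum, h _ (fun r hr => ?_), ih (fun r hr => hhs r (by simp [hr]))]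
      · intro hs' hhs'
        refine h _ fun r hr => ?_
        rcases mem_cons.mp hr with rfl | hr
        · exact hhs r (by simp)
        · exact hhs' r hr
      · rcases mem_cons.mp hr with rfl | hr
        · exact hhs t (by simp)
        · exact hhs r (by simp [hr])

open Classical in
/-- The restriction of a function of programs to the programs whose labels satisfy a condition. -/
def restrictLabels (Γ : A' → Prop) (Φ : List (A' × A') → V' → Y) :
    List (A' × A') → V' → Y := fun ps v => if LabelsIn Γ ps then Φ ps v else 0

lemma restrictLabels_apply (Φ : List (A' × A') → V' → Y) {ps : List (A' × A')}
    (hps : LabelsIn Γ ps) (v : V') : Φ ps v = restrictLabels Γ Φ ps v := (if_pos hps).symm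

lemma progTot_progAdd {f : List A' → V' → Y} (hm : MultiAdd f) (hf : ProgFinite Γ f) {γ : A'}
    (hγ : Γ γ) : ProgAdd (restrictLabels Γ (progTot γ f)) := by
  constructor
  · intro l l' a b γ' v
    have h1 : ∀ x, LabelsIn Γ (l ++ (x, γ') :: l') ↔ LabelsIn Γ (l ++ (a, γ') :: l') := by
      intro x; simp only [LabelsIn, mem_append, mem_cons]
      constructor
      · rintro h s (hs | rfl | hs)
        · grind
        · exact h (x, γ') (Or.inr (Or.inl rfl))
        all_goals grind
      · rintro h s (hs | rfl | hs)
        · grind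
        · exact h (a, γ') (Or.inr (Or.inl rfl))
        all_goals grind
    by_cases h : LabelsIn Γ (l ++ (a, γ') :: l')
    · rw [restrictLabels, if_pos ((h1 _).mpr h), restrictLabels, if_pos h, restrictLabels,
        if_pos ((h1 _).mpr h), progTot, progTot, progTot,
        ← tot_add (hf γ hγ _ h v) (hf γ hγ _ ((h1 b).mpr h) v)]
      congr 1; funext K
      exact (prog_progAdd hm γ K).entry l l' a b γ' v
    · rw [restrictLabels, if_neg (mt (h1 _).mp h), restrictLabels, if_neg h, restrictLabels,
        if_neg (mt (h1 _).mp h), add_zero]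
  · intro l v v'
    simp only [restrictLabels]
    split_ifs with h
    · rw [progTot, progTot, progTot, ← tot_add (hf γ hγ _ h v) (hf γ hγ _ h v')]
      congr 1; funext K
      exact (prog_progAdd hm γ K).right l v v'
    all_goals simp

/-- The commutator of an insertion operator with the differentials. -/
theorem strD_opTot (hΓ : ∀ γ, Γ γ → γ ∈ gr' 1) (H : PathIn Γ h hs) (Hc : PathCompat CV CV' h hs)
    (m : ℤ) {f : List A' → V' → W'} (hm : MultiAdd f) (hf : ProgFinite Γ f) (ω : W' →+ W)
    (ω_D : ∀ x, ω (CW'.D x - h.β • x) = CW.D (ω x)) (ω_θ : ∀ a x, ω (h.θ a • x) = a • ω x)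
    (hs0 : ∀ s ∈ hs, s.1 ∈ gr' 0) (l : List A) (v : V) :
    ω (opTot gr hs.length h hs (strD CV' CW' m f) l v) = (hs.length : ℤ).negOnePow •
          strD CV CW (m - hs.length) (fun l v => ω (opTot gr hs.length h hs f l v)) l v
        + stepMove hs (fun s hs' => ω (s.1 • opTot gr ((hs.length : ℤ) - 1) s.2 hs' f l v))
        + ω (dropSum hs fun hs' => opTot gr ((hs.length : ℤ) - 1) h hs' f l v) := by
  have hB : opTot gr hs.length h hs (strB CV' f) l v
      = (hs.length : ℤ).negOnePow • strB CV (opTot gr hs.length h hs f) l v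
        + dropSum hs fun hs' => opTot gr ((hs.length : ℤ) - 1) h hs' f l v := by
    have h1 : opTot gr hs.length h hs (strB CV' f) l v = pathSum gr hs.length h hs l
          (progB CV' (.id W') h.β fun ps v => progTot h.β f ps v) v := by
      refine pathSum_congr H _ l (fun ps hps v => ?_) v
      rw [progTot, progSeq_strB CV' h.β ps (hΓ _ H.1) (fun s hs => hΓ _ (hps s hs)) hm]
      exact (tot_progB CV' Γ h.β H.1 (progSeq h.β f) (fun ps hps v => hf _ H.1 ps hps v) ps hps v).2
    have h2 : pathFun gr hs.length h hs (restrictLabels Γ (progTot h.β f))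
        = opTot gr hs.length h hs f := by
      funext l v
      exact pathSum_congr H _ l (fun ps hps v => (restrictLabels_apply _ hps v).symm) v
    have h3 : dropSum hs (fun hs' => opTot gr ((hs.length : ℤ) - 1) h hs' f l v)
        = dropSum hs (fun hs' => pathSum gr ((hs.length : ℤ) - 1) h hs' l
            (restrictLabels Γ (progTot h.β f)) v) :=
      dropSum_congr (P := fun k => Γ k.β) H.2 fun hs' hhs' =>
        pathSum_congr ⟨H.1, hhs'⟩ _ l (fun ps hps v => restrictLabels_apply _ hps v) v
    rw [h1, h3, ← h2, ← pathSum_progB CV CV' Hc l (progTot_progAdd hm hf H.1) v]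
    refine pathSum_congr H _ l (fun ps hps v => ?_) v
    exact progB_congr CV' _ H.1 (fun ps hps v => restrictLabels_apply _ hps v) hps v
  generalize (hs.length : ℤ) = N at hB ⊢
  have hF : strD CV' CW' m f = ((fun l v => (m + 1).negOnePow • CW'.D (f l v))
      + actFirst (gr := gr') m f) + strB CV' f := rfl
  have hf1 : ProgFinite Γ (fun l v => (m + 1).negOnePow • CW'.D (f l v)) :=
    hf.map ((toAddMonoidHom W' (m + 1).negOnePow).comp CW'.D)
  have hf2 : ProgFinite Γ (actFirst (gr := gr') m f) := fun γ hγ ps hps v =>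
    (actFirst_evZero m hγ hf hps v).1
  have h1 : opTot gr N h hs (fun l v => (m + 1).negOnePow • CW'.D (f l v)) l v
      = (m + 1).negOnePow • CW'.D (opTot gr N h hs f l v) :=
    opTot_map H _ hf ((toAddMonoidHom W' (m + 1).negOnePow).comp CW'.D) l v
  have h2 : ∀ a l, ω (koszul gr' m (h.θ (bar gr N a)) • opTot gr N h hs f l v)
      = N.negOnePow • koszul gr (m - N) a • ω (opTot gr N h hs f l v) := by
    intro a l
    rw [koszul_map_zero gr gr' h.θ Hc.head.graded.θ_mem, ω_θ, bar_eq_koszul, map_units_smul,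
      koszul_koszul, units_smul_smul, show m + N = m - N + 2 * N by ring, ← koszul_koszul,
      koszul_eq_bar gr (2 * N), bar_two_mul, negOnePow_two_mul, one_smul]
  have h3 : stepMove hs (fun s hs' => koszul gr' m s.1 • opTot gr (N - 1) s.2 hs' f l v)
      = stepMove hs (fun s hs' => s.1 • opTot gr (N - 1) s.2 hs' f l v) :=
    stepMove_congr fun s hs' e => by rw [koszul_of_mem_zero gr' m (hs0 s (by simp [e]))]
  have h4 : strB CV (fun l v => ω (opTot gr N h hs f l v)) l v
      = ω (strB CV (opTot gr N h hs f) l v) := strB_map CV ω _ l v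
  have h5 : (m + 1).negOnePow • CW.D (ω (opTot gr N h hs f l v))
      = N.negOnePow • (m - N + 1).negOnePow • CW.D (ω (opTot gr N h hs f l v)) := by
    rw [smul_smul, ← negOnePow_add]; congr 2; ring
  have h6 : ω (CW'.D (opTot gr N h hs f l v)) = CW.D (ω (opTot gr N h hs f l v))
      + ω (h.β • opTot gr N h hs f l v) := by
    rw [← ω_D, map_sub, sub_add_cancel]
  rw [hF, opTot_add H N (hf1.add hf2) (hf.strB CV' hΓ hm), opTot_add H N hf1 hf2, h1, hB,
    opTot_actFirst hΓ H N m hf, h3, strD, Pi.add_apply, Pi.add_apply, frontD, h4]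
  simp only [map_add, map_units_smul, ← stepMove_map, h2, h6, smul_add, ← h5, stepMove_smul]
  rw [negOnePow_succ, Units.neg_smul, Units.neg_smul]
  abel

end TotalOperators

/-! ## The operators of inner automorphisms as insertion operators -/

section InsertionSums

variable {B : Type u} {M : Type v} [AddCommGroup M]

/-- Sum over the insertions of `K` copies of an element. -/
def insSum (β : B) (K : ℕ) (l : List B) (f : List B → M) : M := ((insertions β K l).map f).sum

lemma insSum_rec (β : B) (K : ℕ) (l : List B) (f : List B → M) :
    insSum β K l f = shift (fun K => insSum β K l (consF β f)) K
      + stepMove l (fun a l' => insSum β K l' (consF a f))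
      + (if l = [] ∧ K = 0 then f [] else 0) := by
  match K, l with
  | 0, [] => simp [insSum, insertions]
  | 0, a :: l => simp [insSum, insertions]
  | K + 1, [] => cases K <;> simp [insSum, insertions, replicate_succ]
  | K + 1, a :: l =>
    simp only [insSum, insertions, map_append, List.sum_append, map_map,
      shift_succ_apply, stepMove_cons]
    simp; rfl

lemma insertions_map {B' : Type u} (θ : B → B') (β : B) (K : ℕ) (l : List B) :
    (insertions β K l).map (List.map θ) = insertions (θ β) K (l.map θ) := by
  induction l generalizing K with
  | nil => cases K <;> simp [insertions]
  | cons a l ih =>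
    induction K with
    | zero => simp [insertions]
    | succ K ihK =>
      rw [insertions, map_append, map_map, map_map, map_cons, insertions,
        ← map_cons, ← ihK, ← ih, map_map, map_map]
      rfl

end InsertionSums

section InnerVertices

variable {A : Type u} [Ring A] {gr : ℤ → AddSubgroup A} [GradedRing gr] {A' : Type u} [Ring A']
  {gr' : ℤ → AddSubgroup A'} [GradedRing gr']
  {V V' Y : Type*} [AddCommGroup V] [AddCommGroup V'] [AddCommGroup Y]

lemma op_nil_eq_insSum (h : Vtx A A' V V') (K : ℕ) (l : List A) (f : List A' → V' → Y) (v : V) :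
    op gr 0 h [] K l f v = insSum h.β K (l.map h.θ) (fun y => f y (h.ν v)) := by
  have key := op_induction (S := Unit) (P := fun _ K l => ∀ f : List A' → V' → Y,
    op gr 0 h [] K l f v = insSum h.β K (l.map h.θ) (fun y => f y (h.ν v))) ?_ [] K l
  · grind
  intro _ K l h1 _ h2 f
  rw [op_rec, insSum_rec]
  congr 1
  · congr 1
    · cases K with
      | zero => simp
      | succ K =>
        rw [stepMove_nil, add_zero]
        exact h1 K rfl (consF h.β f)
    · cases l with
      | nil => simp
      | cons a l =>
        simp only [stepMove_cons, bar_zero, map_cons]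
        exact h2 a l rfl (consF (h.θ a) f)
  all_goals simp

variable [Module A V] (C : Curved gr)

/-- The vertex that corresponds to the inverse of the operator `Ãd(u)`. -/
def adVtx (V : Type*) [AddCommGroup V] [Module A V] (u : Aˣ) : Vtx A A V V where
  θ := (AddMonoidHom.mulRight (u : A)).comp (AddMonoidHom.mulLeft (↑u⁻¹ : A))
  β := -(↑u⁻¹ * C.D ↑u)
  ν := toAddMonoidHom V (↑u⁻¹ : A)

lemma adVtx_θ (u : Aˣ) (a : A) : (adVtx C V u).θ a = ↑u⁻¹ * a * ↑u := rfl
lemma adVtx_β (u : Aˣ) : (adVtx C V u).β = -(↑u⁻¹ * C.D ↑u) := rfl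
lemma adVtx_ν (u : Aˣ) (v : V) : (adVtx C V u).ν v = (↑u⁻¹ : A) • v := rfl

/-- The lattice path with the steps `c₁, …, cₘ`. -/
def adPath (V : Type*) [AddCommGroup V] [Module A V] : Aˣ → List Aˣ → Steps A A V V
  | _, [] => []
  | u, c :: cs => ((c : A), adVtx C V (u * c)) :: adPath V (u * c) cs

@[simp] lemma adPath_length (u : Aˣ) (cs : List Aˣ) : (adPath C V u cs).length = cs.length := by
  induction cs generalizing u with
  | nil => rfl
  | cons c cs ih => simp [adPath, ih]

lemma phiSum_cons_aux (β c : A) (P : ℕ → List A → (List A → Y) → Y) (ρ : A → A) (K : ℕ)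
    (l : List A) (f : List A → Y) (G : ℕ → List A → (List A → Y) → Y)
    (hG : ∀ K l f, G K l f = ∑ j ∈ Finset.range (l.length + 1), ∑ i ∈ Finset.range (K + 1), insSum
    β i ((l.take j).map ρ) (fun y => P (K - i) (l.drop j) fun z => f (y ++ c :: z))) :
    G K l f = shift (fun K => G K l (consF β f)) K + P K l (consF c f)
      + stepMove l (fun a l' => G K l' (consF (ρ a) f)) := by
  have h1 : ∀ j, ∑ i ∈ Finset.range (K + 1),
      shift (fun i => insSum β i ((l.take j).map ρ) (consF β fun y =>
        P (K - (i + 1)) (l.drop j) fun z => f (y ++ c :: z))) i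
      = shift (fun K => ∑ i ∈ Finset.range (K + 1), insSum β i ((l.take j).map ρ)
        (fun y => P (K - i) (l.drop j) fun z => consF β f (y ++ c :: z))) K := by
    intro j
    cases K with
    | zero => simp
    | succ K =>
      rw [Finset.sum_range_succ']
      simp only [shift_succ_apply, shift_zero_apply, add_zero]
      refine sum_congr rfl fun i _ => ?_
      rw [show K + 1 - (i + 1) = K - i by omega]; rfl
  have h2 : ∀ i j, insSum β i ((l.take j).map ρ) (fun y => P (K - i) (l.drop j) fun z =>
        f (y ++ c :: z))
      = shift (fun i => insSum β i ((l.take j).map ρ) (consF β fun y =>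
        P (K - (i + 1)) (l.drop j) fun z => f (y ++ c :: z))) i
        + stepMove ((l.take j).map ρ) (fun a l' => insSum β i l' (consF a fun y =>
          P (K - i) (l.drop j) fun z => f (y ++ c :: z)))
        + (if (l.take j).map ρ = [] ∧ i = 0 then P (K - i) (l.drop j) (consF c f) else 0) := by
    intro i j
    rw [insSum_rec]
    congr 2
    cases i <;> rfl
  have hS : ∑ j ∈ Finset.range (l.length + 1), shift (fun K => ∑ i ∈ Finset.range (K + 1),
      insSum β i ((l.take j).map ρ) (fun y => P (K - i) (l.drop j) fun z =>
        consF β f (y ++ c :: z))) K = shift (fun K => G K l (consF β f)) K := by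
    cases K with
    | zero => simp
    | succ K => exact (hG K l (consF β f)).symm
  have hT : ∑ j ∈ Finset.range (l.length + 1), ∑ i ∈ Finset.range (K + 1),
      stepMove ((l.take j).map ρ) (fun a l' => insSum β i l' (consF a fun y =>
        P (K - i) (l.drop j) fun z => f (y ++ c :: z)))
      = stepMove l (fun a l' => G K l' (consF (ρ a) f)) := by
    cases l with
    | nil => simp
    | cons a l =>
      rw [length_cons, Finset.sum_range_succ']
      simp only [List.take_zero, map_nil, stepMove_nil, Finset.sum_const_zero, add_zero]
      exact (hG K l (consF (ρ a) f)).symm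
  have hU : ∑ j ∈ Finset.range (l.length + 1), ∑ i ∈ Finset.range (K + 1),
      (if (l.take j).map ρ = [] ∧ i = 0 then P (K - i) (l.drop j) (consF c f) else 0)
      = P K l (consF c f) := by
    rw [Finset.sum_eq_single 0, Finset.sum_eq_single 0]
    · simp
    · intro i _ hi; simp [hi]
    · simp
    · intro j hj hj0
      refine sum_eq_zero fun i _ => if_neg ?_
      rintro ⟨h, -⟩
      cases l with
      | nil => simp at hj; exact hj0 hj
      | cons a l => cases j <;> simp at h hj0
    · simp
  rw [hG]
  simp only [h2, sum_add_distrib, h1]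
  rw [hS, hT, hU]
  abel

/-- The sum `phiSum` in terms of insertion operators. -/
lemma op_adPath (u : Aˣ) (cs : List Aˣ) (K : ℕ) (l : List A) (f : List A → V → Y) (v : V) :
    op gr cs.length (adVtx C V u) (adPath C V u cs) K l f v
      = phiSum gr C.D u cs K l (fun y => f y ((↑(u * cs.prod)⁻¹ : A) • v)) := by
  induction cs generalizing u K l f with
  | nil =>
    have := op_nil_eq_insSum (gr := gr) (adVtx C V u) K l f v
    simp only [length_nil, Nat.cast_zero, adPath, phiSum, List.prod_nil, mul_one]
    rw [this]; rfl
  | cons c cs ih =>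
    have key := op_induction (S := Unit) (P := fun _ K l => ∀ f : List A → V → Y,
      op gr (c :: cs).length (adVtx C V u) (adPath C V u (c :: cs)) K l f v
      = phiSum gr C.D u (c :: cs) K l (fun y => f y ((↑(u * (c :: cs).prod)⁻¹ : A) • v))) ?_ [] K l
    · exact key f
    intro _ K l h1 _ h2 f
    rw [op_rec]
    have e1 := phiSum_cons_aux (-(↑u⁻¹ * C.D ↑u)) (c : A)
      (fun K l f => phiSum gr C.D (u * c) cs K l f)
      (fun a => ↑u⁻¹ * bar gr (cs.length + 1) a * ↑u) K l
      (fun y => f y ((↑(u * (c :: cs).prod)⁻¹ : A) • v))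
      (fun K l f => phiSum gr C.D u (c :: cs) K l f) ?_
    · rw [e1]
      simp only [adPath, stepMove_cons, length_cons, Nat.cast_add, Nat.cast_one,
        add_sub_cancel_right]
      have e2 := ih (u * c) K l (consF (c : A) f)
      rw [e2]
      simp only [List.cons_ne_nil, false_and, if_false, add_zero]
      congr 1
      · congr 1
        · cases K with
          | zero => rfl
          | succ K =>
            have := h1 K rfl (consF (-(↑u⁻¹ * C.D ↑u)) f)
            simp only [length_cons, Nat.cast_add, Nat.cast_one] at this
            exact this
        · congr 1; funext y; simp only [consF_apply, List.prod_cons, mul_assoc]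
      · cases l with
        | nil => rfl
        | cons a l =>
          have := h2 a l rfl (consF (↑u⁻¹ * bar gr (cs.length + 1) a * ↑u) f)
          simp only [length_cons, Nat.cast_add, Nat.cast_one] at this
          exact this
    · intro K l f
      rw [phiSum]
      refine sum_congr rfl fun j _ => sum_congr rfl fun i _ => ?_
      rw [blocks, map_map]; rfl

end InnerVertices

section Compatibility

variable {A : Type u} [Ring A] {gr : ℤ → AddSubgroup A} [GradedRing gr] {C : Curved gr}
  {V W : Type*} [AddCommGroup V] [Module A V] [AddCommGroup W] [Module A W] (CV : CurvedMod C V)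
  (CW : CurvedMod C W)

lemma Curved.D_one : C.D 1 = 0 := by
  have h := C.D_mul 1 1
  rw [koszul_of_mem_zero gr 1 (SetLike.GradedOne.one_mem (A := gr))] at h
  grind

lemma Curved.D_mul_zero {u : A} (hu : u ∈ gr 0) (a : A) : C.D (u * a) = C.D u * a + u * C.D a := by
  rw [C.D_mul, koszul_of_mem_zero gr 1 hu]

lemma Curved.D_inv (u : Aˣ) (hu : (u : A) ∈ gr 0) : C.D ↑u⁻¹ = -(↑u⁻¹ * C.D ↑u * ↑u⁻¹) := by
  have h := C.D_mul_zero hu ↑u⁻¹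
  rw [Units.mul_inv, C.D_one] at h
  have h2 : (↑u⁻¹ : A) * (C.D ↑u * ↑u⁻¹ + ↑u * C.D ↑u⁻¹) = 0 := by rw [← h, mul_zero]
  rw [mul_add, Units.inv_mul_cancel_left] at h2
  grind

lemma adVtx_graded (u : Aˣ) (hu : (u : A) ∈ gr 0) : (adVtx C V u).Graded gr gr := by
  have hi := units_inv_mem_zero gr u hu
  constructor
  · intro i a ha
    have := SetLike.mul_mem_graded (SetLike.mul_mem_graded hi ha) hu
    rw [zero_add, add_zero] at this
    exact this
  · have := SetLike.mul_mem_graded hi (C.D_mem hu)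
    exact neg_mem (by simpa using this)

lemma adVtx_compat (u : Aˣ) (hu : (u : A) ∈ gr 0) : (adVtx C V u).Compat CV CV := by
  have hi := units_inv_mem_zero gr u hu
  have hD := C.D_inv u hu
  refine ⟨adVtx_graded u hu, ?_, ?_, ?_, ?_, ?_⟩
  · intro a b
    simp only [adVtx_θ, mul_assoc, Units.mul_inv_cancel_left]
  · intro a
    have h1 : bar gr 1 (↑u⁻¹ * a * ↑u) = ↑u⁻¹ * bar gr 1 a * ↑u :=
      bar_map_zero gr gr (adVtx C V u).θ (adVtx_graded u hu).θ_mem 1 a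
    have h2 : C.D (↑u⁻¹ * a * ↑u) = -(↑u⁻¹ * C.D ↑u * ↑u⁻¹) * (a * ↑u)
        + ↑u⁻¹ * (C.D a * ↑u - bar gr 1 a * C.D ↑u) := by
      rw [mul_assoc, C.D_mul_zero hi, hD, C.D_mul, koszul_one, neg_mul (bar gr 1 a),
        ← sub_eq_add_neg]
    simp only [adVtx_θ, adVtx_β, h1]
    rw [h2]
    simp only [mul_assoc, mul_neg, neg_mul, mul_sub, Units.mul_inv_cancel_left]
    abel
  · simp only [adVtx_θ, adVtx_β, map_neg]
    rw [C.D_mul_zero hi, hD, C.D_D]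
    simp only [mul_assoc, mul_neg, neg_mul, mul_sub, Units.inv_mul_cancel_left]
    abel
  · intro a v
    simp only [adVtx_θ, adVtx_ν, smul_smul, mul_assoc, Units.mul_inv, mul_one]
  · intro v
    simp only [adVtx_β, adVtx_ν]
    rw [CV.D_smul, koszul_of_mem_zero gr 1 hi, hD, neg_smul, neg_smul, smul_smul]
    abel

lemma adVtx_edge (u c : Aˣ) (hu : (u : A) ∈ gr 0) (hc : (c : A) ∈ gr 0) :
    (adVtx C V u).Edge C ↑c (adVtx C V (u * c)) := by
  refine ⟨hc, ?_, ?_, ?_⟩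
  · intro a
    simp only [adVtx_θ, mul_inv_rev, Units.val_mul, mul_assoc, Units.mul_inv_cancel_left]
  · simp only [adVtx_β, mul_inv_rev, Units.val_mul, mul_assoc, mul_neg, Units.mul_inv_cancel_left]
    rw [C.D_mul_zero hu]
    simp only [mul_add, mul_assoc, neg_mul, Units.inv_mul_cancel_left]
    abel
  · intro v
    simp only [adVtx_ν, mul_inv_rev, Units.val_mul, smul_smul, Units.mul_inv_cancel_left]

lemma adPath_compat (u : Aˣ) (hu : (u : A) ∈ gr 0) (cs : List Aˣ) (hcs : ∀ c ∈ cs, (c : A) ∈ gr 0) :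
    PathCompat CV CV (adVtx C V u) (adPath C V u cs) := by
  induction cs generalizing u with
  | nil => exact adVtx_compat CV u hu
  | cons c cs ih =>
    have hc := hcs c (by simp)
    have huc : ((u * c : Aˣ) : A) ∈ gr 0 := by
      have := SetLike.mul_mem_graded hu hc; simpa using this
    exact ⟨adVtx_compat CV u hu, adVtx_edge u c hu hc,
      ih (u * c) huc fun d hd => hcs d (by simp [hd])⟩

lemma adVtx_smul_D (u : Aˣ) (hu : (u : A) ∈ gr 0) (x : W) :
    (u : A) • (CW.D x - (adVtx C V u).β • x) = CW.D ((u : A) • x) := by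
  rw [CW.D_smul, koszul_of_mem_zero gr 1 hu, adVtx_β, neg_smul, sub_neg_eq_add, smul_add, smul_smul,
    Units.mul_inv_cancel_left, add_comm]

lemma adVtx_smul_θ (u : Aˣ) (a : A) (x : W) :
    (u : A) • (adVtx C V u).θ a • x = a • (u : A) • x := by
  rw [adVtx_θ, smul_smul, smul_smul, mul_assoc, Units.mul_inv_cancel_left]

end Compatibility

/-! ## Linearity over graded central elements -/

section Central

variable {A A' V V' W : Type*} [Ring A] {gr : ℤ → AddSubgroup A} [GradedRing gr] [Ring A']
  {gr' : ℤ → AddSubgroup A'} [GradedRing gr']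
  [AddCommGroup V] [Module A V] [AddCommGroup V'] [Module A' V'] [AddCommGroup W] [Module A W]

variable (gr) in
/-- A homogeneous element that is central in the graded sense. -/
structure Central (x : A) (i : ℤ) : Prop where
  mem : x ∈ gr i
  comm : ∀ a, a * x = x * koszul gr i a

variable (gr) in
/-- The function `f` is linear with respect to `x`, up to the replacement of `f` by `f'`. -/
structure OLin (x : A) (i : ℤ) (f f' : List A → V → W) : Prop where
  entry : ∀ p a l v, f (p ++ x * a :: l) v = x • f' (p.map (bar gr i) ++ a :: l) v
  right : ∀ p v, f p (x • v) = i.negOnePow • x • f' (p.map (bar gr i)) v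

variable {x : A} {i : ℤ} {f f' : List A → V → W}

lemma Central.bar (hx : Central gr x i) (n : ℤ) (a : A) :
    bar gr n (x * a) = (n * i).negOnePow • (x * bar gr n a) :=
  bar_map gr gr (AddMonoidHom.mulLeft x)
    (fun {j a} ha => by rw [add_comm]; exact SetLike.mul_mem_graded hx.mem ha) n a

lemma Central.koszul (hx : Central gr x i) (n : ℤ) (a : A) :
    koszul gr n (x * a) = (n * i).negOnePow • (x * koszul gr n a) := by
  rw [koszul_mul, koszul_of_mem gr n hx.mem, units_smul_mul]

lemma OLin.cons (h : OLin gr x i f f') (a : A) : OLin gr x i (consF a f) (consF (bar gr i a) f') :=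
  ⟨fun p b l v => h.entry (a :: p) b l v, fun p v => h.right (a :: p) v⟩

lemma OLin.first (h : OLin gr x i f f') (a : A) :
    consF (x * a) f = fun l v => x • f' (a :: l) v := by
  funext l v; exact h.entry [] a l v

variable {C : Curved gr} (CV : CurvedMod C V) (CW : CurvedMod C W)

lemma MultiAdd.bar_R_cons (hf : MultiAdd f) (l : List A) (v : V) :
    f (bar gr i C.R :: l) v = i.negOnePow • f (C.R :: l) v := by
  rw [C.bar_R]
  exact congrFun (congrFun (hf.consF_units_smul _ _) l) v

lemma MultiAdd.bar_D_cons (hf : MultiAdd f) (a : A) (l : List A) (v : V) :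
    f (bar gr i (C.D a) :: l) v = i.negOnePow • f (C.D (bar gr i a) :: l) v := by
  rw [C.bar_D]
  exact congrFun (congrFun (hf.consF_units_smul _ _) l) v

lemma mulFirst_central (hx : Central gr x i) (hf : MultiAdd f) (h : OLin gr x i f f') (a : A)
    (l : List A) (v : V) : mulFirst gr (x * a) f l v = i.negOnePow • x • mulFirst gr a f' l v := by
  cases l with
  | nil => rw [mulFirst, mulFirst, mul_smul, h.right]; simp
  | cons b l =>
    rw [mulFirst, mulFirst, hx.bar, one_mul, units_smul_mul, mul_assoc]
    change consF _ f l v = _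
    rw [hf.consF_units_smul, h.first]; rfl

lemma mulFirst_entry (hx : Central gr x i) (hf' : MultiAdd f') (h : OLin gr x i f f') (b : A)
    (p : List A) (a : A) (l : List A) (v : V) : mulFirst gr b f (p ++ x * a :: l) v
      = i.negOnePow • x • mulFirst gr (bar gr i b) f' (p.map (bar gr i) ++ a :: l) v := by
  cases p with
  | nil =>
    simp only [nil_append, map_nil, mulFirst]
    rw [← mul_assoc, hx.comm, mul_assoc]
    change consF _ f l v = i.negOnePow • x • consF _ f' l v
    rw [h.first, koszul_eq_bar, bar_bar, bar_bar, add_comm, units_smul_mul]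
    change x • consF _ f' l v = _
    rw [hf'.consF_units_smul, Pi.smul_apply, Pi.smul_apply, smul_units_smul]
  | cons c p =>
    simp only [cons_append, map_cons, mulFirst]
    have := h.entry ((bar gr 1 b * c) :: p) a l v
    simp only [cons_append, map_cons] at this
    rw [this, bar_mul, bar_bar, bar_bar, add_comm]
    change x • consF _ f' _ v = i.negOnePow • x • consF _ f' _ v
    rw [hf'.consF_units_smul, Pi.smul_apply, Pi.smul_apply, smul_units_smul]

lemma mulFirst_right (hx : Central gr x i) (hf' : MultiAdd f') (h : OLin gr x i f f') (b : A)
    (p : List A) (v : V) :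
    mulFirst gr b f p (x • v) = x • mulFirst gr (bar gr i b) f' (p.map (bar gr i)) v := by
  cases p with
  | nil =>
    simp only [map_nil, mulFirst]
    rw [smul_smul, hx.comm, mul_smul, h.right, koszul_eq_bar, units_smul_smul, map_nil]
    rw [show f' [] (i.negOnePow • bar gr i b • v) = i.negOnePow • f' [] (bar gr i b • v) from
      map_units_smul (hf'.rightHom []) _ _, smul_units_smul, negOnePow_smul_smul, smul_neg]
  | cons c p =>
    simp only [map_cons, mulFirst]
    rw [h.right, map_cons, bar_mul, bar_bar, bar_bar, add_comm]
    change i.negOnePow • x • consF _ f' _ v = x • consF _ f' _ v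
    rw [hf'.consF_units_smul, Pi.smul_apply, Pi.smul_apply, smul_units_smul, negOnePow_smul_smul]

lemma strB_entry {y : A} (hx : Central gr x i) (hy : y = C.D x) {f'' : List A → V → W}
    (hf : MultiAdd f) (hf' : MultiAdd f') (h : OLin gr x i f f') (h' : OLin gr y (i + 1) f f'')
    (p : List A) (a : A) (l : List A) (v : V) : strB CV f (p ++ x * a :: l) v
      = i.negOnePow • x • strB CV f' (p.map (bar gr i) ++ a :: l) v
        - y • f'' (p.map (bar gr i) ++ a :: l) v := by
  induction p generalizing f f' f'' with
  | nil =>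
    have e1 := h.entry [C.R] a l v
    have e2 : f (C.D (x * a) :: l) v = y • f'' (a :: l) v + i.negOnePow • x • f' (C.D a :: l) v := by
      change consF _ f l v = _
      rw [C.D_mul, koszul_of_mem gr 1 hx.mem, one_mul, units_smul_mul, hf.consF_add,
        hf.consF_units_smul, ← hy, h.first, h'.first]
      rfl
    have e3 : strB CV (consF (bar gr 1 (x * a)) f) l v
        = i.negOnePow • x • strB CV (consF (bar gr 1 a) f') l v := by
      rw [hx.bar, one_mul, hf.consF_units_smul, h.first]
      exact strB_map CV ((toAddMonoidHom W i.negOnePow).comp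
        (toAddMonoidHom W x)) (consF (bar gr 1 a) f') l v
    simp only [map_cons, map_nil, cons_append, nil_append] at e1 ⊢
    rw [strB_cons_apply, strB_cons_apply, e1, e2, e3, hf'.bar_R_cons, mulFirst_central hx hf h]
    simp only [smul_add, smul_sub, smul_units_smul]
    abel
  | cons b p ih =>
    have e1 := h.entry (C.R :: b :: p) a l v
    have e2 := h.entry (C.D b :: p) a l v
    have e3 := mulFirst_entry hx hf' h b p a l v
    have e4 := ih (hf.cons _) (hf'.cons _) (h.cons (bar gr 1 b)) (h'.cons (bar gr 1 b))
    simp only [map_cons, cons_append] at e1 e2 ⊢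
    rw [strB_cons_apply, strB_cons_apply, e1, e2, e3, e4, hf'.bar_R_cons,
      hf'.bar_D_cons, bar_bar_one gr (i + 1), add_sub_cancel_right, bar_bar, bar_bar, add_comm 1 i]
    simp only [smul_add, smul_sub, smul_units_smul, consF_apply]
    abel

lemma strB_right {y : A} (hx : Central gr x i) (hy : y = C.D x) {f'' : List A → V → W}
    (hf : MultiAdd f) (hf' : MultiAdd f') (h : OLin gr x i f f') (h' : OLin gr y (i + 1) f f'')
    (p : List A) (v : V) : strB CV f p (x • v) = x • strB CV f' (p.map (bar gr i)) v
        - i.negOnePow • y • f'' (p.map (bar gr i)) v := by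
  induction p generalizing f f' f'' with
  | nil =>
    have e1 := h.right [C.R] v
    have e2 : f [] (CV.D (x • v)) = i.negOnePow • i.negOnePow • x • f' [] (CV.D v)
        + (i + 1).negOnePow • y • f'' [] v := by
      rw [CV.D_smul, koszul_of_mem gr 1 hx.mem, one_mul, hf.right, ← hy, h'.right, units_smul_smul,
        show f [] (i.negOnePow • x • CV.D v) = i.negOnePow • f [] (x • CV.D v) from
        map_units_smul (hf.rightHom []) _ _, h.right, add_comm]
      rfl
    simp only [map_cons, map_nil, hf'.bar_R_cons] at e1 ⊢
    rw [strB, strB, e1, e2, smul_units_smul, negOnePow_smul_smul, negOnePow_smul_smul, smul_add,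
      negOnePow_succ, Units.neg_smul]
    abel
  | cons b p ih =>
    have e1 := h.right (C.R :: b :: p) v
    have e2 := h.right (C.D b :: p) v
    have e3 := mulFirst_right hx hf' h b p v
    have e4 := ih (hf.cons _) (hf'.cons _) (h.cons (bar gr 1 b)) (h'.cons (bar gr 1 b))
    simp only [map_cons] at e1 e2 ⊢
    rw [strB_cons_apply, strB_cons_apply, e1, e2, e3, e4, hf'.bar_R_cons,
      hf'.bar_D_cons, bar_bar_one gr (i + 1), add_sub_cancel_right, bar_bar, bar_bar, add_comm 1 i]
    simp only [smul_add, smul_sub, smul_units_smul, consF_apply, negOnePow_smul_smul]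
    abel

/-- The differential of a linear function is linear. -/
lemma strD_olin (m : ℤ) (hx : Central gr x i) (hf : MultiAdd f)
    (h : OLin gr x i f ((i * (m + 1)).negOnePow • f))
    (h' : OLin gr (C.D x) (i + 1) f (((i + 1) * (m + 1)).negOnePow • f)) :
    OLin gr x i (strD CV CW m f) ((i * (m + 2)).negOnePow • strD CV CW m f) := by
  have hsm : ∀ e : ℤˣ, MultiAdd (e • f) := fun e => hf.comp (toAddMonoidHom W e)
  have hB : ∀ (e : ℤˣ) l v, strB CV (e • f) l v = e • strB CV f l v := fun e l v =>
    strB_map CV (toAddMonoidHom W e) f l v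
  have t1 : (i * (m + 2)).negOnePow = i.negOnePow * (i * (m + 1)).negOnePow := by
    rw [← negOnePow_add]; congr 1; ring
  have t2 : ((i + 1) * (m + 1)).negOnePow = (m + 1).negOnePow * (i * (m + 1)).negOnePow := by
    rw [← negOnePow_add]; congr 1; ring
  have s3 : ∀ w : W, (i * m).negOnePow • w = (i * (m + 2)).negOnePow • w := by
    intro w; rw [negOnePow_eq_of (show i * (m + 2) = i * m + 2 * i by ring)]
  have hk : ∀ b, (i * (m + 1)).negOnePow • (koszul gr m b * x)
      = (i * (m + 2)).negOnePow • (x * koszul gr m (bar gr i b)) := by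
    intro b
    rw [hx.comm, bar_eq_koszul, map_units_smul, mul_units_smul, smul_smul, koszul_koszul,
      koszul_koszul, add_comm i m, ← negOnePow_add]
    congr 1
    rw [negOnePow_eq_of (show i * (m + 2) + i = i * (m + 1) + 2 * i by ring)]
  constructor
  case' entry =>
    intro p a l v
    have e1 := strB_entry CV hx rfl hf (hsm _) h h' p a l v
    have e2 := h.entry p a l v
    have e3 : stepMove (p ++ x * a :: l) (fun a l' => koszul gr m a • f l' v)
        = (i * (m + 2)).negOnePow • x • stepMove (p.map (bar gr i) ++ a :: l)
          (fun a l' => koszul gr m a • f l' v) := by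
      cases p with
      | nil =>
        simp only [nil_append, map_nil, stepMove_cons]
        rw [hx.koszul, units_smul_smul, mul_smul, mul_comm m i, s3]
      | cons b p =>
        simp only [cons_append, map_cons, stepMove_cons]
        rw [h.entry, Pi.smul_apply, Pi.smul_apply, smul_units_smul, smul_units_smul, smul_smul,
          ← units_smul_smul, hk, units_smul_smul, mul_smul]
  case' right =>
    intro p v
    have e1 := strB_right CV hx rfl hf (hsm _) h h' p v
    have e2 := h.right p v
    have e3 : stepMove p (fun a l' => koszul gr m a • f l' (x • v))
        = i.negOnePow • (i * (m + 2)).negOnePow • x • stepMove (p.map (bar gr i))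
          (fun a l' => koszul gr m a • f l' v) := by
      cases p with
      | nil => simp
      | cons b p =>
        simp only [map_cons, stepMove_cons]
        rw [h.right, Pi.smul_apply, Pi.smul_apply, smul_units_smul, smul_units_smul,
          smul_units_smul, smul_smul (koszul gr m b), ← units_smul_smul (i * (m + 1)).negOnePow, hk,
          units_smul_smul, mul_smul]
  all_goals
    rw [strD, Pi.add_apply, Pi.add_apply, frontD, e1, e2, e3, hB]
    simp only [Pi.smul_apply, Pi.add_apply, frontD, smul_units_smul, map_units_smul, CW.D_smul,
      koszul_of_mem gr 1 hx.mem, one_mul, units_smul_smul, smul_add]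
    rw [t1, t2]
    generalize i.negOnePow = ε₁
    generalize (i * (m + 1)).negOnePow = ε₂
    generalize (m + 1).negOnePow = ε₃
    rcases Int.units_eq_one_or ε₁ with rfl | rfl <;> rcases Int.units_eq_one_or ε₂ with rfl | rfl <;>
      rcases Int.units_eq_one_or ε₃ with rfl | rfl <;> simp <;> abel

variable (gr') in
/-- A vertex is linear with respect to central elements of the source and of the target. -/
structure Vtx.Linear (x : A) (x' : A') (h : Vtx A A' V V') : Prop where
  graded : h.Graded gr gr'
  θ : ∀ a, h.θ (x * a) = x' * h.θ a
  ν : ∀ v, h.ν (x • v) = x' • h.ν v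

variable (gr gr') in
/-- All vertices of a path are linear. -/
structure PathLinear (x : A) (x' : A') (h : Vtx A A' V V') (hs : Steps A A' V V') :
    Prop where
  vtx : h.Linear (gr := gr) gr' x x'
  step : ∀ s ∈ hs, s.1 ∈ gr' 0 ∧ s.2.Linear (gr := gr) gr' x x'

lemma PathLinear.tail {x : A} {x' : A'} {h : Vtx A A' V V'} {s : A' × Vtx A A' V V'}
    {hs : Steps A A' V V'} (H : PathLinear gr gr' x x' h (s :: hs)) :
    PathLinear gr gr' x x' s.2 hs :=
  ⟨(H.step s (by simp)).2, fun t ht => H.step t (by simp [ht])⟩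

variable (gr') in
/-- The analogue of `OLin` for functions with values in a module over another ring. -/
structure OLinOver (x' : A') (x : A) (i : ℤ) (f f' : List A' → V' → W) : Prop where
  entry : ∀ p a l v, f (p ++ x' * a :: l) v = x • f' (p.map (bar gr' i) ++ a :: l) v
  right : ∀ p v, f p (x' • v) = i.negOnePow • x • f' (p.map (bar gr' i)) v

lemma OLinOver.cons {x' : A'} {x : A} {i : ℤ} {f f' : List A' → V' → W}
    (h : OLinOver gr' x' x i f f') (a : A') :
    OLinOver gr' x' x i (consF a f) (consF (bar gr' i a) f') :=
  ⟨fun p b l v => h.entry (a :: p) b l v, fun p v => h.right (a :: p) v⟩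

/-- Insertion operators preserve linearity. -/
lemma op_olin {x : A} {x' : A'} {i : ℤ} (hx : Central gr x i) {h : Vtx A A' V V'}
    {hs : Steps A A' V V'} (H : PathLinear gr gr' x x' h hs) (K : ℕ) {f f' : List A' → V' → W}
    (hf : MultiAdd f) (hf' : MultiAdd f') (hff : OLinOver gr' x' x i f f') :
    OLin gr x i (fun l v => op gr hs.length h hs K l f v)
      (fun l v => ((hs.length : ℤ) * i).negOnePow • op gr hs.length h hs K l f' v) := by
  have hsucc : ∀ (N : ℤ) (y : W), ((N + 1) * i).negOnePow • i.negOnePow • y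
      = (N * i).negOnePow • y := by
    intro N y
    rw [smul_smul, ← negOnePow_add, show (N + 1) * i + i = N * i + 2 * i by ring,
      negOnePow_add, negOnePow_two_mul, mul_one]
  have hmap : ∀ (N : ℤ) (e : ℤˣ) h (hs : Steps A A' V V') K l (f : List A' → V' → W) v,
      op gr N h hs K l (e • f) v = e • op gr N h hs K l f v := fun N e h hs K l f v =>
    op_map gr (toAddMonoidHom W e) N h hs K l f v
  have hmapx : ∀ (N : ℤ) h (hs : Steps A A' V V') K l (f : List A' → V' → W) v,
      op gr N h hs K l (fun y w => x • f y w) v = x • op gr N h hs K l f v :=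
    fun N h hs K l f v => op_map gr (toAddMonoidHom W x) N h hs K l f v
  have key := op_induction (P := fun (hs : Steps A A' V V') K p => ∀ (h : Vtx A A' V V')
      (f f' : List A' → V' → W), PathLinear gr gr' x x' h hs → MultiAdd f → MultiAdd f' →
      OLinOver gr' x' x i f f' →
      (∀ a l v, op gr hs.length h hs K (p ++ x * a :: l) f v = x • ((hs.length : ℤ) * i).negOnePow •
        op gr hs.length h hs K (p.map (bar gr i) ++ a :: l) f' v) ∧
      (∀ v, op gr hs.length h hs K p f (x • v) = i.negOnePow • x • ((hs.length : ℤ) * i).negOnePow •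
        op gr hs.length h hs K (p.map (bar gr i)) f' v)) (by
    intro hs K p hK hS hP h f f' H hf hf' hff
    obtain ⟨ε, hε⟩ : ∃ ε, ε = ((hs.length : ℤ) * i).negOnePow := ⟨_, rfl⟩
    simp only [← hε] at hK hP ⊢
    have hβ : bar gr' i h.β = h.β := bar_of_mem_one gr' i H.vtx.graded.β_mem
    have hffβ := hff.cons h.β
    rw [hβ] at hffβ
    constructor
    · intro a l v
      have e1 : shift (fun K' => op gr hs.length h hs K' (p ++ x * a :: l) (consF h.β f) v) K
          = x • ε • shift (fun K' =>
            op gr hs.length h hs K' (p.map (bar gr i) ++ a :: l) (consF h.β f') v) K := by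
        cases K with
        | zero => simp
        | succ K => exact (hK K rfl h _ _ H (hf.cons _) (hf'.cons _) hffβ).1 a l v
      have e2 : stepMove hs (fun s hs' =>
            op gr (hs.length - 1) s.2 hs' K (p ++ x * a :: l) (consF s.1 f) v)
          = x • ε • stepMove hs (fun s hs' =>
            op gr (hs.length - 1) s.2 hs' K (p.map (bar gr i) ++ a :: l) (consF s.1 f') v) := by
        cases hs with
        | nil => simp
        | cons s hs =>
          subst hε
          have := (hS s hs rfl s.2 _ _ H.tail (hf.cons _) (hf'.cons _) (hff.cons s.1)).1 a l v
          rw [bar_of_mem_zero gr' i (H.step s (by simp)).1, hf'.consF_units_smul, hmap] at this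
          simp only [stepMove_cons, length_cons, Nat.cast_add, Nat.cast_one, add_sub_cancel_right]
          rw [this, ← hsucc, smul_comm i.negOnePow i.negOnePow, negOnePow_smul_smul]
      have e3 : stepMove (p ++ x * a :: l) (fun a l' =>
            op gr hs.length h hs K l' (consF (h.θ (bar gr hs.length a)) f) v)
          = x • ε • stepMove (p.map (bar gr i) ++ a :: l) (fun a l' =>
            op gr hs.length h hs K l' (consF (h.θ (bar gr hs.length a)) f') v) := by
        cases p with
        | nil =>
          simp only [nil_append, map_nil, stepMove_cons]
          rw [hx.bar, ← hε, map_units_smul, H.vtx.θ, hf.consF_units_smul, hmap,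
            show consF (x' * h.θ (bar gr hs.length a)) f
              = fun y w => x • consF (h.θ (bar gr hs.length a)) f' y w from
              funext fun y => funext fun w => hff.entry [] _ y w, hmapx, smul_units_smul]
        | cons b p =>
          have := (hP b p rfl h _ _ H (hf.cons _) (hf'.cons _)
            (hff.cons (h.θ (bar gr hs.length b)))).1 a l v
          simp only [cons_append, map_cons, stepMove_cons]
          rw [this, bar_map_zero gr gr' h.θ H.vtx.graded.θ_mem, bar_bar, bar_bar, add_comm i]
      rw [op_rec, op_rec gr hs.length h hs K (p.map (bar gr i) ++ a :: l), e1, e2, e3]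
      simp only [smul_add]
      congr 1
      simp
    · intro v
      have e1 : shift (fun K' => op gr hs.length h hs K' p (consF h.β f) (x • v)) K
          = i.negOnePow • x • ε • shift (fun K' =>
            op gr hs.length h hs K' (p.map (bar gr i)) (consF h.β f') v) K := by
        cases K with
        | zero => simp
        | succ K => exact (hK K rfl h _ _ H (hf.cons _) (hf'.cons _) hffβ).2 v
      have e2 : stepMove hs (fun s hs' => op gr (hs.length - 1) s.2 hs' K p (consF s.1 f) (x • v))
          = i.negOnePow • x • ε • stepMove hs (fun s hs' =>
            op gr (hs.length - 1) s.2 hs' K (p.map (bar gr i)) (consF s.1 f') v) := by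
        cases hs with
        | nil => simp
        | cons s hs =>
          subst hε
          have := (hS s hs rfl s.2 _ _ H.tail (hf.cons _) (hf'.cons _) (hff.cons s.1)).2 v
          rw [bar_of_mem_zero gr' i (H.step s (by simp)).1, hf'.consF_units_smul, hmap] at this
          simp only [stepMove_cons, length_cons, Nat.cast_add, Nat.cast_one, add_sub_cancel_right]
          rw [this, ← hsucc, smul_comm i.negOnePow i.negOnePow, negOnePow_smul_smul]
      have e3 : stepMove p (fun a l' =>
            op gr hs.length h hs K l' (consF (h.θ (bar gr hs.length a)) f) (x • v))
          = i.negOnePow • x • ε • stepMove (p.map (bar gr i))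
            (fun a l' => op gr hs.length h hs K l' (consF (h.θ (bar gr hs.length a)) f') v) := by
        cases p with
        | nil => simp
        | cons b p =>
          have := (hP b p rfl h _ _ H (hf.cons _) (hf'.cons _)
            (hff.cons (h.θ (bar gr hs.length b)))).2 v
          simp only [map_cons, stepMove_cons]
          rw [this, bar_map_zero gr gr' h.θ H.vtx.graded.θ_mem, bar_bar, bar_bar, add_comm i]
      have e4 : (if hs = [] ∧ p = [] ∧ K = 0 then f [] (h.ν (x • v)) else 0) = i.negOnePow • x • ε •
            (if hs = [] ∧ p.map (bar gr i) = [] ∧ K = 0 then f' [] (h.ν v) else 0) := by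
        simp only [List.map_eq_nil_iff]
        split_ifs with hc
        · obtain ⟨rfl, rfl, rfl⟩ := hc
          rw [H.vtx.ν, hff.right]
          simp [hε]
        · simp
      rw [op_rec, op_rec gr hs.length h hs K (p.map (bar gr i)), e1, e2, e3, e4]
      simp only [smul_add])
  exact ⟨fun p a l v => (key hs K p h f f' H hf hf' hff).1 a l v,
    fun p v => (key hs K p h f f' H hf hf' hff).2 v⟩

end Central

/-! ## The standard complex -/

section Degrees

variable {A V W : Type*} [Ring A] {gr : ℤ → AddSubgroup A} [AddCommGroup V] [AddCommGroup W]
  {𝒱 : ℤ → AddSubgroup V} {𝒲 : ℤ → AddSubgroup W}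

/-- The values of `f` have the degrees of the values of a function of degree `m`. -/
def StrDeg (gr : ℤ → AddSubgroup A) (𝒱 : ℤ → AddSubgroup V) (𝒲 : ℤ → AddSubgroup W) (m : ℤ)
    (f : List A → V → W) : Prop :=
  ∀ (l : List A) (e : List ℤ) (j : ℤ) (v : V), List.Forall₂ (fun a i => a ∈ gr i) l e → v ∈ 𝒱 j →
    f l v ∈ 𝒲 (e.sum + j + m - l.length)

lemma StrDeg.cons {m : ℤ} {f : List A → V → W} (h : StrDeg gr 𝒱 𝒲 m f) {a : A} {i : ℤ}
    (ha : a ∈ gr i) : StrDeg gr 𝒱 𝒲 (m + i - 1) (consF a f) := by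
  intro l e j v hl hv
  have := h (a :: l) (i :: e) j v (List.Forall₂.cons ha hl) hv
  change f (a :: l) v ∈ _
  grind

end Degrees

section Structure

variable {A A' V V' W W' : Type*} [Ring A] {gr : ℤ → AddSubgroup A} [GradedRing gr] [Ring A']
  {gr' : ℤ → AddSubgroup A'} [GradedRing gr'] {C : Curved gr} {C' : Curved gr'}
  [AddCommGroup V] [Module A V] [AddCommGroup V'] [Module A' V'] [AddCommGroup W] [Module A W]
  [AddCommGroup W'] [Module A' W'] (CV : CurvedMod C V) (CW : CurvedMod C W)
  (CV' : CurvedMod C' V') (CW' : CurvedMod C' W') {𝒱 : ℤ → AddSubgroup V} {𝒲 : ℤ → AddSubgroup W}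

lemma StrDeg.strB {m : ℤ} {f : List A → V → W} (h : StrDeg gr 𝒱 𝒲 m f)
    (hV : ∀ i j a v, a ∈ gr i → v ∈ 𝒱 j → a • v ∈ 𝒱 (i + j))
    (hD : ∀ j v, v ∈ 𝒱 j → CV.D v ∈ 𝒱 (j + 1)) : StrDeg gr 𝒱 𝒲 (m + 1) (strB CV f) := by
  intro l e j v hl hv
  induction hl generalizing m f with
  | nil =>
    have h1 := h [C.R] [2] j v (List.Forall₂.cons C.R_mem List.Forall₂.nil) hv
    have h2 := h [] [] (j + 1) (CV.D v) List.Forall₂.nil (hD j v hv)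
    rw [InnerAct.strB]
    refine add_mem ?_ ?_
    all_goals grind
  | @cons a i l e ha hl ih =>
    have h1 := h (C.R :: a :: l) (2 :: i :: e) j v
      (List.Forall₂.cons C.R_mem (List.Forall₂.cons ha hl)) hv
    have h2 := h (C.D a :: l) ((i + 1) :: e) j v (List.Forall₂.cons (C.D_mem ha) hl) hv
    have h3 : mulFirst gr a f l v ∈ 𝒲 (i + e.sum + j + m - l.length) := by
      cases hl with
      | nil =>
        rw [mulFirst]
        refine neg_mem ?_
        convert h [] [] _ _ List.Forall₂.nil (hV i j a v ha hv) using 2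
        simp
      | @cons b i' l e hb hl =>
        rw [mulFirst]
        convert h (bar gr 1 a * b :: l) ((i + i') :: e) j v
          (List.Forall₂.cons (SetLike.mul_mem_graded (bar_mem gr 1 ha) hb) hl) hv using 2
        simp; ring
    have h4 := ih (h.cons (bar_mem gr 1 ha))
    rw [strB_cons_apply]
    refine add_mem (add_mem (sub_mem ?_ ?_) ?_) ?_
    · convert h1 using 2; simp; ring
    · convert h2 using 2; simp; ring
    · convert h3 using 2; simp; ring
    · convert h4 using 2; simp; ring

lemma StrDeg.strD {m : ℤ} {f : List A → V → W} (h : StrDeg gr 𝒱 𝒲 m f)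
    (hV : ∀ i j a v, a ∈ gr i → v ∈ 𝒱 j → a • v ∈ 𝒱 (i + j))
    (hD : ∀ j v, v ∈ 𝒱 j → CV.D v ∈ 𝒱 (j + 1))
    (hW : ∀ i j a v, a ∈ gr i → v ∈ 𝒲 j → a • v ∈ 𝒲 (i + j))
    (hDW : ∀ j v, v ∈ 𝒲 j → CW.D v ∈ 𝒲 (j + 1)) : StrDeg gr 𝒱 𝒲 (m + 1) (strD CV CW m f) := by
  intro l e j v hl hv
  have h1 := h.strB CV hV hD l e j v hl hv
  have h2 := hDW _ _ (h l e j v hl hv)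
  refine add_mem (add_mem (units_smul_mem _ _ ?_) ?_) h1
  · grind
  · cases hl with
    | nil => exact zero_mem _
    | @cons a i l e ha hl =>
      change koszul gr m a • f l v ∈ _
      convert hW _ _ _ _ (koszul_mem gr m ha) (h l e j v hl hv) using 2
      simp; ring

lemma strB_eq_zero {f : List A → V → W} (N : ℕ) (hf : ∀ l v, N ≤ l.length → f l v = 0)
    (l : List A) (v : V) (hl : N ≤ l.length - 1) : strB CV f l v = 0 := by
  induction l generalizing N f with
  | nil =>
    have hN : N = 0 := by simpa using hl
    rw [strB, hf _ _ (by omega), hf _ _ (by omega), add_zero]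
  | cons a l ih =>
    have hN : N ≤ l.length := by simpa using hl
    have h1 : mulFirst gr a f l v = 0 := by
      cases l with
      | nil => rw [mulFirst, hf _ _ (by simpa using hN), neg_zero]
      | cons b l => rw [mulFirst, hf _ _ (by simpa using hN)]
    rw [strB_cons_apply, hf _ _ (by simp; omega), hf _ _ (by simp; omega), h1,
      ih (f := consF (bar gr 1 a) f) (N - 1)
        (fun l v h => hf (bar gr 1 a :: l) v (by simp; omega)) (by omega)]
    simp

lemma strD_eq_zero {f : List A → V → W} (m : ℤ) (N : ℕ) (hf : ∀ l v, N ≤ l.length → f l v = 0)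
    (l : List A) (v : V) (hl : N + 1 ≤ l.length) : strD CV CW m f l v = 0 := by
  rw [strD, Pi.add_apply, Pi.add_apply, strB_eq_zero CV N hf l v (by omega), frontD,
    hf l v (by omega)]
  cases l with
  | nil => simp at hl
  | cons a l => simp [hf l v (by simpa using hl)]

/-- A homomorphism of graded rings and modules with connections. -/
structure CurvedHom (ρ : A →+* A') (σ : V →+ V') : Prop where
  mem : ∀ {i a}, a ∈ gr i → ρ a ∈ gr' i
  R : ρ C.R = C'.R
  D : ∀ a, ρ (C.D a) = C'.D (ρ a)
  smul : ∀ (a : A) (v : V), σ (a • v) = ρ a • σ v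
  DV : ∀ v, σ (CV.D v) = CV'.D (σ v)

lemma strB_res {ρ : A →+* A'} {σ : V →+ V'} (h : CurvedHom CV CV' ρ σ) (τ : W →+ W')
    {f : List A → V → W} {f' : List A' → V' → W'} (hf : ∀ l v, τ (f l v) = f' (l.map ρ) (σ v))
    (l : List A) (v : V) : τ (strB CV f l v) = strB CV' f' (l.map ρ) (σ v) := by
  have hb : ∀ a, bar gr' 1 (ρ a) = ρ (bar gr 1 a) := fun a =>
    bar_map_zero gr gr' ρ.toAddMonoidHom h.mem 1 a
  induction l generalizing f f' with
  | nil => simp [strB, hf, h.R, h.DV]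
  | cons a l ih =>
    have h1 : τ (mulFirst gr a f l v) = mulFirst gr' (ρ a) f' (l.map ρ) (σ v) := by
      cases l <;> simp [mulFirst, hf, h.smul, hb]
    have h2 := ih (f := consF (bar gr 1 a) f) (f' := consF (bar gr' 1 (ρ a)) f')
      (fun l v => by simp [hf, hb])
    rw [strB_cons_apply, map_cons, strB_cons_apply, map_add, map_add, map_sub, h1, h2]
    simp [hf, h.R, h.D]

lemma strD_res {ρ : A →+* A'} {σ : V →+ V'} (h : CurvedHom CV CV' ρ σ) {τ : W →+ W'}
    (hτ : CurvedHom CW CW' ρ τ) (m : ℤ) {f : List A → V → W} {f' : List A' → V' → W'}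
    (hf : ∀ l v, τ (f l v) = f' (l.map ρ) (σ v)) (l : List A) (v : V) :
    τ (strD CV CW m f l v) = strD CV' CW' m f' (l.map ρ) (σ v) := by
  have hb : ∀ a, koszul gr' m (ρ a) = ρ (koszul gr m a) := fun a =>
    koszul_map_zero gr gr' ρ.toAddMonoidHom h.mem m a
  have h1 := strB_res CV CV' h τ hf l v
  rw [strD, strD, Pi.add_apply, Pi.add_apply, Pi.add_apply, Pi.add_apply, map_add, h1, frontD,
    frontD, map_add, map_units_smul, hτ.DV, hf]
  cases l <;> simp [hτ.smul, hb, hf]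

end Structure

variable {𝕋 : Type u} [Category.{v} 𝕋] {O : DGScalars.{u, v, w₂} 𝕋}
  {F : GroupoidPresheaf.{u, v, w} 𝕋} {A : OAlg O F} {act : InnerAction A}
  {conn : FlatConnection act} {V W : CompatModule conn} {κ : CochainKind} {r q p : El F} {m i : ℤ}
  {n : ℕ} {φ : Raw V W p} {ω : O.obj p.base} {S : 𝕋} {x y z : F.Ob S} {c₀ : (A.obj p)ˣ}
  {cs : List (A.obj p)ˣ}

/-- The connection on the sections over `q`. -/
def FlatConnection.curved (conn : FlatConnection act) (q : El F) : Curved (A.gr q) where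
  D := conn.D q
  R := conn.R q
  D_mem := conn.D_mem
  R_mem := conn.R_mem q
  D_mul := conn.D_mul q
  D_D := conn.D_D q
  D_R := conn.D_R q

/-- The connection on the sections of the module over `q`. -/
def CompatModule.curvedMod (V : CompatModule conn) (q : El F) :
    CurvedMod (conn.curved q) (V.obj q) where
  D := V.D q
  D_D := V.D_D q
  D_smul := V.D_smul q

lemma IsCochain.multiAdd (h : IsCochain κ p m φ) (k : q ⟶ p) : MultiAdd (φ q k) :=
  ⟨fun l l' a b v => h.add_entry k l l' a b v, fun l v v' => h.add_right k l v v'⟩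

lemma strB_eq {f : List (A.obj q) → V.obj q → W.obj q} (l : List (A.obj q)) (v : V.obj q) :
    strB (V.curvedMod q) f l v = insertSigned (A.gr q) (conn.R q) (fun x => f x v) l
        - deriveEntries (A.gr q) (conn.D q) (fun x => f x v) l
        + mulAdjacent (A.gr q) (fun x => f x v) l - (if h : l = [] then 0
          else f (l.dropLast.map (bar (A.gr q) 1)) (l.getLast h • v))
        + f (l.map (bar (A.gr q) 1)) (V.D q v) := by
  induction l generalizing f with
  | nil =>
    simp only [strB, insertSigned, deriveEntries, mulAdjacent]
    simp; rfl
  | cons a l ih =>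
    rw [strB_cons_apply, ih, insertSigned, deriveEntries]
    cases l with
    | nil =>
      simp only [mulFirst, mulAdjacent, consF_apply]
      simp
      change _ - f [conn.D q a] v + _ + _ = _
      have : f [(conn.curved q).R, a] v = f [conn.R q, a] v := rfl
      rw [this]; abel
    | cons b l =>
      simp only [mulFirst, mulAdjacent, consF_apply, reduceCtorEq, dite_false,
        List.dropLast_cons_cons, map_cons, List.getLast_cons_cons]
      change f (conn.R q :: a :: b :: l) v - f (conn.D q a :: b :: l) v + _ + _ = _
      abel

lemma totalD_eq (m : ℤ) (φ : Raw V W p) (q : El F) (k : q ⟶ p) :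
    totalD m φ q k = strD (V.curvedMod q) (W.curvedMod q) m (φ q k) := by
  funext l v
  have h2 : delta m φ q k l v = stepMove l (fun a l' => koszul (A.gr q) m a • φ q k l' v)
      + mulAdjacent (A.gr q) (fun x => φ q k x v) l - (if h : l = [] then 0
        else φ q k (l.dropLast.map (bar (A.gr q) 1)) (l.getLast h • v)) := by
    cases l <;> rfl
  have h3 : (m + 1).negOnePow • m.negOnePow • φ q k (l.map (bar (A.gr q) 1)) (V.D q v)
      = -φ q k (l.map (bar (A.gr q) 1)) (V.D q v) := by
    rw [negOnePow_succ, Units.neg_smul, negOnePow_smul_smul]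
  have h1 : totalD m φ q k l v = delta m φ q k l v + nablaHom m φ q k l v
    + curvatureTerm φ q k l v := rfl
  rw [h1, strD, Pi.add_apply, Pi.add_apply, frontD, strB_eq, h2, nablaHom, curvatureTerm,
    smul_sub, h3]
  change _ = (m + 1).negOnePow • W.D q (φ q k l v) + _ + _
  abel

lemma central_η {ω : O.obj q.base} (hω : ω ∈ O.gr q.base i) : Central (A.gr q) (A.η q ω) i := by
  refine ⟨A.η_mem hω, fun a => ?_⟩
  refine addHom_ext_homogeneous (A.gr q) (f := AddMonoidHom.mulRight (A.η q ω))
    (g := (AddMonoidHom.mulLeft (A.η q ω)).comp (koszul (A.gr q) i)) (fun j a ha => ?_) a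
  change a * A.η q ω = A.η q ω * koszul (A.gr q) i a
  rw [koszul_of_mem _ i ha, mul_units_smul, A.η_comm hω ha, negOnePow_smul_smul]

/-- Linearity of a cochain in all arguments. -/
lemma IsCochain.olin (h : IsCochain κ p m φ) (k : q ⟶ p) {ω : O.obj q.base}
    (hω : ω ∈ O.gr q.base i) :
    OLin (A.gr q) (A.η q ω) i (φ q k) ((i * (m + 1)).negOnePow • φ q k) := by
  have hm := h.multiAdd k
  have hc : Central (A.gr q) (A.η q ω) i := central_η hω
  have e1 : ∀ p a l v, φ q k (p ++ A.η q ω * a :: l) v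
      = (i * (m + 1)).negOnePow • A.η q ω • φ q k (p.map (bar (A.gr q) i) ++ a :: l) v := by
    intro p
    induction p using List.reverseRecOn with
    | nil => intro a l v; exact h.linear_first k a l v hω
    | append_singleton p b ih =>
      intro a l v
      have g1 := h.linear_middle k p l b a v hω
      rw [hc.comm, ih] at g1
      rw [append_assoc, singleton_append, ← negOnePow_smul_smul i (φ q k _ v), ← g1, koszul_eq_bar]
      rw [show φ q k (p.map (bar (A.gr q) i) ++ i.negOnePow • bar (A.gr q) i b :: a :: l) v
        = i.negOnePow • φ q k (p.map (bar (A.gr q) i) ++ bar (A.gr q) i b :: a :: l) v from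
        map_units_smul (AddMonoidHom.mk' (fun b => φ q k (p.map (bar (A.gr q) i) ++ b :: a :: l) v)
          fun b c => hm.entry _ _ b c v) _ _, smul_units_smul, smul_comm i.negOnePow,
        negOnePow_smul_smul]
      simp
  constructor
  · intro p a l v
    rw [e1, Pi.smul_apply, Pi.smul_apply, smul_units_smul]
  · intro p v
    rw [Pi.smul_apply, Pi.smul_apply, smul_units_smul]
    rcases List.eq_nil_or_concat p with rfl | ⟨p, b, rfl⟩
    · rw [h.linear_nil k v hω, map_nil, smul_smul, ← negOnePow_add,
        negOnePow_eq_of (show i + i * (m + 1) = i * m + 2 * i by ring)]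
    · rw [List.concat_eq_append, ← h.linear_last, hc.comm, e1, koszul_eq_bar]
      rw [show φ q k (p.map (bar (A.gr q) i) ++ [i.negOnePow • bar (A.gr q) i b]) v
        = i.negOnePow • φ q k (p.map (bar (A.gr q) i) ++ [bar (A.gr q) i b]) v from
        map_units_smul (AddMonoidHom.mk' (fun b => φ q k (p.map (bar (A.gr q) i) ++ [b]) v)
          fun b c => hm.entry _ _ b c v) _ _]
      simp only [smul_units_smul]
      rw [smul_comm i.negOnePow (i * (m + 1)).negOnePow]
      simp

/-- Construction of cochains from the uniform linearity condition. -/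
lemma IsCochain.of_olin (hm : ∀ {q : El F} (k : q ⟶ p), MultiAdd (φ q k))
    (hres : ∀ {r q : El F} (k' : r ⟶ q) (k : q ⟶ p) (l : List (A.obj q)) (v : V.obj q), W.res k'
    (φ q k l v) = φ r (k' ≫ k) (l.map (A.res k')) (V.res k' v))
    (hdeg : ∀ {q : El F} (k : q ⟶ p) {l : List (A.obj q)} {e : List ℤ} {j : ℤ} {v : V.obj q},
    List.Forall₂ (fun a i => a ∈ A.gr q i) l e → v ∈ V.gr q j → φ q k l v ∈ W.gr q
    (e.sum + j + m - l.length))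
    (hlin : ∀ {q : El F} (k : q ⟶ p) {i : ℤ} {ω : O.obj q.base}, ω ∈ O.gr q.base i → OLin (A.gr q)
    (A.η q ω) i (φ q k) ((i * (m + 1)).negOnePow • φ q k))
    (hbdd : κ = CochainKind.sum → ∃ N : ℕ, ∀ (q : El F) (k : q ⟶ p) (l : List (A.obj q))
    (v : V.obj q), N ≤ l.length → φ q k l v = 0) :
    IsCochain κ p m φ := by
  have hcomm : ∀ {q : El F} (k : q ⟶ p) {i : ℤ} {ω : O.obj q.base}, ω ∈ O.gr q.base i →
      ∀ (l l' : List (A.obj q)) (a : A.obj q) (v : V.obj q),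
      φ q k (l ++ a * A.η q ω :: l') v = (i * (m + 1)).negOnePow • i.negOnePow • A.η q ω •
        φ q k ((l ++ [a]).map (bar (A.gr q) i) ++ l') v := by
    intro q k i ω hω l l' a v
    rw [(central_η hω).comm, (hlin k hω).entry, koszul_eq_bar, Pi.smul_apply, Pi.smul_apply]
    rw [show φ q k (l.map (bar (A.gr q) i) ++ i.negOnePow • bar (A.gr q) i a :: l') v
        = i.negOnePow • φ q k (l.map (bar (A.gr q) i) ++ bar (A.gr q) i a :: l') v from
        map_units_smul (AddMonoidHom.mk' (fun b => φ q k (l.map (bar (A.gr q) i) ++ b :: l') v)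
          fun b c => (hm k).entry _ _ b c v) _ _, smul_units_smul, smul_units_smul]
    simp
  refine ⟨fun k' k l v => hres k' k l v, fun k l l' a b v => (hm k).entry l l' a b v,
    fun k l v v' => (hm k).right l v v', fun k => hdeg k, ?_, ?_, ?_, ?_, hbdd⟩
  · intro q k i ω v hω
    rw [(hlin k hω).right, Pi.smul_apply, Pi.smul_apply, smul_units_smul, smul_smul,
      ← negOnePow_add, negOnePow_eq_of (show i + i * (m + 1) = i * m + 2 * i by ring)]
    rfl
  · intro q k i ω a l v hω
    have := (hlin k hω).entry [] a l v
    simp only [nil_append] at this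
    rw [this, Pi.smul_apply, Pi.smul_apply, smul_units_smul]; rfl
  · intro q k i ω l l' a b v hω
    rw [hcomm k hω]
    have := (hlin k hω).entry (l ++ [a]) b l' v
    simp only [append_assoc, singleton_append] at this
    rw [this, Pi.smul_apply, Pi.smul_apply]
    simp only [smul_units_smul]
    rw [smul_comm i.negOnePow (i * (m + 1)).negOnePow]
  · intro q k ω l a v
    have hadd : (AddMonoidHom.mk' (fun ω => φ q k (l ++ [a * A.η q ω]) v) fun ω ω' => by
          rw [map_add, mul_add, (hm k).entry] : O.obj q.base →+ W.obj q)
        = AddMonoidHom.mk' (fun ω => φ q k (l ++ [a]) (A.η q ω • v)) fun ω ω' => by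
          rw [map_add, add_smul, (hm k).right] := by
      refine AddMonoidHom.ext fun ω => addHom_ext_homogeneous (O.gr q.base) (fun i ω hω => ?_) ω
      change φ q k (l ++ [a * A.η q ω]) v = φ q k (l ++ [a]) (A.η q ω • v)
      rw [hcomm k hω, (hlin k hω).right, Pi.smul_apply, Pi.smul_apply, smul_units_smul, smul_comm,
        append_nil]
    exact DFunLike.congr_fun hadd ω

lemma curvedHom (V : CompatModule conn) (k : r ⟶ q) :
    CurvedHom (V.curvedMod q) (V.curvedMod r) (A.res k) (V.res k) :=
  ⟨fun h => A.res_mem k h, conn.R_res k, fun a => (conn.D_res k a).symm, V.res_smul k,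
    fun v => (V.D_res k v).symm⟩

lemma strDeg_of (h : IsCochain κ p m φ) (k : q ⟶ p) : StrDeg (A.gr q) (V.gr q) (W.gr q) m (φ q k) :=
  fun _ _ _ _ hl hv => h.degree k hl hv

lemma totalD_mem (h : φ ∈ cochains V W κ p m) : totalD m φ ∈ cochains V W κ p (m + 1) := by
  replace h : IsCochain κ p m φ := h
  refine IsCochain.of_olin ?_ ?_ ?_ ?_ ?_
  · intro q k
    rw [totalD_eq]
    exact (h.multiAdd k).strD _ _ m
  · intro r q k' k l v
    rw [totalD_eq, totalD_eq]
    exact strD_res _ _ _ _ (curvedHom V k') (curvedHom W k') m (fun l v => h.res k' k l v) l v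
  · intro q k l e j v hl hv
    rw [totalD_eq]
    exact (strDeg_of h k).strD _ _ (fun i j a v ha hv => V.smul_mem ha hv)
      (fun j v hv => V.D_mem hv) (fun i j a v ha hv => W.smul_mem ha hv)
      (fun j v hv => W.D_mem hv) l e j v hl hv
  · intro q k i ω hω
    rw [totalD_eq]
    have h1 := h.olin k hω
    have h2 := h.olin k (O.d_mem hω)
    rw [← conn.D_η] at h2
    have := strD_olin (V.curvedMod q) (W.curvedMod q) m (central_η hω) (h.multiAdd k) h1 h2
    grind
  · intro hκ
    obtain ⟨N, hN⟩ := h.bounded hκ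
    refine ⟨N + 1, fun q k l v hl => ?_⟩
    rw [totalD_eq]
    exact strD_eq_zero _ _ m N (fun l v h => hN q k l v h) l v hl

lemma totalD_totalD (h : φ ∈ cochains V W κ p m) : totalD (m + 1) (totalD m φ) = 0 := by
  funext q k
  rw [totalD_eq, totalD_eq]
  funext l v
  exact strD_strD _ _ m (IsCochain.multiAdd h k) l v

lemma totalD_add (m : ℤ) (φ ψ : Raw V W p) : totalD m (φ + ψ) = totalD m φ + totalD m ψ := by
  funext q k l v
  rw [totalD_eq, Pi.add_apply, Pi.add_apply, Pi.add_apply, Pi.add_apply, totalD_eq, totalD_eq]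
  simp only [strD, Pi.add_apply]
  rw [frontD_add, strB_add]
  simp only [Pi.add_apply]
  abel

lemma restrict_mem (k : q ⟶ p) (h : φ ∈ cochains V W κ p m) :
    Raw.restrict k φ ∈ cochains V W κ q m := by
  replace h : IsCochain κ p m φ := h
  refine IsCochain.of_olin (fun k' => h.multiAdd _) ?_ (fun k' => h.degree _)
    (fun k' => h.olin _) ?_
  · intro r q' k' k'' l v
    exact (h.res k' (k'' ≫ k) l v).trans (by rw [Raw.restrict, Category.assoc])
  · intro hκ
    obtain ⟨N, hN⟩ := h.bounded hκ
    exact ⟨N, fun q' k' l v hl => hN _ _ l v hl⟩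

lemma scale_apply (hω : ω ∈ O.gr p.base i) (φ : Raw V W p) (q : El F) (k : q ⟶ p)
    (l : List (A.obj q)) (v : V.obj q) :
    Raw.scale m ω φ q k l v = (i * m + i * (i + 1) / 2).negOnePow •
      A.η q (O.res (El.Hom.map k) ω) • φ q k l v := by
  rw [Raw.scale, signBy_of_mem _ _ hω, map_units_smul, map_units_smul, units_smul_smul]

lemma scale_mem (hω : ω ∈ O.gr p.base i) (h : φ ∈ cochains V W κ p m) :
    Raw.scale m ω φ ∈ cochains V W κ p (i + m) := by
  replace h : IsCochain κ p m φ := h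
  have hres : ∀ {q : El F} (k : q ⟶ p), A.η q (O.res (El.Hom.map k) ω) ∈ A.gr q i := fun k =>
    A.η_mem (O.res_mem _ hω)
  refine IsCochain.of_olin ?_ ?_ ?_ ?_ ?_
  · intro q k
    constructor
    · intro l l' a b v
      simp only [scale_apply hω, h.add_entry, smul_add]
    · intro l v v'
      simp only [scale_apply hω, h.add_right, smul_add]
  · intro r q k' k l v
    rw [scale_apply hω, scale_apply hω, map_units_smul, W.res_smul, h.res, A.η_res, ← O.res_comp]
    rfl
  · intro q k l e j v hl hv
    rw [scale_apply hω]
    refine units_smul_mem _ _ ?_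
    convert W.smul_mem (hres k) (h.degree k hl hv) using 2
    ring
  · intro q k j ω' hω'
    have h1 := h.olin k hω'
    have hsg : ∀ y : W.obj q, A.η q (O.res (El.Hom.map k) ω) • A.η q ω' • y
        = (i * j).negOnePow • A.η q ω' • A.η q (O.res (El.Hom.map k) ω) • y := by
      intro y
      rw [smul_smul, (central_η hω').comm, koszul_of_mem _ j (hres k), mul_units_smul,
        units_smul_smul, smul_smul, mul_comm j i]
    have hsg2 : ∀ y : W.obj q, (i * j).negOnePow • (j * (m + 1)).negOnePow • y
        = (j * (i + m + 1)).negOnePow • y := by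
      intro y; rw [smul_smul, ← negOnePow_add]; congr 2; ring
    constructor
    · intro p a l v
      rw [scale_apply hω, h1.entry]
      simp only [Pi.smul_apply, scale_apply hω, smul_units_smul, hsg]
      rw [smul_comm ((j * (m + 1)).negOnePow), hsg2, smul_comm]
    · intro p v
      rw [scale_apply hω, h1.right]
      simp only [Pi.smul_apply, scale_apply hω, smul_units_smul, hsg]
      rw [smul_comm ((j * (m + 1)).negOnePow), hsg2]
      simp only [smul_smul, ← negOnePow_add]
      congr 2
      ring_nf
  · intro hκ
    obtain ⟨N, hN⟩ := h.bounded hκ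
    exact ⟨N, fun q k l v hl => by rw [scale_apply hω, hN _ _ _ _ hl, smul_zero, smul_zero]⟩

lemma koszul_two_mul {A : Type*} [Ring A] (gr : ℤ → AddSubgroup A) [GradedRing gr] (n : ℤ) (a : A) :
    koszul gr (2 * n) a = a := by
  rw [koszul_eq_bar, bar_two_mul, negOnePow_two_mul, one_smul]

lemma signBy_map {A A' : Type*} [Ring A] (gr : ℤ → AddSubgroup A) [GradedRing gr] [Ring A']
    (gr' : ℤ → AddSubgroup A') [GradedRing gr'] (f : A →+ A') (hf : ∀ {i a}, a ∈ gr i → f a ∈ gr' i)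
    (e : ℤ → ℤ) (a : A) : signBy gr' e (f a) = f (signBy gr e a) := by
  refine addHom_ext_homogeneous gr (f := (signBy gr' e).comp f) (g := f.comp (signBy gr e))
    (fun i a ha => ?_) a
  change signBy gr' e (f a) = f (signBy gr e a)
  rw [signBy_of_mem _ _ ha, signBy_of_mem _ _ (hf ha), map_units_smul]

lemma strD_units_smul {A V W : Type*} [Ring A] {gr : ℤ → AddSubgroup A} [GradedRing gr]
    {C : Curved gr} [AddCommGroup V] [Module A V] [AddCommGroup W] [Module A W]
    (CV : CurvedMod C V) (CW : CurvedMod C W) (e : ℤˣ) (m : ℤ) (f : List A → V → W) (l : List A)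
    (v : V) : strD CV CW m (fun l v => e • f l v) l v = e • strD CV CW m f l v := by
  have hB : strB CV (fun l v => e • f l v) l v = e • strB CV f l v :=
    strB_map CV (toAddMonoidHom W e) f l v
  rw [strD, strD, Pi.add_apply, Pi.add_apply, Pi.add_apply, Pi.add_apply, hB, smul_add, frontD,
    frontD, map_units_smul, smul_add, smul_comm e]
  cases l <;> simp [smul_units_smul]

lemma strD_central {A V W : Type*} [Ring A] {gr : ℤ → AddSubgroup A} [GradedRing gr]
    {C : Curved gr} [AddCommGroup V] [Module A V] [AddCommGroup W] [Module A W]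
    (CV : CurvedMod C V) (CW : CurvedMod C W) {x : A} (hx : Central gr x i) (m : ℤ)
    (f : List A → V → W) (l : List A) (v : V) : strD CV CW (i + m) (fun l v => x • f l v) l v
      = (i + m + 1).negOnePow • C.D x • f l v + x • strD CV CW m f l v := by
  have hB : strB CV (fun l v => x • f l v) l v = x • strB CV f l v :=
    strB_map CV (toAddMonoidHom W x) f l v
  rw [strD, strD, Pi.add_apply, Pi.add_apply, Pi.add_apply, Pi.add_apply, hB, smul_add,
    ← add_assoc, frontD, frontD, CW.D_smul, koszul_of_mem _ 1 hx.mem, smul_add, smul_add,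
    units_smul_smul, smul_smul ((i + m + 1).negOnePow) _ (x • _), ← negOnePow_add,
    negOnePow_eq_of (show i + m + 1 + 1 * i = (m + 1) + 2 * i by ring), smul_units_smul]
  have h2 : stepMove l (fun a l' => koszul gr (i + m) a • x • f l' v)
      = x • stepMove l (fun a l' => koszul gr m a • f l' v) := by
    cases l with
    | nil => simp
    | cons a l =>
      simp only [stepMove_cons]
      rw [smul_smul, hx.comm, koszul_koszul, mul_smul, show i + (i + m) = 2 * i + m by ring,
        ← koszul_koszul, koszul_two_mul]
  grind

lemma totalD_scale (hω : ω ∈ O.gr p.base i) (φ : Raw V W p) : totalD (i + m) (Raw.scale m ω φ)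
      = Raw.scale m (O.d p.base ω) φ + i.negOnePow • Raw.scale (m + 1) ω (totalD m φ) := by
  funext q k l v
  have hdx : conn.D q (A.η q (O.res (El.Hom.map k) ω))
      = A.η q (O.res (El.Hom.map k) (O.d p.base ω)) := by rw [conn.D_η, O.d_res]
  have hc : Central (A.gr q) (A.η q (O.res (El.Hom.map k) ω)) i := central_η (O.res_mem _ hω)
  have hf : Raw.scale m ω φ q k = fun l v => (i * m + i * (i + 1) / 2).negOnePow •
      A.η q (O.res (El.Hom.map k) ω) • φ q k l v := by
    funext l v; exact scale_apply hω φ q k l v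
  have hs : ∀ f : List (A.obj q) → V.obj q → W.obj q,
      strD (V.curvedMod q) (W.curvedMod q) (i + m) (fun l v =>
        (i * m + i * (i + 1) / 2).negOnePow • f l v) l v = (i * m + i * (i + 1) / 2).negOnePow •
        strD (V.curvedMod q) (W.curvedMod q) (i + m) f l v := by
    exact fun f => strD_units_smul _ _ _ _ f l v
  rw [Pi.add_apply, Pi.add_apply, Pi.add_apply, Pi.add_apply, Pi.smul_apply, Pi.smul_apply,
    Pi.smul_apply, Pi.smul_apply, scale_apply (O.d_mem hω), scale_apply hω, totalD_eq, totalD_eq,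
    hf, hs, strD_central _ _ hc, ← hdx, smul_add, smul_smul, smul_smul _ _ (_ • strD _ _ _ _ _ _),
    ← negOnePow_add, ← negOnePow_add]
  have h1 : (i + 1) * (i + 1 + 1) / 2 = i * (i + 1) / 2 + (i + 1) := by grind
  congr 2
  · grind
  · exact (negOnePow_eq_of (c := i) (by ring)).symm

lemma scale_add_left (m : ℤ) (ω ω' : O.obj p.base) (φ : Raw V W p) :
    Raw.scale m (ω + ω') φ = Raw.scale m ω φ + Raw.scale m ω' φ := by
  funext q k l v
  simp only [Raw.scale, map_add, add_smul, Pi.add_apply]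

lemma scale_mul (ω : O.obj p.base) {ω' : O.obj p.base} (hω' : ω' ∈ O.gr p.base i) (φ : Raw V W p) :
    Raw.scale m (ω * ω') φ = Raw.scale (i + m) ω (Raw.scale m ω' φ) := by
  refine DFunLike.congr_fun (f := AddMonoidHom.mk' (fun ω => Raw.scale m (ω * ω') φ)
    (fun a b => by rw [add_mul, scale_add_left])) (g := AddMonoidHom.mk'
    (fun ω => Raw.scale (i + m) ω (Raw.scale m ω' φ)) (fun a b => by rw [scale_add_left])) ?_ ω
  refine AddMonoidHom.ext fun ω => addHom_ext_homogeneous (O.gr p.base) (fun j ω hω => ?_) ω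
  funext q k l v
  change Raw.scale m (ω * ω') φ q k l v = Raw.scale (i + m) ω (Raw.scale m ω' φ) q k l v
  rw [scale_apply (SetLike.mul_mem_graded hω hω'), scale_apply hω, scale_apply hω', map_mul,
    map_mul, mul_smul, smul_units_smul, smul_smul (_ : ℤˣ), ← negOnePow_add]
  congr 2
  have h1 : (j + i) * (j + i + 1) / 2 = j * (j + 1) / 2 + i * (i + 1) / 2 + j * i := by
    obtain ⟨a, ha⟩ := Int.even_mul_succ_self i
    grind
  grind

lemma scale_one (m : ℤ) (φ : Raw V W p) : Raw.scale m 1 φ = φ := by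
  funext q k l v
  rw [scale_apply (SetLike.one_mem_graded (O.gr p.base))]
  simp

lemma totalD_restrict (k : q ⟶ p) (m : ℤ) (φ : Raw V W p) :
    totalD m (Raw.restrict k φ) = Raw.restrict k (totalD m φ) := by
  funext r k' l v
  rw [Raw.restrict, totalD_eq, totalD_eq]
  rfl

/-- The standard complex is a differential graded module. -/
theorem stdCx_isDGModule (κ : CochainKind) : (stdCx V W κ).IsDGModule where
  smul_mem := fun hω hφ => scale_mem hω hφ
  add_smul := fun m ω ω' φ _ => scale_add_left m ω ω' φ
  smul_add := fun m ω φ ψ _ _ => by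
    funext q k l v
    exact smul_add _ _ _
  one_smul := fun m φ _ => scale_one m φ
  mul_smul := fun ω ω' φ hω' _ => scale_mul ω hω' φ
  d_mem := fun h => totalD_mem h
  d_add := fun {p m φ ψ} _ _ => totalD_add m φ ψ
  d_d := fun h => totalD_totalD h
  d_smul := fun hω _ => totalD_scale hω _
  res_mem := fun k _ _ h => restrict_mem k h
  res_add := fun k _ _ _ _ _ => rfl
  res_id := fun {p m φ} _ => by
    funext q k l v
    change φ q (k ≫ 𝟙 p) l v = _
    simp
  res_comp := fun k' k m φ _ => by
    funext q k l v
    change φ _ _ l v = φ _ _ l v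
    simp
  res_smul := fun k m ω φ _ => by
    funext r k' l v
    change A.η r _ • φ _ _ l v = A.η r _ • φ _ _ l v
    rw [show signBy (O.gr _) (fun i => i * m + i * (i + 1) / 2) (O.res (El.Hom.map k) ω)
      = O.res (El.Hom.map k) (signBy (O.gr _) (fun i => i * m + i * (i + 1) / 2) ω) from
        signBy_map _ _ (O.res (El.Hom.map k)).toAddMonoidHom (O.res_mem _) _ _, ← O.res_comp]
    rfl
  res_d := fun k m φ _ => (totalD_restrict k m φ).symm

/-! ## Convergence of the insertion operators -/

section Lists

variable {A V Y : Type*} [Ring A] (gr : ℤ → AddSubgroup A) [GradedRing gr] [AddCommGroup V]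
  [AddCommGroup Y]

/-- A string of homogeneous elements for which the sum of the numbers `|a| - 1` is `n`. -/
inductive HomList : List A → ℤ → Prop
  | nil : HomList [] 0
  | cons {a : A} {i : ℤ} {l : List A} {n : ℤ} : a ∈ gr i → HomList l n → HomList (a :: l) (i - 1 + n)

variable {gr}

lemma HomList.forall₂ {l : List A} {n : ℤ} (h : HomList gr l n) :
    ∃ e : List ℤ, List.Forall₂ (fun a i => a ∈ gr i) l e ∧ e.sum = n + l.length := by
  induction h with
  | nil => exact ⟨[], List.Forall₂.nil, by simp⟩
  | @cons a i l n ha _ ih =>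
    obtain ⟨e, he, hs⟩ := ih
    exact ⟨i :: e, List.Forall₂.cons ha he, by simp [hs]; ring⟩

lemma HomList.map {A' : Type*} [Ring A'] {gr' : ℤ → AddSubgroup A'} [GradedRing gr'] {f : A → A'}
    (hf : ∀ {i a}, a ∈ gr i → f a ∈ gr' i) {l : List A} {n : ℤ} (h : HomList gr l n) :
    HomList gr' (l.map f) n := by
  induction h with
  | nil => exact HomList.nil
  | cons ha _ ih => exact HomList.cons (hf ha) ih

lemma HomList.exists {l : List A} (h : ∀ a ∈ l, ∃ i, a ∈ gr i) : ∃ n, HomList gr l n := by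
  induction l with
  | nil => exact ⟨0, HomList.nil⟩
  | cons a l ih =>
    obtain ⟨i, hi⟩ := h a (by simp)
    obtain ⟨n, hn⟩ := ih fun b hb => h b (by simp [hb])
    exact ⟨_, HomList.cons hi hn⟩

lemma MultiAdd.entry_units_smul {f : List A → V → Y} (hf : MultiAdd f) (l l' : List A) (e : ℤˣ)
    (a : A) (v : V) : f (l ++ e • a :: l') v = e • f (l ++ a :: l') v :=
  map_units_smul (AddMonoidHom.mk' (fun b => f (l ++ b :: l') v) fun b c => hf.entry l l' b c v) e a

lemma HomList.map_bar {l : List A} {n : ℤ} (h : HomList gr l n) {f : List A → V → Y}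
    (hf : MultiAdd f) (i : ℤ) (p l' : List A) (v : V) :
    f (p ++ l.map (bar gr i) ++ l') v = (i * n).negOnePow • f (p ++ l ++ l') v := by
  induction h generalizing p with
  | nil => simp
  | @cons a j l n ha _ ih =>
    have := ih (p ++ [a])
    simp only [append_assoc, map_cons, cons_append, nil_append] at this ⊢
    rw [bar_of_mem _ i ha, hf.entry_units_smul, this, smul_smul, ← negOnePow_add]
    congr 1
    exact negOnePow_eq_of (c := i) (by ring)

/-- Induction principle: a property that is additive in every entry and holds for the lists of
homogeneous entries holds for all lists. -/
lemma list_induction_of_step {B : Type*} {Hom : B → Prop} {R : B → B → Prop} {P : List B → Prop}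
    (hom : ∀ l, (∀ b ∈ l, Hom b) → P l)
    (step : ∀ b l l', (∀ b', Hom b' → R b b' → P (l ++ b' :: l')) → P (l ++ b :: l')) (l : List B) :
    P l := by
  have key : ∀ l₂ l₁ : List B, (∀ b ∈ l₁, Hom b) → P (l₁ ++ l₂) := by
    intro l₂
    induction l₂ with
    | nil => intro l₁ h; simpa using hom l₁ h
    | cons b l₂ ih =>
      intro l₁ h
      refine step b l₁ l₂ fun b' hb' _ => ?_
      have := ih (l₁ ++ [b']) (by
        intro c hc
        rcases mem_append.mp hc with hc | hc
        · exact h c hc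
        · rw [mem_singleton.mp hc]; exact hb')
      grind
  exact key l [] (by simp)

lemma mem_of_homogeneous (H : AddSubgroup A) (h : ∀ i, ∀ a ∈ gr i, a ∈ H) (a : A) : a ∈ H := by
  refine DirectSum.Decomposition.inductionOn gr (zero_mem H) (fun {i} a => h i a a.2)
    (fun a b ha hb => add_mem ha hb) a

/-- The property that a sequence depending additively on `a` has finitely many nonzero terms. -/
def evZeroSubgroup (X : A →+ (ℕ → Y)) : AddSubgroup A where
  carrier := {a | EvZero (X a)}
  zero_mem' := by
    change EvZero (X 0)
    rw [map_zero]; exact evZero_zero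
  add_mem' := fun {a b} ha hb => by
    change EvZero (X (a + b))
    rw [map_add]; exact EvZero.add ha hb
  neg_mem' := fun {a} ha => by
    change EvZero (X (-a))
    rw [map_neg]; exact EvZero.neg ha

lemma prog_mem {M : Type*} [AddCommGroup M] {H : AddSubgroup M} {γ : A} (hγ : γ ∈ gr 1)
    {ps : List (A × A)} (hps : ∀ s ∈ ps, s.2 ∈ gr 1) {n : ℤ} (hn : HomList gr (ps.map Prod.fst) n)
    (K : ℕ) {f : List A → M} (hf : ∀ y, HomList gr y n → f y ∈ H) : prog γ ps K f ∈ H := by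
  induction' hm : ps.length + K using Nat.strong_induction_on with m ih generalizing γ ps K f n
  have hins : ∀ {K'}, K = K' + 1 → prog γ ps K' (consF γ f) ∈ H := by
    rintro K' rfl
    exact ih _ (by omega) hγ hps hn _ (fun y hy => hf _ (by simpa using HomList.cons hγ hy)) rfl
  match ps, K with
  | [], 0 => rw [prog]; exact hf _ hn
  | [], K + 1 => rw [prog]; exact hins rfl
  | (e, γ') :: ps, K =>
    have hst : prog γ' ps K (consF e f) ∈ H := by
      rw [map_cons] at hn
      cases hn with
      | cons he hn =>
        exact ih _ (by simp at hm; omega) (hps _ List.mem_cons_self)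
          (fun s hs => hps s (mem_cons_of_mem _ hs)) hn _
          (fun y hy => hf _ (HomList.cons he hy)) rfl
    cases K with
    | zero => rw [prog]; exact hst
    | succ K => rw [prog]; exact add_mem (hins rfl) hst

lemma prog_mapList {B B' M : Type*} [AddCommMonoid M] (ρ : B → B') (γ : B) (ps : List (B × B))
    (K : ℕ) (f : List B' → M) :
    prog γ ps K (fun y => f (y.map ρ)) = prog (ρ γ) (ps.map (Prod.map ρ ρ)) K f := by
  induction' hm : ps.length + K using Nat.strong_induction_on with m ih generalizing γ ps K f
  match ps, K with
  | [], K => rw [map_nil, prog_nil, prog_nil, map_replicate]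
  | (e, γ') :: ps, 0 =>
    rw [prog, map_cons, Prod.map_apply, prog]
    exact ih _ (by simp at hm; omega) γ' ps 0 (consF (ρ e) f) rfl
  | (e, γ') :: ps, K + 1 =>
    rw [prog, map_cons, Prod.map_apply, prog]
    congr 1
    · exact ih _ (by omega) γ ((e, γ') :: ps) K (consF (ρ γ) f) rfl
    · exact ih _ (by simp at hm; omega) γ' ps (K + 1) (consF (ρ e) f) rfl

/-- The strings of a program have the length `ps.length + K`. -/
lemma prog_congr_length {B M : Type*} [AddCommMonoid M] (γ : B) (ps : List (B × B)) (K : ℕ)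
    {f g : List B → M} (h : ∀ y, y.length = ps.length + K → f y = g y) :
    prog γ ps K f = prog γ ps K g := by
  induction' hm : ps.length + K using Nat.strong_induction_on with m ih generalizing γ ps K f g
  match ps, K with
  | [], 0 => rw [prog, prog]; exact h _ rfl
  | [], K + 1 => rw [prog, prog]; exact ih _ (by omega) γ [] K (fun y hy => h _ (by simp [hy])) rfl
  | (e, γ') :: ps, 0 =>
    rw [prog, prog]
    exact ih _ (by simp at hm; omega) γ' ps 0 (fun y hy => h _ (by simp [hy])) rfl
  | (e, γ') :: ps, K + 1 =>
    rw [prog, prog]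
    congr 1
    · exact ih _ (by omega) γ ((e, γ') :: ps) K (fun y hy => h _ (by simp [hy]; omega)) rfl
    · exact ih _ (by simp at hm; omega) γ' ps (K + 1) (fun y hy => h _ (by simp [hy]; omega)) rfl

lemma prog_cons_sum {B M : Type*} [AddCommMonoid M] (γ e γ' : B) (ps : List (B × B)) (K : ℕ)
    (f : List B → M) : prog γ ((e, γ') :: ps) K f = ∑ p ∈ antidiagonal K,
      prog γ' ps p.2 (fun y => f (replicate p.1 γ ++ e :: y)) := by
  induction K generalizing f with
  | zero => rw [prog]; simp; rfl
  | succ K ih =>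
    rw [prog, ih, Finset.Nat.sum_antidiagonal_succ, add_comm]
    rfl

end Lists

/-- The part of a cochain with numbers of arguments in a set. -/
def Raw.arities (S : Set ℕ) (φ : Raw V W p) : Raw V W p := fun q k l v =>
  open Classical in if l.length ∈ S then φ q k l v else 0

lemma Raw.arities_of_mem {S : Set ℕ} (φ : Raw V W p) (k : q ⟶ p) {l : List (A.obj q)}
    (v : V.obj q) (h : l.length ∈ S) : Raw.arities S φ q k l v = φ q k l v :=
  if_pos h

lemma Raw.arities_of_notMem {S : Set ℕ} (φ : Raw V W p) (k : q ⟶ p) {l : List (A.obj q)}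
    (v : V.obj q) (h : l.length ∉ S) : Raw.arities S φ q k l v = 0 :=
  if_neg h

lemma arities_mem (h : φ ∈ cochains V W κ p m) (S : Set ℕ) :
    Raw.arities S φ ∈ cochains V W κ p m := by
  classical
  replace h : IsCochain κ p m φ := h
  refine IsCochain.of_olin ?_ ?_ ?_ ?_ ?_
  · intro q k
    constructor
    · intro l l' a b v
      simp only [Raw.arities, length_append, length_cons, h.add_entry]
      split_ifs <;> simp
    · intro l v v'
      simp only [Raw.arities, h.add_right]
      split_ifs <;> simp
  · intro r q k' k l v
    simp only [Raw.arities, length_map, ← h.res]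
    split_ifs <;> simp
  · intro q k l e j v hl hv
    simp only [Raw.arities]
    split_ifs
    · exact h.degree k hl hv
    all_goals simp
  · intro q k i ω hω
    have h1 := h.olin k hω
    constructor
    · intro p a l v
      simp only [Raw.arities, Pi.smul_apply, length_append, length_cons, length_map, h1.entry]
      split_ifs <;> simp
    · intro p v
      simp only [Raw.arities, Pi.smul_apply, length_map, h1.right]
      split_ifs <;> simp
  · intro hκ
    obtain ⟨N, hN⟩ := h.bounded hκ
    refine ⟨N, fun q k l v hl => ?_⟩
    simp only [Raw.arities, hN q k l v hl, ite_self]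

/-- The cochain with some first and last arguments fixed. -/
def Raw.partial (n : ℤ) (x y : List (A.obj p)) (φ : Raw V W p) :
    Raw V W p := fun q k l v =>
  φ q k (x.map (A.res k) ++ l.map (bar (A.gr q) n) ++ y.map (A.res k)) v

lemma partial_mem (h : φ ∈ cochains V W κ p m) {x y : List (A.obj p)} {n₀ n : ℤ}
    (hx : HomList (A.gr p) x n₀) (hy : HomList (A.gr p) y n) :
    Raw.partial n x y φ ∈ cochains V W κ p (m + n₀ + n) := by
  replace h : IsCochain κ p m φ := h
  refine IsCochain.of_olin ?_ ?_ ?_ ?_ ?_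
  · intro q k
    constructor
    · intro l l' a b v
      have := (h.multiAdd k).entry (x.map (A.res k) ++ l.map (bar (A.gr q) n))
        (l'.map (bar (A.gr q) n) ++ y.map (A.res k)) (bar (A.gr q) n a) (bar (A.gr q) n b) v
      simpa [Raw.partial] using this
    · intro l v v'
      simp only [Raw.partial, h.add_right]
  · intro r q k' k l v
    rw [Raw.partial, h.res, Raw.partial]
    simp only [map_append, map_map]
    have h1 : ∀ z : List (A.obj p), z.map (A.res k' ∘ A.res k) = z.map (A.res (k' ≫ k)) :=
      fun z => map_congr_left fun a _ => (A.res_comp k' k a).symm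
    have h2 : l.map (A.res k' ∘ bar (A.gr q) n) = l.map (bar (A.gr r) n ∘ A.res k') :=
      map_congr_left fun a _ =>
        (bar_map_zero (A.gr q) (A.gr r) (A.res k').toAddMonoidHom (fun h => A.res_mem k' h) n a).symm
    grind
  · intro q k l e j v hl hv
    obtain ⟨ex, hex, hsx⟩ := (hx.map fun h => A.res_mem k h).forall₂
    obtain ⟨ey, hey, hsy⟩ := (hy.map fun h => A.res_mem k h).forall₂
    have hl' : List.Forall₂ (fun a i => a ∈ A.gr q i) (l.map (bar (A.gr q) n)) e := by
      rw [List.forall₂_map_left_iff]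
      exact hl.imp fun a i ha => bar_mem _ _ ha
    have := h.degree k (List.rel_append (List.rel_append hex hl') hey) hv
    rw [Raw.partial]
    grind
  · intro q k i ω hω
    have h1 := h.olin k hω
    have hm := h.multiAdd k
    have hc : Central (A.gr q) (A.η q ω) i := central_η hω
    have hx' : HomList (A.gr q) (x.map (A.res k)) n₀ := hx.map fun h => A.res_mem k h
    have hy' : HomList (A.gr q) (y.map (A.res k)) n := hy.map fun h => A.res_mem k h
    have hcomm : ∀ l : List (A.obj q), (l.map (bar (A.gr q) n)).map (bar (A.gr q) i)
        = (l.map (bar (A.gr q) i)).map (bar (A.gr q) n) := by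
      intro l
      rw [map_map, map_map]
      exact map_congr_left fun a _ => by
        rw [Function.comp_apply, Function.comp_apply, bar_bar, bar_bar, add_comm]
    constructor
    · intro p a l v
      have e1 := h1.entry (x.map (A.res k) ++ p.map (bar (A.gr q) n)) (bar (A.gr q) n a)
        (l.map (bar (A.gr q) n) ++ y.map (A.res k)) v
      have e2 := hm.entry_units_smul (x.map (A.res k) ++ p.map (bar (A.gr q) n))
        (l.map (bar (A.gr q) n) ++ y.map (A.res k)) (n * i).negOnePow (A.η q ω * bar (A.gr q) n a) v
      have e3 := hx'.map_bar hm i [] ((p.map (bar (A.gr q) i)).map (bar (A.gr q) n) ++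
        bar (A.gr q) n a :: (l.map (bar (A.gr q) n) ++ y.map (A.res k))) v
      simp only [Raw.partial, Pi.smul_apply, map_append, map_cons, hc.bar, hcomm,
        append_assoc, cons_append, nil_append] at e1 e2 e3 ⊢
      rw [e2, e1, e3]
      simp only [smul_units_smul, smul_smul, ← negOnePow_add]
      congr 2
      ring_nf
    · intro p v
      have e1 := h1.right (x.map (A.res k) ++ p.map (bar (A.gr q) n) ++ y.map (A.res k)) v
      have e2 := hx'.map_bar hm i [] ((p.map (bar (A.gr q) i)).map (bar (A.gr q) n) ++
        (y.map (A.res k)).map (bar (A.gr q) i)) v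
      have e3 := hy'.map_bar hm i (x.map (A.res k) ++
        (p.map (bar (A.gr q) i)).map (bar (A.gr q) n)) [] v
      simp only [Raw.partial, Pi.smul_apply, map_append, hcomm, append_assoc,
        nil_append, append_nil] at e1 e2 e3 ⊢
      rw [e1, e2, e3]
      simp only [smul_units_smul, smul_smul, ← negOnePow_add]
      congr 2
      ring_nf
  · intro hκ
    obtain ⟨N, hN⟩ := h.bounded hκ
    refine ⟨N, fun q k l v hl => hN _ _ _ _ ?_⟩
    grind

lemma tot_mem {Y : Type*} [AddCommGroup Y] {H : AddSubgroup Y} {X : ℕ → Y} (h : ∀ n, X n ∈ H) :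
    tot X ∈ H := by
  rw [tot]
  exact finsum_induction (· ∈ H) (zero_mem H) (fun _ _ => add_mem) h

/-- Sums of cochains with finitely many nonzero terms on all arguments. -/
lemma tot_cochains_mem {X : ℕ → Raw V W p} (h : ∀ n, X n ∈ cochains V W κ p m)
    (hfin : ∀ (q : El F) (k : q ⟶ p) (l : List (A.obj q)) (v : V.obj q), EvZero fun n => X n q k l v)
    (hbdd : κ = CochainKind.sum → ∃ N : ℕ, ∀ (n : ℕ) (q : El F) (k : q ⟶ p) (l : List (A.obj q))
    (v : V.obj q), N ≤ l.length → X n q k l v = 0) :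
    (fun q k l v => tot fun n => X n q k l v) ∈ cochains V W κ p m := by
  replace h : ∀ n, IsCochain κ p m (X n) := h
  refine IsCochain.of_olin ?_ ?_ ?_ ?_ ?_
  · intro q k
    constructor
    · intro l l' a b v
      rw [← tot_add (hfin _ _ _ _) (hfin _ _ _ _)]
      congr 1; funext n; exact (h n).add_entry k l l' a b v
    · intro l v v'
      rw [← tot_add (hfin _ _ _ _) (hfin _ _ _ _)]
      congr 1; funext n; exact (h n).add_right k l v v'
  · intro r q k' k l v
    rw [← tot_map (W.res k') (hfin _ _ _ _)]
    congr 1; funext n; exact (h n).res k' k l v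
  · intro q k l e j v hl hv
    exact tot_mem fun n => (h n).degree k hl hv
  · intro q k i ω hω
    constructor
    · intro p a l v
      rw [Pi.smul_apply, Pi.smul_apply, smul_units_smul]
      refine Eq.trans ?_ (tot_map ((toAddMonoidHom (W.obj q)
        (i * (m + 1)).negOnePow).comp (toAddMonoidHom (W.obj q) (A.η q ω))) (hfin _ _ _ _))
      congr 1; funext n
      rw [((h n).olin k hω).entry, Pi.smul_apply, Pi.smul_apply, smul_units_smul]; rfl
    · intro p v
      rw [Pi.smul_apply, Pi.smul_apply, smul_units_smul]
      refine Eq.trans ?_ (tot_map ((toAddMonoidHom (W.obj q) i.negOnePow).comp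
        ((toAddMonoidHom (W.obj q)
        (i * (m + 1)).negOnePow).comp (toAddMonoidHom (W.obj q) (A.η q ω)))) (hfin _ _ _ _))
      congr 1; funext n
      rw [((h n).olin k hω).right, Pi.smul_apply, Pi.smul_apply, smul_units_smul]; rfl
  · intro hκ
    obtain ⟨N, hN⟩ := hbdd hκ
    refine ⟨N, fun q k l v hl => ?_⟩
    rw [show (fun n => X n q k l v) = 0 from funext fun n => hN n q k l v hl, tot_zero]

variable (V W κ) in
/-- Elements of degree one such that every cochain vanishes on almost all strings of copies of the
element. -/
def ExpOne (p : El F) (γ : A.obj p) : Prop :=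
  γ ∈ A.gr p 1 ∧ ∀ (q : El F) (k : q ⟶ p) (m : ℤ) (φ : Raw V W q), φ ∈ cochains V W κ q m →
    ∀ v : V.obj q, EvZero fun n => φ q (𝟙 q) (replicate n (A.res k γ)) v

lemma ExpOne.restrict (k : q ⟶ p) {a : A.obj p} (h : ExpOne V W κ p a) :
    ExpOne V W κ q (A.res k a) :=
  ⟨A.res_mem k h.1, fun r k' m φ hφ v => by rw [← A.res_comp]; exact h.2 r (k' ≫ k) m φ hφ v⟩

lemma insertions_nil {B : Type u} (a : B) (n : ℕ) : insertions a n [] = [replicate n a] := by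
  cases n <;> simp [insertions]

lemma map_bar_zero (l : List (A.obj q)) : l.map (bar (A.gr q) 0) = l := by
  conv_rhs => rw [← List.map_id l]
  exact map_congr_left fun a _ => bar_zero _ a

lemma map_res_id (l : List (A.obj q)) : l.map (A.res (𝟙 q)) = l := by
  conv_rhs => rw [← List.map_id l]
  exact map_congr_left fun a _ => A.res_id q a

lemma prog_eval (γ : A.obj p) (ps : List (A.obj p × A.obj p)) (K : ℕ)
    (f : List (A.obj p) → Raw V W p) (q : El F) (k : q ⟶ p) (l : List (A.obj q)) (v : V.obj q) :
    prog γ ps K f q k l v = prog γ ps K fun y => f y q k l v :=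
  (prog_map (AddMonoidHom.mk' (fun φ : Raw V W p => φ q k l v) fun _ _ => rfl) γ ps K f).symm

/-- The terms of a program for the function `φ (l₀ ++ ·)`. -/
lemma prog_evZero_prefix {γ : A.obj q} {ps : List (A.obj q × A.obj q)}
    (hfin : ∀ (m : ℤ) (φ : Raw V W q), φ ∈ cochains V W κ q m → ∀ v : V.obj q, EvZero fun K => prog
    γ ps K fun y => φ q (𝟙 q) y v)
    {φ : Raw V W q} (h : φ ∈ cochains V W κ q m) (l₀ : List (A.obj q)) (v : V.obj q) :
    EvZero fun K => prog γ ps K fun y => φ q (𝟙 q) (l₀ ++ y) v := by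
  have hm : MultiAdd (φ q (𝟙 q)) := IsCochain.multiAdd h _
  refine list_induction_of_step (Hom := fun a => ∃ i, a ∈ A.gr q i) (R := fun _ _ => True)
    (P := fun l₀ => EvZero fun K => prog γ ps K fun y => φ q (𝟙 q) (l₀ ++ y) v) ?_ ?_ l₀
  · intro l hl
    obtain ⟨n, hn⟩ := HomList.exists hl
    have := hfin _ _ (partial_mem h hn HomList.nil) v
    simpa only [Raw.partial, map_res_id, map_bar_zero, map_nil, append_nil] using this
  · intro b l l' hb
    let X : A.obj q →+ (ℕ → W.obj q) := AddMonoidHom.mk'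
      (fun a K => prog γ ps K fun y => φ q (𝟙 q) ((l ++ a :: l') ++ y) v) fun a a' => by
        funext K
        rw [Pi.add_apply, ← prog_add]
        congr 1
        funext y
        have := hm.entry l (l' ++ y) a a' v
        simp_all
    exact mem_of_homogeneous (gr := A.gr q) (evZeroSubgroup X)
      (fun i a ha => hb a ⟨i, ha⟩ trivial) b

lemma prog_evZero_homogeneous (n : ℕ) {γ : A.obj q} (hγ : ExpOne V W κ q γ)
    {ps : List (A.obj q × A.obj q)} (hn : ps.length = n) (hps : LabelsIn (ExpOne V W κ q) ps)
    (hhom : ∀ s ∈ ps, ∃ i, s.1 ∈ A.gr q i) {φ : Raw V W q} (h : φ ∈ cochains V W κ q m)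
    (v : V.obj q) : EvZero fun K => prog γ ps K fun y => φ q (𝟙 q) y v := by
  classical
  induction n generalizing q γ ps m φ with
  | zero =>
    obtain rfl := List.length_eq_zero_iff.mp hn
    have := hγ.2 q (𝟙 q) m φ h v
    rw [A.res_id] at this
    simpa only [prog_nil] using this
  | succ n ih =>
    obtain _ | ⟨⟨e, γ₁⟩, ps⟩ := ps
    · simp at hn
    have hn' : ps.length = n := by simpa using hn
    have hγ₁ : ExpOne V W κ q γ₁ := hps (e, γ₁) (by simp)
    have hps' : LabelsIn (ExpOne V W κ q) ps := fun s hs => hps s (by simp [hs])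
    have hhom' : ∀ s ∈ ps, ∃ i, s.1 ∈ A.gr q i := fun s hs => hhom s (by simp [hs])
    obtain ⟨d, he⟩ : ∃ i, e ∈ A.gr q i := hhom (e, γ₁) (by simp)
    obtain ⟨n₁, hn₁⟩ : ∃ n₁, HomList (A.gr q) (ps.map Prod.fst) n₁ := HomList.exists (by
      intro a ha
      obtain ⟨s, hs, rfl⟩ := mem_map.mp ha
      exact hhom' s hs)
    have hpre : ∀ {r : El F} (k : r ⟶ q) (m : ℤ) (χ : Raw V W q), χ ∈ cochains V W κ q m →
        ∀ (l₀ : List (A.obj r)) (v : V.obj r), EvZero fun j =>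
          prog γ₁ ps j fun y => χ r k (l₀ ++ y.map (A.res k)) v := by
      intro r k m χ hχ l₀ v
      have h1 := prog_evZero_prefix (q := r) (γ := A.res k γ₁)
        (ps := ps.map (Prod.map (A.res k) (A.res k)))
        (fun m φ hφ v => ih (hγ₁.restrict k) (by simpa using hn') (by
          intro s hs
          obtain ⟨t, ht, rfl⟩ := mem_map.mp hs
          exact (hps' t ht).restrict k) (by
          intro s hs
          obtain ⟨t, ht, rfl⟩ := mem_map.mp hs
          obtain ⟨i, hi⟩ := hhom' t ht
          exact ⟨i, A.res_mem k hi⟩) hφ v) (restrict_mem k hχ) l₀ v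
      refine Eq.mp ?_ h1
      congr 1
      funext j
      rw [← prog_mapList (A.res k) γ₁ ps j (fun y => Raw.restrict k χ r (𝟙 r) (l₀ ++ y) v)]
      simp only [Raw.restrict, Category.id_comp]
    let X : ℕ → ℕ → W.obj q := fun i j =>
      prog γ₁ ps j fun y => φ q (𝟙 q) (replicate i γ ++ e :: y) v
    have hrow : ∀ i, EvZero (X i) := fun i => by
      have := hpre (𝟙 q) m φ h (replicate i γ ++ [e]) v
      simpa only [map_res_id, append_assoc, singleton_append] using this
    have hcol : ∀ P : Set ℕ, EvZero fun i => tot fun j => if i + j ∈ P then X i j else 0 := by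
      intro P
      let S : Set ℕ := {t | ∃ s ∈ P, t = s + 1 + ps.length}
      let N := d - 1 + n₁
      let Z : ℕ → Raw V W q := fun j =>
        prog γ₁ ps j fun y => Raw.partial N [] (e :: y) (Raw.arities S φ)
      have hZ : ∀ j (r : El F) (k : r ⟶ q) (l : List (A.obj r)) (v : V.obj r), Z j r k l v
          = prog γ₁ ps j fun y => Raw.arities S φ r k
            ((l.map (bar (A.gr r) N) ++ [A.res k e]) ++ y.map (A.res k)) v := by
        intro j r k l v
        simp only [Z, prog_eval, Raw.partial, map_nil, nil_append, map_cons,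
          append_assoc, singleton_append]
      have hmem : (fun r k l v => tot fun j => Z j r k l v) ∈ cochains V W κ q (m + 0 + N) := by
        refine tot_cochains_mem (fun j => ?_) (fun r k l v => ?_) (fun hκ => ?_)
        · exact prog_mem hγ₁.1 (fun s hs => (hps' s hs).1) hn₁ j fun y hy =>
            partial_mem (arities_mem h S) HomList.nil (HomList.cons he hy)
        · simp only [hZ]
          exact hpre k m _ (arities_mem h S) _ v
        · obtain ⟨B, hB⟩ := (arities_mem h S).bounded hκ
          refine ⟨B, fun j r k l v hl => ?_⟩
          rw [hZ]
          have h0 : (fun y : List (A.obj q) => Raw.arities S φ r k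
              ((l.map (bar (A.gr r) N) ++ [A.res k e]) ++ y.map (A.res k)) v) = fun _ => 0 := by
            funext y
            refine hB _ _ _ _ ?_
            simp only [length_append, length_map]
            omega
          rw [h0]
          exact prog_map (0 : W.obj r →+ W.obj r) γ₁ ps j fun _ => 0
      obtain ⟨B, hB⟩ := hγ.2 q (𝟙 q) _ _ hmem v
      refine ⟨B, fun i hi => ?_⟩
      have h0 := hB i hi
      simp only [A.res_id, hZ] at h0
      change tot (fun j => if i + j ∈ P then X i j else 0) = 0
      refine Eq.trans ?_ h0
      congr 1
      funext j
      have hrep : (replicate i γ).map (bar (A.gr q) N) = replicate i γ := by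
        rw [map_replicate, bar_of_mem_one _ _ hγ.1]
      by_cases hP : i + j ∈ P
      · rw [if_pos hP]
        refine prog_congr_length γ₁ ps j fun y hy => ?_
        rw [Raw.arities_of_mem, hrep, map_res_id]
        · simp
        · refine ⟨i + j, hP, ?_⟩
          simp [hy]; omega
      · rw [if_neg hP]
        refine ((prog_congr_length (g := fun _ => (0 : W.obj q)) γ₁ ps j fun y hy => ?_).trans
          (prog_map (0 : W.obj q →+ W.obj q) γ₁ ps j fun _ => 0)).symm
        refine Raw.arities_of_notMem _ _ _ ?_
        rintro ⟨s, hs, hs'⟩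
        simp [hy] at hs'
        exact hP (by rwa [show i + j = s by omega])
    obtain ⟨B, hB⟩ := finite_of_rows hrow hcol
    refine ⟨B, fun K hK => (prog_cons_sum γ e γ₁ ps K _).trans ?_⟩
    refine sum_eq_zero fun p hp => hB _ _ ?_
    rw [Finset.HasAntidiagonal.mem_antidiagonal.mp hp]
    exact hK

/-- All programs with convergent labels are finite on cochains. -/
theorem cochain_progFinite (h : φ ∈ cochains V W κ p m) (k : q ⟶ p) :
    ProgFinite (ExpOne V W κ q) (φ q k) := by
  intro γ hγ ps hps v
  have h' := restrict_mem k h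
  have hm : MultiAdd (φ q k) := IsCochain.multiAdd h k
  have hsame : Raw.restrict k φ q (𝟙 q) = φ q k := by
    funext l v; simp only [Raw.restrict, Category.id_comp]
  refine list_induction_of_step (Hom := fun s => ∃ i, s.1 ∈ A.gr q i) (R := fun s s' => s'.2 = s.2)
    (P := fun ps => LabelsIn (ExpOne V W κ q) ps → EvZero (progSeq γ (φ q k) ps v)) ?_ ?_ ps hps
  · intro ps hhom hps
    have := prog_evZero_homogeneous ps.length hγ rfl hps hhom h' v
    simp only [hsame] at this
    refine Eq.mp ?_ this
    congr 1
    funext K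
    exact prog_map (Pi.evalAddMonoidHom (fun _ : V.obj q => W.obj q) v) γ ps K (φ q k)
  · rintro ⟨e, γ'⟩ l l' hb hl
    let X : A.obj q →+ (ℕ → W.obj q) := AddMonoidHom.mk'
      (fun a => progSeq γ (φ q k) (l ++ (a, γ') :: l') v) fun a a' => by
        funext K
        exact (prog_progAdd hm γ K).entry l l' a a' γ' v
    refine mem_of_homogeneous (gr := A.gr q) (evZeroSubgroup X) (fun i a ha => ?_) e
    refine hb (a, γ') ⟨i, ha⟩ rfl fun s hs => ?_
    simp only [mem_append, mem_cons] at hs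
    rcases hs with hs | rfl | hs
    · exact hl s (by simp [hs])
    · exact hl (e, γ') (by simp)
    · exact hl s (by simp [hs])

/-- Convergence of the exponential on cochains is convergence on the empty string. -/
lemma expOne_iff {γ : A.obj p} : ExpOne V W κ p γ ↔ γ ∈ A.gr p 1 ∧ ExpDefined V W κ p γ := by
  refine ⟨fun h => ⟨h.1, fun q k m φ hφ l v => ?_⟩, fun h => ⟨h.1, fun q k m φ hφ v => ?_⟩⟩
  · obtain ⟨N, hN⟩ := (op_evZero (gr := A.gr q) (h := ⟨AddMonoidHom.id _, A.res k γ,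
      AddMonoidHom.id (V.obj q)⟩) (hs := []) ⟨h.restrict k, by simp⟩ 0
      (cochain_progFinite hφ (𝟙 q)) l v).1
    refine ⟨N, fun n hn => ?_⟩
    have := hN n hn
    beta_reduce at this
    rw [op_nil_eq_insSum] at this
    simpa [insSum] using this
  · obtain ⟨N, hN⟩ := h.2 q k m φ hφ [] v
    exact ⟨N, fun n hn => by simpa [insertions_nil] using hN n hn⟩

/-! ## Properties of the insertion operators -/

section OpProperties

variable {A A' A'' V V' V'' Y Y' Y'' : Type*} [Ring A] [Ring A'] [Ring A''] [AddCommGroup V]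
  [AddCommGroup V'] [AddCommGroup V''] [AddCommGroup Y] [AddCommGroup Y'] [AddCommGroup Y'']
  [Module A V] [Module A' V'] [Module A'' V'']
  {gr : ℤ → AddSubgroup A} [GradedRing gr] {gr' : ℤ → AddSubgroup A'} [GradedRing gr']
  {gr'' : ℤ → AddSubgroup A''} [GradedRing gr'']

variable {h : Vtx A A' V V'} {hs : Steps A A' V V'}

lemma op_multiAdd (N : ℤ) (h : Vtx A A' V V') (hs : Steps A A' V V') (K : ℕ)
    {f : List A' → V' → Y} (hf : MultiAdd f) : MultiAdd fun l v => op gr N h hs K l f v := by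
  constructor
  · intro l l' a b v
    refine op_induction (P := fun (hs : Steps A A' V V') K (l : List A) =>
      ∀ (N : ℤ) (h : Vtx A A' V V') (f : List A' → V' → Y), MultiAdd f →
        op gr N h hs K (l ++ (a + b) :: l') f v
          = op gr N h hs K (l ++ a :: l') f v + op gr N h hs K (l ++ b :: l') f v)
      ?_ hs K l N h f hf
    intro hs K l h1 h2 h3 N h f hf
    rw [op_rec, op_rec gr N h hs K (l ++ a :: l'), op_rec gr N h hs K (l ++ b :: l')]
    have e1 : shift (fun K' => op gr N h hs K' (l ++ (a + b) :: l') (consF h.β f) v) K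
        = shift (fun K' => op gr N h hs K' (l ++ a :: l') (consF h.β f) v) K
          + shift (fun K' => op gr N h hs K' (l ++ b :: l') (consF h.β f) v) K := by
      cases K with
      | zero => simp
      | succ K => exact h1 K rfl N h _ (hf.cons _)
    have e2 : stepMove hs (fun s hs' => op gr (N - 1) s.2 hs' K (l ++ (a + b) :: l')
          (consF s.1 f) v)
        = stepMove hs (fun s hs' => op gr (N - 1) s.2 hs' K (l ++ a :: l') (consF s.1 f) v)
          + stepMove hs (fun s hs' => op gr (N - 1) s.2 hs' K (l ++ b :: l') (consF s.1 f) v) := by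
      cases hs with
      | nil => simp
      | cons s hs => exact h2 s hs rfl _ _ _ (hf.cons _)
    have e3 : stepMove (l ++ (a + b) :: l')
          (fun a l' => op gr N h hs K l' (consF (h.θ (bar gr N a)) f) v)
        = stepMove (l ++ a :: l') (fun a l' => op gr N h hs K l' (consF (h.θ (bar gr N a)) f) v)
          + stepMove (l ++ b :: l')
            (fun a l' => op gr N h hs K l' (consF (h.θ (bar gr N a)) f) v) := by
      cases l with
      | nil => simp only [nil_append, stepMove_cons, map_add, hf.consF_add, op_add]
      | cons c l => exact h3 c l rfl _ _ _ (hf.cons _)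
    rw [e1, e2, e3]
    simp only [List.append_eq_nil_iff, reduceCtorEq, and_false, false_and, if_false, add_zero]
    abel
  · intro l v v'
    rw [op, op, op]
    have key : ∀ (N : ℤ) (h : Vtx A A' V V') (hs : Steps A A' V V') (l : List A)
        (Φ : List (A' × A') → V' → Y), (∀ ps v v', Φ ps (v + v') = Φ ps v + Φ ps v') →
        pathSum gr N h hs l Φ (v + v') = pathSum gr N h hs l Φ v + pathSum gr N h hs l Φ v' := by
      intro N h hs l Φ hΦ
      induction' hn : hs.length + l.length using Nat.strong_induction_on with
        n ih generalizing N h hs l Φ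
      have e1 : ∀ s, ∀ ps v v', consF s Φ ps (v + v') = consF s Φ ps v + consF s Φ ps v' :=
        fun s ps v v' => hΦ _ v v'
      match hs, l with
      | [], [] => simp only [pathSum, map_add, hΦ]
      | [], a :: l => simp only [pathSum]; exact ih _ (by simp at hn ⊢; omega) _ _ _ _ _ (e1 _) rfl
      | s :: hs, [] => simp only [pathSum]; exact ih _ (by simp at hn ⊢; omega) _ _ _ _ _ (e1 _) rfl
      | s :: hs, a :: l =>
        simp only [pathSum]
        grind
    exact key N h hs l _ fun ps v v' => (prog_progAdd hf h.β K).right ps v v'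

/-- Insertion operators applied to functions that agree on the relevant strings. -/
lemma op_eq_zero (N : ℤ) (h : Vtx A A' V V') (hs : Steps A A' V V') (K : ℕ) (l : List A)
    {f g : List A' → V' → Y} (hf : ∀ y v, y.length = hs.length + K + l.length → f y v = g y v)
    (v : V) : op gr N h hs K l f v = op gr N h hs K l g v := by
  refine op_induction (P := fun (hs : Steps A A' V V') K (l : List A) =>
      ∀ (N : ℤ) (h : Vtx A A' V V') (f g : List A' → V' → Y),
      (∀ y v, y.length = hs.length + K + l.length → f y v = g y v) →
        op gr N h hs K l f v = op gr N h hs K l g v) ?_ hs K l N h f g hf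
  intro hs K l h1 h2 h3 N h f g hf
  rw [op_rec, op_rec gr N h hs K l g]
  congr 1
  · congr 1
    · congr 1
      · cases K with
        | zero => simp
        | succ K => exact h1 K rfl N h _ _ fun y v hy => hf _ _ (by simp [hy]; omega)
      · cases hs with
        | nil => simp
        | cons s hs => exact h2 s hs rfl _ _ _ _ fun y v hy => hf _ _ (by simp [hy]; omega)
    · cases l with
      | nil => simp
      | cons a l => exact h3 a l rfl _ _ _ _ fun y v hy => hf _ _ (by simp [hy]; omega)
  · split_ifs with hc
    · obtain ⟨rfl, rfl, rfl⟩ := hc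
      exact hf _ _ rfl
    · rfl

/-- Homomorphisms intertwine two vertices. -/
structure Vtx.Intertwines {B B' U U' : Type*} [Ring B] [Ring B'] [AddCommGroup U]
    [AddCommGroup U'] (ρ : A →+* B) (σ : V →+ U) (ρ' : A' →+* B') (σ' : V' →+ U')
    (h : Vtx A A' V V') (k : Vtx B B' U U') : Prop where
  θ : ∀ a, k.θ (ρ a) = ρ' (h.θ a)
  β : k.β = ρ' h.β
  ν : ∀ v, k.ν (σ v) = σ' (h.ν v)

lemma op_res {B B' U U' : Type*} [Ring B] [Ring B'] [AddCommGroup U] [AddCommGroup U']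
    {ℬ : ℤ → AddSubgroup B} [GradedRing ℬ] {ρ : A →+* B} (hρ : ∀ {i a}, a ∈ gr i → ρ a ∈ ℬ i)
    {σ : V →+ U} {ρ' : A' →+* B'} {σ' : V' →+ U'} (g : Y →+ Y') {f : List A' → V' → Y}
    {f' : List B' → U' → Y'} (hf : ∀ l v, g (f l v) = f' (l.map ρ') (σ' v)) (N : ℤ)
    {k : Vtx B B' U U'} (hk : h.Intertwines ρ σ ρ' σ' k) {ks : List (B' × Vtx B B' U U')}
    (hks : List.Forall₂ (fun s t => t.1 = ρ' s.1 ∧ s.2.Intertwines ρ σ ρ' σ' t.2) hs ks) (K : ℕ)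
    (l : List A) (v : V) : g (op gr N h hs K l f v) = op ℬ N k ks K (l.map ρ) f' (σ v) := by
  refine op_induction (P := fun (hs : Steps A A' V V') K (l : List A) =>
      ∀ (N : ℤ) (h : Vtx A A' V V') (k : Vtx B B' U U') (ks : List (B' × Vtx B B' U U'))
      (f : List A' → V' → Y) (f' : List B' → U' → Y'), h.Intertwines ρ σ ρ' σ' k →
      List.Forall₂ (fun s t => t.1 = ρ' s.1 ∧ s.2.Intertwines ρ σ ρ' σ' t.2) hs ks →
      (∀ l v, g (f l v) = f' (l.map ρ') (σ' v)) →
        g (op gr N h hs K l f v) = op ℬ N k ks K (l.map ρ) f' (σ v)) ?_ hs K l N h k ks f f' hk hks hf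
  intro hs K l h1 h2 h3 N h k ks f f' hk hks hf
  have hcons : ∀ a l v, g (consF a f l v) = consF (ρ' a) f' (l.map ρ') (σ' v) :=
    fun a l v => hf (a :: l) v
  rw [op_rec, op_rec ℬ N k ks, map_add, map_add, map_add]
  congr 1
  · congr 1
    · congr 1
      · cases K with
        | zero => simp
        | succ K => exact h1 K rfl N h k ks _ _ hk hks (hk.β ▸ hcons _)
      · cases hks with
        | nil => simp
        | cons hst hks => exact h2 _ _ rfl _ _ _ _ _ _ hst.2 hks (hst.1 ▸ hcons _)
    · cases l with
      | nil => simp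
      | cons a l =>
        refine h3 a l rfl _ _ _ _ _ _ hk hks ?_
        have hb : bar ℬ N (ρ a) = ρ (bar gr N a) := bar_map_zero gr ℬ ρ.toAddMonoidHom hρ N a
        rw [hb, hk.θ]
        exact hcons _
  · have : (hs = [] ∧ l = [] ∧ K = 0) ↔ (ks = [] ∧ l.map ρ = [] ∧ K = 0) := by
      rw [List.map_eq_nil_iff]
      cases hks <;> simp
    by_cases hc : hs = [] ∧ l = [] ∧ K = 0
    · rw [if_pos hc, if_pos (this.mp hc), hf, hk.ν]; rfl
    · rw [if_neg hc, if_neg (mt this.mpr hc), map_zero]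

lemma op_strDeg {𝒱 : ℤ → AddSubgroup V} {𝒱' : ℤ → AddSubgroup V'} {𝒲 : ℤ → AddSubgroup Y} {m : ℤ}
    {f : List A' → V' → Y} (hf : StrDeg gr' 𝒱' 𝒲 m f) (H : PathGraded gr gr' h hs)
    (hν : ∀ {j v}, v ∈ 𝒱 j → h.ν v ∈ 𝒱' j) (hsν : ∀ s ∈ hs, ∀ {j v}, v ∈ 𝒱 j → s.2.ν v ∈ 𝒱' j)
    (N : ℤ) (K : ℕ) : StrDeg gr 𝒱 𝒲 (m - hs.length) (fun l v => op gr N h hs K l f v) := by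
  intro l e j v hl hv
  refine op_induction (P := fun (hs : Steps A A' V V') K (l : List A) =>
      ∀ (N : ℤ) (h : Vtx A A' V V') (m : ℤ) (e : List ℤ) (f : List A' → V' → Y),
      StrDeg gr' 𝒱' 𝒲 m f → PathGraded gr gr' h hs → (∀ {j v}, v ∈ 𝒱 j → h.ν v ∈ 𝒱' j) →
      (∀ s ∈ hs, ∀ {j v}, v ∈ 𝒱 j → s.2.ν v ∈ 𝒱' j) → List.Forall₂ (fun a i => a ∈ gr i) l e →
        op gr N h hs K l f v ∈ 𝒲 (e.sum + j + (m - hs.length) - l.length))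
    ?_ hs K l N h m e f hf H hν hsν hl
  intro hs K l h1 h2 h3 N h m e f hf H hν hsν hl
  rw [op_rec]
  refine add_mem (add_mem (add_mem ?_ ?_) ?_) ?_
  · cases K with
    | zero => exact zero_mem _
    | succ K =>
      have := h1 K rfl N h _ e _ (hf.cons H.vtx.β_mem) H hν hsν hl
      simpa using this
  · cases hs with
    | nil => exact zero_mem _
    | cons s hs =>
      have := h2 s hs rfl (N - 1) s.2 _ e _ (hf.cons H.step_mem) H.tail (hsν s (by simp))
        (fun t ht => hsν t (by simp [ht])) hl
      rw [stepMove_cons]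
      convert this using 2
      simp; ring
  · cases hl with
    | nil => exact zero_mem _
    | @cons a i l e ha hl =>
      have := h3 a l rfl N h _ e _ (hf.cons (H.vtx.θ_mem (bar_mem gr N ha))) H hν hsν hl
      rw [stepMove_cons]
      convert this using 2
      simp; ring
  · split_ifs with hc
    · obtain ⟨rfl, rfl, rfl⟩ := hc
      cases hl
      simpa using hf [] [] j _ List.Forall₂.nil (hν hv)
    · exact zero_mem _

/-- The part of a function with lengths of strings in a set. -/
def lengthPart (S : Set ℕ) (f : List A' → V' → Y) : List A' → V' → Y := fun l v =>
  open Classical in if l.length ∈ S then f l v else 0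

/-- The sequences with finitely many nonzero terms. -/
def evZeroSeq (Y : Type*) [AddCommGroup Y] : AddSubgroup (ℕ → Y) where
  carrier := {X | EvZero X}
  zero_mem' := evZero_zero
  add_mem' := EvZero.add
  neg_mem' := EvZero.neg

lemma op_evZero_values (N : ℤ) (h : Vtx A A' V V') (hs : Steps A A' V V') (a : ℕ) (l : List A)
    {g : ℕ → List A' → V' → Y} (hg : ∀ x v', EvZero fun b => g b x v') (v : V) :
    EvZero (fun b => op gr N h hs a l (g b) v) ∧ tot (fun b => op gr N h hs a l (g b) v)
        = op gr N h hs a l (fun x v' => tot fun b => g b x v') v := by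
  let E : AddSubgroup (ℕ → Y) := evZeroSeq Y
  let T : E →+ Y := AddMonoidHom.mk' (fun X => tot X.1) fun X Z => tot_add X.2 Z.2
  let G : List A' → V' → E := fun x v' => ⟨fun b => g b x v', hg x v'⟩
  have h1 : (fun b => op gr N h hs a l (g b) v) = (op gr N h hs a l G v).1 := by
    funext b
    exact op_map gr ((Pi.evalAddMonoidHom (fun _ : ℕ => Y) b).comp E.subtype) N h hs a l G v
  rw [h1]
  exact ⟨(op gr N h hs a l G v).2, (op_map gr T N h hs a l G v).symm⟩

/-- The joint finiteness of the composition of two insertion operators. -/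
lemma op_op_finite {Γ : A' → Prop} {Γ' : A'' → Prop} (N N' : ℤ) {k : Vtx A' A'' V' V''}
    {ks : Steps A' A'' V' V''} (Hh : PathIn Γ h hs) (Hk : PathIn Γ' k ks) {f : List A'' → V'' → Y}
    (hf : ∀ S, ProgFinite Γ' (lengthPart S f)) (ω : Y →+ Y')
    (hg : ∀ S, ProgFinite Γ fun x v' => ω (opTot gr' N' k ks (lengthPart S f) x v')) (l : List A)
    (v : V) : ∃ B, ∀ a b, B ≤ a + b →
      op gr N h hs a l (fun x v' => ω (op gr' N' k ks b x f v')) v = 0 := by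
  classical
  have hrows : ∀ S x v', EvZero (fun b => ω (op gr' N' k ks b x (lengthPart S f) v')) ∧
      tot (fun b => ω (op gr' N' k ks b x (lengthPart S f) v'))
        = ω (opTot gr' N' k ks (lengthPart S f) x v') := fun S x v' => by
    obtain ⟨e1, e2⟩ := op_evZero (gr := gr') Hk N' (hf S) x v'
    exact ⟨e1.map ω, by rw [tot_map ω e1, e2]⟩
  have huniv : lengthPart Set.univ f = f := by funext x v'; exact if_pos (Set.mem_univ _)
  have hlen : ∀ (S : Set ℕ) (a b : ℕ) (P : Prop) [Decidable P],
      (P ↔ a + b + (l.length + hs.length + ks.length) ∈ S) →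
      op gr N h hs a l (fun x v' => ω (op gr' N' k ks b x (lengthPart S f) v')) v
        = if P then op gr N h hs a l (fun x v' => ω (op gr' N' k ks b x f v')) v else 0 := by
    intro S a b P _ hP
    split_ifs with hc
    · refine op_eq_zero N h hs a l (fun x v' hx => ?_) v
      congr 1
      refine op_eq_zero N' k ks b x (fun y w hy => if_pos ?_) v'
      grind
    · rw [← op_zero gr N h hs a l v]
      refine op_eq_zero N h hs a l (fun x v' hx => ?_) v
      change ω _ = 0
      rw [← map_zero ω, ← op_zero gr' N' k ks b x v']
      congr 1
      refine op_eq_zero N' k ks b x (fun y w hy => if_neg fun hc' => hc (hP.mpr ?_)) v'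
      grind
  refine finite_of_rows (fun a => ?_) (fun P => ?_)
  · have := (op_evZero_values (gr := gr) N h hs a l (g := fun b x v' => ω (op gr' N' k ks b x f v'))
      (fun x v' => by have := (hrows Set.univ x v').1; rwa [huniv] at this) v).1
    exact this
  · let S : Set ℕ := {t | ∃ s ∈ P, t = s + (l.length + hs.length + ks.length)}
    have hS : ∀ a b, a + b ∈ P ↔ a + b + (l.length + hs.length + ks.length) ∈ S := fun a b =>
      ⟨fun h => ⟨_, h, rfl⟩, fun ⟨s, hs, he⟩ => by rwa [show a + b = s by omega]⟩
    have h1 : (fun a => tot fun b => if a + b ∈ P then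
        op gr N h hs a l (fun x v' => ω (op gr' N' k ks b x f v')) v else 0)
        = fun a => op gr N h hs a l
          (fun x v' => ω (opTot gr' N' k ks (lengthPart S f) x v')) v := by
      funext a
      simp only [← hlen S a _ _ (hS a _)]
      rw [(op_evZero_values N h hs a l
        (g := fun b x v' => ω (op gr' N' k ks b x (lengthPart S f) v'))
        (fun x v' => (hrows S x v').1) v).2]
      grind
    have h2 := (op_evZero (gr := gr) Hh N (hg S) l v).1
    grind

lemma op_op_tot {Γ : A' → Prop} {Γ' : A'' → Prop} (N N' : ℤ) {k : Vtx A' A'' V' V''}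
    {ks : Steps A' A'' V' V''} (Hh : PathIn Γ h hs) (Hk : PathIn Γ' k ks) {f : List A'' → V'' → Y}
    (hf : ∀ S, ProgFinite Γ' (lengthPart S f)) (ω : Y →+ Y')
    (hg : ∀ S, ProgFinite Γ fun x v' => ω (opTot gr' N' k ks (lengthPart S f) x v')) (l : List A)
    (v : V) : EvZero (fun n => ω (opop gr gr' N N' h hs k ks n l f v)) ∧
    opTot gr N h hs (fun x v' => ω (opTot gr' N' k ks f x v')) l v
      = tot fun n => ω (opop gr gr' N N' h hs k ks n l f v) := by
  have huniv : lengthPart Set.univ f = f := by funext x v'; exact if_pos (Set.mem_univ _)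
  obtain ⟨-, h1, h2⟩ := tot_tot_eq (op_op_finite (gr := gr) (gr' := gr') N N' Hh Hk hf ω hg l v)
  have h3 : ∀ n, ∑ p ∈ antidiagonal n,
      op gr N h hs p.1 l (fun x v' => ω (op gr' N' k ks p.2 x f v')) v
      = ω (opop gr gr' N N' h hs k ks n l f v) := by
    intro n
    rw [opop, map_sum]
    exact sum_congr rfl fun p _ => op_map gr ω N h hs p.1 l _ v
  simp only [h3] at h1 h2
  refine ⟨h1, ?_⟩
  rw [← h2]
  have hg' := hg Set.univ
  have hf' := hf Set.univ
  rw [huniv] at hg' hf'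
  rw [← (op_evZero (gr := gr) Hh N hg' l v).2]
  congr 1
  funext a
  rw [(op_evZero_values N h hs a l (g := fun b x v' => ω (op gr' N' k ks b x f v'))
    (fun x v' => (op_evZero (gr := gr') Hk N' hf' x v').1.map ω) v).2]
  congr 1
  funext x v'
  rw [tot_map ω (op_evZero (gr := gr') Hk N' hf' x v').1, (op_evZero (gr := gr') Hk N' hf' x v').2]

lemma shSum_congr {Γ' : A'' → Prop} (N : ℤ) {k : Vtx A' A'' V' V''} {ks : Steps A' A'' V' V''}
    (hΓ : ∀ h' ∈ h :: hs.map Prod.snd, ∀ k' ∈ k :: ks.map Prod.snd, Γ' (h'.comp k').β)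
    {F G : Steps A A'' V V'' → Y} (hFG : ∀ z, (∀ s ∈ z, Γ' s.2.β) → F z = G z) :
    shSum N h hs k ks F = shSum N h hs k ks G := by
  induction' hn : hs.length + ks.length using Nat.strong_induction_on with
    n ih generalizing N h hs k ks F G
  have hcons : ∀ s : A'' × Vtx A A'' V V'', Γ' s.2.β → ∀ z, (∀ t ∈ z, Γ' t.2.β) →
      consF s F z = consF s G z := by
    intro s hs z hz
    refine hFG (s :: z) fun t ht => ?_
    rcases mem_cons.mp ht with rfl | ht
    · exact hs
    · exact hz t ht
  rw [shSum_rec, shSum_rec N h hs k ks G]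
  congr 1
  · congr 1
    · refine stepMove_congr fun s hs' he => ?_
      subst he
      congr 1
      refine ih _ (by simp at hn; omega) _ (fun h' hh' => ?_) (hcons _ (hΓ _ (by simp) _ (by simp)))
        rfl
      exact hΓ h' (by simp at hh' ⊢; tauto)
    · refine stepMove_congr fun s ks' he => ?_
      subst he
      refine ih _ (by simp at hn; omega) _ (fun h' hh' k' hk' => ?_)
        (hcons _ (hΓ _ (by simp) _ (by simp))) rfl
      exact hΓ h' hh' k' (by simp at hk' ⊢; tauto)
  · rw [hFG [] (by simp)]

lemma tot_shSum (N : ℤ) {k : Vtx A' A'' V' V''} {ks : Steps A' A'' V' V''} {Γ' : A'' → Prop}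
    (hΓ : ∀ h' ∈ h :: hs.map Prod.snd, ∀ k' ∈ k :: ks.map Prod.snd, Γ' (h'.comp k').β)
    {F : Steps A A'' V V'' → ℕ → Y} (hF : ∀ z, (∀ s ∈ z, Γ' s.2.β) → EvZero (F z)) :
    tot (shSum N h hs k ks F) = shSum N h hs k ks fun z => tot (F z) := by
  classical
  let E : AddSubgroup (ℕ → Y) := evZeroSeq Y
  let T : E →+ Y := AddMonoidHom.mk' (fun X => tot X.1) fun X Z => tot_add X.2 Z.2
  let G : Steps A A'' V V'' → E := fun z => if hz : ∀ s ∈ z, Γ' s.2.β then ⟨F z, hF z hz⟩ else 0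
  have hG : ∀ z (hz : ∀ s ∈ z, Γ' s.2.β), G z = ⟨F z, hF z hz⟩ := fun z hz => dif_pos hz
  rw [shSum_congr N hΓ (F := F) (G := fun z => E.subtype (G z)) (fun z hz => by rw [hG z hz]; rfl),
    shSum_congr N hΓ (F := fun z => tot (F z)) (G := fun z => T (G z))
      (fun z hz => by rw [hG z hz]; rfl), shSum_map T, shSum_map E.subtype]
  rfl

/-- The composition of two insertion operators is a sum of insertion operators. -/
theorem opTot_opTot {Γ : A' → Prop} {Γ' : A'' → Prop} (N N' : ℤ) {k : Vtx A' A'' V' V''}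
    {ks : Steps A' A'' V' V''} (Gh : PathGraded gr gr' h hs) (Gk : PathGraded gr' gr'' k ks)
    (Hh : PathIn Γ h hs) (Hk : PathIn Γ' k ks) {f : List A'' → V'' → Y} (hm : MultiAdd f)
    (hf : ∀ S, ProgFinite Γ' (lengthPart S f)) (ω : Y →+ Y')
    (hg : ∀ S, ProgFinite Γ fun x v' => ω (opTot gr' N' k ks (lengthPart S f) x v'))
    (hΓ : ∀ h' ∈ h :: hs.map Prod.snd, ∀ k' ∈ k :: ks.map Prod.snd, Γ' (h'.comp k').β)
    (l : List A) (v : V) : opTot gr N h hs (fun x v' => ω (opTot gr' N' k ks f x v')) l v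
      = ω (shSum N' h hs k ks fun z => opTot gr (N + N') (h.comp k) z f l v) := by
  have huniv : lengthPart Set.univ f = f := by funext x v'; exact if_pos (Set.mem_univ _)
  have hf' := hf Set.univ
  rw [huniv] at hf'
  have hz : ∀ z : Steps A A'' V V'', (∀ s ∈ z, Γ' s.2.β) → PathIn Γ' (h.comp k) z :=
    fun z hz => ⟨hΓ h (by simp) k (by simp), hz⟩
  rw [(op_op_tot N N' Hh Hk hf ω hg l v).2]
  have h1 : (fun n => ω (opop gr gr' N N' h hs k ks n l f v))
      = shSum N' h hs k ks fun z n => ω (op gr (N + N') (h.comp k) z n l f v) := by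
    funext n
    rw [opop_eq_shSum gr gr' N N' Gh Gk n l hm v, ← shSum_map ω]
    exact shSum_map (Pi.evalAddMonoidHom (fun _ : ℕ => Y') n) N' h hs k ks
      (fun z n => ω (op gr (N + N') (h.comp k) z n l f v))
  rw [h1, tot_shSum N' hΓ (fun z hz' => (op_evZero (gr := gr) (hz z hz') _ hf' l v).1.map ω),
    ← shSum_map ω]
  refine shSum_congr N' hΓ fun z hz' => ?_
  obtain ⟨e1, e2⟩ := op_evZero (gr := gr) (hz z hz') (N + N') hf' l v
  rw [tot_map ω e1, e2]

end OpProperties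

/-! ## Insertion operators on cochains -/

lemma PathCompat.pathGraded {A A' V V' : Type*} [Ring A] [Ring A'] {gr : ℤ → AddSubgroup A}
    [GradedRing gr] {gr' : ℤ → AddSubgroup A'} [GradedRing gr'] {C : Curved gr} {C' : Curved gr'}
    [AddCommGroup V] [Module A V] [AddCommGroup V'] [Module A' V'] {CV : CurvedMod C V}
    {CV' : CurvedMod C' V'} {h : Vtx A A' V V'} {hs : Steps A A' V V'}
    (H : PathCompat CV CV' h hs) : PathGraded gr gr' h hs := by
  induction hs generalizing h with
  | nil => exact ⟨H.graded, by simp⟩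
  | cons s hs ih =>
    refine ⟨H.1.graded, fun t ht => ?_⟩
    have h2 := ih H.2.2
    rcases mem_cons.mp ht with rfl | ht
    · exact ⟨H.2.1.mem, h2.vtx⟩
    · exact h2.step t ht

section Operators

/-- An operator from functions over `p'` to functions over `p` that is given, over every test object
`q` over `p`, by a lattice path with values in the algebra over an object `tgt q` over `p'`. -/
structure InsOp (V W : CompatModule conn) (p' p : El F) where
  tgt : ∀ {q : El F}, (q ⟶ p) → El F
  hom : ∀ {q : El F} (k : q ⟶ p), tgt k ⟶ p'
  tr : ∀ {r q : El F} (k' : r ⟶ q) (k : q ⟶ p), tgt (k' ≫ k) ⟶ tgt k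
  tr_hom : ∀ {r q : El F} (k' : r ⟶ q) (k : q ⟶ p), tr k' k ≫ hom k = hom (k' ≫ k)
  len : ℕ
  vtx : ∀ {q : El F} (k : q ⟶ p), Vtx (A.obj q) (A.obj (tgt k)) (V.obj q) (V.obj (tgt k))
  path : ∀ {q : El F} (k : q ⟶ p),
    List (A.obj (tgt k) × Vtx (A.obj q) (A.obj (tgt k)) (V.obj q) (V.obj (tgt k)))
  path_length : ∀ {q : El F} (k : q ⟶ p), (path k).length = len
  val : ∀ {q : El F} (k : q ⟶ p), W.obj (tgt k) →+ W.obj q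

/-- The naturality conditions under which the terms of an insertion operator map cochains to
cochains. -/
structure InsOp.Natural {p' : El F} (E : InsOp V W p' p) : Prop where
  vtx_res : ∀ {r q : El F} (k' : r ⟶ q) (k : q ⟶ p),
    (E.vtx k).Intertwines (A.res k') (V.res k') (A.res (E.tr k' k)) (V.res (E.tr k' k))
      (E.vtx (k' ≫ k))
  path_res : ∀ {r q : El F} (k' : r ⟶ q) (k : q ⟶ p),
    List.Forall₂ (fun s t => t.1 = A.res (E.tr k' k) s.1 ∧ s.2.Intertwines (A.res k') (V.res k')
      (A.res (E.tr k' k)) (V.res (E.tr k' k)) t.2) (E.path k) (E.path (k' ≫ k))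
  val_res : ∀ {r q : El F} (k' : r ⟶ q) (k : q ⟶ p) (y : W.obj (E.tgt k)),
    W.res k' (E.val k y) = E.val (k' ≫ k) (W.res (E.tr k' k) y)
  pathGraded : ∀ {q : El F} (k : q ⟶ p),
    PathGraded (A.gr q) (A.gr (E.tgt k)) (E.vtx k) (E.path k)
  ν_mem : ∀ {q : El F} (k : q ⟶ p), ∀ h ∈ E.vtx k :: (E.path k).map Prod.snd, ∀ {j v},
    v ∈ V.gr q j → h.ν v ∈ V.gr (E.tgt k) j
  val_mem : ∀ {q : El F} (k : q ⟶ p) {j y}, y ∈ W.gr (E.tgt k) j → E.val k y ∈ W.gr q j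
  linear : ∀ {q : El F} (k : q ⟶ p) {i : ℤ} {ω : O.obj q.base}, ω ∈ O.gr q.base i →
    ∃ ω' ∈ O.gr (E.tgt k).base i,
      PathLinear (A.gr q) (A.gr (E.tgt k)) (A.η q ω) (A.η (E.tgt k) ω') (E.vtx k) (E.path k) ∧
      ∀ y, E.val k (A.η (E.tgt k) ω' • y) = A.η q ω • E.val k y

/-- The inserted elements of a natural insertion operator have convergent exponentials. -/
structure InsOp.Convergent (κ : CochainKind) {p' : El F} (E : InsOp V W p' p) : Prop
    extends E.Natural where
  labels : ∀ {q : El F} (k : q ⟶ p), PathIn (ExpOne V W κ (E.tgt k)) (E.vtx k) (E.path k)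

/-- A convergent insertion operator that is compatible with the connections. -/
structure InsOp.Good (κ : CochainKind) {p' : El F} (E : InsOp V W p' p) : Prop
    extends E.Convergent κ where
  compat : ∀ {q : El F} (k : q ⟶ p),
    PathCompat (V.curvedMod q) (V.curvedMod (E.tgt k)) (E.vtx k) (E.path k)
  val_D : ∀ {q : El F} (k : q ⟶ p) (y : W.obj (E.tgt k)),
    E.val k (W.D _ y - (E.vtx k).β • y) = W.D q (E.val k y)
  val_θ : ∀ {q : El F} (k : q ⟶ p) (a : A.obj q) (y : W.obj (E.tgt k)),
    E.val k ((E.vtx k).θ a • y) = a • E.val k y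

namespace InsOp

/-- The terms with `K` inserted elements of an insertion operator. -/
def term {p' : El F} (E : InsOp V W p' p) (K : ℕ) (φ : Raw V W p') : Raw V W p :=
  fun q k l v => E.val k
    (op (A.gr q) (E.path k).length (E.vtx k) (E.path k) K l (φ (E.tgt k) (E.hom k)) v)

/-- The action of an insertion operator. -/
def app {p' : El F} (E : InsOp V W p' p) (φ : Raw V W p') : Raw V W p :=
  fun q k l v => E.val k
    (opTot (A.gr q) (E.path k).length (E.vtx k) (E.path k) (φ (E.tgt k) (E.hom k)) l v)

variable {p' p : El F} {E : InsOp V W p' p}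

lemma term_evZero (hE : E.Convergent κ) {φ : Raw V W p'} (h : φ ∈ cochains V W κ p' m) (q : El F)
    (k : q ⟶ p) (l : List (A.obj q)) (v : V.obj q) :
    EvZero (fun K => E.term K φ q k l v) ∧ E.app φ q k l v = tot fun K => E.term K φ q k l v := by
  obtain ⟨e1, e2⟩ := op_evZero (gr := A.gr q) (hE.labels k) (E.path k).length
    (cochain_progFinite h (E.hom k)) l v
  exact ⟨e1.map _, by rw [app, ← e2, ← tot_map _ e1]; rfl⟩

lemma term_mem (hE : E.Natural) {φ : Raw V W p'} (h : φ ∈ cochains V W κ p' m) (K : ℕ) :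
    E.term K φ ∈ cochains V W κ p (m - E.len) := by
  replace h : IsCochain κ p' m φ := h
  refine IsCochain.of_olin ?_ ?_ ?_ ?_ ?_
  · intro q k
    exact (op_multiAdd _ _ _ K (h.multiAdd (E.hom k))).comp (E.val k)
  · intro r q k' k l v
    rw [term, hE.val_res, term, E.path_length, E.path_length]
    congr 1
    refine op_res (fun h => A.res_mem k' h) (W.res (E.tr k' k)) (fun l v => ?_) _
      (hE.vtx_res k' k) (hE.path_res k' k) K l v
    rw [h.res, E.tr_hom]
  · intro q k l e j v hl hv
    refine hE.val_mem k ?_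
    have := op_strDeg (strDeg_of h (E.hom k)) (hE.pathGraded k) (hE.ν_mem k (E.vtx k) (by simp))
      (fun s hs => hE.ν_mem k s.2 (mem_cons_of_mem _ (List.mem_map_of_mem hs)))
      (E.path k).length K l e j v hl hv
    rw [E.path_length] at this ⊢
    grind
  · intro q k i ω hω
    obtain ⟨ω', hω', hlin, hval⟩ := hE.linear k hω
    have h1 := h.olin (E.hom k) hω'
    have hm := h.multiAdd (E.hom k)
    have h2 := op_olin (f := fun l v => E.val k (φ (E.tgt k) (E.hom k) l v))
      (f' := fun l v => E.val k (((i * (m + 1)).negOnePow • φ (E.tgt k) (E.hom k)) l v))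
      (central_η hω) hlin K (hm.comp _)
      ((hm.comp (toAddMonoidHom _ (i * (m + 1)).negOnePow)).comp (E.val k))
      ⟨fun p a l v => by rw [h1.entry, hval], fun p v => by rw [h1.right, map_units_smul, hval]⟩
    have e1 : E.term K φ q k = fun l v => op (A.gr q) (E.path k).length (E.vtx k) (E.path k) K l
        (fun l v => E.val k (φ (E.tgt k) (E.hom k) l v)) v := by
      funext l v
      exact (op_map _ (E.val k) _ _ _ _ _ _ _).symm
    have e2 : (i * (m - E.len + 1)).negOnePow • E.term K φ q k = fun l v =>
        (((E.path k).length : ℤ) * i).negOnePow •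
        op (A.gr q) (E.path k).length (E.vtx k) (E.path k) K l
        (fun l v => E.val k (((i * (m + 1)).negOnePow • φ (E.tgt k) (E.hom k)) l v)) v := by
      funext l v
      have := op_map (A.gr q) ((toAddMonoidHom _ (i * (m + 1)).negOnePow).comp
        (E.val k)) (E.path k).length (E.vtx k) (E.path k) K l (φ (E.tgt k) (E.hom k)) v
      simp only [AddMonoidHom.comp_apply, DistribSMul.toAddMonoidHom_apply] at this
      simp only [Pi.smul_apply, map_units_smul, this, term]
      rw [smul_smul, ← negOnePow_add, E.path_length]
      congr 1
      exact negOnePow_eq_of (c := -(E.len * i)) (by ring)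
    rw [e1] at e2 ⊢
    rw [e2]
    exact h2
  · intro hκ
    obtain ⟨N, hN⟩ := h.bounded hκ
    refine ⟨N, fun q k l v hl => ?_⟩
    rw [term, op_eq_zero (g := 0) _ _ _ _ _ (fun y v hy => hN _ _ _ _ (by omega)), op_zero,
      map_zero]

lemma app_mem (hE : E.Convergent κ) {φ : Raw V W p'} (h : φ ∈ cochains V W κ p' m) :
    E.app φ ∈ cochains V W κ p (m - E.len) := by
  have h1 : E.app φ = fun q k l v => tot fun K => E.term K φ q k l v := by
    funext q k l v; exact (term_evZero hE h q k l v).2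
  rw [h1]
  refine tot_cochains_mem (fun K => term_mem hE.toNatural h K)
    (fun q k l v => (term_evZero hE h q k l v).1)
    fun hκ => ?_
  obtain ⟨N, hN⟩ := IsCochain.bounded h hκ
  refine ⟨N, fun K q k l v hl => ?_⟩
  rw [term, op_eq_zero (g := 0) _ _ _ _ _ (fun y v hy => hN _ _ _ _ (by omega)), op_zero, map_zero]

lemma app_add (hE : E.Convergent κ) {m' : ℤ} {φ ψ : Raw V W p'} (h : φ ∈ cochains V W κ p' m)
    (h' : ψ ∈ cochains V W κ p' m') : E.app (φ + ψ) = E.app φ + E.app ψ := by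
  funext q k l v
  simp only [app, Pi.add_apply]
  rw [opTot_add (hE.labels k) _ (cochain_progFinite h _) (cochain_progFinite h' _), map_add]

lemma app_totalD (hE : E.Good κ) {φ : Raw V W p'} (h : φ ∈ cochains V W κ p' m) (q : El F)
    (k : q ⟶ p) (l : List (A.obj q)) (v : V.obj q) :
    E.app (totalD m φ) q k l v = (E.len : ℤ).negOnePow • totalD (m - E.len) (E.app φ) q k l v
      + stepMove (E.path k) (fun s hs' => E.val k (s.1 •
        opTot (A.gr q) ((E.path k).length - 1) s.2 hs' (φ (E.tgt k) (E.hom k)) l v))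
      + E.val k (dropSum (E.path k) fun hs' => opTot (A.gr q) ((E.path k).length - 1) (E.vtx k) hs'
        (φ (E.tgt k) (E.hom k)) l v) := by
  rw [app, totalD_eq, totalD_eq, ← E.path_length k]
  exact strD_opTot (V.curvedMod q) (V.curvedMod (E.tgt k)) (W.curvedMod q) (W.curvedMod (E.tgt k))
    (fun γ hγ => hγ.1) (hE.labels k) (hE.compat k) m (IsCochain.multiAdd h _)
    (cochain_progFinite h _) (E.val k) (hE.val_D k) (hE.val_θ k)
    (fun s hs => ((hE.pathGraded k).step s hs).1) l v

lemma app_app {p'' : El F} {E' : InsOp V W p'' p'} (hE : E.Convergent κ) (hE' : E'.Convergent κ)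
    {φ : Raw V W p''} (h : φ ∈ cochains V W κ p'' m) (k : q ⟶ p)
    (hΓ : ∀ h₁ ∈ E.vtx k :: (E.path k).map Prod.snd, ∀ h₂ ∈ E'.vtx (E.hom k) ::
    (E'.path (E.hom k)).map Prod.snd, ExpOne V W κ (E'.tgt (E.hom k)) (h₁.comp h₂).β)
    (l : List (A.obj q)) (v : V.obj q) : E.app (E'.app φ) q k l v = E.val k (E'.val (E.hom k)
      (shSum (E'.path (E.hom k)).length (E.vtx k) (E.path k) (E'.vtx (E.hom k))
        (E'.path (E.hom k)) fun z => opTot (A.gr q)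
          ((E.path k).length + (E'.path (E.hom k)).length) ((E.vtx k).comp (E'.vtx (E.hom k))) z
          (φ (E'.tgt (E.hom k)) (E'.hom (E.hom k))) l v)) := by
  have hS : ∀ S, lengthPart S (φ (E'.tgt (E.hom k)) (E'.hom (E.hom k)))
      = Raw.arities S φ (E'.tgt (E.hom k)) (E'.hom (E.hom k)) := fun S => rfl
  have := opTot_opTot (gr := A.gr q) (E.path k).length (E'.path (E.hom k)).length
    (hE.pathGraded k) (hE'.pathGraded (E.hom k)) (hE.labels k)
    (hE'.labels (E.hom k)) (IsCochain.multiAdd h (E'.hom (E.hom k)))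
    (fun S => by rw [hS]; exact cochain_progFinite (arities_mem h S) _) (E'.val (E.hom k))
    (fun S => by
      rw [hS]
      exact cochain_progFinite (app_mem hE' (arities_mem h S)) (E.hom k)) hΓ l v
  rw [app, ← this]
  rfl

end InsOp

end Operators

/-! ## The operators of inner automorphisms on cochains -/

section Vertices

variable {A A' : Type u} [Ring A] {gr : ℤ → AddSubgroup A} [GradedRing gr] [Ring A']
  {gr' : ℤ → AddSubgroup A'} [GradedRing gr'] {C : Curved gr} {C' : Curved gr'}
  {V V' : Type*} [AddCommGroup V] [Module A V] [AddCommGroup V'] [Module A' V']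

lemma adVtx_intertwines {ρ : A →+* A'} {σ : V →+ V'} (hD : ∀ a, ρ (C.D a) = C'.D (ρ a))
    (hσ : ∀ (a : A) v, σ (a • v) = ρ a • σ v) (u : Aˣ) :
    (adVtx C V u).Intertwines ρ σ ρ σ (adVtx C' V' (Units.map ρ.toMonoidHom u)) := by
  have h1 : ((Units.map ρ.toMonoidHom u : A'ˣ) : A') = ρ u := rfl
  have h2 : ((Units.map ρ.toMonoidHom u)⁻¹ : A'ˣ) = ρ (↑u⁻¹ : A) := rfl
  refine ⟨fun a => ?_, ?_, fun v => ?_⟩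
  · simp only [adVtx_θ, h1, h2, map_mul]
  · simp only [adVtx_β, h1, h2, map_mul, map_neg, hD]
  · simp only [adVtx_ν, h2, hσ]

lemma adPath_intertwines {ρ : A →+* A'} {σ : V →+ V'} (hD : ∀ a, ρ (C.D a) = C'.D (ρ a))
    (hσ : ∀ (a : A) v, σ (a • v) = ρ a • σ v) (u : Aˣ) (cs : List Aˣ) :
    List.Forall₂ (fun s t => t.1 = ρ s.1 ∧ s.2.Intertwines ρ σ ρ σ t.2) (adPath C V u cs)
      (adPath C' V' (Units.map ρ.toMonoidHom u) (cs.map (Units.map ρ.toMonoidHom))) := by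
  induction cs generalizing u with
  | nil => exact List.Forall₂.nil
  | cons c cs ih =>
    have := ih (u * c)
    rw [map_mul] at this
    refine List.Forall₂.cons ⟨rfl, ?_⟩ this
    have := adVtx_intertwines (V := V) hD hσ (u * c)
    grind

lemma adPath_vtx_mem (S : Subgroup Aˣ) {u : Aˣ} {cs : List Aˣ} (hu : u ∈ S)
    (hcs : ∀ c ∈ cs, c ∈ S) :
    ∀ h ∈ adVtx C V u :: (adPath C V u cs).map Prod.snd, ∃ w ∈ S, h = adVtx C V w := by
  induction cs generalizing u with
  | nil =>
    intro h hh
    simp only [adPath, map_nil, mem_singleton] at hh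
    grind
  | cons c cs ih =>
    intro h hh
    rcases mem_cons.mp hh with rfl | hh
    · grind
    · exact ih (S.mul_mem hu (hcs c (by simp))) (fun d hd => hcs d (by simp [hd])) h hh

variable (gr) in
/-- The invertible elements of degree zero. -/
def unitsZero : Subgroup Aˣ where
  carrier := {u | (u : A) ∈ gr 0}
  one_mem' := SetLike.GradedOne.one_mem (A := gr)
  mul_mem' {u v} hu hv := by
    have := SetLike.mul_mem_graded (A := gr) (show (u : A) ∈ gr 0 from hu)
      (show (v : A) ∈ gr 0 from hv)
    simp_all
  inv_mem' {u} hu := units_inv_mem_zero gr u hu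

end Vertices

/-- Inverse image of invertible elements. -/
abbrev OAlg.resU (A : OAlg O F) (k : q ⟶ p) : (A.obj p)ˣ →* (A.obj q)ˣ :=
  Units.map (A.res k).toMonoidHom

lemma resU_comp (k' : r ⟶ q) (k : q ⟶ p) (c : (A.obj p)ˣ) :
    A.resU (k' ≫ k) c = A.resU k' (A.resU k c) := Units.ext (A.res_comp k' k c)

lemma resU_id (c : (A.obj p)ˣ) : A.resU (𝟙 p) c = c := Units.ext (A.res_id p c)

/-- The vertex of an invertible element on the modules of sections. -/
abbrev CompatModule.adVtx (V : CompatModule conn) (u : (A.obj q)ˣ) :=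
  InnerAct.adVtx (conn.curved q) (V.obj q) u

/-- The path of a list of invertible elements on the modules of sections. -/
abbrev CompatModule.adPath (V : CompatModule conn) (u : (A.obj q)ˣ) (cs : List (A.obj q)ˣ) :=
  InnerAct.adPath (conn.curved q) (V.obj q) u cs

variable (V W) in
/-- The insertion operator underlying `c₀ φ(c₁, …, cₘ)`. -/
def phiIns (c₀ : (A.obj p)ˣ) (cs : List (A.obj p)ˣ) : InsOp V W p p where
  tgt {q} _ := q
  hom k := k
  tr k' _ := k'
  tr_hom _ _ := rfl
  len := cs.length
  vtx {q} k := V.adVtx (A.resU k c₀)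
  path {q} k := V.adPath (A.resU k c₀) (cs.map (A.resU k))
  path_length _ := by simp
  val {q} k := toAddMonoidHom (W.obj q) (A.res k ↑c₀ : A.obj q)

lemma resU_mem_zero (k : q ⟶ p) {c : (A.obj p)ˣ} (hc : c ∈ unitsZero (A.gr p)) :
    A.resU k c ∈ unitsZero (A.gr q) := A.res_mem k hc

lemma adVtx_linear {u : (A.obj q)ˣ} (hu : u ∈ unitsZero (A.gr q)) {ω : O.obj q.base}
    (hω : ω ∈ O.gr q.base i) :
    (V.adVtx u).Linear (gr := A.gr q) (A.gr q) (A.η q ω) (A.η q ω) := by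
  have hi : (↑u⁻¹ : A.obj q) ∈ A.gr q 0 := units_inv_mem_zero _ u hu
  have hc : (↑u⁻¹ : A.obj q) * A.η q ω = A.η q ω * ↑u⁻¹ := by
    rw [(central_η hω).comm, koszul_of_mem_zero _ _ hi]
  refine ⟨adVtx_graded u hu, fun a => ?_, fun v => ?_⟩
  · rw [adVtx_θ, adVtx_θ, ← mul_assoc, hc]; simp only [mul_assoc]
  · rw [adVtx_ν, adVtx_ν, smul_smul, hc, mul_smul]

lemma adPath_fst_mem {u : (A.obj q)ˣ} {cs : List (A.obj q)ˣ}
    (hcs : ∀ c ∈ cs, c ∈ unitsZero (A.gr q)) :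
    ∀ s ∈ V.adPath u cs, s.1 ∈ A.gr q 0 := by
  induction cs generalizing u with
  | nil => intro s hs; simp [adPath] at hs
  | cons c cs ih =>
    intro s hs
    rcases mem_cons.mp hs with rfl | hs
    · exact hcs c (by simp)
    all_goals grind

lemma phiIns_natural (h₀ : c₀ ∈ unitsZero (A.gr p)) (hcs : ∀ c ∈ cs, c ∈ unitsZero (A.gr p)) :
    (phiIns V W c₀ cs).Natural := by
  have hcs' : ∀ {q : El F} (k : q ⟶ p), ∀ c ∈ cs.map (A.resU k), c ∈ unitsZero (A.gr q) := by
    intro q k c hc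
    obtain ⟨d, hd, rfl⟩ := mem_map.mp hc
    exact resU_mem_zero k (hcs d hd)
  have hvtx : ∀ {q : El F} (k : q ⟶ p), ∀ h ∈ (phiIns V W c₀ cs).vtx k ::
      ((phiIns V W c₀ cs).path k).map Prod.snd, ∃ w ∈ unitsZero (A.gr q),
      h = V.adVtx w := fun k =>
    adPath_vtx_mem _ (resU_mem_zero k h₀) (hcs' k)
  refine ⟨?_, ?_, ?_, ?_, ?_, ?_, ?_⟩
  · intro r q k' k
    have := adVtx_intertwines (C := conn.curved q) (C' := conn.curved r) (V := V.obj q)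
      (fun a => (conn.D_res k' a).symm) (V.res_smul k') (A.resU k c₀)
    change Vtx.Intertwines _ _ _ _ _ (adVtx _ _ (A.resU (k' ≫ k) c₀))
    rw [resU_comp]; exact this
  · intro r q k' k
    have := adPath_intertwines (C := conn.curved q) (C' := conn.curved r) (V := V.obj q)
      (fun a => (conn.D_res k' a).symm) (V.res_smul k') (A.resU k c₀) (cs.map (A.resU k))
    rw [map_map] at this
    change List.Forall₂ _ (V.adPath _ _)
      (V.adPath (A.resU (k' ≫ k) c₀) (cs.map (A.resU (k' ≫ k))))
    rw [resU_comp, show cs.map (A.resU (k' ≫ k)) = cs.map (A.resU k' ∘ A.resU k) from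
      map_congr_left fun c _ => resU_comp k' k c]
    exact this
  · intro r q k' k (y : W.obj q)
    change W.res k' (A.res k ↑c₀ • y) = A.res (k' ≫ k) ↑c₀ • W.res k' y
    rw [W.res_smul, A.res_comp]
  · intro q k
    have := (adPath_compat (C := conn.curved q) (V.curvedMod q) _ (resU_mem_zero k h₀) _
      (hcs' k)).pathGraded
    exact this
  · intro q k h hh j v hv
    obtain ⟨w, hw, rfl⟩ := hvtx k h hh
    have := V.smul_mem (units_inv_mem_zero _ w hw) hv
    rwa [zero_add] at this
  · intro q k j (y : W.obj q) hy
    have := W.smul_mem (resU_mem_zero k h₀) hy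
    rwa [zero_add] at this
  · intro q k i ω hω
    refine ⟨ω, hω, ⟨adVtx_linear (resU_mem_zero k h₀) hω, fun s hs =>
      ⟨adPath_fst_mem (hcs' k) s hs, ?_⟩⟩, fun (y : W.obj q) => ?_⟩
    · obtain ⟨w, hw, he⟩ := hvtx k s.2 (mem_cons_of_mem _ (List.mem_map_of_mem hs))
      rw [he]; exact adVtx_linear hw hω
    · change A.res k ↑c₀ • A.η q ω • y = A.η q ω • A.res k ↑c₀ • y
      have hk : A.res k ↑c₀ ∈ A.gr q 0 := resU_mem_zero k h₀
      rw [smul_smul, (central_η hω).comm, koszul_of_mem_zero _ _ hk, mul_smul]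

/-! ### Elements with convergent exponentials -/

lemma MultiAdd.replicate_neg {A V Y : Type*} [Ring A] [AddCommGroup V] [AddCommGroup Y]
    {f : List A → V → Y} (hf : MultiAdd f) (a : A) (n : ℕ) (v : V) :
    f (replicate n (-a)) v = (n : ℤ).negOnePow • f (replicate n a) v := by
  induction n generalizing f with
  | zero => simp
  | succ n ih =>
    rw [replicate_succ, replicate_succ, ← consF_apply (-a) f, hf.consF_neg]
    have := ih (hf.cons a)
    simp only [consF_apply] at this
    rw [Pi.neg_apply, Pi.neg_apply, consF_apply, this, Nat.cast_succ, negOnePow_succ,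
      Units.neg_smul]

lemma ExpOne.neg {a : A.obj p} (h : ExpOne V W κ p a) : ExpOne V W κ p (-a) := by
  refine ⟨neg_mem h.1, fun q k m φ hφ v => ?_⟩
  obtain ⟨N, hN⟩ := h.2 q k m φ hφ v
  refine ⟨N, fun n hn => ?_⟩
  beta_reduce at hN ⊢
  rw [map_neg, (IsCochain.multiAdd hφ (𝟙 q)).replicate_neg, hN n hn, smul_zero]

lemma ExpOne.zero : ExpOne V W κ p 0 := by
  refine ⟨zero_mem _, fun q k m φ hφ v => ⟨1, fun n hn => ?_⟩⟩
  obtain ⟨n, rfl⟩ : ∃ n', n = n' + 1 := ⟨n - 1, by omega⟩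
  beta_reduce
  rw [map_zero, replicate_succ]
  exact congrFun (congrFun (IsCochain.multiAdd hφ (𝟙 q)).consF_zero _) v

lemma ExpOne.conj {a : A.obj p} (h : ExpOne V W κ p a) {u : (A.obj p)ˣ}
    (hu : u ∈ unitsZero (A.gr p)) : ExpOne V W κ p (↑u⁻¹ * a * ↑u) := by
  refine ⟨(adVtx_graded (C := conn.curved p) (V := V.obj p) u hu).θ_mem h.1, fun q k m φ hφ v => ?_⟩
  have hn : (phiIns V W (A.resU k u) []).Natural := phiIns_natural (resU_mem_zero k hu) (by simp)
  have h1 := ((h.2 q k _ _ (InsOp.term_mem hn hφ 0) ((A.res k ↑u : A.obj q) • v)).map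
    (toAddMonoidHom (W.obj q) (A.res k ↑u⁻¹ : A.obj q)))
  refine Eq.mp (congrArg EvZero (funext fun n => ?_)) h1
  have h2 := op_nil_eq_insSum (gr := A.gr q)
    (V.adVtx (A.resU (𝟙 q) (A.resU k u))) 0
    (replicate n (A.res k a)) (φ q (𝟙 q)) ((A.res k ↑u : A.obj q) • v)
  change A.res k ↑u⁻¹ • A.res (𝟙 q) (A.res k ↑u) • op (A.gr q) 0
    (V.adVtx (A.resU (𝟙 q) (A.resU k u))) [] 0 _ (φ q (𝟙 q)) _ = _
  rw [h2, insSum, insertions]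
  simp only [map_cons, map_nil, List.sum_cons, List.sum_nil, add_zero, resU_id,
    map_replicate, adVtx_θ, adVtx_ν, A.res_id]
  rw [smul_smul, ← map_mul, Units.inv_mul, map_one, one_smul]
  have h3 : (((A.resU k u)⁻¹ : (A.obj q)ˣ) : A.obj q) = A.res k ↑u⁻¹ := rfl
  have h4 : ((A.resU k u : (A.obj q)ˣ) : A.obj q) = A.res k ↑u := rfl
  rw [h3, h4, smul_smul, ← map_mul, ← map_mul, ← map_mul, Units.inv_mul, map_one, one_smul]

variable (V W) in
/-- The operator `exp(ι_a)` as an insertion operator. -/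
def expIns (a : A.obj p) : InsOp V W p p where
  tgt {q} _ := q
  hom k := k
  tr k' _ := k'
  tr_hom _ _ := rfl
  len := 0
  vtx k := ⟨AddMonoidHom.id _, A.res k a, AddMonoidHom.id _⟩
  path _ := []
  path_length _ := rfl
  val _ := AddMonoidHom.id _

lemma expIns_convergent {a : A.obj p} (h : ExpOne V W κ p a) : (expIns V W a).Convergent κ where
  vtx_res k' k := ⟨fun _ => rfl, A.res_comp k' k a, fun _ => rfl⟩
  path_res _ _ := List.Forall₂.nil
  val_res _ _ _ := rfl
  pathGraded k := ⟨⟨fun h => h, A.res_mem k h.1⟩, fun s hs => (not_mem_nil hs).elim⟩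
  ν_mem k h hh j v hv := by
    obtain rfl := mem_singleton.mp hh
    exact hv
  val_mem _ _ _ hy := hy
  linear k i ω hω := ⟨ω, hω, ⟨⟨⟨fun h => h, A.res_mem k h.1⟩, fun _ => rfl, fun _ => rfl⟩,
    fun s hs => (not_mem_nil hs).elim⟩, fun _ => rfl⟩
  labels k := ⟨h.restrict k, fun s hs => (not_mem_nil hs).elim⟩

lemma ExpOne.add {a b : A.obj p} (ha : ExpOne V W κ p a) (hb : ExpOne V W κ p b) :
    ExpOne V W κ p (a + b) := by
  refine ⟨add_mem ha.1 hb.1, fun q k m φ hφ v => ?_⟩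
  replace ha := ha.restrict k
  replace hb := hb.restrict k
  let ea : Vtx (A.obj q) (A.obj q) (V.obj q) (V.obj q) :=
    ⟨AddMonoidHom.id _, A.res (𝟙 q) (A.res k a), AddMonoidHom.id _⟩
  let eb : Vtx (A.obj q) (A.obj q) (V.obj q) (V.obj q) :=
    ⟨AddMonoidHom.id _, A.res (𝟙 q) (A.res k b), AddMonoidHom.id _⟩
  have Ea := expIns_convergent ha
  have Eb := expIns_convergent hb
  have h1 := (op_op_tot (gr := A.gr q) (gr' := A.gr q) (h := eb) (k := ea) (hs := []) (ks := []) 0 0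
    (Eb.labels (𝟙 q)) (Ea.labels (𝟙 q))
    (f := φ q (𝟙 q)) (fun S => cochain_progFinite (arities_mem hφ S) (𝟙 q))
    (AddMonoidHom.id (W.obj q))
    (fun S => cochain_progFinite (InsOp.app_mem Ea (arities_mem hφ S)) (𝟙 q)) [] v).1
  refine Eq.mp (congrArg EvZero (funext fun n => ?_)) h1
  have h2 := opop_eq_shSum (gr := A.gr q) (gr' := A.gr q) (gr'' := A.gr q) (h := eb) (k := ea)
    (hs := []) (ks := []) 0 0 (Eb.pathGraded (𝟙 q)) (Ea.pathGraded (𝟙 q)) n []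
    (IsCochain.multiAdd hφ (𝟙 q)) v
  rw [shSum] at h2
  refine h2.trans ((op_nil_eq_insSum (gr := A.gr q) (eb.comp ea) n [] (φ q (𝟙 q)) v).trans ?_)
  rw [insSum, map_nil, insertions_nil]
  simp only [map_cons, map_nil, List.sum_cons, List.sum_nil, add_zero]
  simp only [Vtx.comp, ea, eb, AddMonoidHom.id_apply, A.res_id, map_add]
  rfl

/-! ### Admissible elements -/

variable (V W κ) in
/-- The group of admissible elements. -/
def admissibles (p : El F) : Subgroup (A.obj p)ˣ where
  carrier := {c | (c : A.obj p) ∈ A.gr p 0 ∧ ExpOne V W κ p (-(conn.D p c * ↑c⁻¹))}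
  one_mem' := by
    refine ⟨SetLike.GradedOne.one_mem, ?_⟩
    have h1 : conn.D p (1 : A.obj p) = 0 := (conn.curved p).D_one
    rw [Units.val_one, h1, zero_mul, neg_zero]
    exact ExpOne.zero
  mul_mem' {c d} hc hd := by
    have hc' : c⁻¹ ∈ unitsZero (A.gr p) := inv_mem hc.1
    refine ⟨(unitsZero (A.gr p)).mul_mem hc.1 hd.1, ?_⟩
    have h1 : conn.D p ↑(c * d) = conn.D p ↑c * ↑d + ↑c * conn.D p ↑d :=
      (conn.curved p).D_mul_zero hc.1 d
    have h2 := hc.2.add (hd.2.conj hc')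
    refine Eq.mp (congrArg _ ?_) h2
    rw [h1, mul_inv_rev, Units.val_mul, inv_inv, add_mul, neg_add]
    congr 1
    · rw [mul_assoc, Units.mul_inv_cancel_left]
    all_goals grind
  inv_mem' {c} hc := by
    refine ⟨(unitsZero (A.gr p)).inv_mem hc.1, ?_⟩
    have h1 : conn.D p ↑c⁻¹ = -(↑c⁻¹ * conn.D p ↑c * ↑c⁻¹) := (conn.curved p).D_inv c hc.1
    have h2 := (hc.2.conj hc.1).neg
    refine Eq.mp (congrArg _ ?_) h2
    rw [h1, inv_inv]
    grind

lemma mem_admissibles {c : (A.obj p)ˣ} : c ∈ admissibles V W κ p ↔ Admissible V W κ p c := by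
  refine ⟨fun h => ⟨h.1, (expOne_iff.mp h.2).2⟩, fun h => ⟨h.1, expOne_iff.mpr ⟨?_, h.2⟩⟩⟩
  have := SetLike.mul_mem_graded (conn.D_mem h.1) (units_inv_mem_zero _ c h.1)
  simp_all

lemma resU_mem_admissibles (k : q ⟶ p) {c : (A.obj p)ˣ} (h : c ∈ admissibles V W κ p) :
    A.resU k c ∈ admissibles V W κ q := by
  refine ⟨resU_mem_zero k h.1, ?_⟩
  have := h.2.restrict k
  rwa [map_neg, map_mul, ← conn.D_res] at this

lemma adVtx_expOne {c : (A.obj p)ˣ} (h : c ∈ admissibles V W κ p) :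
    ExpOne V W κ p (V.adVtx c).β := by
  have := h.2.conj h.1
  refine Eq.mp (congrArg _ ?_) this
  rw [adVtx_β]
  simp only [mul_neg, neg_mul, mul_assoc, Units.inv_mul, mul_one]
  rfl

lemma phiIns_good (h₀ : c₀ ∈ admissibles V W κ p) (hcs : ∀ c ∈ cs, c ∈ admissibles V W κ p) :
    (phiIns V W c₀ cs).Good κ where
  toNatural := phiIns_natural h₀.1 fun c hc => (hcs c hc).1
  labels {q} k := by
    have := adPath_vtx_mem (C := conn.curved q) (V := V.obj q) (admissibles V W κ q)
      (resU_mem_admissibles k h₀) (cs := cs.map (A.resU k)) (fun c hc => by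
        obtain ⟨d, hd, rfl⟩ := mem_map.mp hc
        exact resU_mem_admissibles k (hcs d hd))
    refine ⟨adVtx_expOne (resU_mem_admissibles k h₀), fun s hs => ?_⟩
    obtain ⟨w, hw, he⟩ := this s.2 (mem_cons_of_mem _ (List.mem_map_of_mem hs))
    rw [he]; exact adVtx_expOne hw
  compat {q} k := adPath_compat (V.curvedMod q) _ (resU_mem_zero k h₀.1) _ fun c hc => by
    obtain ⟨d, hd, rfl⟩ := mem_map.mp hc
    exact resU_mem_zero k (hcs d hd).1
  val_D {q} k (y : W.obj q) := adVtx_smul_D (W.curvedMod q) _ (resU_mem_zero k h₀.1) y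
  val_θ {q} k a (y : W.obj q) := adVtx_smul_θ (C := conn.curved q) (V := V.obj q) (A.resU k c₀) a y

/-! ## The operators of the groupoid on cochains -/

lemma mem_of_map_mem {M N : Type*} [AddCommGroup M] [AddCommGroup N] (ℳ : ℤ → AddSubgroup M)
    (𝒩 : ℤ → AddSubgroup N) [DirectSum.Decomposition ℳ] [DirectSum.Decomposition 𝒩] {f : M →+ N}
    (hf : Function.Injective f) (h : ∀ {i a}, a ∈ ℳ i → f a ∈ 𝒩 i) {i : ℤ} {b : M}
    (hb : f b ∈ 𝒩 i) : b ∈ ℳ i := by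
  have key := addHom_ext_homogeneous ℳ (f := (𝒩 i).subtype.comp ((DFinsupp.evalAddMonoidHom i).comp
      ((DirectSum.decomposeAddEquiv 𝒩).toAddMonoidHom.comp f)))
    (g := f.comp ((ℳ i).subtype.comp ((DFinsupp.evalAddMonoidHom i).comp
      (DirectSum.decomposeAddEquiv ℳ).toAddMonoidHom))) (fun j a ha => ?_) b
  · have h1 : (DirectSum.decompose 𝒩 (f b) i : N) = f (DirectSum.decompose ℳ b i) := key
    rw [DirectSum.decompose_of_mem_same _ hb] at h1
    grind
  · change (DirectSum.decompose 𝒩 (f a) i : N) = f (DirectSum.decompose ℳ a i)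
    by_cases hij : j = i
    · subst hij
      rw [DirectSum.decompose_of_mem_same _ (h ha), DirectSum.decompose_of_mem_same _ ha]
    · rw [DirectSum.decompose_of_mem_ne _ (h ha) hij, DirectSum.decompose_of_mem_ne _ ha hij,
        map_zero]

/-- Test objects over the target of an arrow, for a test object over its source. -/
abbrev El.transport (y : F.Ob S) (k : q ⟶ ⟨S, x⟩) : El F := ⟨q.base, (F.res (El.Hom.map k)).obj y⟩

/-- The morphism of test objects over the target that corresponds to a morphism of test objects over
the source of an arrow. -/
def El.transportHom (y : F.Ob S) (k' : r ⟶ q) (k : q ⟶ ⟨S, x⟩) :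
    El.transport y (k' ≫ k) ⟶ El.transport y k :=
  El.Hom.mk (El.Hom.map (q := r) (p := q) k') (by
    change _ = (F.res (El.Hom.map k' ≫ El.Hom.map k)).obj y
    rw [F.res_comp]; rfl)

lemma El.transportHom_lift (y : F.Ob S) (k' : r ⟶ q) (k : q ⟶ ⟨S, x⟩) :
    El.transportHom y k' k ≫ El.lift F (El.Hom.map k) y = El.lift F (El.Hom.map (k' ≫ k)) y := rfl

/-- Every morphism of test objects is one of the standard morphisms. -/
lemma El.hom_cases {P : ∀ q : El F, (q ⟶ ⟨S, x⟩) → Prop}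
    (h : ∀ (S' : 𝕋) (h : S' ⟶ S), P ⟨S', (F.res h).obj x⟩ (El.lift F h x)) (q : El F)
    (k : q ⟶ ⟨S, x⟩) : P q k := by
  obtain ⟨b, z⟩ := q
  have key : ∀ (m : b ⟶ S) (e : (F.res m).obj x = z), P ⟨b, z⟩ (El.Hom.mk m e) := by
    rintro m rfl
    exact h b m
  exact key (El.Hom.map k) (El.Hom.eq k)

lemma El.pull_lift {S' : 𝕋} (h : S' ⟶ S) (g : x ⟶ y) :
    El.pull g (El.lift F h x) = (F.res h).map g := Category.id_comp _

lemma congr_arrow {M : Sort*} (Φ : ∀ z : F.Ob S, (x ⟶ z) → ((⟨S, z⟩ : El F) ⟶ p) → M)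
    {z' : F.Ob S} {f : x ⟶ z} {f' : x ⟶ z'} {k : (⟨S, z⟩ : El F) ⟶ p} {k' : (⟨S, z'⟩ : El F) ⟶ p}
    (e : z = z') (hf : f' = f ≫ eqToHom e) (hk : El.Hom.map k = El.Hom.map k') :
    Φ z f k = Φ z' f' k' := by
  subst e
  have h1 : k = k' := El.Hom.ext hk
  simp_all

lemma eqToHom_cancel {X : Type u} [Category.{v} X] {a b c : X} (e : a = b) (e' : b = a)
    (f : a ⟶ c) : eqToHom e ≫ eqToHom e' ≫ f = f := by
  simp

/-- A family of maps that is natural for the standard morphisms is natural. -/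
lemma pull_natural (g : x ⟶ y) {M N : El F → Type*} (res : ∀ {q p : El F}, (q ⟶ p) → M p → M q)
    (res' : ∀ {q p : El F}, (q ⟶ p) → N p → N q)
    (T : ∀ {S : 𝕋} {x y : F.Ob S}, (x ⟶ y) → M ⟨S, y⟩ → N ⟨S, x⟩)
    (hT : ∀ {S' S : 𝕋} (h : S' ⟶ S) {x y : F.Ob S} (g : x ⟶ y) (a : M ⟨S, y⟩), res' (El.lift F h x)
    (T g a) = T ((F.res h).map g) (res (El.lift F h y) a))
    (k' : r ⟶ q) (k : q ⟶ ⟨S, x⟩) (a : M (El.transport y k)) :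
    res' k' (T (El.pull g k) a) = T (El.pull g (k' ≫ k)) (res (El.transportHom y k' k) a) := by
  revert k' a
  refine El.hom_cases (P := fun q k => ∀ (k' : r ⟶ q) (a : M (El.transport y k)),
    res' k' (T (El.pull g k) a) = T (El.pull g (k' ≫ k)) (res (El.transportHom y k' k) a)) ?_ q k
  intro S' h k'
  refine El.hom_cases (P := fun r k' => ∀ a : M (El.transport y (El.lift F h x)),
    res' k' (T (El.pull g (El.lift F h x)) a)
      = T (El.pull g (k' ≫ El.lift F h x)) (res (El.transportHom y k' (El.lift F h x)) a)) ?_ r k'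
  intro S'' h' a
  rw [hT]
  refine congr_arrow (fun z f k => T f (res k a)) ?_ ?_ rfl
  · change _ = (F.res (h' ≫ h)).obj y
    rw [F.res_comp]; rfl
  · have h1 := Functor.congr_hom (F.res_comp h' h) g
    change eqToHom _ ≫ (F.res (h' ≫ h)).map g = (F.res h').map (eqToHom rfl ≫ (F.res h).map g) ≫ _
    rw [h1]
    simp only [eqToHom_refl, Category.id_comp]
    exact eqToHom_cancel _ _ _

lemma T_pull_res (g : x ⟶ y) (k' : r ⟶ q) (k : q ⟶ ⟨S, x⟩) (a : A.obj (El.transport y k)) :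
    A.res k' (act.T (El.pull g k) a)
      = act.T (El.pull g (k' ≫ k)) (A.res (El.transportHom y k' k) a) :=
  pull_natural g (fun k => A.res k) (fun k => A.res k) (fun g => act.T g) act.T_res k' k a

lemma CompatModule.T_pull_res (V : CompatModule conn) (g : x ⟶ y) (k' : r ⟶ q) (k : q ⟶ ⟨S, x⟩)
    (a : V.obj (El.transport y k)) : V.res k' (V.T (El.pull g k) a)
      = V.T (El.pull g (k' ≫ k)) (V.res (El.transportHom y k' k) a) :=
  pull_natural g (fun k => V.res k) (fun k => V.res k) (fun g => V.T g) V.T_res k' k a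

lemma T_pull (g : x ⟶ y) (k : q ⟶ ⟨S, x⟩) (a : A.obj ⟨S, y⟩) :
    act.T (El.pull g k) (A.res (El.lift F (El.Hom.map k) y) a) = A.res k (act.T g a) := by
  refine El.hom_cases (P := fun q k => act.T (El.pull g k)
    (A.res (El.lift F (El.Hom.map k) y) a) = A.res k (act.T g a)) (fun S' h => ?_) q k
  rw [act.T_res, El.pull_lift]; rfl

lemma T_pull_symm (g : x ⟶ y) (k : q ⟶ ⟨S, x⟩) (a : A.obj ⟨S, x⟩) :
    (act.T (El.pull g k)).symm (A.res k a)
      = A.res (El.lift F (El.Hom.map k) y) ((act.T g).symm a) := by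
  rw [RingEquiv.symm_apply_eq, T_pull, RingEquiv.apply_symm_apply]

lemma α_pull (g : x ⟶ y) (k : q ⟶ ⟨S, x⟩) : conn.α (El.pull g k) = A.res k (conn.α g) := by
  refine El.hom_cases (P := fun q k => conn.α (El.pull g k) = A.res k (conn.α g))
    (fun S' h => ?_) q k
  rw [conn.α_res, El.pull_lift]
  rfl

lemma T_symm_mem (g : x ⟶ y) {a : A.obj ⟨S, x⟩} (h : a ∈ A.gr ⟨S, x⟩ i) :
    (act.T g).symm a ∈ A.gr ⟨S, y⟩ i :=
  mem_of_map_mem (A.gr ⟨S, y⟩) (A.gr ⟨S, x⟩) (f := (act.T g).toAddMonoidHom) (act.T g).injective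
    (fun h => act.T_mem g h) (by
      change act.T g _ ∈ _
      rwa [RingEquiv.apply_symm_apply])

lemma CompatModule.T_symm_mem (V : CompatModule conn) (g : x ⟶ y) {a : V.obj ⟨S, x⟩}
    (h : a ∈ V.gr ⟨S, x⟩ i) : (V.T g).symm a ∈ V.gr ⟨S, y⟩ i :=
  letI := V.dec ⟨S, x⟩
  letI := V.dec ⟨S, y⟩
  mem_of_map_mem (V.gr ⟨S, y⟩) (V.gr ⟨S, x⟩) (f := (V.T g).toAddMonoidHom) (V.T g).injective
    (fun h => V.T_mem g h) (by
      change V.T g _ ∈ _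
      rwa [AddEquiv.apply_symm_apply])

variable (V) in
/-- The vertex that corresponds to the inverse of the operator `𝒯_g`. -/
def tVtx (g : x ⟶ y) :
    Vtx (A.obj ⟨S, x⟩) (A.obj ⟨S, y⟩) (V.obj ⟨S, x⟩) (V.obj ⟨S, y⟩) where
  θ := (act.T g).symm.toAddMonoidHom
  β := (act.T g).symm (conn.α g)
  ν := (V.T g).symm.toAddMonoidHom

lemma tVtx_compat (g : x ⟶ y) : (tVtx V g).Compat (V.curvedMod ⟨S, x⟩) (V.curvedMod ⟨S, y⟩) := by
  have hθD : ∀ a, (act.T g).symm (conn.D _ a) = conn.D _ ((act.T g).symm a)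
      - ((act.T g).symm (conn.α g) * (act.T g).symm a
        + bar (A.gr ⟨S, y⟩) 1 ((act.T g).symm a) * (act.T g).symm (conn.α g)) := by
    intro a
    have hb : bar (A.gr ⟨S, y⟩) 1 ((act.T g).symm a) = (act.T g).symm (bar (A.gr ⟨S, x⟩) 1 a) :=
      bar_map_zero _ _ (act.T g).symm.toAddMonoidHom (fun h => T_symm_mem g h) 1 a
    rw [hb, ← map_mul, ← map_mul, ← map_add, eq_sub_iff_add_eq, ← map_add,
      RingEquiv.symm_apply_eq, conn.T_D, koszul_one]
    simp
  refine ⟨⟨fun h => T_symm_mem g h, T_symm_mem g (conn.α_mem g)⟩, fun a b => map_mul (act.T g).symm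
    a b, hθD,
    ?_, fun a v => ?_, fun v => ?_⟩
  · have h1 := hθD (conn.α g)
    rw [bar_of_mem_one _ 1 (T_symm_mem g (conn.α_mem g))] at h1
    have h2 := congrArg (act.T g).symm (conn.D_α g)
    rw [map_add, map_sub, RingEquiv.symm_apply_apply, map_mul, h1] at h2
    change (act.T g).symm (conn.R _) = conn.R _ - conn.D _ ((act.T g).symm (conn.α g))
      + (act.T g).symm (conn.α g) * (act.T g).symm (conn.α g)
    rw [eq_sub_iff_add_eq] at h2
    rw [← h2]; abel
  · change (V.T g).symm (a • v) = (act.T g).symm a • (V.T g).symm v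
    rw [AddEquiv.symm_apply_eq, V.T_smul, RingEquiv.apply_symm_apply, AddEquiv.apply_symm_apply]
  · change (V.T g).symm (V.D _ v) = V.D _ ((V.T g).symm v)
      - (act.T g).symm (conn.α g) • (V.T g).symm v
    rw [AddEquiv.symm_apply_eq, map_sub, V.T_smul, V.T_D, RingEquiv.apply_symm_apply,
      AddEquiv.apply_symm_apply, add_sub_cancel_right]

variable (V W) in
/-- The insertion operator underlying `𝒯_g`. -/
def tIns (g : x ⟶ y) : InsOp V W ⟨S, y⟩ ⟨S, x⟩ where
  tgt k := El.transport y k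
  hom k := El.lift F (El.Hom.map k) y
  tr k' k := El.transportHom y k' k
  tr_hom k' k := El.transportHom_lift y k' k
  len := 0
  vtx k := tVtx V (El.pull g k)
  path _ := []
  path_length _ := rfl
  val k := (W.T (El.pull g k)).toAddMonoidHom

lemma tIns_natural (g : x ⟶ y) : (tIns V W g).Natural where
  vtx_res {r q} k' k := by
    refine ⟨fun a => ?_, ?_, fun v => ?_⟩
    · change (act.T (El.pull g (k' ≫ k))).symm (A.res k' a)
        = A.res (El.transportHom y k' k) ((act.T (El.pull g k)).symm a)
      rw [RingEquiv.symm_apply_eq, ← T_pull_res, RingEquiv.apply_symm_apply]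
    · change (act.T (El.pull g (k' ≫ k))).symm (conn.α _)
        = A.res (El.transportHom y k' k) ((act.T (El.pull g k)).symm (conn.α _))
      rw [RingEquiv.symm_apply_eq, ← T_pull_res, RingEquiv.apply_symm_apply, α_pull, α_pull,
        A.res_comp]
    · change (V.T (El.pull g (k' ≫ k))).symm (V.res k' v)
        = V.res (El.transportHom y k' k) ((V.T (El.pull g k)).symm v)
      rw [AddEquiv.symm_apply_eq, ← V.T_pull_res, AddEquiv.apply_symm_apply]
  path_res _ _ := List.Forall₂.nil
  val_res k' k y' := W.T_pull_res g k' k y'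
  pathGraded k := ⟨(tVtx_compat _).graded, fun s hs => (not_mem_nil hs).elim⟩
  ν_mem k h hh j v hv := by
    obtain rfl := mem_singleton.mp hh
    exact V.T_symm_mem _ hv
  val_mem k _ _ hy := W.T_mem _ hy
  linear {q} k i ω hω := by
    refine ⟨ω, hω, ⟨⟨(tVtx_compat _).graded, fun a => ?_, fun v => ?_⟩,
      fun s hs => (not_mem_nil hs).elim⟩, fun (y' : W.obj (El.transport y k)) => ?_⟩
    · change (act.T (El.pull g k)).symm (A.η q ω * a)
        = A.η (El.transport y k) ω * (act.T (El.pull g k)).symm a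
      rw [RingEquiv.symm_apply_eq, map_mul, act.T_η, RingEquiv.apply_symm_apply]
    · change (V.T (El.pull g k)).symm (A.η q ω • v)
        = A.η (El.transport y k) ω • (V.T (El.pull g k)).symm v
      rw [AddEquiv.symm_apply_eq, V.T_smul, act.T_η, AddEquiv.apply_symm_apply]
    · change W.T (El.pull g k) (A.η (El.transport y k) ω • y') = A.η q ω • W.T (El.pull g k) y'
      rw [W.T_smul, act.T_η]

lemma ExpOne.symm {a : A.obj ⟨S, x⟩} (h : ExpOne V W κ ⟨S, x⟩ a) (g : x ⟶ y) :
    ExpOne V W κ ⟨S, y⟩ ((act.T g).symm a) := by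
  refine ⟨T_symm_mem g h.1, fun q k => ?_⟩
  refine El.hom_cases (P := fun q k => ∀ (m : ℤ) (φ : Raw V W q), φ ∈ cochains V W κ q m →
    ∀ v : V.obj q, EvZero fun n => φ q (𝟙 q) (replicate n (A.res k ((act.T g).symm a))) v)
    (fun S' i m φ hφ v => ?_) q k
  let z : El F := ⟨S', (F.res i).obj y⟩
  let x' : El F := ⟨S', (F.res i).obj x⟩
  let f : x'.pt ⟶ z.pt := (F.res i).map g
  let ι : El.transport z.pt (𝟙 x') ⟶ z := El.lift F (El.Hom.map (𝟙 x')) z.pt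
  let ι' : z ⟶ El.transport z.pt (𝟙 x') := El.Hom.mk (𝟙 S') (by
    change (F.res (𝟙 S')).obj ((F.res (𝟙 S')).obj z.pt) = z.pt
    rw [F.res_id]; rfl)
  have hι : ι' ≫ ι = 𝟙 z := El.Hom.ext (Category.id_comp (𝟙 S'))
  have hsymm : A.res (El.lift F i y) ((act.T g).symm a)
      = (act.T f).symm (A.res (El.lift F i x) a) := by
    rw [RingEquiv.eq_symm_apply, ← act.T_res, RingEquiv.apply_symm_apply]
  have h1 := (h.2 x' (El.lift F i x) _ _ (InsOp.term_mem (tIns_natural f) hφ 0)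
    (V.T (El.pull f (𝟙 x')) (V.res ι v))).map
      ((W.res ι').comp (W.T (El.pull f (𝟙 x'))).symm.toAddMonoidHom)
  refine Eq.mp (congrArg EvZero (funext fun n => ?_)) h1
  have h2 := op_nil_eq_insSum (gr := A.gr x') (tVtx V (El.pull f (𝟙 x'))) 0
    (replicate n (A.res (El.lift F i x) a)) (φ (El.transport z.pt (𝟙 x')) ι)
    (V.T (El.pull f (𝟙 x')) (V.res ι v))
  change W.res ι' ((W.T (El.pull f (𝟙 x'))).symm (W.T (El.pull f (𝟙 x'))
    (op (A.gr x') 0 (tVtx V (El.pull f (𝟙 x'))) [] 0 _ (φ (El.transport z.pt (𝟙 x')) ι) _))) = _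
  rw [AddEquiv.symm_apply_apply, h2, insSum, insertions]
  simp only [map_cons, map_nil, List.sum_cons, List.sum_nil, add_zero, map_replicate]
  have h3 : (tVtx V (El.pull f (𝟙 x'))).θ (A.res (El.lift F i x) a)
      = A.res ι (A.res (El.lift F i y) ((act.T g).symm a)) := by
    have := T_pull_symm (act := act) f (𝟙 x') (A.res (El.lift F i x) a)
    rw [A.res_id] at this
    rw [hsymm]; exact this
  have h4 : (tVtx V (El.pull f (𝟙 x'))).ν (V.T (El.pull f (𝟙 x')) (V.res ι v)) = V.res ι v :=
    AddEquiv.symm_apply_apply _ _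
  have h5 := IsCochain.res hφ ι (𝟙 z) (replicate n (A.res (El.lift F i y) ((act.T g).symm a))) v
  rw [map_replicate, Category.comp_id] at h5
  rw [h3, h4, ← h5, ← W.res_comp, hι, W.res_id]

/-- The exponentials of the elements `α(g)` converge. -/
def ConvergentAction (V W : CompatModule conn) (κ : CochainKind) : Prop :=
  ∀ {S : 𝕋} {x y : F.Ob S} (g : x ⟶ y), ExpDefined V W κ ⟨S, x⟩ (conn.α g)

lemma ConvergentAction.expOne (H : ConvergentAction V W κ) (g : x ⟶ y) :
    ExpOne V W κ ⟨S, x⟩ (conn.α g) := expOne_iff.mpr ⟨conn.α_mem g, H g⟩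

lemma tIns_good (H : ConvergentAction V W κ) (g : x ⟶ y) : (tIns V W g).Good κ where
  toNatural := tIns_natural g
  labels k := ⟨(H.expOne (El.pull g k)).symm _, fun s hs => (not_mem_nil hs).elim⟩
  compat k := tVtx_compat (El.pull g k)
  val_D {q} k (y' : W.obj (El.transport y k)) := by
    change W.T (El.pull g k) (W.D _ y' - (act.T (El.pull g k)).symm (conn.α _) • y')
      = W.D q (W.T (El.pull g k) y')
    have h1 := W.T_D (El.pull g k) (W.T (El.pull g k) y')
    rw [AddEquiv.symm_apply_apply] at h1
    rw [map_sub, W.T_smul, RingEquiv.apply_symm_apply, h1, add_sub_cancel_right]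
  val_θ {q} k a (y' : W.obj (El.transport y k)) := by
    change W.T (El.pull g k) ((act.T (El.pull g k)).symm a • y') = a • W.T (El.pull g k) y'
    rw [W.T_smul, RingEquiv.apply_symm_apply]

/-! ### Convergence along the action -/

lemma T_inv_apply (g : x ⟶ y) (a : A.obj ⟨S, y⟩) :
    ∃ u : (A.obj ⟨S, x⟩)ˣ, u ∈ unitsZero (A.gr ⟨S, x⟩) ∧
      act.T g a = ↑u⁻¹ * (act.T (inv g)).symm a * ↑u := by
  have h1 := act.T_T g (inv g) ((act.T (inv g)).symm a)
  rw [RingEquiv.apply_symm_apply, IsIso.hom_inv_id] at h1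
  have h2 := act.T_T (𝟙 x) (𝟙 x) ((act.T (𝟙 x)).symm ((act.T (inv g)).symm a))
  rw [RingEquiv.apply_symm_apply, Category.comp_id, RingEquiv.apply_symm_apply] at h2
  refine ⟨(act.c g (inv g) * act.c (𝟙 x) (𝟙 x))⁻¹, inv_mem (mul_mem (act.c_mem _ _)
    (act.c_mem _ _)), ?_⟩
  rw [h1, h2]
  simp only [inv_inv, mul_inv_rev, Units.val_mul, mul_assoc]

lemma ExpOne.map_T {a : A.obj ⟨S, y⟩} (h : ExpOne V W κ ⟨S, y⟩ a) (g : x ⟶ y) :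
    ExpOne V W κ ⟨S, x⟩ (act.T g a) := by
  obtain ⟨u, hu, he⟩ := T_inv_apply (act := act) g a
  rw [he]
  exact (h.symm (inv g)).conj hu

lemma T_admissible (H : ConvergentAction V W κ) (g : x ⟶ y) {c : (A.obj ⟨S, y⟩)ˣ}
    (hc : c ∈ admissibles V W κ ⟨S, y⟩) :
    Units.map (act.T g).toRingHom.toMonoidHom c ∈ admissibles V W κ ⟨S, x⟩ := by
  have h0 : Units.map (act.T g).toRingHom.toMonoidHom c ∈ unitsZero (A.gr ⟨S, x⟩) :=
    act.T_mem g hc.1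
  refine ⟨h0, ?_⟩
  have h1 := conn.T_D g (act.T g c)
  rw [RingEquiv.symm_apply_apply, koszul_of_mem_zero _ _ (act.T_mem g hc.1)] at h1
  have h2 := ((hc.2.map_T g).add (H.expOne g)).add ((H.expOne g).conj (inv_mem h0)).neg
  refine Eq.mp (congrArg _ ?_) h2
  change act.T g (-(conn.D ⟨S, y⟩ ↑c * ↑c⁻¹)) + conn.α g
    + -(↑((Units.map (act.T g).toRingHom.toMonoidHom c)⁻¹)⁻¹ * conn.α g * act.T g ↑c⁻¹)
    = -(conn.D ⟨S, x⟩ (act.T g ↑c) * act.T g ↑c⁻¹)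
  rw [inv_inv, map_neg, map_mul, h1]
  change _ + _ + -(act.T g ↑c * conn.α g * act.T g ↑c⁻¹) = _
  have h3 : act.T g (c : A.obj ⟨S, y⟩) * act.T g ↑c⁻¹ = 1 := by
    rw [← map_mul, Units.mul_inv, map_one]
  rw [add_mul, sub_mul, mul_assoc (conn.α g), h3, mul_one]
  abel

lemma c_admissible (H : ConvergentAction V W κ) (g₁ : x ⟶ y) (g₂ : y ⟶ z) :
    act.c g₁ g₂ ∈ admissibles V W κ ⟨S, x⟩ := by
  have h0 : act.c g₁ g₂ ∈ unitsZero (A.gr ⟨S, x⟩) := act.c_mem g₁ g₂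
  refine ⟨h0, ?_⟩
  have h2 := ((H.expOne g₁).add ((H.expOne g₂).map_T g₁)).add
    ((H.expOne (g₁ ≫ g₂)).conj (inv_mem h0)).neg
  refine Eq.mp (congrArg _ ?_) h2
  rw [inv_inv, ← sub_eq_add_neg]
  exact eq_neg_of_add_eq_zero_left (conn.α_α g₁ g₂)

/-! ## Compositions of insertion operators -/

lemma negOnePow_smul_int {M : Type*} [AddCommGroup M] (n : ℤ) (x : M) :
    ((n.negOnePow : ℤˣ) : ℤ) • x = n.negOnePow • x := rfl

/-- The sign `(-1) ^ (m (m + 1) / 2)`. -/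
def triSign (m : ℕ) : ℤˣ := ((m : ℤ) * (m + 1) / 2).negOnePow

lemma triSign_succ (m : ℕ) : triSign (m + 1) = triSign m * ((m : ℤ) + 1).negOnePow := by
  rw [triSign, triSign, ← negOnePow_add]
  grind

lemma triSign_add (m n : ℕ) : triSign (m + n) = triSign m * triSign n * ((m : ℤ) * n).negOnePow := by
  induction n with
  | zero => simp [triSign]
  | succ n ih =>
    rw [← add_assoc, triSign_succ, ih, triSign_succ]
    simp only [mul_assoc, ← negOnePow_add]
    grind

section Merge

variable {G : Type*} [Mul G] {M : Type*} [AddCommGroup M]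

lemma mergeListSum_map {M' : Type*} [AddCommGroup M'] (g : M →+ M') (l : List G) (f : List G → M) :
    mergeListSum l (fun x => g (f x)) = g (mergeListSum l f) := by
  induction l generalizing f with
  | nil => simp [mergeListSum]
  | cons a l ih =>
    cases l with
    | nil => simp [mergeListSum]
    | cons b l => rw [mergeListSum, mergeListSum, ih fun x => f (a :: x), map_sub, map_neg]

lemma mergeListSum_congr {P : G → Prop} (hP : ∀ a b, P a → P b → P (a * b)) {l : List G}
    (hl : ∀ a ∈ l, P a) {f g : List G → M}
    (h : ∀ x, (∀ a ∈ x, P a) → x.length + 1 = l.length → f x = g x) :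
    mergeListSum l f = mergeListSum l g := by
  induction l generalizing f g with
  | nil => rfl
  | cons a l ih =>
    cases l with
    | nil => rfl
    | cons b l =>
      rw [mergeListSum, mergeListSum, h (a * b :: l) ?_ (by simp), ih (f := fun x => f (a :: x))
        (g := fun x => g (a :: x)) (fun c hc => hl c (mem_cons_of_mem _ hc)) fun x hx hlen =>
          h _ (fun c hc => ?_) (by simpa using hlen)]
      · rcases mem_cons.mp hc with rfl | hc
        · exact hl c (by simp)
        · exact hx c hc
      · intro c hc
        rcases mem_cons.mp hc with rfl | hc
        · exact hP _ _ (hl a (by simp)) (hl b (by simp))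
        · exact hl c (by simp [hc])

lemma mergeListSum_list_map {G' : Type*} [Mul G'] {e : G → G'} (he : ∀ a b, e (a * b) = e a * e b)
    (l : List G) (f : List G' → M) :
    mergeListSum (l.map e) f = mergeListSum l fun x => f (x.map e) := by
  induction l generalizing f with
  | nil => rfl
  | cons a l ih =>
    cases l with
    | nil => rfl
    | cons b l =>
      have := ih (f := fun x => f (e a :: x))
      rw [map_cons] at this
      rw [map_cons, map_cons, mergeListSum, mergeListSum, this, map_cons, he]
      rfl

end Merge

section Algebra

variable {A A' A'' V V' V'' Y : Type*} [Ring A] [Ring A'] [Ring A''] [AddCommGroup V]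
  [AddCommGroup V'] [AddCommGroup V''] [AddCommGroup Y]

lemma shSum_nil_right (h : Vtx A A' V V') (hs : Steps A A' V V') (k : Vtx A' A'' V' V'')
    (F : Steps A A'' V V'' → Y) :
    shSum 0 h hs k [] F = F (hs.map fun s => (k.θ s.1, s.2.comp k)) := by
  induction hs generalizing h F with
  | nil => rw [shSum]; rfl
  | cons s hs ih => rw [shSum, ih, negOnePow_zero, one_smul]; rfl

lemma shSum_nil_left (N : ℤ) (h : Vtx A A' V V') (k : Vtx A' A'' V' V'')
    (ks : Steps A' A'' V' V'') (F : Steps A A'' V V'' → Y) :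
    shSum N h [] k ks F = F (ks.map fun s => (s.1, h.comp s.2)) := by
  induction ks generalizing N k F with
  | nil => rw [shSum]; rfl
  | cons s ks ih => rw [shSum, ih]; rfl

end Algebra

section Inner

variable {A : Type u} [Ring A] {gr : ℤ → AddSubgroup A} [GradedRing gr] (C : Curved gr)
  (V : Type*) {Y : Type*} [AddCommGroup V] [Module A V] [AddCommGroup Y]

lemma adVtx_comp {u : Aˣ} (hu : u ∈ unitsZero gr) (w : Aˣ) :
    (adVtx C V u).comp (adVtx C V w) = adVtx C V (u * w) := by
  ext a
  · simp only [Vtx.comp, AddMonoidHom.comp_apply, adVtx_θ, mul_inv_rev, Units.val_mul, mul_assoc]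
  · simp only [Vtx.comp, adVtx_β, adVtx_θ, mul_inv_rev, Units.val_mul, C.D_mul_zero hu]
    simp only [mul_add, neg_add, mul_neg, neg_mul, mul_assoc, Units.inv_mul_cancel_left]
    abel
  · simp only [Vtx.comp, AddMonoidHom.comp_apply, adVtx_ν, mul_inv_rev, Units.val_mul, mul_smul]

lemma shSum_adPath {u : Aˣ} (hu : u ∈ unitsZero gr) {cs : List Aˣ}
    (hcs : ∀ c ∈ cs, c ∈ unitsZero gr) (w : Aˣ) (ds : List Aˣ) (G : Steps A A V V → Y) :
    shSum ds.length (adVtx C V u) (adPath C V u cs) (adVtx C V w) (adPath C V w ds) G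
      = ((cs.length : ℤ) * ds.length).negOnePow • FreeAbelianGroup.lift
        (fun zs => G (adPath C V (u * w) zs)) (shuffle (cs.map fun c => w⁻¹ * c * w) ds) := by
  induction' hn : cs.length + ds.length using Nat.strong_induction_on with
    n ih generalizing u cs w ds G
  match cs, ds with
  | [], ds =>
    have h1 : ∀ (ds : List Aˣ) (w : Aˣ), (adPath C V w ds).map
        (fun s => (s.1, (adVtx C V u).comp s.2)) = adPath C V (u * w) ds := by
      intro ds
      induction ds with
      | nil => intro w; rfl
      | cons d ds ih =>
        intro w
        rw [adPath, map_cons, ih, adPath, adVtx_comp C V hu, mul_assoc]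
    simp only [adPath, shSum_nil_left, h1, map_nil, shuffle, FreeAbelianGroup.lift_apply_of,
      length_nil, Nat.cast_zero, zero_mul, negOnePow_zero, one_smul]
  | c :: cs, [] =>
    have h1 : ∀ (cs : List Aˣ) (u : Aˣ), u ∈ unitsZero gr → (∀ c ∈ cs, c ∈ unitsZero gr) →
        (adPath C V u cs).map (fun s => ((adVtx C V w).θ s.1, s.2.comp (adVtx C V w)))
          = adPath C V (u * w) (cs.map fun c => w⁻¹ * c * w) := by
      intro cs
      induction cs with
      | nil => intro u _ _; rfl
      | cons c cs ih =>
        intro u hu hcs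
        have huc := mul_mem hu (hcs c (by simp))
        rw [adPath, map_cons, ih _ huc (fun d hd => hcs d (by simp [hd])), map_cons,
          adPath, adVtx_comp C V huc, adVtx_θ,
          show u * w * (w⁻¹ * c * w) = u * c * w by group]
        rfl
    have h2 := h1 (c :: cs) u hu hcs
    rw [adPath] at h2
    simp only [adPath, length_nil, Nat.cast_zero, shSum_nil_right, h2, map_cons,
      shuffle, FreeAbelianGroup.lift_apply_of, mul_zero, negOnePow_zero, one_smul]
  | c :: cs, d :: ds =>
    have huc := mul_mem hu (hcs c (by simp))
    have i1 := ih _ (by simp [← hn]) huc (cs := cs) (fun d hd => hcs d (by simp [hd])) w (d :: ds)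
      (consF ((adVtx C V w).θ c, (adVtx C V (u * c)).comp (adVtx C V w)) G) rfl
    have i2 := ih _ (by simp [← hn]) hu hcs (w * d) ds
      (consF ((d : A), (adVtx C V u).comp (adVtx C V (w * d))) G) rfl
    rw [adPath] at i1
    rw [adPath] at i2
    have e1 : (((d :: ds).length : ℤ) - 1) = ds.length := by simp
    rw [adPath, adPath, shSum, i1, e1, i2]
    simp only [map_cons]
    rw [shuffle, map_add, map_zsmul, negOnePow_smul_int, smul_add,
      ← FreeAbelianGroup.lift_comp, ← FreeAbelianGroup.lift_comp, smul_smul, smul_smul,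
      ← negOnePow_add, ← negOnePow_add, adVtx_comp C V huc, adVtx_comp C V hu]
    congr 1
    · congr 1
      · congr 1
        simp only [length_cons]; push_cast; ring
      · congr 1
        congr 1
        funext zs
        rw [consF_apply, Function.comp_apply, adPath, adVtx_θ,
          show u * w * (w⁻¹ * c * w) = u * c * w by group]
        rfl
    · congr 1
      · refine negOnePow_eq_of (c := -((cs.length : ℤ) + 1)) ?_
        simp only [length_cons, length_map]; push_cast; ring
      · have e2 : (fun x => (w * d)⁻¹ * x * (w * d)) = (fun x => d⁻¹ * x * d) ∘ fun c => w⁻¹ * c * w := by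
          funext x; simp [mul_assoc]
        rw [map_cons, map_map, ← e2, ← Function.comp_apply (f := fun x => d⁻¹ * x * d)
          (g := fun c => w⁻¹ * c * w), ← e2]
        congr 1
        congr 1
        funext zs
        rw [consF_apply, Function.comp_apply, adPath, mul_assoc]

lemma dropSum_adPath (u c : Aˣ) (cs : List Aˣ) (G : Steps A A V V → Y) :
    dropSum (adPath C V u (c :: cs)) G = mergeListSum (c :: cs) (fun zs => G (adPath C V u zs))
        + ((cs.length : ℤ) + 1).negOnePow • G (adPath C V u (c :: cs).dropLast) := by
  induction cs generalizing u c G with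
  | nil => simp [adPath, dropSum, mergeListSum]
  | cons d cs ih =>
    have := ih (u * c) d (consF ((c : A), adVtx C V (u * c)) G)
    rw [adPath] at this
    rw [adPath, adPath, dropSum, this, mergeListSum, sub_add_eq_sub_sub, List.dropLast_cons_cons,
      length_cons, Nat.cast_succ, negOnePow_succ (_ + 1), Units.neg_smul, ← sub_eq_add_neg,
      mul_assoc]
    rfl

end Inner

open FreeAbelianGroup (of lift map lift_apply_of map_of_apply map_comp_apply lift_add_apply)

/-! ## Linear combinations of words with restricted entries -/

section Free

variable {α : Type*} {β : Type*} {M N : Type*} [AddCommGroup M] [AddCommGroup N]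

/-- The linear combinations of the generators that satisfy a condition. -/
def suppIn (P : α → Prop) : AddSubgroup (FreeAbelianGroup α) :=
  AddSubgroup.closure (of '' {a | P a})

lemma of_mem_suppIn {P : α → Prop} {a : α} (h : P a) : of a ∈ suppIn P :=
  AddSubgroup.subset_closure ⟨a, h, rfl⟩

lemma lift_mem {P : α → Prop} {x : FreeAbelianGroup α} (hx : x ∈ suppIn P) {f : α → M}
    {H : AddSubgroup M} (h : ∀ a, P a → f a ∈ H) : lift f x ∈ H := by
  have : suppIn P ≤ H.comap (lift f) := by
    refine (AddSubgroup.closure_le _).mpr ?_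
    rintro _ ⟨a, ha, rfl⟩
    simp_all
  exact this hx

lemma lift_congr {P : α → Prop} {x : FreeAbelianGroup α} (hx : x ∈ suppIn P) {f g : α → M}
    (h : ∀ a, P a → f a = g a) : lift f x = lift g x := by
  have := lift_mem hx (f := f - g) (H := ⊥) fun a ha => by simp [h a ha]
  rw [sub_eq_add_neg, lift_add_apply, FreeAbelianGroup.lift_neg_apply] at this
  exact add_neg_eq_zero.mp this

lemma map_mem_suppIn {P : α → Prop} {Q : β → Prop} {x : FreeAbelianGroup α} (hx : x ∈ suppIn P)
    {f : α → β} (h : ∀ a, P a → Q (f a)) : map f x ∈ suppIn Q :=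
  lift_mem hx fun a ha => of_mem_suppIn (h a ha)

lemma hom_lift (g : M →+ N) (f : α → M) (x : FreeAbelianGroup α) :
    g (lift f x) = lift (fun a => g (f a)) x :=
  (FreeAbelianGroup.lift_comp_apply x f g).symm

lemma lift_map_apply (f : α → β) (g : β → M) (x : FreeAbelianGroup α) :
    lift g (map f x) = lift (fun a => g (f a)) x := (FreeAbelianGroup.lift_comp f g x).symm

lemma lift_of_self (x : FreeAbelianGroup α) : lift of x = x := FreeAbelianGroup.map_id_apply x

end Free

section Words

variable {G H : Type u} [Group G] [Group H]

/-- The words whose entries belong to a subgroup, with `n` entries apart from the first. -/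
def wordsIn (S : Subgroup G) (n : ℕ) : AddSubgroup (Words G) :=
  suppIn fun w => w.1 ∈ S ∧ (∀ c ∈ w.2, c ∈ S) ∧ w.2.length = n

lemma shuffle_mem (S : Subgroup G) {cs ds : List G} (hc : ∀ c ∈ cs, c ∈ S) (hd : ∀ d ∈ ds, d ∈ S) :
    shuffle cs ds ∈ suppIn fun zs => (∀ z ∈ zs, z ∈ S) ∧ zs.length = cs.length + ds.length := by
  induction' hn : cs.length + ds.length using Nat.strong_induction_on with n ih generalizing cs ds
  match cs, ds with
  | [], ds => rw [shuffle]; exact of_mem_suppIn ⟨hd, by simpa using hn⟩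
  | c :: cs, [] => rw [shuffle]; exact of_mem_suppIn ⟨hc, by simpa using hn⟩
  | c :: cs, d :: ds =>
    rw [forall_mem_cons] at hc hd
    have h1 : ∀ x ∈ (c :: cs).map (fun x => d⁻¹ * x * d), x ∈ S := by
      intro x hx
      obtain ⟨y, hy, rfl⟩ := mem_map.mp hx
      exact mul_mem (mul_mem (inv_mem hd.1) (forall_mem_cons.mpr hc y hy)) hd.1
    have i1 := ih _ (by simp [← hn]) hc.2 (forall_mem_cons.mpr hd) rfl
    have i2 := ih _ (by simp [← hn]) h1 hd.2 rfl
    rw [shuffle]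
    refine add_mem (map_mem_suppIn i1 fun zs hzs => ⟨?_, ?_⟩)
      (zsmul_mem (map_mem_suppIn i2 fun zs hzs => ⟨?_, ?_⟩) _)
    · exact forall_mem_cons.mpr ⟨hc.1, hzs.1⟩
    · rw [length_cons, hzs.2, ← hn, length_cons, length_cons]; omega
    · exact forall_mem_cons.mpr ⟨hd.1, hzs.1⟩
    · rw [length_cons, hzs.2, ← hn, length_map, length_cons, length_cons]; omega

lemma shuffle_map (e : G →* H) (cs ds : List G) :
    shuffle (cs.map e) (ds.map e) = map (List.map e) (shuffle cs ds) := by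
  induction' hn : cs.length + ds.length using Nat.strong_induction_on with n ih generalizing cs ds
  match cs, ds with
  | [], ds => rw [map_nil, shuffle, shuffle, map_of_apply]
  | c :: cs, [] =>
    rw [map_nil, map_cons, shuffle, shuffle, map_of_apply, map_cons]
  | c :: cs, d :: ds =>
    have i1 := ih _ (by simp [← hn]) cs (d :: ds) rfl
    have i2 := ih _ (by simp [← hn]) ((c :: cs).map fun x => d⁻¹ * x * d) ds rfl
    rw [map_cons] at i1
    rw [map_map] at i2
    rw [map_cons, map_cons, shuffle, shuffle, i1, ← map_cons, map_map,
      show (fun x => (e d)⁻¹ * x * e d) ∘ e = e ∘ fun x => d⁻¹ * x * d by funext x; simp, i2,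
      map_add, map_zsmul, length_map]
    simp only [← map_comp_apply]
    congr 2

lemma wordMul_of_of (w w' : G × List G) : wordMul (of w) (of w') = map (fun l => (w.1 * w'.1, l))
        (shuffle (w.2.map fun c => w'.1⁻¹ * c * w'.1) w'.2) := by
  rw [wordMul, lift_apply_of, lift_apply_of]

/-- The product of words as a biadditive map. -/
def wordMulHom : Words G →+ Words G →+ Words G :=
  lift fun w => lift fun w' => map (fun l => (w.1 * w'.1, l))
      (shuffle (w.2.map fun c => w'.1⁻¹ * c * w'.1) w'.2)

lemma wordMulHom_apply (x y : Words G) : wordMulHom x y = wordMul x y :=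
  hom_lift (AddMonoidHom.flip (AddMonoidHom.id (Words G →+ Words G)) y) _ x

lemma wordMul_eq_lift (x y : Words G) : wordMul x y = lift (fun w =>
    lift (fun w' => wordMul (of w) (of w')) y) x := by
  simp only [wordMul_of_of]; rfl

lemma wordMul_mem {S : Subgroup G} {m n : ℕ} {x y : Words G} (hx : x ∈ wordsIn S m)
    (hy : y ∈ wordsIn S n) : wordMul x y ∈ wordsIn S (m + n) := by
  rw [wordMul_eq_lift]
  refine lift_mem hx fun w hw => lift_mem hy fun w' hw' => ?_
  rw [wordMul_of_of]
  have h1 := shuffle_mem S (cs := w.2.map fun c => w'.1⁻¹ * c * w'.1) (ds := w'.2) (fun x hx => by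
    obtain ⟨y, hy, rfl⟩ := mem_map.mp hx
    exact mul_mem (mul_mem (inv_mem hw'.1) (hw.2.1 y hy)) hw'.1) hw'.2.1
  refine map_mem_suppIn h1 fun zs hzs => ⟨mul_mem hw.1 hw'.1, hzs.1, ?_⟩
  grind

lemma wordMap_mem {S : Subgroup G} {S' : Subgroup H} {n : ℕ} {x : Words G} (hx : x ∈ wordsIn S n)
    {e : G →* H} (he : ∀ c ∈ S, e c ∈ S') : wordMap e x ∈ wordsIn S' n :=
  map_mem_suppIn hx fun w hw => ⟨he _ hw.1, fun c hc => by
    obtain ⟨d, hd, rfl⟩ := mem_map.mp hc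
    exact he d (hw.2.1 d hd), by simp [hw.2.2]⟩

lemma wordShift_mem {S : Subgroup G} {n : ℕ} {x : Words G} (hx : x ∈ wordsIn S n) :
    wordShift x ∈ wordsIn S (n + 1) :=
  map_mem_suppIn hx fun w hw => ⟨one_mem S, forall_mem_cons.mpr ⟨hw.1, hw.2.1⟩, by simp [hw.2.2]⟩

lemma wordMap_of (e : G →* H) (w : G × List G) : wordMap e (of w) = of (e w.1, w.2.map e) :=
  map_of_apply _

lemma wordMap_def (e : G →* H) (x : Words G) :
    wordMap e x = map (fun w => (e w.1, w.2.map e)) x := rfl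

lemma wordMap_wordMul (e : G →* H) (x y : Words G) :
    wordMap e (wordMul x y) = wordMul (wordMap e x) (wordMap e y) := by
  rw [wordMul_eq_lift, wordMul_eq_lift (wordMap e x), wordMap_def _ x, wordMap_def _ y, lift_map_apply,
    hom_lift]
  congr 1; congr 1; funext w
  rw [lift_map_apply, hom_lift]
  congr 1; congr 1; funext w'
  rw [wordMul_of_of, wordMul_of_of, wordMap_def, ← map_comp_apply, map_map,
    show (fun c => (e w'.1)⁻¹ * c * e w'.1) ∘ e = e ∘ fun c => w'.1⁻¹ * c * w'.1 by funext c; simp,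
    ← map_map, shuffle_map, ← map_comp_apply]
  congr 2; funext zs; simp

lemma wordMap_wordShift (e : G →* H) (x : Words G) :
    wordMap e (wordShift x) = wordShift (wordMap e x) := by
  rw [wordMap_def, wordMap_def, wordShift, wordShift, ← map_comp_apply, ← map_comp_apply]
  congr 2; funext w; simp

/-- The differential of `c₀ Φ(c₁, …, cₘ)`. -/
def wordBd : Words G →+ Words G :=
  lift fun w => match w.2 with
    | [] => 0
    | c :: cs => of (w.1 * c, cs) + mergeListSum (c :: cs) (fun zs => of (w.1, zs))
        + ((cs.length : ℤ) + 1).negOnePow • of (w.1, (c :: cs).dropLast)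

lemma wordBd_nil (a : G) : wordBd (of (a, [])) = 0 := by simp [wordBd]

lemma wordBd_cons (a c : G) (cs : List G) : wordBd (of (a, c :: cs)) = of (a * c, cs)
        + mergeListSum (c :: cs) (fun zs => of (a, zs))
        + ((cs.length : ℤ) + 1).negOnePow • of (a, (c :: cs).dropLast) := by
  simp [wordBd]

end Words

/-! ## The operators of words -/

lemma InsOp.app_units_smul {p' : El F} {E : InsOp V W p' p} (hE : E.Convergent κ) {φ : Raw V W p'}
    (h : φ ∈ cochains V W κ p' m) (e : ℤˣ) : E.app (e • φ) = e • E.app φ := by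
  funext q k l v
  have := opTot_map (gr := A.gr q) (hE.labels k) (E.path k).length (cochain_progFinite h (E.hom k))
    (toAddMonoidHom _ e) l v
  rw [Pi.smul_apply, Pi.smul_apply, Pi.smul_apply, Pi.smul_apply, app, app, ← map_units_smul]
  exact congrArg _ this

lemma resU_prod (k : q ⟶ p) (c₀ : (A.obj p)ˣ) (cs : List (A.obj p)ˣ) :
    A.resU k c₀ * (cs.map (A.resU k)).prod = A.resU k (c₀ * cs.prod) := by
  rw [map_mul, map_list_prod]

lemma smul_phiTerm (c₀ : (A.obj p)ˣ) (cs : List (A.obj p)ˣ) (φ : Raw V W p) (q : El F) (k : q ⟶ p)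
    (l : List (A.obj q)) (v : V.obj q) (K : ℕ) :
    A.res k ↑c₀ • phiTerm c₀ cs φ q k l v K = (phiIns V W c₀ cs).term K φ q k l v := by
  have h1 := op_adPath (gr := A.gr q) (conn.curved q) (A.resU k c₀) (cs.map (A.resU k)) K l (φ q k) v
  rw [resU_prod] at h1
  have h2 : (phiIns V W c₀ cs).term K φ q k l v = A.res k ↑c₀ • op (A.gr q)
    (V.adPath (A.resU k c₀) (cs.map (A.resU k))).length
    (V.adVtx (A.resU k c₀))
    (V.adPath (A.resU k c₀) (cs.map (A.resU k))) K l (φ q k) v := rfl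
  rw [h2, adPath_length, h1]
  rfl

lemma phiIns_vtx (h₀ : c₀ ∈ admissibles V W κ p) (hcs : ∀ c ∈ cs, c ∈ admissibles V W κ p)
    (k : q ⟶ p) (h : Vtx (A.obj q) (A.obj q) (V.obj q) (V.obj q))
    (hh : h ∈ (phiIns V W c₀ cs).vtx k :: ((phiIns V W c₀ cs).path k).map Prod.snd) :
    ∃ w ∈ admissibles V W κ q, h = V.adVtx w :=
  adPath_vtx_mem _ (resU_mem_admissibles k h₀) (fun c hc => by
    obtain ⟨d, hd, rfl⟩ := mem_map.mp hc
    exact resU_mem_admissibles k (hcs d hd)) h hh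

lemma phiTerm_evZero (h₀ : c₀ ∈ admissibles V W κ p) (hcs : ∀ c ∈ cs, c ∈ admissibles V W κ p)
    (hφ : φ ∈ cochains V W κ p m) (q : El F) (k : q ⟶ p) (l : List (A.obj q)) (v : V.obj q) :
    EvZero (phiTerm c₀ cs φ q k l v) := by
  have h1 := ((phiIns V W c₀ cs).term_evZero (phiIns_good h₀ hcs).toConvergent hφ q k l v).1.map
    (toAddMonoidHom (W.obj q) (A.res k ↑c₀⁻¹ : A.obj q))
  refine Eq.mp (congrArg EvZero (funext fun K => ?_)) h1
  rw [DistribSMul.toAddMonoidHom_apply, ← smul_phiTerm, smul_smul, ← map_mul, Units.inv_mul, map_one,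
    one_smul]

lemma phiOp_eq (h₀ : c₀ ∈ admissibles V W κ p) (hcs : ∀ c ∈ cs, c ∈ admissibles V W κ p)
    (hφ : φ ∈ cochains V W κ p m) :
    phiOp c₀ cs φ = triSign cs.length • (phiIns V W c₀ cs).app φ := by
  funext q k l v
  rw [phiOp, Pi.smul_apply, Pi.smul_apply, Pi.smul_apply, Pi.smul_apply,
    ((phiIns V W c₀ cs).term_evZero (phiIns_good h₀ hcs).toConvergent hφ q k l v).2]
  have := tot_map (toAddMonoidHom (W.obj q) (A.res k ↑c₀ : A.obj q))
    (phiTerm_evZero h₀ hcs hφ q k l v)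
  simp only [DistribSMul.toAddMonoidHom_apply, smul_phiTerm] at this
  rw [this]; rfl

lemma phiOp_apply (h₀ : c₀ ∈ admissibles V W κ p) (hcs : ∀ c ∈ cs, c ∈ admissibles V W κ p)
    (hφ : φ ∈ cochains V W κ p m) (q : El F) (k : q ⟶ p) (l : List (A.obj q)) (v : V.obj q) :
    phiOp c₀ cs φ q k l v = triSign cs.length • A.res k ↑c₀ • opTot (A.gr q) cs.length
      (V.adVtx (A.resU k c₀))
      (V.adPath (A.resU k c₀) (cs.map (A.resU k))) (φ q k) l v := by
  rw [phiOp_eq h₀ hcs hφ]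
  have : (cs.length : ℤ) = (V.adPath (A.resU k c₀)
    (cs.map (A.resU k))).length := by simp
  rw [this]; rfl

lemma phiOp_mem (h₀ : c₀ ∈ admissibles V W κ p) (hcs : ∀ c ∈ cs, c ∈ admissibles V W κ p)
    (hφ : φ ∈ cochains V W κ p m) : phiOp c₀ cs φ ∈ cochains V W κ p (m - cs.length) := by
  rw [phiOp_eq h₀ hcs hφ]
  exact units_smul_mem _ _ ((phiIns V W c₀ cs).app_mem (phiIns_good h₀ hcs).toConvergent hφ)

lemma phiOp_add {ψ : Raw V W p} (h₀ : c₀ ∈ admissibles V W κ p)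
    (hcs : ∀ c ∈ cs, c ∈ admissibles V W κ p) (hφ : φ ∈ cochains V W κ p m)
    (hψ : ψ ∈ cochains V W κ p m) : phiOp c₀ cs (φ + ψ) = phiOp c₀ cs φ + phiOp c₀ cs ψ := by
  rw [phiOp_eq h₀ hcs hφ, phiOp_eq h₀ hcs hψ, phiOp_eq h₀ hcs (add_mem hφ hψ),
    InsOp.app_add (phiIns_good h₀ hcs).toConvergent hφ hψ, smul_add]

/-- The value of a function of local sections. -/
def Raw.eval (q : El F) (k : q ⟶ p) (l : List (A.obj q)) (v : V.obj q) : Raw V W p →+ W.obj q where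
  toFun φ := φ q k l v
  map_zero' := rfl
  map_add' _ _ := rfl

lemma Raw.eval_apply (q : El F) (k : q ⟶ p) (l : List (A.obj q)) (v : V.obj q) :
    Raw.eval q k l v φ = φ q k l v := rfl

lemma phiOp_phiOp {d₀ : (A.obj p)ˣ} {ds : List (A.obj p)ˣ} (h₀ : c₀ ∈ admissibles V W κ p)
    (hcs : ∀ c ∈ cs, c ∈ admissibles V W κ p) (h₀' : d₀ ∈ admissibles V W κ p)
    (hds : ∀ d ∈ ds, d ∈ admissibles V W κ p) (hφ : φ ∈ cochains V W κ p m) :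
    phiOp c₀ cs (phiOp d₀ ds φ) = lift (fun w => phiOp w.1 w.2 φ)
      (wordMul (of (c₀, cs)) (of (d₀, ds))) := by
  have E := phiIns_good h₀ hcs
  have E' := phiIns_good h₀' hds
  have hmem := (phiIns V W d₀ ds).app_mem E'.toConvergent hφ
  have hcs' : ∀ x ∈ cs.map (fun c => d₀⁻¹ * c * d₀), x ∈ admissibles V W κ p := by
    intro x hx
    obtain ⟨y, hy, rfl⟩ := mem_map.mp hx
    exact mul_mem (mul_mem (inv_mem h₀') (hcs y hy)) h₀'
  rw [phiOp_eq h₀' hds hφ, phiOp_eq h₀ hcs (units_smul_mem _ _ hmem),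
    InsOp.app_units_smul E.toConvergent hmem, smul_smul, wordMul_of_of, lift_map_apply]
  funext q k l v
  have hu := resU_mem_zero k h₀.1
  rw [Pi.smul_apply, Pi.smul_apply, Pi.smul_apply, Pi.smul_apply,
    InsOp.app_app E.toConvergent E'.toConvergent hφ k (fun h₁ hh₁ h₂ hh₂ => by
      obtain ⟨w, hw, rfl⟩ := phiIns_vtx h₀ hcs k h₁ hh₁
      obtain ⟨w', hw', rfl⟩ := phiIns_vtx h₀' hds k h₂ hh₂
      exact (congrArg (fun h => ExpOne V W κ q (Vtx.β h)) (adVtx_comp (conn.curved q) (V.obj q)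
        hw.1 w')).mpr (adVtx_expOne (mul_mem hw hw')))]
  let u := A.resU k c₀
  let w := A.resU k d₀
  let cs' := cs.map (A.resU k)
  let ds' := ds.map (A.resU k)
  have h1 := shSum_adPath (conn.curved q) (V.obj q) hu (cs := cs') (fun c hc => by
    obtain ⟨d, hd, rfl⟩ := mem_map.mp hc
    exact resU_mem_zero k (hcs d hd).1) w ds' (fun z => opTot (A.gr q)
      (((V.adPath u cs').length : ℤ)
        + (V.adPath w ds').length)
      ((V.adVtx u).comp (V.adVtx w)) z (φ q k) l v)
  have h2 : cs'.map (fun c => w⁻¹ * c * w) = (cs.map fun c => d₀⁻¹ * c * d₀).map (A.resU k) := by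
    rw [map_map, map_map]
    congr 1
    funext c
    simp [w]
  have hl : (ds'.length : ℤ) = (V.adPath w ds').length := by
    rw [adPath_length]
  rw [h2, shuffle_map, lift_map_apply, hl] at h1
  have h3 := congrArg (fun y => (triSign cs.length * triSign ds.length) •
    (A.res k ↑c₀ • A.res k ↑d₀ • y)) h1
  have h4 := hom_lift (Raw.eval q k l v) (fun zs => phiOp (c₀ * d₀) zs φ)
    (shuffle (cs.map fun c => d₀⁻¹ * c * d₀) ds)
  refine Eq.trans (b := _) (by rfl) (h3.trans (Eq.trans ?_ h4.symm))
  · rw [adVtx_comp _ _ hu, adPath_length, adPath_length]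
    let g : W.obj q →+ W.obj q := (toAddMonoidHom _
      (triSign cs.length * triSign ds.length)).comp ((toAddMonoidHom _ (A.res k ↑c₀)).comp
      ((toAddMonoidHom _ (A.res k ↑d₀)).comp (toAddMonoidHom _
        ((cs'.length : ℤ) * ds'.length).negOnePow)))
    refine (hom_lift g _ _).trans (lift_congr (shuffle_mem _ hcs' hds) fun zs hzs => ?_)
    have h5 := phiOp_apply (mul_mem h₀ h₀') hzs.1 hφ q k l v
    refine Eq.trans ?_ h5.symm
    rw [hzs.2, length_map, triSign_add]
    change (triSign cs.length * triSign ds.length) • (A.res k ↑c₀ • (A.res k ↑d₀ •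
      (((cs'.length : ℤ) * ds'.length).negOnePow • (_ : W.obj q)))) = _
    rw [smul_units_smul, smul_units_smul]
    simp only [cs', ds', w, length_map, Nat.cast_add, Units.val_mul, map_mul, mul_smul]

lemma lift_wordBd_apply (h₀ : c₀ ∈ admissibles V W κ p) (hcs : ∀ c ∈ cs, c ∈ admissibles V W κ p)
    (hφ : φ ∈ cochains V W κ p m) (q : El F) (k : q ⟶ p) (l : List (A.obj q)) (v : V.obj q) :
    lift (fun w => phiOp w.1 w.2 φ) (wordBd (of (c₀, cs))) q k l v
      = (triSign cs.length * (cs.length : ℤ).negOnePow) • (stepMove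
          (V.adPath (A.resU k c₀) (cs.map (A.resU k))) (fun s hs' =>
            A.res k ↑c₀ • (s.1 • opTot (A.gr q) (((V.adPath (A.resU k c₀)
              (cs.map (A.resU k))).length : ℤ) - 1) s.2 hs' (φ q k) l v))
        + A.res k ↑c₀ • dropSum (V.adPath (A.resU k c₀) (cs.map (A.resU k)))
          fun hs' => opTot (A.gr q) (((V.adPath (A.resU k c₀)
            (cs.map (A.resU k))).length : ℤ) - 1) (V.adVtx (A.resU k c₀))
            hs' (φ q k) l v) := by
  refine (Raw.eval_apply (φ := lift _ _) q k l v).symm.trans ?_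
  cases cs with
  | nil => simp [wordBd_nil, adPath, dropSum]
  | cons c cs =>
    rw [forall_mem_cons] at hcs
    have hs : triSign (c :: cs).length * ((c :: cs).length : ℤ).negOnePow = triSign cs.length := by
      rw [length_cons, triSign_succ, mul_assoc, Nat.cast_succ, ← negOnePow_add, ← two_mul,
        negOnePow_two_mul, mul_one]
    have hN : ((V.adPath (A.resU k c₀)
        ((c :: cs).map (A.resU k))).length : ℤ) - 1 = cs.length := by simp
    let g : W.obj q →+ W.obj q := (toAddMonoidHom _ (triSign cs.length)).comp
      (toAddMonoidHom _ (A.res k ↑c₀))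
    have hz : ∀ zs : List (A.obj p)ˣ, (∀ z ∈ zs, z ∈ admissibles V W κ p) →
        zs.length = cs.length → Raw.eval q k l v (phiOp c₀ zs φ) = g (opTot (A.gr q) cs.length
          (V.adVtx (A.resU k c₀))
          (V.adPath (A.resU k c₀) (zs.map (A.resU k))) (φ q k) l v) := by
      intro zs hzs hlen
      rw [← hlen]
      refine (phiOp_apply h₀ hzs hφ q k l v).trans ?_
      rw [hlen]; rfl
    rw [hs, hN, wordBd_cons, map_add, map_add, map_add, map_add, map_units_smul, map_units_smul,
      lift_apply_of, lift_apply_of, ← mergeListSum_map,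
      ← mergeListSum_map, map_cons, dropSum_adPath, smul_add, smul_add, add_assoc]
    congr 1
    · have := phiOp_apply (mul_mem h₀ hcs.1) hcs.2 hφ q k l v
      refine this.trans ?_
      rw [CompatModule.adPath, CompatModule.adPath, adPath, stepMove_cons, Units.val_mul, map_mul,
        map_mul, mul_smul]
      rfl
    · rw [smul_add]
      congr 1
      · rw [← map_cons, mergeListSum_list_map (map_mul (A.resU k))]
        refine Eq.trans ?_ (mergeListSum_map g _ _)
        refine mergeListSum_congr (P := fun z => z ∈ admissibles V W κ p)
          (fun a b ha hb => mul_mem ha hb) (forall_mem_cons.mpr hcs) fun zs hzs hlen => ?_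
        rw [lift_apply_of]
        exact hz zs hzs (by simpa using hlen)
      · rw [length_map, smul_units_smul, smul_comm, ← map_cons, ← List.map_dropLast]
        congr 1
        refine hz (c :: cs).dropLast (fun z hz => ?_) (by simp)
        exact forall_mem_cons.mpr hcs z (List.mem_of_mem_dropLast hz)

lemma phiOp_totalD (h₀ : c₀ ∈ admissibles V W κ p) (hcs : ∀ c ∈ cs, c ∈ admissibles V W κ p)
    (hφ : φ ∈ cochains V W κ p m) :
    totalD (m - cs.length) (phiOp c₀ cs φ) = (cs.length : ℤ).negOnePow • phiOp c₀ cs (totalD m φ)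
      - lift (fun w => phiOp w.1 w.2 φ) (wordBd (of (c₀, cs))) := by
  have E := phiIns_good h₀ hcs
  have hD : ∀ (e : ℤˣ) (m : ℤ) (ψ : Raw V W p), totalD m (e • ψ) = e • totalD m ψ := fun e m ψ =>
    map_units_smul (AddMonoidHom.mk' (totalD m) (totalD_add m)) e ψ
  have h0 : (cs.length : ℤ).negOnePow • phiOp c₀ cs (totalD m φ)
      = totalD (m - cs.length) (phiOp c₀ cs φ)
        + lift (fun w => phiOp w.1 w.2 φ) (wordBd (of (c₀, cs))) := by
    funext q k l v
    have h2 := InsOp.app_totalD E hφ q k l v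
    have h3 := lift_wordBd_apply h₀ hcs hφ q k l v
    rw [phiOp_eq h₀ hcs hφ, phiOp_eq h₀ hcs (totalD_mem hφ), hD]
    simp only [Pi.smul_apply, Pi.add_apply]
    rw [h2, h3, add_assoc, smul_add, smul_add, smul_comm]
    refine congrArg₂ _ (congrArg _ (negOnePow_smul_smul _ _)) ?_
    rw [smul_smul, mul_comm]
    rfl
  grind

/-! ## The operators of the groupoid and their compositions -/

section Operators

/-- The isomorphisms `T_g` on invertible elements. -/
abbrev InnerAction.TU (act : InnerAction A) (g : x ⟶ y) :
    (A.obj ⟨S, y⟩)ˣ →* (A.obj ⟨S, x⟩)ˣ := Units.map (act.T g).toRingHom.toMonoidHom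

variable {φ : Raw V W ⟨S, y⟩}

lemma curvedT_eq (H : ConvergentAction V W κ) (g : x ⟶ y) (hφ : φ ∈ cochains V W κ ⟨S, y⟩ m) :
    curvedT g φ = (tIns V W g).app φ := by
  funext q k l v
  rw [((tIns V W g).term_evZero (tIns_good H g).toConvergent hφ q k l v).2, curvedT, expInsert, tot]
  refine finsum_congr fun n => ?_
  have h1 := op_nil_eq_insSum (gr := A.gr q) (tVtx V (El.pull g k)) n l
    (φ (El.transport y k) (El.lift F (El.Hom.map k) y)) v
  have h2 := insertions_map (act.T (El.pull g k)).symm (conn.α (El.pull g k)) n l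
  refine Eq.trans ?_ (congrArg (W.T (El.pull g k)) h1).symm
  rw [insSum]
  change _ = W.T (El.pull g k) (((insertions ((act.T (El.pull g k)).symm (conn.α (El.pull g k))) n
    (l.map (act.T (El.pull g k)).symm)).map _).sum)
  rw [← h2, map_list_sum, map_map, map_map, α_pull]
  rfl

lemma curvedT_mem (H : ConvergentAction V W κ) (g : x ⟶ y) (hφ : φ ∈ cochains V W κ ⟨S, y⟩ m) :
    curvedT g φ ∈ cochains V W κ ⟨S, x⟩ m := by
  rw [curvedT_eq H g hφ]
  have := (tIns V W g).app_mem (tIns_good H g).toConvergent hφ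
  rwa [show m - ((tIns V W g).len : ℤ) = m from sub_zero m] at this

lemma curvedT_add (H : ConvergentAction V W κ) (g : x ⟶ y) {ψ : Raw V W ⟨S, y⟩}
    (hφ : φ ∈ cochains V W κ ⟨S, y⟩ m) (hψ : ψ ∈ cochains V W κ ⟨S, y⟩ m) :
    curvedT g (φ + ψ) = curvedT g φ + curvedT g ψ := by
  rw [curvedT_eq H g hφ, curvedT_eq H g hψ, curvedT_eq H g (add_mem hφ hψ),
    InsOp.app_add (tIns_good H g).toConvergent hφ hψ]

lemma curvedT_units_smul (H : ConvergentAction V W κ) (g : x ⟶ y)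
    (hφ : φ ∈ cochains V W κ ⟨S, y⟩ m) (e : ℤˣ) : curvedT g (e • φ) = e • curvedT g φ := by
  rw [curvedT_eq H g hφ, curvedT_eq H g (units_smul_mem _ e hφ),
    InsOp.app_units_smul (tIns_good H g).toConvergent hφ]

lemma curvedT_totalD (H : ConvergentAction V W κ) (g : x ⟶ y) (hφ : φ ∈ cochains V W κ ⟨S, y⟩ m) :
    curvedT g (totalD m φ) = totalD m (curvedT g φ) := by
  rw [curvedT_eq H g hφ, curvedT_eq H g (totalD_mem hφ)]
  funext q k l v
  rw [InsOp.app_totalD (tIns_good H g) hφ]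
  have h1 : ((tIns V W g).len : ℤ).negOnePow = 1 := negOnePow_zero
  have h2 : m - ((tIns V W g).len : ℤ) = m := sub_zero m
  rw [h1, h2, one_smul]
  refine (add_assoc _ _ _).trans ?_
  change _ + ((0 : W.obj q) + W.T (El.pull g k) 0) = _
  simp

/-! ### Vertices -/

lemma adVtx_tVtx (g : x ⟶ y) {w : (A.obj ⟨S, y⟩)ˣ} (hw : w ∈ unitsZero (A.gr ⟨S, y⟩)) :
    (V.adVtx (act.TU g w)).comp (tVtx V g)
      = (tVtx V g).comp (V.adVtx w) := by
  have h3 := conn.T_D g (act.T g w)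
  rw [RingEquiv.symm_apply_apply, koszul_of_mem_zero _ _ (act.T_mem g hw)] at h3
  ext a
  · change (act.T g).symm (act.T g ↑w⁻¹ * a * act.T g ↑w) = ↑w⁻¹ * (act.T g).symm a * ↑w
    simp
  · change (act.T g).symm (conn.α g) + (act.T g).symm (-(act.T g ↑w⁻¹ * conn.D ⟨S, x⟩ (act.T g ↑w)))
      = -(↑w⁻¹ * conn.D ⟨S, y⟩ ↑w) + ↑w⁻¹ * (act.T g).symm (conn.α g) * ↑w
    rw [← map_add, RingEquiv.symm_apply_eq, map_add, map_neg, map_mul, map_mul, map_mul,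
      RingEquiv.apply_symm_apply]
    have h4 : act.T g (↑w⁻¹ : A.obj ⟨S, y⟩) * act.T g ↑w = 1 := by
      rw [← map_mul, Units.inv_mul, map_one]
    rw [h3, mul_add, mul_sub, ← mul_assoc _ (act.T g ↑w) (conn.α g), h4, one_mul, ← mul_assoc]
    abel
  · change (V.T g).symm (act.T g ↑w⁻¹ • a) = (↑w⁻¹ : A.obj ⟨S, y⟩) • (V.T g).symm a
    rw [AddEquiv.symm_apply_eq, V.T_smul, AddEquiv.apply_symm_apply]

lemma tVtx_tVtx (g₁ : x ⟶ y) (g₂ : y ⟶ z) :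
    (tVtx V g₁).comp (tVtx V g₂) = (V.adVtx
      (act.c g₁ g₂)).comp (tVtx V (g₁ ≫ g₂)) := by
  ext a
  · change (act.T g₂).symm ((act.T g₁).symm a)
      = (act.T (g₁ ≫ g₂)).symm (↑(act.c g₁ g₂)⁻¹ * a * ↑(act.c g₁ g₂))
    rw [RingEquiv.symm_apply_eq, RingEquiv.symm_apply_eq, act.T_T, RingEquiv.apply_symm_apply]
    simp only [mul_assoc, Units.mul_inv, Units.mul_inv_cancel_left, mul_one]
  · change (act.T g₂).symm (conn.α g₂) + (act.T g₂).symm ((act.T g₁).symm (conn.α g₁))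
      = (act.T (g₁ ≫ g₂)).symm (conn.α _)
        + (act.T (g₁ ≫ g₂)).symm (-(↑(act.c g₁ g₂)⁻¹ * conn.D ⟨S, x⟩ ↑(act.c g₁ g₂)))
    rw [← map_add, ← map_add, RingEquiv.symm_apply_eq]
    apply (act.T g₁).injective
    rw [act.T_T, RingEquiv.apply_symm_apply, map_add, RingEquiv.apply_symm_apply, mul_add,
      add_mul, mul_neg, Units.mul_inv_cancel_left, neg_mul, ← sub_eq_zero, ← conn.α_α g₁ g₂]
    abel
  · change (V.T g₂).symm ((V.T g₁).symm a)
      = (V.T (g₁ ≫ g₂)).symm ((↑(act.c g₁ g₂)⁻¹ : A.obj ⟨S, x⟩) • a)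
    rw [AddEquiv.symm_apply_eq, AddEquiv.symm_apply_eq, V.T_T, AddEquiv.apply_symm_apply, smul_smul,
      Units.mul_inv, one_smul]

lemma adPath_tVtx (g : x ⟶ y) {u : (A.obj ⟨S, y⟩)ˣ} (hu : u ∈ unitsZero (A.gr ⟨S, y⟩))
    {cs : List (A.obj ⟨S, y⟩)ˣ} (hcs : ∀ c ∈ cs, c ∈ unitsZero (A.gr ⟨S, y⟩)) :
    (V.adPath (act.TU g u) (cs.map (act.TU g))).map
        (fun s => ((tVtx V g).θ s.1, s.2.comp (tVtx V g)))
      = (V.adPath u cs).map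
        (fun s => (s.1, (tVtx V g).comp s.2)) := by
  induction cs generalizing u with
  | nil => rfl
  | cons c cs ih =>
    rw [forall_mem_cons] at hcs
    have hc := mul_mem hu hcs.1
    rw [map_cons, CompatModule.adPath, CompatModule.adPath, adPath, adPath, map_cons,
      map_cons, ← map_mul, ih hc hcs.2, adVtx_tVtx g hc]
    congr 2
    exact RingEquiv.symm_apply_apply _ _

lemma resU_TU (g : x ⟶ y) (k : q ⟶ ⟨S, x⟩) (c : (A.obj ⟨S, y⟩)ˣ) :
    A.resU k (act.TU g c) = act.TU (El.pull g k) (A.resU (El.lift F (El.Hom.map k) y) c) :=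
  Units.ext (T_pull g k (c : A.obj ⟨S, y⟩)).symm

lemma adVtx_comp_expOne {w : (A.obj ⟨S, x⟩)ˣ} (H : ConvergentAction V W κ)
    (hw : w ∈ admissibles V W κ ⟨S, x⟩) (g : x ⟶ y) : ExpOne V W κ ⟨S, y⟩
      ((V.adVtx w).comp (tVtx V g)).β :=
  ((H.expOne g).symm g).add ((adVtx_expOne hw).symm g)

end Operators

lemma curvedT_phiOp (H : ConvergentAction V W κ) (g : x ⟶ y) {d : (A.obj ⟨S, y⟩)ˣ}
    {ds : List (A.obj ⟨S, y⟩)ˣ} (hd : d ∈ admissibles V W κ ⟨S, y⟩)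
    (hds : ∀ c ∈ ds, c ∈ admissibles V W κ ⟨S, y⟩) {φ : Raw V W ⟨S, y⟩}
    (hφ : φ ∈ cochains V W κ ⟨S, y⟩ m) :
    curvedT g (phiOp d ds φ) = phiOp (act.TU g d) (ds.map (act.TU g)) (curvedT g φ) := by
  have hd' := T_admissible H g hd
  have hds' : ∀ c ∈ ds.map (act.TU g), c ∈ admissibles V W κ ⟨S, x⟩ := by
    intro c hc
    obtain ⟨b, hb, rfl⟩ := mem_map.mp hc
    exact T_admissible H g (hds b hb)
  have E := tIns_good H g
  have E₁ := phiIns_good hd hds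
  have E₂ := phiIns_good hd' hds'
  have hm := (phiIns V W d ds).app_mem E₁.toConvergent hφ
  rw [phiOp_eq hd hds hφ, curvedT_units_smul H g hm, curvedT_eq H g hm,
    phiOp_eq hd' hds' (curvedT_mem H g hφ), curvedT_eq H g hφ, length_map]
  congr 1
  funext q k l v
  let k' := El.lift F (El.Hom.map k) y
  let f := El.pull g k
  let u := A.resU k' d
  let us := ds.map (A.resU k')
  have hu : u ∈ admissibles V W κ (El.transport y k) := resU_mem_admissibles k' hd
  have hus : ∀ c ∈ us, c ∈ admissibles V W κ (El.transport y k) := by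
    intro c hc
    obtain ⟨b, hb, rfl⟩ := mem_map.mp hc
    exact resU_mem_admissibles k' (hds b hb)
  have e1 : A.resU k (act.TU g d) = act.TU f u := resU_TU g k d
  have e2 : (ds.map (act.TU g)).map (A.resU k) = us.map (act.TU f) := by
    rw [map_map, map_map]
    exact map_congr_left fun c _ => resU_TU g k c
  have L := InsOp.app_app E.toConvergent E₁.toConvergent hφ k (fun h₁ hh₁ h₂ hh₂ => by
    obtain rfl := mem_singleton.mp hh₁
    obtain ⟨w, hw, rfl⟩ := phiIns_vtx hd hds k' h₂ hh₂
    refine (congrArg (fun h => ExpOne V W κ (El.transport y k) (Vtx.β h)) (adVtx_tVtx f hw.1)).mp ?_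
    exact adVtx_comp_expOne H (T_admissible H f hw) f) l v
  have R := InsOp.app_app E₂.toConvergent E.toConvergent hφ k (fun h₁ hh₁ h₂ hh₂ => by
    obtain rfl := mem_singleton.mp hh₂
    obtain ⟨w, hw, rfl⟩ := phiIns_vtx hd' hds' k h₁ hh₁
    exact adVtx_comp_expOne H hw f) l v
  refine L.trans (Eq.trans ?_ R.symm)
  refine (congrArg (fun t => W.T f (A.res k' ↑d • t)) (shSum_nil_left _ (tVtx V f)
    (V.adVtx u) (V.adPath u us) _)).trans ?_
  refine Eq.trans ?_ (congrArg (fun t => A.res k (act.T g d) • W.T f t) (shSum_nil_right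
    (V.adVtx (A.resU k (act.TU g d))) (V.adPath
    (A.resU k (act.TU g d)) ((ds.map (act.TU g)).map (A.resU k))) (tVtx V f) _)).symm
  have key : W.T f (A.res k' ↑d • opTot (A.gr q) (((0 : ℕ) : ℤ)
        + (V.adPath u us).length)
        ((tVtx V f).comp (V.adVtx u))
        ((V.adPath u us).map
          fun s => (s.1, (tVtx V f).comp s.2)) (φ (El.transport y k) k') l v)
      = A.res k (act.T g d) • W.T f (opTot (A.gr q)
        ((V.adPath (A.resU k (act.TU g d))
          ((ds.map (act.TU g)).map (A.resU k))).length + ((0 : ℕ) : ℤ))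
        ((V.adVtx (A.resU k (act.TU g d))).comp (tVtx V f))
        ((V.adPath (A.resU k (act.TU g d))
          ((ds.map (act.TU g)).map (A.resU k))).map
          fun s => ((tVtx V f).θ s.1, s.2.comp (tVtx V f))) (φ (El.transport y k) k') l v) := by
    have h1 := adPath_tVtx (conn := conn) (V := V) f hu.1 fun c hc => (hus c hc).1
    have hl : (us.map (act.TU f)).length = us.length := length_map _
    have h2 := adVtx_tVtx (conn := conn) (V := V) f hu.1
    rw [W.T_smul, T_pull, e1, e2, adPath_length, adPath_length, hl, add_comm]
    exact congrArg₂ (fun a b => A.res k (act.T g d) • W.T f (opTot (A.gr q)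
      ((us.length : ℤ) + ((0 : ℕ) : ℤ)) a b (φ (El.transport y k) k') l v)) h2.symm h1.symm
  exact key

lemma curvedT_curvedT (H : ConvergentAction V W κ) (g₁ : x ⟶ y) (g₂ : y ⟶ z) {φ : Raw V W ⟨S, z⟩}
    (hφ : φ ∈ cochains V W κ ⟨S, z⟩ m) :
    curvedT g₁ (curvedT g₂ φ) = phiOp (act.c g₁ g₂) [] (curvedT (g₁ ≫ g₂) φ) := by
  have hc := c_admissible H g₁ g₂
  have hn : ∀ c ∈ ([] : List (A.obj ⟨S, x⟩)ˣ), c ∈ admissibles V W κ ⟨S, x⟩ := by simp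
  have E₁ := tIns_good H g₁
  have E₂ := tIns_good H g₂
  have E := tIns_good H (g₁ ≫ g₂)
  rw [curvedT_eq H g₁ (curvedT_mem H g₂ hφ), curvedT_eq H g₂ hφ,
    phiOp_eq hc hn (curvedT_mem H _ hφ), curvedT_eq H _ hφ]
  funext q k l v
  let k' := El.lift F (El.Hom.map k) y
  have hf : El.pull (g₁ ≫ g₂) k = El.pull g₁ k ≫ El.pull g₂ k' := by
    simp only [El.pull, Functor.map_comp, Category.assoc]
    congr 1
    congr 1
    exact (Category.id_comp _).symm
  have hcr : A.resU k (act.c g₁ g₂) = act.c (El.pull g₁ k) (El.pull g₂ k') := by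
    refine El.hom_cases (P := fun q k => A.resU k (act.c g₁ g₂) = act.c (El.pull g₁ k)
      (El.pull g₂ (El.lift F (El.Hom.map k) y))) (fun S' h => ?_) q k
    rw [El.pull_lift]
    refine Units.ext ((act.c_res h g₁ g₂).trans ?_)
    congr 1
    exact congrArg _ (El.pull_lift h g₂).symm
  have hc' : act.c (El.pull g₁ k) (El.pull g₂ k') ∈ admissibles V W κ q := c_admissible H _ _
  have hv := tVtx_tVtx (conn := conn) (V := V) (El.pull g₁ k) (El.pull g₂ k')
  have L := InsOp.app_app E₁.toConvergent E₂.toConvergent hφ k (fun h₁ hh₁ h₂ hh₂ => by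
    obtain rfl := mem_singleton.mp hh₁
    obtain rfl := mem_singleton.mp hh₂
    refine (congrArg (fun h => ExpOne V W κ (El.transport z k) (Vtx.β h)) hv).mpr ?_
    exact adVtx_comp_expOne H hc' _) l v
  have R := InsOp.app_app (phiIns_good hc hn).toConvergent E.toConvergent hφ k
    (fun h₁ hh₁ h₂ hh₂ => by
      obtain rfl := mem_singleton.mp hh₂
      obtain ⟨w, hw, rfl⟩ := phiIns_vtx hc hn k h₁ hh₁
      exact adVtx_comp_expOne H hw _) l v
  refine L.trans (Eq.trans ?_ (congrArg (fun t => triSign 0 • t) R).symm)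
  refine (congrArg (fun t => W.T (El.pull g₁ k) (W.T (El.pull g₂ k') t)) (shSum_nil_left _
    (tVtx V (El.pull g₁ k)) (tVtx V (El.pull g₂ k')) [] _)).trans ?_
  refine Eq.trans ?_ (congrArg (fun t => triSign 0 • A.res k ↑(act.c g₁ g₂) •
    W.T (El.pull (g₁ ≫ g₂) k) t) (shSum_nil_right
    (V.adVtx (A.resU k (act.c g₁ g₂))) []
    (tVtx V (El.pull (g₁ ≫ g₂) k)) _)).symm
  have key : W.T (El.pull g₁ k) (W.T (El.pull g₂ k') (opTot (A.gr q) (((0 : ℕ) : ℤ) + ((0 : ℕ) : ℤ))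
        ((tVtx V (El.pull g₁ k)).comp (tVtx V (El.pull g₂ k'))) []
        (φ (El.transport z k) (El.lift F (El.Hom.map k) z)) l v))
      = triSign 0 • A.res k ↑(act.c g₁ g₂) • W.T (El.pull (g₁ ≫ g₂) k)
        (opTot (A.gr q) (((0 : ℕ) : ℤ) + ((0 : ℕ) : ℤ)) ((V.adVtx
          (A.resU k (act.c g₁ g₂))).comp (tVtx V (El.pull (g₁ ≫ g₂) k))) []
        (φ (El.transport z k) (El.lift F (El.Hom.map k) z)) l v) := by
    have h1 : triSign 0 = 1 := negOnePow_zero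
    have h2 : A.res k (act.c g₁ g₂ : A.obj ⟨S, x⟩) = act.c (El.pull g₁ k) (El.pull g₂ k') :=
      congrArg Units.val hcr
    rw [h1, one_smul, W.T_T, h2, hcr, hf]
    exact congrArg (fun a => (act.c (El.pull g₁ k) (El.pull g₂ k') : A.obj q) •
      W.T (El.pull g₁ k ≫ El.pull g₂ k') (opTot (A.gr q) (((0 : ℕ) : ℤ) + ((0 : ℕ) : ℤ)) a []
      (φ (El.transport z k) (El.lift F (El.Hom.map k) z)) l v)) hv
  exact key

/-! ### Products with scalars -/

lemma InsOp.app_scale {p' : El F} {E : InsOp V W p' p} (hE : E.Convergent κ) {φ : Raw V W p'}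
    (hφ : φ ∈ cochains V W κ p' m) {ω' : O.obj p'.base} (hω : ω ∈ O.gr p.base i)
    (hω' : ω' ∈ O.gr p'.base i)
    (h : ∀ {q : El F} (k : q ⟶ p) (y : W.obj (E.tgt k)), E.val k
    (A.η _ (O.res (El.Hom.map (E.hom k)) ω') • y) = A.η q (O.res (El.Hom.map k) ω) • E.val k y) :
    E.app (Raw.scale m ω' φ) = (i * E.len).negOnePow • Raw.scale (m - E.len) ω (E.app φ) := by
  funext q k l v
  simp only [Pi.smul_apply]
  rw [scale_apply hω]
  have h1 : Raw.scale m ω' φ (E.tgt k) (E.hom k) = fun l v =>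
      (i * m + i * (i + 1) / 2).negOnePow • A.η _ (O.res (El.Hom.map (E.hom k)) ω') •
        φ (E.tgt k) (E.hom k) l v := by
    funext l v; exact scale_apply hω' φ _ _ l v
  have h2 := opTot_map (gr := A.gr q) (hE.labels k) (E.path k).length (cochain_progFinite hφ (E.hom k))
    ((toAddMonoidHom _ (i * m + i * (i + 1) / 2).negOnePow).comp
      (toAddMonoidHom _ (A.η _ (O.res (El.Hom.map (E.hom k)) ω')))) l v
  rw [app, h1]
  refine (congrArg (E.val k) h2).trans ?_
  simp only [AddMonoidHom.comp_apply, DistribSMul.toAddMonoidHom_apply]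
  rw [map_units_smul, h, smul_smul, ← negOnePow_add]
  congr 1
  refine negOnePow_eq_of (c := 0) (by ring)

lemma phiOp_scale (h₀ : c₀ ∈ admissibles V W κ p) (hcs : ∀ c ∈ cs, c ∈ admissibles V W κ p)
    (hφ : φ ∈ cochains V W κ p m) (hω : ω ∈ O.gr p.base i) : phiOp c₀ cs (Raw.scale m ω φ)
      = (i * cs.length).negOnePow • Raw.scale (m - cs.length) ω (phiOp c₀ cs φ) := by
  have hs : ∀ (e : ℤˣ) (ψ : Raw V W p), Raw.scale (m - cs.length) ω (e • ψ)
      = e • Raw.scale (m - cs.length) ω ψ := fun e ψ => by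
    funext q k l v
    simp only [Pi.smul_apply, Raw.scale, smul_units_smul]
  rw [phiOp_eq h₀ hcs hφ, phiOp_eq h₀ hcs (scale_mem hω hφ), hs,
    InsOp.app_scale (phiIns_good h₀ hcs).toConvergent hφ hω hω, smul_comm]
  · rfl
  · intro q k (y : W.obj q)
    change A.res k ↑c₀ • A.η q (O.res (El.Hom.map k) ω) • y
      = A.η q (O.res (El.Hom.map k) ω) • A.res k ↑c₀ • y
    rw [smul_smul, (central_η (O.res_mem _ hω)).comm,
      koszul_of_mem_zero _ _ (A.res_mem k h₀.1), mul_smul]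

lemma curvedT_scale (H : ConvergentAction V W κ) (g : x ⟶ y) {φ : Raw V W ⟨S, y⟩}
    (hφ : φ ∈ cochains V W κ ⟨S, y⟩ m) {ω : O.obj S} (hω : ω ∈ O.gr S i) :
    curvedT g (Raw.scale (p := ⟨S, y⟩) m ω φ) = Raw.scale (p := ⟨S, x⟩) m ω (curvedT g φ) := by
  rw [curvedT_eq H g hφ, curvedT_eq H g (scale_mem hω hφ)]
  refine (InsOp.app_scale (ω := ω) (ω' := ω) (tIns_good H g).toConvergent hφ hω hω ?_).trans ?_
  · intro q k (y' : W.obj (El.transport y k))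
    change W.T (El.pull g k) (A.η (El.transport y k) (O.res (El.Hom.map k) ω) • y') = _
    rw [W.T_smul, act.T_η]
    rfl
  · have h1 : (i * ((tIns V W g).len : ℤ)).negOnePow = 1 := by
      change (i * 0).negOnePow = 1
      rw [mul_zero, negOnePow_zero]
    have h2 : m - ((tIns V W g).len : ℤ) = m := sub_zero m
    rw [h1, h2, one_smul]

/-! ### Inverse images -/

lemma phiOp_restrict (k : q ⟶ p) (c₀ : (A.obj p)ˣ) (cs : List (A.obj p)ˣ) (φ : Raw V W p) :
    Raw.restrict k (phiOp c₀ cs φ)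
      = phiOp (A.resU k c₀) (cs.map (A.resU k)) (Raw.restrict k φ) := by
  funext r k' l v
  have h1 : cs.map (A.resU (k' ≫ k)) = (cs.map (A.resU k)).map (A.resU k') := by
    rw [map_map]; exact map_congr_left fun c _ => resU_comp k' k c
  rw [Raw.restrict, phiOp, phiOp, length_map, A.res_comp]
  congr 3
  funext K
  rw [phiTerm, phiTerm, A.res_comp, resU_prod]
  change phiSum _ _ (A.resU (k' ≫ k) c₀) (cs.map (A.resU (k' ≫ k))) K l _ = _
  rw [h1, resU_comp]
  rfl

lemma eqToHom_sandwich {X : Type u} [Category.{v} X] {a b b' c c' : X} (e₁ : a = b) (e₂ : a = b')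
    (e₃ : b' = b) (e₄ : c = c') (e₅ : c' = c) (f : b ⟶ c) :
    (eqToHom e₂ ≫ eqToHom e₃ ≫ f ≫ eqToHom e₄) ≫ eqToHom e₅ = eqToHom e₁ ≫ f := by
  simp

lemma curvedT_restrict {S' : 𝕋} (h : S' ⟶ S) (g : x ⟶ y) (φ : Raw V W ⟨S, y⟩) :
    Raw.restrict (El.lift F h x) (curvedT g φ)
      = curvedT ((F.res h).map g) (Raw.restrict (El.lift F h y) φ) := by
  funext q k l v
  rw [Raw.restrict, curvedT, curvedT, expInsert, expInsert]
  refine finsum_congr fun n => ?_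
  rw [← conn.α_res, A.res_comp]
  congr 2
  funext l
  refine congr_arrow (x := q.pt) (p := ⟨S, y⟩) (fun z f k => W.T f (φ ⟨q.base, z⟩ k
    (l.map (act.T f).symm) ((V.T f).symm v)))
    (congrArg (fun f => Functor.obj f y) (F.res_comp (El.Hom.map k) h)) ?_ rfl
  have h1 := Functor.congr_hom (F.res_comp (El.Hom.map k) h) g
  change eqToHom _ ≫ (F.res (El.Hom.map k)).map ((F.res h).map g)
    = (eqToHom _ ≫ (F.res (El.Hom.map k ≫ h)).map g) ≫ _
  rw [h1]
  exact (eqToHom_sandwich _ _ _ _ _ _).symm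

/-! ## The product of words -/

lemma hom_ext_mem {α M : Type*} [AddCommGroup M] {P : α → Prop} {f g : FreeAbelianGroup α →+ M}
    (h : ∀ a, P a → f (of a) = g (of a)) {x : FreeAbelianGroup α} (hx : x ∈ suppIn P) :
    f x = g x := by
  rw [← lift_of_self x, hom_lift, hom_lift]
  exact lift_congr hx h

lemma mem_suppIn_true {α : Type*} (x : FreeAbelianGroup α) : x ∈ suppIn fun _ : α => True := by
  rw [← lift_of_self x]
  induction x using FreeAbelianGroup.induction_on with
  | zero => simp
  | of a => simpa using of_mem_suppIn (P := fun _ : α => True) trivial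
  | neg a h => rw [map_neg]; exact neg_mem h
  | add x y hx hy => rw [map_add]; exact add_mem hx hy

section Words

variable {G : Type u} [Group G]

lemma shuffle_nil (ds : List G) : shuffle [] ds = of ds := by rw [shuffle]

lemma shuffle_nil' (cs : List G) : shuffle cs [] = of cs := by cases cs <;> rw [shuffle]

/-- Conjugation of all entries by an element. -/
abbrev conjBy (d : G) : G →* G := (MulAut.conj d⁻¹).toMonoidHom

lemma conjBy_apply (d c : G) : conjBy d c = d⁻¹ * c * d := by simp [conjBy]

lemma conjBy_conjBy (d e : G) (l : List G) :
    (l.map (conjBy d)).map (conjBy e) = l.map (conjBy (d * e)) := by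
  simp

lemma shuffle_cons_cons (c d : G) (cs ds : List G) : shuffle (c :: cs) (d :: ds)
    = map (List.cons c) (shuffle cs (d :: ds)) + ((cs.length : ℤ) + 1).negOnePow • map (List.cons d)
          (shuffle ((c :: cs).map (conjBy d)) ds) := by
  rw [shuffle, show (conjBy d : G → G) = fun x => d⁻¹ * x * d from funext (conjBy_apply d)]; rfl

lemma lift_shuffle_cons_left {n : ℕ} (c e : G) (es : List G) {x : FreeAbelianGroup (List G)}
    (hx : x ∈ suppIn fun l : List G => l.length = n) :
    lift (fun zs => shuffle zs (e :: es)) (map (List.cons c) x)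
      = map (List.cons c) (lift (fun zs => shuffle zs (e :: es)) x)
        + ((n : ℤ) + 1).negOnePow • map (List.cons e)
          (lift (fun zs => shuffle ((c :: zs).map (conjBy e)) es) x) := by
  rw [lift_map_apply, hom_lift, hom_lift]
  have key := hom_ext_mem (f := lift fun a => shuffle (c :: a) (e :: es))
    (g := lift (fun a => map (List.cons c) (shuffle a (e :: es)))
      + ((n : ℤ) + 1).negOnePow • lift (fun a => map (List.cons e)
        (shuffle ((c :: a).map (conjBy e)) es))) (fun a ha => by
      rw [AddMonoidHom.add_apply, AddMonoidHom.smul_apply]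
      simp only [lift_apply_of]
      rw [shuffle_cons_cons, ha]) hx
  simp_all

lemma lift_shuffle_cons_right (c d : G) (cs : List G) (y : FreeAbelianGroup (List G)) :
    lift (fun zs => shuffle (c :: cs) zs) (map (List.cons d) y) = map (List.cons c)
          (lift (fun zs => shuffle cs zs) (map (List.cons d) y))
        + ((cs.length : ℤ) + 1).negOnePow • map (List.cons d)
          (lift (fun zs => shuffle ((c :: cs).map (conjBy d)) zs) y) := by
  rw [lift_map_apply, lift_map_apply, hom_lift, hom_lift]
  have key := hom_ext_mem (f := lift fun a => shuffle (c :: cs) (d :: a))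
    (g := lift (fun a => map (List.cons c) (shuffle cs (d :: a)))
      + ((cs.length : ℤ) + 1).negOnePow • lift (fun a =>
        map (List.cons d) (shuffle ((c :: cs).map (conjBy d)) a))) (fun a _ => by
      rw [AddMonoidHom.add_apply, AddMonoidHom.smul_apply]
      simp only [lift_apply_of]
      rw [shuffle_cons_cons]) (mem_suppIn_true y)
  simp_all

lemma shuffle_length (cs ds : List G) :
    shuffle cs ds ∈ suppIn fun l : List G => l.length = cs.length + ds.length := by
  have := map_mem_suppIn (f := id) (Q := fun l : List G => l.length = cs.length + ds.length)
    (shuffle_mem (⊤ : Subgroup G) (cs := cs) (ds := ds) (by simp) (by simp)) fun a h => h.2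
  rwa [FreeAbelianGroup.map_id_apply] at this

lemma shuffle_assoc (cs ds es : List G) :
    lift (fun zs => shuffle zs es) (shuffle cs ds)
      = lift (fun zs => shuffle cs zs) (shuffle ds es) := by
  induction' hn : cs.length + ds.length + es.length using Nat.strong_induction_on with
    n ih generalizing cs ds es
  match cs, ds, es with
  | [], ds, es => simp only [shuffle_nil, lift_apply_of, lift_of_self]
  | c :: cs, [], es => simp only [shuffle_nil, shuffle_nil', lift_apply_of]
  | c :: cs, d :: ds, [] => simp only [shuffle_nil', lift_apply_of, lift_of_self]
  | c :: cs, d :: ds, e :: es =>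
    have i1 := ih _ (by simp only [length_cons] at hn ⊢; omega) cs (d :: ds) (e :: es) rfl
    have i2 := ih _ (by simp only [length_cons, length_map] at hn ⊢; omega)
      ((c :: cs).map (conjBy d)) ds (e :: es) rfl
    have i3 := ih _ (by simp only [length_cons, length_map] at hn ⊢; omega)
      ((c :: cs).map (conjBy e)) ((d :: ds).map (conjBy e)) es rfl
    rw [shuffle_map, lift_map_apply] at i3
    have hE : lift (fun zs => shuffle (zs.map (conjBy e)) es) (shuffle (c :: cs) (d :: ds))
        = lift (fun zs => shuffle ((c :: zs).map (conjBy e)) es) (shuffle cs (d :: ds))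
          + ((cs.length : ℤ) + 1).negOnePow •
            lift (fun zs => shuffle ((d :: zs).map (conjBy e)) es)
              (shuffle ((c :: cs).map (conjBy d)) ds) := by
      rw [shuffle_cons_cons, map_add, map_units_smul, lift_map_apply, lift_map_apply]
    have hc : lift (fun zs => shuffle cs zs) (shuffle (d :: ds) (e :: es))
        = lift (fun zs => shuffle cs zs) (map (List.cons d) (shuffle ds (e :: es)))
          + ((ds.length : ℤ) + 1).negOnePow • lift (fun zs => shuffle cs zs)
            (map (List.cons e) (shuffle ((d :: ds).map (conjBy e)) es)) := by
      rw [shuffle_cons_cons, map_add, map_units_smul]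
    have s1 : ((cs.length + (d :: ds).length : ℕ) + 1 : ℤ).negOnePow
        = ((ds.length : ℤ) + 1).negOnePow * ((cs.length : ℤ) + 1).negOnePow := by
      rw [← negOnePow_add, length_cons]; congr 1; push_cast; ring
    have s2 : ((((c :: cs).map (conjBy d)).length + ds.length : ℕ) + 1 : ℤ).negOnePow
        = ((ds.length : ℤ) + 1).negOnePow * ((cs.length : ℤ) + 1).negOnePow := by
      rw [← negOnePow_add, length_map, length_cons]; congr 1; push_cast; ring
    rw [shuffle_cons_cons c d, map_add, map_units_smul,
      lift_shuffle_cons_left c e es (shuffle_length cs (d :: ds)),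
      lift_shuffle_cons_left d e es (shuffle_length ((c :: cs).map (conjBy d)) ds),
      shuffle_cons_cons d e, map_add, map_units_smul, lift_shuffle_cons_right,
      lift_shuffle_cons_right, i1, i2, hc, ← i3, hE, s1, s2]
    simp only [map_add, map_units_smul, smul_add, smul_smul]
    rw [mul_comm ((cs.length : ℤ) + 1).negOnePow (((ds.length : ℤ) + 1).negOnePow * _)]
    simp only [mul_assoc]
    abel

lemma wordMul_of (a b : G) (cs ds : List G) : wordMul (of (a, cs)) (of (b, ds))
      = map (Prod.mk (a * b)) (shuffle (cs.map (conjBy b)) ds) := by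
  rw [wordMul_of_of, show (conjBy b : G → G) = fun x => b⁻¹ * x * b from funext (conjBy_apply b)]

lemma wordMul_add_left (x x' y : Words G) : wordMul (x + x') y = wordMul x y + wordMul x' y := by
  simp only [← wordMulHom_apply, map_add, AddMonoidHom.add_apply]

lemma wordMul_add_right (x y y' : Words G) : wordMul x (y + y') = wordMul x y + wordMul x y' := by
  simp only [← wordMulHom_apply, map_add]

lemma wordMul_sub_left (x x' y : Words G) : wordMul (x - x') y = wordMul x y - wordMul x' y := by
  simp only [← wordMulHom_apply, map_sub, AddMonoidHom.sub_apply]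

lemma wordMul_sub_right (x y y' : Words G) : wordMul x (y - y') = wordMul x y - wordMul x y' := by
  simp only [← wordMulHom_apply, map_sub]

lemma wordMul_smul_left (e : ℤˣ) (x y : Words G) : wordMul (e • x) y = e • wordMul x y := by
  simp only [← wordMulHom_apply]
  simp

lemma wordMul_smul_right (e : ℤˣ) (x y : Words G) : wordMul x (e • y) = e • wordMul x y := by
  simp only [← wordMulHom_apply]
  simp

lemma words_hom_ext {M : Type*} [AddCommGroup M] {f g : Words G →+ M}
    (h : ∀ a cs, f (of (a, cs)) = g (of (a, cs))) (x : Words G) : f x = g x :=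
  hom_ext_mem (fun a _ => h a.1 a.2) (mem_suppIn_true x)

lemma wordMul_assoc_of (a b c : G) (cs ds es : List G) : wordMul (wordMul (of (a, cs)) (of (b, ds)))
        (of (c, es))
      = wordMul (of (a, cs)) (wordMul (of (b, ds)) (of (c, es))) := by
  have h1 := hom_lift (wordMulHom.flip (of (c, es)))
    (fun l => of (a * b, l)) (shuffle (cs.map (conjBy b)) ds)
  have h2 := hom_lift (wordMulHom (of (a, cs)))
    (fun l => of (b * c, l)) (shuffle (ds.map (conjBy c)) es)
  have h3 := congrArg (map (Prod.mk (a * b * c)))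
    (shuffle_assoc ((cs.map (conjBy b)).map (conjBy c)) (ds.map (conjBy c)) es)
  rw [shuffle_map, lift_map_apply, hom_lift, hom_lift] at h3
  simp only [AddMonoidHom.flip_apply, wordMulHom_apply, wordMul_of, conjBy_conjBy] at h1 h2 h3
  rw [wordMul_of, wordMul_of]
  refine (h1.trans h3).trans (Eq.trans ?_ h2.symm)
  grind

lemma wordMul_assoc (x y z : Words G) : wordMul (wordMul x y) z = wordMul x (wordMul y z) := by
  have h (x) (y : Words G) (c es) := words_hom_ext
    (f := (wordMulHom.flip (of (c, es))).comp (wordMulHom (of x)))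
    (g := (wordMulHom (of x)).comp (wordMulHom.flip (of (c, es)))) (fun b ds => by
      simpa [wordMulHom_apply] using
        wordMul_assoc_of x.1 b c x.2 ds es) y
  have h' (x) (z : Words G) := words_hom_ext (f := wordMulHom (wordMul (of x) y))
    (g := (wordMulHom (of x)).comp (wordMulHom y)) (fun c es => by
      simpa [wordMulHom_apply] using
        h x y c es) z
  have h'' := words_hom_ext (f := (wordMulHom.flip z).comp (wordMulHom.flip y))
    (g := wordMulHom.flip (wordMul y z)) (fun a cs => by
      simpa [wordMulHom_apply] using
        h' (a, cs) z) x
  simpa [wordMulHom_apply] using h''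

end Words

/-! ## The differential of words -/

section Words

variable {G : Type u} [Group G]

lemma mergeListSum_mem {M : Type*} [AddCommGroup M] {H : AddSubgroup M} (l : List G)
    {f : List G → M} (h : ∀ x, x.length + 1 = l.length → f x ∈ H) : mergeListSum l f ∈ H := by
  match l with
  | [] => exact zero_mem H
  | [_] => exact zero_mem H
  | a :: b :: l =>
    refine sub_mem (neg_mem (h _ rfl)) (mergeListSum_mem (b :: l) fun x hx => h _ ?_)
    grind

lemma of_mem_wordsIn (a : G) (cs : List G) : of (a, cs) ∈ wordsIn (⊤ : Subgroup G) cs.length :=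
  of_mem_suppIn (by simp)

lemma wordBd_of_mem (a : G) (cs : List G) {n : ℕ} (hn : cs.length = n + 1) :
    wordBd (of (a, cs)) ∈ wordsIn (⊤ : Subgroup G) n := by
  match cs with
  | c :: cs =>
    rw [length_cons, Nat.succ_inj] at hn
    subst hn
    rw [wordBd_cons]
    refine add_mem (add_mem (of_mem_wordsIn _ _) (mergeListSum_mem _ fun x hx => ?_))
      (units_smul_mem _ _ ?_)
    · rw [length_cons, Nat.succ_inj] at hx
      rw [← hx]; exact of_mem_wordsIn _ _
    · convert of_mem_wordsIn a (c :: cs).dropLast using 1; simp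

lemma wordShift_of (a : G) (cs : List G) : wordShift (of (a, cs)) = of (1, a :: cs) :=
  map_of_apply _

lemma wordMul_nil_left (a b : G) (ds : List G) : wordMul (of (a, [])) (of (b, ds))
      = of (a * b, ds) := by
  rw [wordMul_of, map_nil, shuffle_nil, map_of_apply]

lemma wordMul_nil_right (a b : G) (cs : List G) : wordMul (of (a, cs)) (of (b, []))
      = of (a * b, cs.map (conjBy b)) := by
  rw [wordMul_of, shuffle_nil', map_of_apply]

lemma wordMul_one_left (y : Words G) : wordMul (of (1, [])) y = y := by
  rw [← wordMulHom_apply]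
  exact words_hom_ext (g := AddMonoidHom.id _) (fun a cs => by
    rw [wordMulHom_apply, wordMul_nil_left, one_mul]; rfl) y

lemma wordMul_one_right (x : Words G) : wordMul x (of (1, [])) = x := by
  rw [← wordMulHom_apply]
  exact words_hom_ext (f := wordMulHom.flip _) (g := AddMonoidHom.id _) (fun a cs => by
    rw [AddMonoidHom.flip_apply, wordMulHom_apply, wordMul_nil_right, mul_one,
      show (conjBy (1 : G) : G → G) = id from funext fun c => by simp, List.map_id]; rfl) x

lemma wordMul_wordShift_of (c d : G) (cs ds : List G) :
    wordMul (wordShift (of (c, cs))) (wordShift (of (d, ds)))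
      = wordShift (wordMul (of (c, cs)) (wordShift (of (d, ds))) + ((cs.length : ℤ) + 1).negOnePow •
          wordMul (wordShift (of (c, cs))) (of (d, ds))) := by
  have hid : (conjBy (1 : G) : G → G) = id := funext fun c => by simp
  rw [wordShift_of, wordShift_of, wordMul_of, wordMul_of, wordMul_of, hid, List.map_id, List.map_id,
    shuffle_cons_cons, map_add, map_add, map_units_smul, map_units_smul, wordShift]
  simp only [← map_comp_apply]
  congr 3 <;> simp [Function.comp_def]

lemma wordMul_wordShift {n : ℕ} {x : Words G} (hx : x ∈ wordsIn (⊤ : Subgroup G) n) (y : Words G) :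
    wordMul (wordShift x) (wordShift y) = wordShift (wordMul x (wordShift y)
        + ((n : ℤ) + 1).negOnePow • wordMul (wordShift x) y) := by
  have h (a) (ha : a.2.length = n) := words_hom_ext
    (f := (wordMulHom (wordShift (of a))).comp wordShift)
    (g := wordShift.comp ((wordMulHom (of a)).comp wordShift
      + ((n : ℤ) + 1).negOnePow • wordMulHom (wordShift (of a)))) (fun d ds => by
      simp only [AddMonoidHom.comp_apply, AddMonoidHom.add_apply, AddMonoidHom.smul_apply,
        wordMulHom_apply, ← ha]
      exact wordMul_wordShift_of a.1 d a.2 ds) y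
  have h' := hom_ext_mem (f := (wordMulHom.flip (wordShift y)).comp wordShift)
    (g := wordShift.comp (wordMulHom.flip (wordShift y)
      + ((n : ℤ) + 1).negOnePow • (wordMulHom.flip y).comp wordShift)) (fun a ha => by
      simpa [wordMulHom_apply] using h a ha.2.2) hx
  simpa [wordMulHom_apply] using h'

lemma wordBd_mul_nil_left (a : G) (x : Words G) : wordBd (wordMul (of (a, [])) x)
      = wordMul (of (a, [])) (wordBd x) := by
  simp only [← wordMulHom_apply]
  refine words_hom_ext (f := wordBd.comp (wordMulHom (of (a, []))))
    (g := (wordMulHom (of (a, []))).comp wordBd) (fun b cs => ?_) x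
  rw [AddMonoidHom.comp_apply, AddMonoidHom.comp_apply, wordMulHom_apply, wordMul_nil_left]
  match cs with
  | [] => rw [wordBd_nil, wordBd_nil, map_zero]
  | c :: cs =>
    rw [wordBd_cons, wordBd_cons, map_add, map_add, map_units_smul, ← mergeListSum_map]
    simp only [wordMulHom_apply, wordMul_nil_left, mul_assoc]

lemma wordBd_mul_nil_right (b : G) (x : Words G) : wordBd (wordMul x (of (b, [])))
      = wordMul (wordBd x) (of (b, [])) := by
  have h := words_hom_ext (f := wordBd.comp (wordMulHom.flip (of (b, []))))
    (g := (wordMulHom.flip (of (b, []))).comp wordBd) (fun a cs => by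
    rw [AddMonoidHom.comp_apply, AddMonoidHom.comp_apply, AddMonoidHom.flip_apply, wordMulHom_apply,
      wordMul_nil_right]
    match cs with
    | [] => rw [map_nil, wordBd_nil, wordBd_nil, map_zero]
    | c :: cs =>
      rw [wordBd_cons, map_cons, wordBd_cons, map_add, map_add, map_units_smul,
        ← mergeListSum_map, ← map_cons, mergeListSum_list_map (map_mul (conjBy b)),
        ← List.map_dropLast]
      simp only [AddMonoidHom.flip_apply, wordMulHom_apply, wordMul_nil_right, length_map]
      congr 4
      simp [mul_assoc]) x
  simpa [wordMulHom_apply] using h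

/-- The augmentation, which annihilates the words of positive degree. -/
def wordAug : Words G →+ Words G :=
  lift fun w => match w.2 with
    | [] => of (1, [])
    | _ :: _ => 0

lemma wordAug_of_nil (a : G) : wordAug (of (a, [])) = of (1, []) := by simp [wordAug]

lemma wordAug_of_cons (a c : G) (cs : List G) : wordAug (of (a, c :: cs)) = 0 := by simp [wordAug]

lemma wordAug_eq_zero {S : Subgroup G} {n : ℕ} {x : Words G} (hx : x ∈ wordsIn S (n + 1)) :
    wordAug x = 0 := by
  refine hom_ext_mem (g := 0) (fun a ha => ?_) hx
  obtain ⟨a, cs⟩ := a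
  match cs, ha with
  | c :: cs, _ => exact wordAug_of_cons a c cs
  | [], h => simp at h

lemma wordBd_wordShift (x : Words G) :
    wordBd (wordShift x) = x - wordShift (wordBd x) - wordAug x := by
  refine words_hom_ext (f := wordBd.comp wordShift)
    (g := AddMonoidHom.id _ - wordShift.comp wordBd - wordAug) (fun a cs => ?_) x
  simp only [AddMonoidHom.comp_apply, AddMonoidHom.sub_apply, AddMonoidHom.id_apply, wordShift_of]
  match cs with
  | [] => rw [wordBd_cons, wordBd_nil, wordAug_of_nil, map_zero]; simp [mergeListSum, sub_eq_add_neg]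
  | c :: cs =>
    rw [wordBd_cons, wordBd_cons, wordAug_of_cons, mergeListSum, map_add, map_add, map_units_smul,
      ← mergeListSum_map]
    simp only [wordShift_of, one_mul, length_cons, List.dropLast_cons_cons, Nat.cast_add, Nat.cast_one,
      negOnePow_succ, Units.neg_smul]
    abel

lemma wordMul_wordShift_wordBd (c : G) (cs : List G) (y : Words G) :
    wordMul (wordShift (wordBd (of (c, cs)))) (wordShift y)
      = wordShift (wordMul (wordBd (of (c, cs))) (wordShift y) + (cs.length : ℤ).negOnePow •
          wordMul (wordShift (wordBd (of (c, cs)))) y) := by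
  cases cs with
  | nil => simp [wordBd_nil, ← wordMulHom_apply]
  | cons e cs =>
    rw [wordMul_wordShift (wordBd_of_mem c (e :: cs) rfl) y, length_cons, Nat.cast_succ]

lemma wordAug_wordMul_wordShift (c : G) (cs : List G) (y : Words G) :
    wordMul (wordAug (of (c, cs))) (wordShift y) = (cs.length : ℤ).negOnePow •
        wordShift (wordMul (wordAug (of (c, cs))) y) := by
  cases cs with
  | nil => simp [wordAug_of_nil, wordMul_one_left]
  | cons e cs => simp [wordAug_of_cons, ← wordMulHom_apply]

lemma wordShift_wordMul_wordAug (x : Words G) (d : G) (ds : List G) :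
    wordMul (wordShift x) (wordAug (of (d, ds)))
      = wordShift (wordMul x (wordAug (of (d, ds)))) := by
  cases ds with
  | nil => simp [wordAug_of_nil, wordMul_one_right]
  | cons e ds => simp [wordAug_of_cons, ← wordMulHom_apply]

lemma wordBd_mul_shift {c d : G} {cs ds : List G}
    (h₁ : wordBd (wordMul (of (c, cs)) (wordShift (of (d, ds)))) = wordMul (wordBd (of (c, cs)))
    (wordShift (of (d, ds))) + (cs.length : ℤ).negOnePow • wordMul (of (c, cs))
    (wordBd (wordShift (of (d, ds)))))
    (h₂ : wordBd (wordMul (wordShift (of (c, cs))) (of (d, ds))) = wordMul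
    (wordBd (wordShift (of (c, cs)))) (of (d, ds)) + ((cs.length : ℤ) + 1).negOnePow • wordMul
    (wordShift (of (c, cs))) (wordBd (of (d, ds)))) :
    wordBd (wordMul (wordShift (of (c, cs))) (wordShift (of (d, ds))))
      = wordMul (wordBd (wordShift (of (c, cs)))) (wordShift (of (d, ds)))
        + ((cs.length : ℤ) + 1).negOnePow • wordMul (wordShift (of (c, cs)))
          (wordBd (wordShift (of (d, ds)))) := by
  have hx := of_mem_wordsIn c cs
  have hy := of_mem_wordsIn d ds
  have hxy : wordMul (wordShift (of (c, cs))) (of (d, ds))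
      ∈ wordsIn (⊤ : Subgroup G) (cs.length + ds.length + 1) := by
    rw [Nat.add_right_comm]; exact wordMul_mem (wordShift_mem hx) hy
  have hyx : wordMul (of (c, cs)) (wordShift (of (d, ds)))
      ∈ wordsIn (⊤ : Subgroup G) (cs.length + ds.length + 1) := by
    rw [Nat.add_assoc]; exact wordMul_mem hx (wordShift_mem hy)
  have hZ := wordAug_eq_zero (add_mem hyx (units_smul_mem _ ((cs.length : ℤ) + 1).negOnePow hxy))
  have hb := wordMul_wordShift_wordBd c cs (of (d, ds))
  have ha := wordAug_wordMul_wordShift c cs (of (d, ds))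
  have ha' := wordShift_wordMul_wordAug (of (c, cs)) d ds
  have hR := wordMul_wordShift hx (of (d, ds))
  have hR' := wordMul_wordShift hx (wordBd (of (d, ds)))
  generalize of (c, cs) = x at *
  generalize of (d, ds) = y at *
  rw [hR, wordBd_wordShift, hZ, map_add, map_units_smul, h₁, h₂, wordBd_wordShift, wordBd_wordShift]
  simp only [wordMul_sub_left, wordMul_sub_right, hb, ha, ha', hR', negOnePow_succ]
  generalize (cs.length : ℤ).negOnePow = e at *
  rcases Int.units_eq_one_or e with rfl | rfl <;>
    simp only [map_add, map_sub, map_neg, one_smul, Units.neg_smul, neg_neg] <;> abel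

/-- The differential is a derivation. -/
lemma wordBd_mul_of (a b : G) (cs ds : List G) : wordBd (wordMul (of (a, cs)) (of (b, ds)))
      = wordMul (wordBd (of (a, cs))) (of (b, ds)) + (cs.length : ℤ).negOnePow •
          wordMul (of (a, cs)) (wordBd (of (b, ds))) := by
  induction' hn : cs.length + ds.length using Nat.strong_induction_on with
    n ih generalizing a b cs ds
  match cs, ds with
  | [], ds => rw [wordBd_mul_nil_left, wordBd_nil]; simp [← wordMulHom_apply]
  | cs, [] => rw [wordBd_mul_nil_right, wordBd_nil]; simp [← wordMulHom_apply]
  | c :: cs, d :: ds =>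
    have hsx : wordMul (of (a, c :: cs)) (of (b, [])) = wordMul (of (a * b, []))
          (wordShift (of (conjBy b c, cs.map (conjBy b)))) := by
      rw [wordMul_nil_right, wordShift_of, wordMul_nil_left, mul_one]; rfl
    have hsy : of (b, d :: ds) = wordMul (of (b, [])) (wordShift (of (d, ds))) := by
      rw [wordShift_of, wordMul_nil_left, mul_one]
    have key := wordBd_mul_shift (c := conjBy b c) (cs := cs.map (conjBy b)) (d := d) (ds := ds)
      (by rw [wordShift_of]
          exact ih _ (by simp only [length_map, length_cons] at hn ⊢; omega) _ _ _ _ rfl)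
      (by rw [wordShift_of]
          have := ih _ (by simp only [length_map, length_cons] at hn ⊢; omega) 1 d
            (conjBy b c :: cs.map (conjBy b)) ds rfl
          rwa [length_cons, Nat.cast_succ] at this)
    rw [length_map] at key
    rw [hsy, ← wordMul_assoc, hsx, wordMul_assoc, wordBd_mul_nil_left, key, wordMul_add_right,
      wordMul_smul_right, ← wordMul_assoc, ← wordMul_assoc, ← wordBd_mul_nil_left, ← hsx,
      wordBd_mul_nil_right, wordMul_assoc, wordMul_assoc, wordBd_mul_nil_left, length_cons,
      Nat.cast_succ]

lemma wordBd_wordMul {n : ℕ} {x : Words G} (hx : x ∈ wordsIn (⊤ : Subgroup G) n) (y : Words G) :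
    wordBd (wordMul x y) = wordMul (wordBd x) y + (n : ℤ).negOnePow • wordMul x (wordBd y) := by
  have h (a) (ha : a.2.length = n) := words_hom_ext (f := wordBd.comp (wordMulHom (of a)))
    (g := wordMulHom (wordBd (of a))
      + (n : ℤ).negOnePow • (wordMulHom (of a)).comp wordBd) (fun d ds => by
      simp only [AddMonoidHom.comp_apply, AddMonoidHom.add_apply, AddMonoidHom.smul_apply,
        wordMulHom_apply, ← ha]
      exact wordBd_mul_of a.1 d a.2 ds) y
  have h' := hom_ext_mem (f := wordBd.comp (wordMulHom.flip y))
    (g := (wordMulHom.flip y).comp wordBd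
      + (n : ℤ).negOnePow • wordMulHom.flip (wordBd y)) (fun a ha => by
      simpa [wordMulHom_apply] using h a ha.2.2) hx
  simpa [wordMulHom_apply] using h'

end Words

/-! ## Strings of arrows -/

namespace Chain

variable {X : Type u} [Category.{v} X] {M N : Type*} [AddCommGroup M] [AddCommGroup N]

lemma length_pos : ∀ {x y : X} (g : Chain x y), 0 < g.length
  | _, _, single _ => Nat.one_pos
  | _, _, cons _ _ => Nat.succ_pos _

lemma comp_map {Y : Type w} [Category.{w₁} Y] (F : X ⥤ Y) :
    ∀ {x y : X} (g : Chain x y), (g.map F).comp = F.map g.comp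
  | _, _, single _ => rfl
  | _, _, cons g gs => (congrArg (F.map g ≫ ·) (gs.comp_map F)).trans (F.map_comp _ _).symm

lemma splitSum_chain_map {Y : Type w} [Category.{w₁} Y] (F : X ⥤ Y) : ∀ {x y : X} (g : Chain x y)
    (f : ∀ z, Chain (F.obj x) z → Chain z (F.obj y) → M),
    (g.map F).splitSum f = g.splitSum fun _ a b => f _ (a.map F) (b.map F)
  | _, _, single _, _ => rfl
  | _, _, cons _ gs, _ => congrArg (_ - ·) (gs.splitSum_chain_map F _)

lemma splitSum_congr : ∀ {x y : X} {g : Chain x y} {f f' : ∀ z, Chain x z → Chain z y → M},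
    (∀ z (a : Chain x z) (b : Chain z y), a.length + b.length = g.length →
      a.comp ≫ b.comp = g.comp → f z a b = f' z a b) → g.splitSum f = g.splitSum f'
  | _, _, single _, _, _, _ => rfl
  | _, _, cons g gs, f, f', h => by
    rw [splitSum, splitSum, h _ (single g) gs (Nat.add_comm _ _) rfl,
      splitSum_congr fun z a b hl hc => h z (cons g a) b (by simp only [length]; omega)
        (by simp only [comp, Category.assoc, hc])]

lemma splitSum_hom (φ : M →+ N) : ∀ {x y : X} (g : Chain x y) (f : ∀ z, Chain x z → Chain z y → M),
    φ (g.splitSum f) = g.splitSum fun z a b => φ (f z a b)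
  | _, _, single _, _ => map_zero φ
  | _, _, cons g gs, f => by rw [splitSum, map_sub, map_neg, splitSum_hom φ gs]; rfl

lemma splitSum_add : ∀ {x y : X} (g : Chain x y) (f f' : ∀ z, Chain x z → Chain z y → M),
    g.splitSum (fun z a b => f z a b + f' z a b) = g.splitSum f + g.splitSum f'
  | _, _, single _, _, _ => (add_zero 0).symm
  | _, _, cons g gs, f, f' => by simp only [splitSum, splitSum_add gs]; abel

lemma splitSum_neg {x y : X} (g : Chain x y) (f : ∀ z, Chain x z → Chain z y → M) :
    g.splitSum (fun z a b => -f z a b) = -g.splitSum f :=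
  (splitSum_hom (-AddMonoidHom.id M) g f).symm

lemma mergeSum_congr : ∀ {x y : X} {g : Chain x y} {f f' : Chain x y → M},
    (∀ c : Chain x y, c.length + 1 = g.length → c.comp = g.comp → f c = f' c) →
      g.mergeSum f = g.mergeSum f'
  | _, _, single _, _, _, _ => rfl
  | _, _, cons g (single h), _, _, H => congrArg Neg.neg (H (single (g ≫ h)) rfl rfl)
  | _, _, cons g (cons h gs), f, f', H => by
    rw [mergeSum, mergeSum, H _ rfl (Category.assoc _ _ _),
      mergeSum_congr fun c hl hc => H (cons g c) (by simp only [length] at hl ⊢; omega)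
        (by simp only [comp] at hc ⊢; rw [hc])]

lemma mergeSum_hom (φ : M →+ N) : ∀ {x y : X} (g : Chain x y) (f : Chain x y → M),
    φ (g.mergeSum f) = g.mergeSum fun c => φ (f c)
  | _, _, single _, _ => map_zero φ
  | _, _, cons _ (single _), _ => map_neg φ _
  | _, _, cons g (cons h gs), f => by
    rw [mergeSum, map_sub, map_neg, mergeSum_hom φ (cons h gs)]; rfl

lemma mergeSum_neg_add_neg : ∀ {x y : X} (g : Chain x y) (f f' : Chain x y → M),
    g.mergeSum (fun c => -f c + -f' c) = -g.mergeSum f + -g.mergeSum f'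
  | _, _, single _, _, _ => by simp [mergeSum]
  | _, _, cons _ (single _), _, _ => by simp only [mergeSum]; abel
  | _, _, cons g (cons h gs), f, f' => by simp only [mergeSum, mergeSum_neg_add_neg (cons h gs)]; abel

lemma splitSum_splitSum : ∀ {x y : X} (g : Chain x y)
    (P : ∀ z t, Chain x z → Chain z t → Chain t y → M),
    g.splitSum (fun t c b => c.splitSum fun z a₁ a₂ => P z t a₁ a₂ b)
      = g.splitSum fun z a₁ c => (a₁.length : ℤ).negOnePow • c.splitSum fun t a₂ b => P z t a₁ a₂ b
  | _, _, single _, _ => rfl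
  | _, _, cons g gs, P => by
    have h := splitSum_splitSum gs fun z t a => P z t (cons g a)
    have e := splitSum_hom (-AddMonoidHom.id M) gs fun _ a b => P _ _ (single g) a b
    have e' := splitSum_add gs (fun t c b => -P _ t (single g) c b)
      (fun t c b => -c.splitSum fun z a₁ a₂ => P z t (cons g a₁) a₂ b)
    simp only [splitSum, length, Nat.cast_add, Nat.cast_one, negOnePow_succ, Units.neg_smul,
      sub_eq_add_neg, splitSum_neg, negOnePow_one, one_smul] at h e' ⊢
    grind

lemma mergeSum_splitSum {x y : X} (g : Chain x y) (Q : ∀ z, Chain x z → Chain z y → M) :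
    g.mergeSum (fun c => c.splitSum Q) = g.splitSum fun z a b => -a.mergeSum (fun a' => Q z a' b)
        + (a.length : ℤ).negOnePow • b.mergeSum fun b' => Q z a b' := by
  induction g with
  | single g => rfl
  | cons g gs ih =>
    cases gs with
    | single h => simp [mergeSum, splitSum]
    | cons h gs =>
      have i := ih fun z a b => Q z (cons g a) b
      simp only [mergeSum, splitSum, mergeSum_neg_add_neg, splitSum_add, splitSum_neg, length,
        Nat.cast_add, Nat.cast_one, negOnePow_succ, negOnePow_one, Units.neg_smul, one_smul,
        sub_eq_add_neg, neg_neg, neg_add_rev, neg_zero, zero_add] at i ⊢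
      grind

end Chain

/-! ## The recursion -/

section Words

variable {G H : Type u} [Group G] [Group H]

lemma wordBd_wordMap (e : G →* H) (x : Words G) : wordBd (wordMap e x) = wordMap e (wordBd x) := by
  refine words_hom_ext (f := wordBd.comp (wordMap e)) (g := (wordMap e).comp wordBd)
    (fun a cs => ?_) x
  rw [AddMonoidHom.comp_apply, AddMonoidHom.comp_apply, wordMap_of]
  match cs with
  | [] => rw [map_nil, wordBd_nil, wordBd_nil, map_zero]
  | c :: cs =>
    rw [wordBd_cons, map_cons, wordBd_cons, map_add, map_add, map_units_smul,
      ← mergeListSum_map, ← map_cons, mergeListSum_list_map (map_mul e), ← List.map_dropLast]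
    simp only [wordMap_of, length_map, map_mul]

end Words

section Recursion

variable (act)
/-- The product `x · T_g y · c(g, h)`. -/
def splitWord (g : x ⟶ y) (h : y ⟶ z) (X : Words (A.obj ⟨S, x⟩)ˣ)
    (Y : Words (A.obj ⟨S, y⟩)ˣ) : Words (A.obj ⟨S, x⟩)ˣ :=
  wordMul (wordMul X (wordMap (act.TU g) Y)) (of (act.c g h, []))

/-- The sum `∑_{j=1}^{n-1} (-1)^j Ψ(g₁, …, gⱼ) · T_{g₁⋯gⱼ} Ψ(gⱼ₊₁, …, gₙ) · c(g₁⋯gⱼ, gⱼ₊₁⋯gₙ)`. -/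
def psiSplit (g : Chain x y) : Words (A.obj ⟨S, x⟩)ˣ :=
  g.splitSum fun _ a b => splitWord act a.comp b.comp (psiWord act a) (psiWord act b)

variable {act}

lemma psiAux_congr {N N' : ℕ} {g : Chain x y} (h : g.length ≤ N) (h' : g.length ≤ N') :
    psiAux act N g = psiAux act N' g := by
  induction N generalizing N' x y with
  | zero => have := g.length_pos; omega
  | succ N ih =>
    match N', g with
    | 0, g => have := g.length_pos; omega
    | N' + 1, .single g => rw [psiAux, psiAux]
    | N' + 1, .cons g gs =>
      rw [psiAux, psiAux]
      congr 1
      refine Chain.splitSum_congr fun z a b hl _ => ?_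
      have ha := a.length_pos
      have hb := b.length_pos
      grind

lemma psiWord_single (g : x ⟶ y) :
    psiWord act (.single g) = of (1, []) := by rw [psiWord, Chain.length, psiAux]

lemma psiWord_cons (g : x ⟶ y) (gs : Chain y z) :
    psiWord act (.cons g gs) = wordShift (psiSplit act (.cons g gs)) := by
  rw [psiWord, Chain.length, psiAux, psiSplit]
  congr 1
  refine Chain.splitSum_congr fun z a b hl _ => ?_
  have ha := a.length_pos
  have hb := b.length_pos
  rw [Chain.length] at hl
  rw [splitWord, psiWord, psiWord, psiAux_congr (g := a) (by omega) le_rfl,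
    psiAux_congr (g := b) (by omega) le_rfl]

lemma splitSum_mem {C : Type*} [Category C] {M : Type*} [AddCommGroup M] {H : AddSubgroup M} :
    ∀ {x y : C} {g : Chain x y} {f : ∀ z, Chain x z → Chain z y → M},
    (∀ z (a : Chain x z) (b : Chain z y), a.length + b.length = g.length → f z a b ∈ H) →
      g.splitSum f ∈ H
  | _, _, .single _, _, _ => zero_mem H
  | _, _, .cons g gs, _, h => sub_mem (neg_mem (h _ (.single g) gs (Nat.add_comm _ _)))
      (splitSum_mem fun _ a b hl => h _ (.cons g a) b (by simp only [Chain.length]; omega))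

lemma psiWord_mem {U : ∀ x : F.Ob S, Subgroup (A.obj ⟨S, x⟩)ˣ}
    (hT : ∀ {x y} (g : x ⟶ y), ∀ c ∈ U y, act.TU g c ∈ U x)
    (hc : ∀ {x y z} (g : x ⟶ y) (h : y ⟶ z), act.c g h ∈ U x) (g : Chain x y) :
    psiWord act g ∈ wordsIn (U x) (g.length - 1) := by
  induction' hn : g.length using Nat.strong_induction_on with n ih generalizing x y
  match g with
  | .single g => 
    rw [psiWord_single]
    exact of_mem_suppIn ⟨one_mem _, by simp, by rw [← hn]; rfl⟩
  | .cons g gs =>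
    obtain ⟨k, hk⟩ := Nat.exists_eq_succ_of_ne_zero gs.length_pos.ne'
    have hn' : n - 1 = k + 1 := by rw [← hn, Chain.length, hk]; rfl
    rw [psiWord_cons, hn']
    refine wordShift_mem (splitSum_mem fun z a b hl => ?_)
    have ha := a.length_pos
    have hb := b.length_pos
    rw [hn] at hl
    have := wordMul_mem (wordMul_mem (ih _ (by omega) a rfl)
      (wordMap_mem (ih _ (by omega) b rfl) (hT a.comp)))
      (of_mem_suppIn ⟨hc a.comp b.comp, by simp, rfl⟩ :
        of (act.c a.comp b.comp, []) ∈ wordsIn (U x) 0)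
    rwa [show a.length - 1 + (b.length - 1) + 0 = k by omega] at this

lemma psiSplit_mem (g : Chain x y) :
    psiSplit act g ∈ wordsIn (⊤ : Subgroup (A.obj ⟨S, x⟩)ˣ) (g.length - 2) := by
  refine splitSum_mem fun z a b hl => ?_
  have ha := a.length_pos
  have hb := b.length_pos
  have hm {x y : F.Ob S} (g : Chain x y) :=
    psiWord_mem (act := act) (U := fun _ => ⊤) (by simp) (by simp) g
  have := wordMul_mem (wordMul_mem (hm a) (wordMap_mem (e := act.TU a.comp) (S' := ⊤) (hm b)
    (by simp))) (of_mem_wordsIn (act.c a.comp b.comp) [])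
  rwa [length_nil, show a.length - 1 + (b.length - 1) + 0 = g.length - 2 by omega] at this

lemma splitWord_assoc {t : F.Ob S} (g : x ⟶ y) (h : y ⟶ z) (k : z ⟶ t) (X : Words (A.obj ⟨S, x⟩)ˣ)
    (Y : Words (A.obj ⟨S, y⟩)ˣ) (Z : Words (A.obj ⟨S, z⟩)ˣ) :
    splitWord act (g ≫ h) k (splitWord act g h X Y) Z
      = splitWord act g (h ≫ k) X (splitWord act h k Y Z) := by
  have h₁ : wordMul (of (act.c g h, [])) (wordMap (act.TU (g ≫ h)) Z)
      = wordMul (wordMap (act.TU g) (wordMap (act.TU h) Z)) (of (act.c g h, [])) := by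
    have key := words_hom_ext (f := (wordMulHom (of (act.c g h, []))).comp
        (wordMap (act.TU (g ≫ h))))
      (g := (wordMulHom.flip (of (act.c g h, []))).comp
        ((wordMap (act.TU g)).comp (wordMap (act.TU h)))) (fun c cs => by
      have hT (c) : act.TU g (act.TU h c)
          = act.c g h * act.TU (g ≫ h) c * (act.c g h)⁻¹ := Units.ext (act.T_T g h _)
      simp only [AddMonoidHom.comp_apply, AddMonoidHom.flip_apply, wordMulHom_apply, wordMap_of,
        wordMul_nil_left, wordMul_nil_right, map_map, hT]
      congr 2
      · simp
      · congr 1; funext c; simp [hT, mul_assoc]) Z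
    simpa [wordMulHom_apply] using key
  have h₂ : act.c g h * act.c (g ≫ h) k = act.TU g (act.c h k) * act.c g (h ≫ k) :=
    Units.ext (act.cocycle g h k)
  simp only [splitWord, wordMap_wordMul, wordMul_assoc, wordMap_of, map_nil, wordMul_nil_left, ← h₂]
  rw [← wordMul_assoc (of (act.c g h, [])), h₁, wordMul_assoc, wordMul_nil_left]

lemma wordBd_splitWord (g : x ⟶ y) (h : y ⟶ z) {X : Words (A.obj ⟨S, x⟩)ˣ}
    (hX : X ∈ wordsIn (⊤ : Subgroup _) n) (Y : Words (A.obj ⟨S, y⟩)ˣ) :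
    wordBd (splitWord act g h X Y) = splitWord act g h (wordBd X) Y
      + (n : ℤ).negOnePow • splitWord act g h X (wordBd Y) := by
  rw [splitWord, wordBd_mul_nil_right, wordBd_wordMul hX, wordBd_wordMap, wordMul_add_left,
    wordMul_smul_left]
  rfl

/-- `splitWord` as a homomorphism in its first argument. -/
def splitWordL (g : x ⟶ y) (h : y ⟶ z) (Y : Words (A.obj ⟨S, y⟩)ˣ) :
    Words (A.obj ⟨S, x⟩)ˣ →+ Words (A.obj ⟨S, x⟩)ˣ :=
  AddMonoidHom.mk' (fun X => splitWord act g h X Y) fun X X' => by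
    simp only [splitWord, wordMul_add_left]

/-- `splitWord` as a homomorphism in its second argument. -/
def splitWordR (g : x ⟶ y) (h : y ⟶ z) (X : Words (A.obj ⟨S, x⟩)ˣ) :
    Words (A.obj ⟨S, y⟩)ˣ →+ Words (A.obj ⟨S, x⟩)ˣ :=
  AddMonoidHom.mk' (splitWord act g h X) fun Y Y' => by
    simp only [splitWord, map_add, wordMul_add_left, wordMul_add_right]

lemma wordBd_psiSplit {g : Chain x y}
    (ih : ∀ {x y : F.Ob S} (a : Chain x y), a.length < g.length → wordBd (psiWord act a) = psiSplit
    act a - a.mergeSum (psiWord act)) :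
    wordBd (psiSplit act g) = g.mergeSum (psiSplit act) := by
  have hX : g.splitSum (fun _ a b => splitWord act a.comp b.comp (psiSplit act a) (psiWord act b))
      = g.splitSum fun _ a b => (a.length : ℤ).negOnePow •
        splitWord act a.comp b.comp (psiWord act a) (psiSplit act b) := by
    refine Eq.trans ?_ ((Chain.splitSum_splitSum g fun _ _ a₁ a₂ b =>
      splitWord act (a₁.comp ≫ a₂.comp) b.comp
        (splitWord act a₁.comp a₂.comp (psiWord act a₁) (psiWord act a₂)) (psiWord act b)).trans ?_)
    · refine Chain.splitSum_congr fun _ a b _ _ => ?_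
      refine (Chain.splitSum_hom (splitWordL a.comp b.comp (psiWord act b)) a _).trans ?_
      refine Chain.splitSum_congr fun _ a₁ a₂ _ hc => ?_
      rw [← hc]; rfl
    · refine Chain.splitSum_congr fun _ a b _ _ => congrArg _ ?_
      refine Eq.trans ?_ (Chain.splitSum_hom (splitWordR a.comp b.comp (psiWord act a)) b _).symm
      refine Chain.splitSum_congr fun _ b₁ b₂ _ hc => ?_
      rw [← hc]; exact splitWord_assoc _ _ _ _ _ _
  have hM : g.mergeSum (psiSplit act) = g.splitSum fun _ a b =>
      -splitWord act a.comp b.comp (a.mergeSum (psiWord act)) (psiWord act b)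
      + (a.length : ℤ).negOnePow •
        splitWord act a.comp b.comp (psiWord act a) (b.mergeSum (psiWord act)) := by
    refine (Chain.mergeSum_splitSum g _).trans (Chain.splitSum_congr fun _ a b _ _ => ?_)
    have h₁ := Chain.mergeSum_hom (splitWordL (act := act) a.comp b.comp (psiWord act b)) a (psiWord act)
    have h₂ := Chain.mergeSum_hom (splitWordR (act := act) a.comp b.comp (psiWord act a)) b (psiWord act)
    refine congrArg₂ _ (congrArg Neg.neg (Eq.trans ?_ h₁.symm)) (congrArg _ (Eq.trans ?_ h₂.symm))
    · exact Chain.mergeSum_congr fun c _ hc => by rw [hc]; rfl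
    · exact Chain.mergeSum_congr fun c _ hc => by rw [hc]; rfl
  have hD : wordBd (psiSplit act g) = g.splitSum fun _ a b =>
      splitWord act a.comp b.comp (psiSplit act a) (psiWord act b) + (-((a.length : ℤ).negOnePow •
          splitWord act a.comp b.comp (psiWord act a) (psiSplit act b))
      + (-splitWord act a.comp b.comp (a.mergeSum (psiWord act)) (psiWord act b)
      + (a.length : ℤ).negOnePow •
        splitWord act a.comp b.comp (psiWord act a) (b.mergeSum (psiWord act)))) := by
    refine (Chain.splitSum_hom wordBd g _).trans (Chain.splitSum_congr fun _ a b hl _ => ?_)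
    have ha := a.length_pos
    have hb := b.length_pos
    have hm := psiWord_mem (act := act) (U := fun _ => ⊤) (by simp) (by simp) a
    have hs : ((a.length - 1 : ℕ) : ℤ).negOnePow = -(a.length : ℤ).negOnePow := by
      rw [Nat.cast_sub ha, Nat.cast_one, negOnePow_sub, negOnePow_one]; simp
    have h₁ := map_sub (splitWordL (act := act) a.comp b.comp (psiWord act b)) (psiSplit act a)
      (a.mergeSum (psiWord act))
    have h₂ := map_sub (splitWordR (act := act) a.comp b.comp (psiWord act a)) (psiSplit act b)
      (b.mergeSum (psiWord act))
    rw [wordBd_splitWord _ _ hm, ih a (by omega), ih b (by omega), hs]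
    refine (congrArg₂ (fun X Y => X + -(a.length : ℤ).negOnePow • Y) h₁ h₂).trans ?_
    rw [Units.neg_smul, smul_sub]
    change splitWord act _ _ _ _ - splitWord act _ _ _ _ + -(_ • splitWord act _ _ _ _
      - _ • splitWord act _ _ _ _) = _
    abel
  rw [hD, Chain.splitSum_add, Chain.splitSum_add, Chain.splitSum_neg, hX, hM]
  abel

/-- The differential of `Ψ(g₁, …, gₙ)`. -/
lemma wordBd_psiWord (g : Chain x y) :
    wordBd (psiWord act g) = psiSplit act g - g.mergeSum (psiWord act) := by
  induction' hn : g.length using Nat.strong_induction_on with n ih generalizing x y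
  match g with
  | .single g => rw [psiWord_single, wordBd_nil, psiSplit, Chain.splitSum, Chain.mergeSum, sub_zero]
  | .cons g (.single h) =>
    rw [psiWord_cons, wordBd_wordShift, Chain.mergeSum, psiSplit]
    simp only [Chain.splitSum, psiWord_single, splitWord, wordMap_of, map_nil,
      wordMul_nil_left, map_one, map_neg, map_zero, wordBd_nil, wordAug_of_nil, sub_zero, neg_zero]
  | .cons g (.cons h gs) =>
    have hm := psiSplit_mem (act := act) (.cons g (.cons h gs))
    obtain ⟨k, hk⟩ := Nat.exists_eq_succ_of_ne_zero gs.length_pos.ne'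
    rw [show (Chain.cons g (.cons h gs)).length - 2 = k + 1 by simp [Chain.length, hk]] at hm
    rw [psiWord_cons, wordBd_wordShift, wordAug_eq_zero hm, sub_zero,
      wordBd_psiSplit fun a ha => ih _ (hn ▸ ha) a rfl, Chain.mergeSum_hom]
    congr 1
    refine Chain.mergeSum_congr fun c hc _ => ?_
    match c with
    | .single c => simp [Chain.length] at hc; have := gs.length_pos; omega
    | .cons c cs => exact (psiWord_cons c cs).symm

end Recursion

/-! ## The action up to homotopy -/

lemma apply_lift {α M N : Type*} [AddCommGroup M] [AddCommGroup N] {P : α → Prop}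
    {x : FreeAbelianGroup α} (hx : x ∈ suppIn P) {f : α → M} {K : AddSubgroup M}
    (hf : ∀ a, P a → f a ∈ K) {g : M → N} (hg : ∀ a ∈ K, ∀ b ∈ K, g (a + b) = g a + g b) :
    g (lift f x) = lift (fun a => g (f a)) x := by
  classical
  let f' : α → K := fun a => if h : P a then ⟨f a, hf a h⟩ else 0
  let g' : K →+ N := AddMonoidHom.mk' (fun a => g a) fun a b => hg a a.2 b b.2
  have h1 : lift f x = lift (fun a => (f' a : M)) x := lift_congr hx fun a ha => by simp [f', ha]
  rw [h1, show lift (fun a => (f' a : M)) x = lift f' x from (hom_lift K.subtype f' x).symm]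
  change g' (lift f' x) = _
  rw [hom_lift]
  exact lift_congr hx fun a ha => by simp [f', g', ha]

lemma mem_of_mem_insertions {B : Type*} {a : B} {y : List B} :
    ∀ {n : ℕ} {l : List B}, y ∈ insertions a (n + 1) l → a ∈ y
  | n, [], h => by rw [insertions, mem_singleton] at h; simp [h, replicate_succ]
  | n, b :: l, h => by
    rw [insertions, mem_append, mem_map, mem_map] at h
    obtain ⟨z, _, rfl⟩ | ⟨z, hz, rfl⟩ := h
    · simp
    · exact mem_cons_of_mem b (mem_of_mem_insertions hz)

lemma MultiAdd.eq_zero {A V Y : Type*} [Ring A] [AddCommGroup V] [AddCommGroup Y]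
    {f : List A → V → Y} (hf : MultiAdd f) {l : List A} (h : (0 : A) ∈ l) (v : V) : f l v = 0 := by
  obtain ⟨s, t, rfl⟩ := List.append_of_mem h
  have := hf.entry s t 0 0 v
  grind

lemma phiOp_one (hφ : φ ∈ cochains V W κ p m) : phiOp 1 [] φ = φ := by
  funext q k l v
  have hD : conn.D q 1 = 0 := (conn.curved q).D_one
  have h (K : ℕ) : phiTerm 1 [] φ q k l v K = ((insertions (0 : A.obj q) K l).map (φ q k · v)).sum := by
    simp [phiTerm, phiSum, blocks, hD]
  rw [phiOp, finsum_eq_single _ 0 fun K hK => ?_, h]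
  · simp [insertions]
  · obtain ⟨K, rfl⟩ := Nat.exists_eq_succ_of_ne_zero hK
    rw [h]
    refine List.sum_eq_zero fun z hz => ?_
    obtain ⟨y, hy, rfl⟩ := mem_map.mp hz
    exact (IsCochain.multiAdd hφ k).eq_zero (mem_of_mem_insertions hy) v

variable (V W κ) in
/-- The operators `c₀ φ(c₁, …, cₘ)` form a homotopy for the inner automorphisms. -/
theorem innerHomotopies : InnerHomotopies V W κ where
  finite c₀ cs _ h₀ hcs hφ q k l v := (phiTerm_evZero (mem_admissibles.mpr h₀)
    (fun c hc => mem_admissibles.mpr (hcs c hc)) hφ q k l v).finite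
  mem c₀ cs _ h₀ hcs hφ := phiOp_mem (mem_admissibles.mpr h₀)
    (fun c hc => mem_admissibles.mpr (hcs c hc)) hφ
  one hφ := phiOp_one hφ
  homotopy c cs φ hcs hφ := by
    have key := phiOp_totalD (one_mem _) (fun b hb => mem_admissibles.mpr (hcs b hb)) hφ
    rw [wordBd_cons, map_add, map_add, map_units_smul, ← mergeListSum_map, length_cons,
      Nat.cast_succ] at key
    simp only [lift_apply_of, one_mul] at key
    rw [key]
    abel

/-- The operator given by a linear combination of words. -/
def wordOp (φ : Raw V W p) : Words (A.obj p)ˣ →+ Raw V W p :=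
  lift fun w => phiOp w.1 w.2 φ

lemma wordOp_mem {X : Words (A.obj p)ˣ} (hX : X ∈ wordsIn (admissibles V W κ p) n)
    (hφ : φ ∈ cochains V W κ p m) : wordOp φ X ∈ cochains V W κ p (m - n) :=
  lift_mem hX fun a ha => by rw [← ha.2.2]; exact phiOp_mem ha.1 ha.2.1 hφ

lemma wordOp_add {X : Words (A.obj p)ˣ} (hX : X ∈ wordsIn (admissibles V W κ p) n) {ψ : Raw V W p}
    (hφ : φ ∈ cochains V W κ p m) (hψ : ψ ∈ cochains V W κ p m) :
    wordOp (φ + ψ) X = wordOp φ X + wordOp ψ X :=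
  (lift_congr hX fun _ ha => phiOp_add ha.1 ha.2.1 hφ hψ).trans (lift_add_apply _ _ _)

lemma wordOp_phiOp {X Y : Words (A.obj p)ˣ} {n' : ℕ} (hX : X ∈ wordsIn (admissibles V W κ p) n)
    (hY : Y ∈ wordsIn (admissibles V W κ p) n') (hφ : φ ∈ cochains V W κ p m) :
    wordOp (wordOp φ Y) X = wordOp φ (wordMul X Y) := by
  rw [wordMul_eq_lift, hom_lift]
  refine lift_congr hX fun a ha => ?_
  rw [hom_lift]
  refine (apply_lift hY (K := cochains V W κ p (m - n')) (fun b hb => ?_) fun φ hφ ψ hψ =>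
    phiOp_add ha.1 ha.2.1 hφ hψ).trans
    (lift_congr hY fun b hb => phiOp_phiOp ha.1 ha.2.1 hb.1 hb.2.1 hφ)
  rw [← hb.2.2]; exact phiOp_mem hb.1 hb.2.1 hφ

lemma wordOp_scale {X : Words (A.obj p)ˣ} (hX : X ∈ wordsIn (admissibles V W κ p) n)
    (hφ : φ ∈ cochains V W κ p m) (hω : ω ∈ O.gr p.base i) :
    wordOp (Raw.scale m ω φ) X = (i * n).negOnePow • Raw.scale (m - n) ω (wordOp φ X) := by
  refine (lift_congr hX fun a ha => ?_).trans (apply_lift hX (f := fun w => phiOp w.1 w.2 φ)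
    (K := ⊤) (g := fun ψ => (i * n).negOnePow • Raw.scale (m - n) ω ψ) (by simp)
    fun ψ _ ψ' _ => ?_).symm
  · rw [phiOp_scale ha.1 ha.2.1 hφ hω, ha.2.2]
  · rw [← smul_add]; congr 1; funext q k l v; exact smul_add _ _ _

lemma wordOp_restrict (k : q ⟶ p) (X : Words (A.obj p)ˣ) (φ : Raw V W p) :
    Raw.restrict k (wordOp φ X) = wordOp (Raw.restrict k φ) (wordMap (A.resU k) X) := by
  rw [wordMap_def, wordOp, wordOp, lift_map_apply]
  refine (apply_lift (mem_suppIn_true X) (K := ⊤) (by simp) fun ψ _ ψ' _ => rfl).trans ?_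
  simp only [phiOp_restrict]

lemma wordOp_totalD {X : Words (A.obj p)ˣ} (hX : X ∈ wordsIn (admissibles V W κ p) n)
    (hφ : φ ∈ cochains V W κ p m) : totalD (m - n) (wordOp φ X)
      = (n : ℤ).negOnePow • wordOp (totalD m φ) X - wordOp φ (wordBd X) := by
  refine (apply_lift hX (K := ⊤) (by simp) fun ψ _ ψ' _ => totalD_add _ ψ ψ').trans ?_
  refine hom_ext_mem (g := (n : ℤ).negOnePow • wordOp (totalD m φ) - (wordOp φ).comp wordBd)
    (fun a ha => ?_) hX
  obtain ⟨c, cs⟩ := a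
  obtain ⟨h₀, hcs, rfl⟩ := ha
  have h := phiOp_totalD h₀ hcs hφ
  rw [AddMonoidHom.sub_apply, AddMonoidHom.smul_apply, wordOp, lift_apply_of, lift_apply_of, h]
  rfl

lemma curvedT_wordOp (H : ConvergentAction V W κ) (g : x ⟶ y) {X : Words (A.obj ⟨S, y⟩)ˣ}
    (hX : X ∈ wordsIn (admissibles V W κ ⟨S, y⟩) n) {φ : Raw V W ⟨S, y⟩}
    (hφ : φ ∈ cochains V W κ ⟨S, y⟩ m) :
    curvedT g (wordOp φ X) = wordOp (curvedT g φ) (wordMap (act.TU g) X) := by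
  rw [wordMap_def, wordOp, wordOp, lift_map_apply]
  refine (apply_lift hX (K := cochains V W κ ⟨S, y⟩ (m - n)) (fun a ha => ?_) fun ψ hψ ψ' hψ' =>
    curvedT_add H g hψ hψ').trans
    (lift_congr hX fun a ha => curvedT_phiOp H g ha.1 ha.2.1 hφ)
  rw [← ha.2.2]; exact phiOp_mem ha.1 ha.2.1 hφ

lemma psiWord_mem_admissibles (H : ConvergentAction V W κ) (g : Chain x y) :
    psiWord act g ∈ wordsIn (admissibles V W κ ⟨S, x⟩) (g.length - 1) :=
  psiWord_mem (U := fun x => admissibles V W κ ⟨S, x⟩) (fun g _ hc => T_admissible H g hc)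
    (fun g h => c_admissible H g h) g

lemma psiWord_res {S' : 𝕋} (h : S' ⟶ S) (g : Chain x y) :
    psiWord act (g.map (F.res h)) = wordMap (A.resU (El.lift F h x)) (psiWord act g) := by
  induction' hn : g.length using Nat.strong_induction_on with n ih generalizing x y
  match g with
  | .single g => rw [psiWord_single, Chain.map, psiWord_single, wordMap_of, map_one]; rfl
  | .cons g gs =>
    rw [Chain.map, psiWord_cons, psiWord_cons, wordMap_wordShift]
    refine congrArg _ ((Chain.splitSum_chain_map (F.res h) (.cons g gs) _).trans
      (Eq.trans (Chain.splitSum_congr fun z a b hl _ => ?_) (Chain.splitSum_hom _ _ _).symm))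
    have ha := a.length_pos
    have hb := b.length_pos
    have hT (c) : act.TU ((F.res h).map a.comp) (A.resU (El.lift F h z) c)
        = A.resU (El.lift F h x) (act.TU a.comp c) := Units.ext (act.T_res h a.comp _).symm
    have hc : act.c ((F.res h).map a.comp) ((F.res h).map b.comp)
        = A.resU (El.lift F h x) (act.c a.comp b.comp) := Units.ext (act.c_res h _ _).symm
    rw [ih _ (by omega) a rfl, ih _ (by omega) b rfl, splitWord, splitWord, wordMap_wordMul,
      wordMap_wordMul, wordMap_of, Chain.comp_map, Chain.comp_map, hc]
    congr 2
    simp only [wordMap_def, ← map_comp_apply]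
    congr 2
    funext w
    simp_all

lemma wordOp_splitWord (H : ConvergentAction V W κ) (g : x ⟶ y) (h : y ⟶ z)
    {X : Words (A.obj ⟨S, x⟩)ˣ} {Y : Words (A.obj ⟨S, y⟩)ˣ} {n' : ℕ}
    (hX : X ∈ wordsIn (admissibles V W κ ⟨S, x⟩) n)
    (hY : Y ∈ wordsIn (admissibles V W κ ⟨S, y⟩) n') {φ : Raw V W ⟨S, z⟩}
    (hφ : φ ∈ cochains V W κ ⟨S, z⟩ m) : wordOp (curvedT g (wordOp (curvedT h φ) Y)) X
      = wordOp (curvedT (g ≫ h) φ) (splitWord act g h X Y) := by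
  have hY' : wordMap (act.TU g) Y ∈ wordsIn (admissibles V W κ ⟨S, x⟩) n' :=
    wordMap_mem hY fun c hc => T_admissible H g hc
  have hc : of (act.c g h, []) ∈ wordsIn (admissibles V W κ ⟨S, x⟩) 0 :=
    of_mem_suppIn ⟨c_admissible H g h, by simp, rfl⟩
  have hm := curvedT_mem H (g ≫ h) hφ
  have e : phiOp (act.c g h) [] (curvedT (g ≫ h) φ)
      = wordOp (curvedT (g ≫ h) φ) (of (act.c g h, [])) :=
    (lift_apply_of _ _).symm
  rw [curvedT_wordOp H g hY (curvedT_mem H h hφ), curvedT_curvedT H g h hφ, e,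
    wordOp_phiOp hY' hc hm, wordOp_phiOp hX (wordMul_mem hY' hc) hm, splitWord, wordMul_assoc]

variable (V W κ) in
/-- The action up to homotopy on the standard complex. -/
def higherAction (H : ConvergentAction V W κ) : AInfAction (stdCx V W κ) where
  T g _ φ := higherT g φ
  mem g m φ hφ := by
    have := wordOp_mem (psiWord_mem_admissibles H g) (curvedT_mem H g.comp hφ)
    rwa [Nat.cast_sub g.length_pos, Nat.cast_one, ← sub_add, sub_add_eq_add_sub] at this
  map_add g m φ ψ hφ hψ := (congrArg (wordOp · (psiWord act g)) (curvedT_add H g.comp hφ hψ)).trans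
    (wordOp_add (psiWord_mem_admissibles H g) (curvedT_mem H g.comp hφ) (curvedT_mem H g.comp hψ))
  map_smul g i m ω φ hω hφ := by
    have h₁ := curvedT_scale H g.comp hφ hω
    have h₂ := wordOp_scale (psiWord_mem_admissibles H g) (curvedT_mem H g.comp hφ) hω
    rw [Nat.cast_sub g.length_pos, Nat.cast_one, ← sub_add, sub_add_eq_add_sub,
      negOnePow_eq_of (b := i * (1 - g.length)) (c := i * (g.length - 1)) (by ring)] at h₂
    exact (congrArg (wordOp · (psiWord act g)) h₁).trans h₂
  res h x y g m φ hφ := by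
    have := (wordOp_restrict (El.lift F h x) (psiWord act g) (curvedT g.comp φ)).trans
      (congrArg₂ (fun ψ X => wordOp ψ X) (curvedT_restrict h g.comp φ) (psiWord_res h g).symm)
    rw [← Chain.comp_map] at this
    exact this
  relation {S x y} g m φ hφ := by
    have hm := psiWord_mem_admissibles H g
    have h₁ := wordOp_totalD hm (curvedT_mem H g.comp hφ)
    rw [wordBd_psiWord, map_sub, ← curvedT_totalD H g.comp hφ, Nat.cast_sub g.length_pos,
      Nat.cast_one, ← sub_add, sub_add_eq_add_sub,
      negOnePow_eq_of (b := 1 - (g.length : ℤ)) (c := g.length - 1) (by ring)] at h₁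
    have h₂ : g.splitSum (fun _ a b => higherT (V := V) (W := W) a (higherT b φ))
        = wordOp (curvedT g.comp φ) (psiSplit act g) := by
      refine Eq.trans (Chain.splitSum_congr fun z a b _ hc => ?_) (Chain.splitSum_hom _ g _).symm
      rw [← hc]
      exact wordOp_splitWord H a.comp b.comp (psiWord_mem_admissibles H a)
        (psiWord_mem_admissibles H b) hφ
    have h₃ : g.mergeSum (fun g' => higherT (V := V) (W := W) g' φ)
        = wordOp (curvedT g.comp φ) (g.mergeSum (psiWord act)) := by
      refine Eq.trans (Chain.mergeSum_congr fun c _ hc => ?_) (Chain.mergeSum_hom _ g _).symm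
      rw [← hc]; rfl
    have key : totalD (m + 1 - g.length) (higherT g φ)
        - (1 - (g.length : ℤ)).negOnePow • higherT g (totalD m φ)
        + g.splitSum (fun _ a b => higherT (V := V) (W := W) a (higherT b φ))
        - g.mergeSum (fun g' => higherT (V := V) (W := W) g' φ) = 0 := by
      rw [h₂, h₃]
      refine (congrArg (fun X => X - _ + _ - _) h₁).trans ?_
      change _ • wordOp _ _ - _ - _ • wordOp _ _ + _ - _ = 0
      abel
    exact key

lemma higherT_single (H : ConvergentAction V W κ) (g : x ⟶ y) {φ : Raw V W ⟨S, y⟩}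
    (hφ : φ ∈ cochains V W κ ⟨S, y⟩ m) : higherT (.single g) φ = curvedT g φ := by
  rw [higherT, psiWord_single, lift_apply_of]
  exact phiOp_one (curvedT_mem H g hφ)

/-- A groupoid acting up to inner automorphisms on a sheaf of algebras with a compatible connection
acts up to homotopy on the standard complex. -/
theorem hasCurvedAInfAction (H : ConvergentAction V W κ) : HasCurvedAInfAction V W κ :=
  ⟨stdCx_isDGModule κ, innerHomotopies V W κ,
    fun g₁ g₂ => mem_admissibles.mp (c_admissible H g₁ g₂), higherAction V W κ H,
    fun g _ _ hφ => higherT_single H g hφ, fun _ _ _ _ => rfl⟩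

end

end InnerAct

theorem mainTheorem1 :
    -- Lie groupoids acting on sheaves of algebras
    (∀ (L : InnerAct.LieGroupoid.{u}) (O : InnerAct.DGScalars.{u + 1, u, w} InnerAct.Mfd.{u})
      (A : InnerAct.OAlg O L.points) (act : InnerAct.InnerAction A)
      (conn : InnerAct.FlatConnection act) (V W : InnerAct.CompatModule conn),
      O.IsSheaf InnerAct.openCoverings →
      A.IsSheaf (InnerAct.openCoverings.comap (InnerAct.El.toBase L.points)) →
      V.IsSheaf (InnerAct.openCoverings.comap (InnerAct.El.toBase L.points)) →
      W.IsSheaf (InnerAct.openCoverings.comap (InnerAct.El.toBase L.points)) →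
      (∀ (S : InnerAct.Mfd.{u}) (x y : L.points.Ob S) (g : x ⟶ y),
        InnerAct.ExpDefined V W InnerAct.CochainKind.prod ⟨S, x⟩ (conn.α g)) →
      InnerAct.HasCurvedAInfAction V W InnerAct.CochainKind.prod) ∧
    -- discrete groupoids (in particular groups) acting on families of algebras
    (∀ (X : Type v) [Groupoid.{v} X]
      (O : InnerAct.DGScalars.{0, 0, w} (Discrete PUnit.{1}))
      (A : InnerAct.OAlg O (InnerAct.constGroupoid X)) (act : InnerAct.InnerAction A)
      (conn : InnerAct.FlatConnection act) (V W : InnerAct.CompatModule conn)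
      (κ : InnerAct.CochainKind),
      (∀ (S : Discrete PUnit.{1}) (x y : (InnerAct.constGroupoid X).Ob S) (g : x ⟶ y),
        InnerAct.ExpDefined V W κ ⟨S, x⟩ (conn.α g)) →
      InnerAct.HasCurvedAInfAction V W κ) := by
  refine ⟨fun L O A act conn V W _ _ _ _ H => ?_, fun X _ O A act conn V W κ H => ?_⟩
  · exact InnerAct.hasCurvedAInfAction fun {S x y} g => H S x y g
  · exact InnerAct.hasCurvedAInfAction fun {S x y} g => H S x y g
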